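/- Let $G$ be a connected, simply connected 2-step nilpotent Lie group with stratified Lie algebra $\mathfrak g=\mathfrak g_1\oplus\mathfrak g_2$, i.e. $[\mathfrak g_1,\mathfrak g_1]=\mathfrak g_2\neq\{0\}$ and $[\mathfrak g,\mathfrak g_2]=\{0\}$, and identify $G$ with $\mathfrak g$ via the exponential map. Fix an inner product $\langle\cdot,\cdot\rangle$ on $\mathfrak g_1$ with an orthonormal basis $(X_j)_j$, and a basis $(U_k)_k$ of $\mathfrak g_2$. Let $L=-\sum_j X_j^2$ and $\mathbf U=(-iU_1,\dots,-iU_{d_2})$, where the elements of $\mathfrak g$ are regarded as left-invariant vector fields and the operators are initially defined on $C_c^\infty(G)$. Let $dx$ be the Lebesgue measure of the Euclidean space $\mathfrak g_1$, let $du$ be the Lebesgue measure on $\mathfrak g_2$ in the coordinates of the basis $(U_k)_k$, and identify $\mathfrak g_2^*$ with $\mathbb R^{d_2}$ via $\eta\mapsto(\eta(U_k))_k$, with Lebesgue measure $d\eta$. The Haar measure of $G$ is $dx\,du$. The closures of $L,-iU_1,\dots,-iU_{d_2}$ on $L^2(G)$ have a joint spectral measure $E$ on $\mathbb R\times\mathfrak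 g_2^*$. For bounded Borel $H$ put $H(L,\mathbf U)=\int H\,dE$, and let $\mathcal K_{H(L,\mathbf U)}$ denote its convolution kernel, i.e. $H(L,\mathbf U)\varphi=\varphi*\mathcal K_{H(L,\mathbf U)}$ for all $\varphi\in C^\infty_c(G)$, where $(\varphi*K)(p)=\int_G\varphi(q)\,K(q^{-1}p)\,dq$. For $\eta\in\mathfrak g_2^*$ let $J_\eta$ be the endomorphism of $\mathfrak g_1$ with $\langle J_\eta x,x'\rangle=\eta([x,x'])$. There are a nonempty homogeneous Zariski-open set $\ddot{\mathfrak g}_2^*\subseteq\mathfrak g_2^*$, integers $d_1, r_0\ge 0$, $r_1,\dots,r_{d_1}\geq 1$ and functions $\eta\mapsto b_j^\eta$, positive and pairwise distinct at each $\eta\in\ddot{\mathfrak g}_2^*$, such that $$\det(\lambda+J_\eta^2)=\lambda^{r_0}\prod_{j=1}^{d_1}\bigl(\lambda-(b_j^\eta)^2\bigr)^{2r_j}\qquad\text{for all }\eta\in\ddot{\mathfrak g}_2^*.$$ Fix any such data, and put $|r|=r_1+\dots+r_{d_1}$ and $$m_H(n,\mu,\eta)=H\Bigl(\sum_{j=1}^{d_1}(2n_j+r_j)\,b_j^\eta+\mu,\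 \eta\Bigr).$$ Then for every $H:\mathbb R\times\mathfrak g_2^*\to\mathbb C$ in the Schwartz class the kernel $\mathcal K_{H(L,\mathbf U)}$ exists as a locally integrable function, belongs to $L^2(G)$, and $$\int_G|\mathcal K_{H(L,\mathbf U)}(x,u)|^2\,dx\,du=(2\pi)^{|r|-\dim G}\int_{\ddot{\mathfrak g}_2^*}\int_{[0,\infty)}\sum_{n\in\mathbb N^{d_1}}|m_H(n,\mu,\eta)|^2\prod_{j=1}^{d_1}\Bigl[(b_j^\eta)^{r_j}\binom{n_j+r_j-1}{n_j}\Bigr]\,d\sigma_{r_0}(\mu)\,d\eta,$$ where $\sigma_{r_0}$ is the Dirac measure at $0$ if $r_0=0$, and $d\sigma_{r_0}(\mu)=\frac{\pi^{r_0/2}}{\Gamma(r_0/2)}\,\mu^{r_0/2}\,\frac{d\mu}{\mu}$ on $(0,\infty)$ if $r_0>0$. -/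

import Mathlib

open MeasureTheory Set
open scoped SchwartzMap

set_option linter.unusedSectionVars false

noncomputable section

/-! ### Two-step stratified groups -/

/-- A two-step stratified Lie algebra `V ⊕ W` with first layer `V` and second layer `W ≠ 0`.
Since `[V ⊕ W, W] = 0`, the Lie bracket is determined by an alternating bilinear map
`V × V → W`, the Jacobi identity is automatic, and `[V, V] = W` says that its values span `W`. -/
structure TwoStepAlgebra (V W : Type*) [AddCommGroup V] [Module ℝ V]
    [AddCommGroup W] [Module ℝ W] where
  bracket : V →ₗ[ℝ] V →ₗ[ℝ] W
  bracket_self : ∀ x, bracket x x = 0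
  span_bracket : Submodule.span ℝ {w | ∃ x y, bracket x y = w} = ⊤
  second_layer_nontrivial : Nontrivial W

namespace TwoStepAlgebra

section Group

variable {V W : Type*} [AddCommGroup V] [Module ℝ V] [AddCommGroup W] [Module ℝ W]

/-- The product of the connected, simply connected group of the Lie algebra `V ⊕ W`, in
exponential coordinates (Baker-Campbell-Hausdorff formula). -/
def mul (g : TwoStepAlgebra V W) (p q : V × W) : V × W :=
  (p.1 + q.1, p.2 + q.2 + (1 / 2 : ℝ) • g.bracket p.1 q.1)

/-- The inverse in exponential coordinates. -/
def inv (_g : TwoStepAlgebra V W) (p : V × W) : V × W := -p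

theorem mul_assoc (g : TwoStepAlgebra V W) (p q s : V × W) :
    g.mul (g.mul p q) s = g.mul p (g.mul q s) := by
  ext
  · simp [mul, add_assoc]
  · simp only [mul, map_add, LinearMap.add_apply, smul_add]
    abel

theorem mul_zero (g : TwoStepAlgebra V W) (p : V × W) : g.mul p 0 = p := by
  ext <;> simp [mul]

theorem zero_mul (g : TwoStepAlgebra V W) (p : V × W) : g.mul 0 p = p := by
  ext <;> simp [mul]

theorem inv_mul (g : TwoStepAlgebra V W) (p : V × W) : g.mul (g.inv p) p = 0 := by
  ext <;> simp [mul, inv, g.bracket_self]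

/-- The left-invariant vector field on the group attached to `Z ∈ V ⊕ W`:
`(Z φ)(p) = d/dt φ(p · exp(tZ))` at `t = 0`. -/
def leftInv (g : TwoStepAlgebra V W) (Z : V × W) (φ : V × W → ℂ) : V × W → ℂ :=
  fun p => deriv (fun t : ℝ => φ (g.mul p (t • Z))) 0

/-- The operator `- ∑ X_j²`, where `X_j` are elements of the first layer. -/
def sublaplacian (g : TwoStepAlgebra V W) {ι : Type*} [Fintype ι] (X : ι → V)
    (φ : V × W → ℂ) : V × W → ℂ :=
  fun p => - ∑ j, g.leftInv (X j, 0) (g.leftInv (X j, 0) φ) p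

/-- The central derivative `-i U`, where `U` is an element of the second layer. -/
def centralDeriv (g : TwoStepAlgebra V W) (u : W) (φ : V × W → ℂ) : V × W → ℂ :=
  fun p => - Complex.I * g.leftInv (0, u) φ p

end Group

end TwoStepAlgebra

/-! ### Projection-valued measures and spectral integrals -/

/-- A (Borel) projection-valued measure on `α` with values in the orthogonal projections of the
Hilbert space `F`, countably additive for the strong operator topology. -/
structure ProjectionValuedMeasure (α F : Type*) [MeasurableSpace α] [NormedAddCommGroup F]
    [InnerProductSpace ℂ F] [CompleteSpace F] where
  proj : Set α → F →L[ℂ] F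
  isStarProjection : ∀ B, MeasurableSet B → IsStarProjection (proj B)
  proj_univ : proj univ = 1
  proj_inter : ∀ A B, MeasurableSet A → MeasurableSet B → proj (A ∩ B) = proj A * proj B
  hasSum_iUnion : ∀ B : ℕ → Set α, (∀ i, MeasurableSet (B i)) →
    Pairwise (fun i j => Disjoint (B i) (B j)) →
    ∀ f : F, HasSum (fun i => proj (B i) f) (proj (⋃ i, B i) f)

namespace ProjectionValuedMeasure

variable {α F : Type*} [MeasurableSpace α] [NormedAddCommGroup F] [InnerProductSpace ℂ F]
  [CompleteSpace F] (E : ProjectionValuedMeasure α F)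

theorem proj_empty : E.proj ∅ = 0 := by
  ext f
  have h := E.hasSum_iUnion (fun _ => ∅) (fun _ => MeasurableSet.empty)
    (fun _ _ _ => by simp) f
  simp only [iUnion_empty] at h
  simpa using (tendsto_nhds_unique h.summable.tendsto_atTop_zero tendsto_const_nhds).symm

theorem inner_proj_nonneg (f : F) {B : Set α} (hB : MeasurableSet B) :
    0 ≤ (inner ℂ f (E.proj B f)).re := by
  have hp := E.isStarProjection B hB
  have h1 : E.proj B f = E.proj B (E.proj B f) := by
    conv_lhs => rw [← hp.isIdempotentElem.eq]
    rfl
  have h2 : inner ℂ f (E.proj B f) = inner ℂ (E.proj B f) (E.proj B f) := by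
    conv_lhs => rw [h1]
    rw [← ContinuousLinearMap.adjoint_inner_left, ← ContinuousLinearMap.star_eq_adjoint,
      hp.isSelfAdjoint.star_eq]
  rw [h2]
  exact inner_self_nonneg (𝕜 := ℂ) (x := E.proj B f)

/-- The scalar spectral measure `E_f(B) = ⟨E(B) f, f⟩`. -/
def scalarMeasure (f : F) : Measure α :=
  Measure.ofMeasurable (fun B _ => ENNReal.ofReal (inner ℂ f (E.proj B f)).re)
    (by simp [E.proj_empty])
    (by
      intro B hB hd
      have h := E.hasSum_iUnion B hB hd f
      have h2 : HasSum (fun i => (inner ℂ f (E.proj (B i) f)).re)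
          (inner ℂ f (E.proj (⋃ i, B i) f)).re :=
        Complex.hasSum_re (h.mapL (innerSL ℂ f))
      rw [← h2.tsum_eq]
      exact ENNReal.ofReal_tsum_of_nonneg (fun i => E.inner_proj_nonneg f (hB i)) h2.summable)

theorem scalarMeasure_apply (f : F) {B : Set α} (hB : MeasurableSet B) :
    E.scalarMeasure f B = ENNReal.ofReal (inner ℂ f (E.proj B f)).re :=
  Measure.ofMeasurable_apply B hB

/-- `T = ∫ h dE` for a bounded Borel function `h`; on a complex Hilbert space `T` is determined by
its quadratic form. -/
def IsIntegral (h : α → ℂ) (T : F →L[ℂ] F) : Prop :=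
  ∀ f : F, inner ℂ f (T f) = ∫ a, h a ∂(E.scalarMeasure f)

theorem IsIntegral.unique {E : ProjectionValuedMeasure α F} {h : α → ℂ} {S T : F →L[ℂ] F}
    (hS : E.IsIntegral h S) (hT : E.IsIntegral h T) : S = T := by
  have key : (S : F →ₗ[ℂ] F) = (T : F →ₗ[ℂ] F) := by
    rw [← ext_inner_map]
    intro f
    have h1 : inner ℂ f (S f) = inner ℂ f (T f) := (hS f).trans (hT f).symm
    have h2 := congrArg (starRingEnd ℂ) h1
    rw [inner_conj_symm, inner_conj_symm] at h2
    exact h2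
  exact ContinuousLinearMap.coe_injective key

/-- The integral `∫ h dE_{f', f}` against the complex measure `E_{f', f}(B) = ⟨f', E(B) f⟩`
(conjugate-linear in `f'`), obtained by polarization. -/
def crossIntegral (h : α → ℂ) (f' f : F) : ℂ :=
  ((∫ a, h a ∂(E.scalarMeasure (f' + f))) - (∫ a, h a ∂(E.scalarMeasure (f' - f)))
    - Complex.I * (∫ a, h a ∂(E.scalarMeasure (f' + Complex.I • f)))
    + Complex.I * (∫ a, h a ∂(E.scalarMeasure (f' - Complex.I • f)))) / 4

/-- The domain of the self-adjoint operator `∫ h dE`, for a real Borel function `h`. -/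
def spectralDomain (h : α → ℝ) : Set F :=
  {f | ∫⁻ a, ENNReal.ofReal (h a ^ 2) ∂(E.scalarMeasure f) < ⊤}

/-- The graph of the self-adjoint operator `∫ h dE`: the pairs `(f, g)` with `f` in the domain and
`⟨f', g⟩ = ∫ h dE_{f', f}` for all `f'` in the (dense) domain. -/
def spectralGraph (h : α → ℝ) : Set (F × F) :=
  {p | p.1 ∈ E.spectralDomain h ∧ ∀ f' ∈ E.spectralDomain h,
    inner ℂ f' p.2 = E.crossIntegral (fun a => (h a : ℂ)) f' p.1}

end ProjectionValuedMeasure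

/-! ### The joint functional calculus of the sublaplacian and the central derivatives -/

/-- Smooth compactly supported functions. -/
def IsTest {M : Type*} [NormedAddCommGroup M] [NormedSpace ℝ M] (φ : M → ℂ) : Prop :=
  ContDiff ℝ (⊤ : ℕ∞) φ ∧ HasCompactSupport φ

/-- The graph, in `L² × L²`, of the operator `A` with domain the smooth compactly supported
functions. -/
def testGraph {M : Type*} [NormedAddCommGroup M] [NormedSpace ℝ M] [MeasurableSpace M]
    (ν : Measure M) (A : (M → ℂ) → (M → ℂ)) : Set (Lp ℂ 2 ν × Lp ℂ 2 ν) :=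
  {p | ∃ φ, IsTest φ ∧ p.1 =ᵐ[ν] φ ∧ p.2 =ᵐ[ν] A φ}

namespace TwoStepAlgebra

section Analysis

variable {V W : Type*} [NormedAddCommGroup V] [InnerProductSpace ℝ V] [FiniteDimensional ℝ V]
  [MeasurableSpace V] [BorelSpace V] [NormedAddCommGroup W] [NormedSpace ℝ W]
  [FiniteDimensional ℝ W] [MeasurableSpace W] [BorelSpace W]
  {ι κ : Type*} [Fintype ι] [Fintype κ]

/-- The Haar measure `dx du` of the group: `dx` is the Lebesgue measure of the Euclidean space `V`
and `du` is the Lebesgue measure of `W` in the coordinates of the basis `U`. -/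
abbrev haar (_g : TwoStepAlgebra V W) (U : Module.Basis κ ℝ W) : Measure (V × W) :=
  (volume : Measure V).prod U.addHaar

/-- `E` is the joint spectral measure on `ℝ × ℝ^κ` of `L = -∑ X_j²` and `-i U_k`: the closures of
these operators, initially defined on the test functions, are `∫ λ dE(λ, η)` and
`∫ η_k dE(λ, η)`. -/
def IsJointSpectralMeasure (g : TwoStepAlgebra V W) (X : OrthonormalBasis ι ℝ V)
    (U : Module.Basis κ ℝ W)
    (E : ProjectionValuedMeasure (ℝ × (κ → ℝ)) (Lp ℂ 2 (g.haar U))) : Prop :=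
  closure (testGraph (g.haar U) (g.sublaplacian X)) = E.spectralGraph (fun a => a.1) ∧
  ∀ k, closure (testGraph (g.haar U) (g.centralDeriv (U k))) = E.spectralGraph (fun a => a.2 k)

/-- `K` is the convolution kernel of the operator `T`: `T φ = φ * K` for all test functions `φ`,
where `(φ * K)(p) = ∫ φ(q) K(q⁻¹ p) dq`. -/
def IsConvKernel (g : TwoStepAlgebra V W) (U : Module.Basis κ ℝ W)
    (T : Lp ℂ 2 (g.haar U) →L[ℂ] Lp ℂ 2 (g.haar U)) (K : V × W → ℂ) : Prop :=
  LocallyIntegrable K (g.haar U) ∧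
  ∀ (φ : V × W → ℂ), IsTest φ → ∀ f : Lp ℂ 2 (g.haar U), f =ᵐ[g.haar U] φ →
    T f =ᵐ[g.haar U] fun p => ∫ q, φ q * K (g.mul (g.inv q) p) ∂(g.haar U)

/-- The skew-adjoint endomorphism `J_η` of `V` with `⟨J_η x, x'⟩ = η([x, x'])`. Here `η ∈ ℝ^κ` is
identified with the linear functional on `W` that maps `U_k` to `η_k`. -/
def J (g : TwoStepAlgebra V W) (U : Module.Basis κ ℝ W) (η : κ → ℝ) : V →ₗ[ℝ] V :=
  (InnerProductSpace.toDual ℝ V).symm.toLinearEquiv.toLinearMap ∘ₗ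
    LinearMap.toContinuousLinearMap.toLinearMap ∘ₗ
      (LinearMap.compRight ℝ (U.constr ℝ η : W →ₗ[ℝ] ℝ)) ∘ₗ g.bracket

theorem inner_J (g : TwoStepAlgebra V W) (U : Module.Basis κ ℝ W) (η : κ → ℝ) (x x' : V) :
    inner ℝ (g.J U η x) x' = U.constr ℝ η (g.bracket x x') := by
  simp [J]

/-- A simultaneous factorization of the characteristic polynomials `p_η` of `-J_η²`, for `η` in a
nonempty homogeneous Zariski-open subset `dom` of `ℝ^κ`:
`p_η(λ) = λ^{r₀} ∏_j (λ - (b_j^η)²)^{2 r_j}` with distinct positive `b_j^η` and constant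
multiplicities. (No regularity of `η ↦ b_j^η` is asked for, so that in particular every continuous
or analytic choice is allowed.) -/
structure SpectralData (g : TwoStepAlgebra V W) (U : Module.Basis κ ℝ W) where
  dom : Set (κ → ℝ)
  dom_nonempty : dom.Nonempty
  dom_zariski_open : ∃ S : Set (MvPolynomial κ ℝ),
    dom = {η | ∃ p ∈ S, MvPolynomial.eval η p ≠ 0}
  dom_homogeneous : ∀ t : ℝ, t ≠ 0 → ∀ η ∈ dom, t • η ∈ dom
  d₁ : ℕ
  r₀ : ℕ
  r : Fin d₁ → ℕ
  r_pos : ∀ j, 0 < r j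
  b : Fin d₁ → (κ → ℝ) → ℝ
  b_pos : ∀ η ∈ dom, ∀ j, 0 < b j η
  b_distinct : ∀ η ∈ dom, ∀ j j', j ≠ j' → b j η ≠ b j' η
  charpoly_eq : ∀ η ∈ dom, (-(g.J U η ∘ₗ g.J U η)).charpoly =
    Polynomial.X ^ r₀ * ∏ j, (Polynomial.X - Polynomial.C (b j η ^ 2)) ^ (2 * r j)

/-- The reparametrized multiplier
`m_H(n, μ, η) = H(∑_j (2 n_j + r_j) b_j^η + μ, η)`. -/
def SpectralData.multiplier {g : TwoStepAlgebra V W} {U : Module.Basis κ ℝ W}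
    (S : g.SpectralData U) (H : ℝ × (κ → ℝ) → ℂ) (n : Fin S.d₁ → ℝ) (μ : ℝ) (η : κ → ℝ) : ℂ :=
  H (∑ j, (2 * n j + S.r j) * S.b j η + μ, η)

end Analysis

/-- The measure `σ_{r₀}` on `[0, ∞)`: the Dirac mass at `0` if `r₀ = 0`, and otherwise
`π^{r₀/2} / Γ(r₀/2) · μ^{r₀/2} dμ/μ`. -/
def sigma (r₀ : ℕ) : Measure ℝ :=
  if r₀ = 0 then Measure.dirac 0
  else (volume.restrict (Ioi 0)).withDensity fun μ =>
    ENNReal.ofReal (Real.pi ^ ((r₀ : ℝ) / 2) / Real.Gamma ((r₀ : ℝ) / 2)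
      * (μ ^ ((r₀ : ℝ) / 2) / μ))

end TwoStepAlgebra

end

open Filter Topology
open scoped ComplexConjugate ContDiff Real
open Complex (I I_im I_sq conjCLE conj_I conj_conj conj_im conj_ofReal continuous_conj
  continuous_ofReal exp_conj measurable_ofReal mul_conj normSq_eq_norm_sq norm_real ofRealCLM
  ofReal_im ofReal_injective ofReal_re ofReal_sum real_smul)
open Real (Gamma cosh cosh_zero exp exp_add exp_le_exp exp_le_one_iff exp_lt_one_iff exp_nat_mul
  exp_pos exp_sum log measurable_exp norm_eq_abs norm_of_nonneg pi_pos rpow_two sinh sq_sqrt sqrt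
  sqrt_eq_rpow sqrt_inv sqrt_mul sqrt_pos sqrt_sq)
open ENNReal (ofReal ofReal_le_ofReal ofReal_lt_top ofReal_mul ofReal_ne_top ofReal_one ofReal_pos
  ofReal_pow ofReal_toReal pow_ne_top rpow_natCast toReal_ofNat toReal_ofReal toReal_pow)
open Finset (mem_erase mem_filter mul_sum prod_congr prod_mul_distrib prod_ne_zero_iff
  sum_add_distrib sum_comm sum_congr sum_le_sum sum_mul sum_neg_distrib sum_nonneg sum_sub_distrib)
open ContinuousLinearMap (adjoint_inner_left adjoint_inner_right star_eq_adjoint)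
open Module (Basis End)
open Function (Injective comp_apply uncurry)
open LinearMap (charpoly_toMatrix mkContinuous toContinuousLinearMap toMatrix_apply)

noncomputable section

/-! The formula is obtained from one explicit family of kernels, the heat kernels, and from the
uniqueness of Laplace transforms; no representation theory and no Hermite expansion is used. After
the Fourier transform in the central variable, `L` acts on the fibre over `η` as a Laplacian on `V`
twisted by `J_η`. With `A = -J_η²`, its heat kernel is the Gaussian with coefficient matrix `√A
coth(s√A)`, normalized by `det(4π sinh(s√A)/√A)^{-1/2}`, which is its value `heatDiag` at the
origin. The heat equation reduces to a Riccati equation and to the vanishing of `⟨f(A)x, J_η x⟩`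
(`sublaplacian_heatLift`, `bil_J`).

The fibre kernels are multiplied by an integrable weight `w(η)`, which makes them the transforms of
vectors `heatVec s` of `L²(G)`. These solve the heat equation weakly, and on bounded spectral bands
such a solution is the solution of a linear ODE; hence `heatVec (s + t) = e^{-tL} heatVec s` for
every joint spectral measure (`heatVec_add`). Letting `s → 0` identifies convolution with `heatVec
t` with `(2π)^{dim W / 2} e^{-tL} w(U)` (`convL_heatVec`). Consequently the convolution kernel of
`H(L,U)` is `(2π)^{-dim W / 2} Q(L,U) heatVec 1` with `Q = H e^λ / w`, and its squared norm is
`(2π)^{-dim W}` times the integral of `|Q|²` against the scalar spectral measure of `heatVec 1`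
(`exists_convL_eq_op`).

That measure is computed from its exponential moments. By the semigroup law, the integral of
`e^{-2tλ}` over the frequencies in `B` is `∫_B w² heatDiag(2s+2t)`. If measures `m_η` on the
half-line have Laplace transform `C · heatDiag(·, η)`, uniqueness gives the density `C⁻¹ w(η)²
e^{-2sλ} dm_η(λ) dη` (`lintegral_scalarMeasure_heatVec`); in the norm of the kernel all weights and
exponentials cancel. The factorization of the characteristic polynomial turns `heatDiag` into powers
of `s^{-1/2}` and of `b / sinh(sb)`. The former are Laplace transforms of `σ_{r₀}`, the latter
expand by the negative binomial series into exponentials at the points `(2n+r)b`, and the resulting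
`m_η` is `fibreMeasure` (`lintegral_exp_fibreMeasure`).

Two existence statements come with the formula. For the joint spectral measure, essential
self-adjointness follows from a Caccioppoli estimate with dilated cut-offs. The resolvents commute
because those of `-iU_k` are averages of central translations, and Gelfand theory then produces the
projection-valued measure. For the generic factorization, the number of eigenvalues that vanish or
have multiplicity at least `k` is the trailing degree of a characteristic polynomial with
coefficients polynomial in `η`; it is minimal on a Zariski-open set, and the multiplicities are
constant there. They are even since `J_η² = -a` on the eigenspace of `a`. -/

/-! ### Bounded measurable functional calculus of a projection-valued measure -/

/-- Bounded measurable functions. -/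
structure BddMeas {α : Type*} [MeasurableSpace α] (h : α → ℂ) : Prop where
  measurable : Measurable h
  bdd : ∃ C, ∀ a, ‖h a‖ ≤ C

namespace BddMeas

variable {α : Type*} [MeasurableSpace α] {h k : α → ℂ}

lemma add (hh : BddMeas h) (hk : BddMeas k) : BddMeas fun a => h a + k a := by
  obtain ⟨C, hC⟩ := hh.bdd
  obtain ⟨D, hD⟩ := hk.bdd
  exact ⟨hh.measurable.add hk.measurable, C + D,
    fun a => (norm_add_le _ _).trans (add_le_add (hC a) (hD a))⟩

lemma mul (hh : BddMeas h) (hk : BddMeas k) : BddMeas fun a => h a * k a := by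
  obtain ⟨C, hC⟩ := hh.bdd
  obtain ⟨D, hD⟩ := hk.bdd
  refine ⟨hh.measurable.mul hk.measurable, C * D, fun a => ?_⟩
  rw [norm_mul]
  exact mul_le_mul (hC a) (hD a) (norm_nonneg _) ((norm_nonneg _).trans (hC a))

lemma const (c : ℂ) : BddMeas fun _ : α => c := ⟨measurable_const, ‖c‖, fun _ => le_rfl⟩

lemma sub (hh : BddMeas h) (hk : BddMeas k) : BddMeas fun a => h a - k a := by
  simpa [sub_eq_add_neg] using hh.add ((const (-1)).mul hk)

lemma star (hh : BddMeas h) : BddMeas fun a => conj (h a) := by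
  obtain ⟨C, hC⟩ := hh.bdd
  exact ⟨continuous_conj.measurable.comp hh.measurable, C, fun a => by simpa using hC a⟩

lemma indicator (hh : BddMeas h) {B : Set α} (hB : MeasurableSet B) : BddMeas (B.indicator h) := by
  obtain ⟨C, hC⟩ := hh.bdd
  exact ⟨hh.measurable.indicator hB, C, fun a => (norm_indicator_le_norm_self _ _).trans (hC a)⟩

lemma comp {β : Type*} [MeasurableSpace β] (hh : BddMeas h) {φ : β → α}
    (hφ : Measurable φ) : BddMeas fun b => h (φ b) := by
  obtain ⟨C, hC⟩ := hh.bdd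
  exact ⟨hh.measurable.comp hφ, C, fun a => hC _⟩

lemma integrable (hh : BddMeas h) (μ : Measure α) [IsFiniteMeasure μ] :
    Integrable h μ := by
  obtain ⟨C, hC⟩ := hh.bdd
  exact Integrable.of_bound hh.measurable.aestronglyMeasurable C (.of_forall hC)

lemma integrable_sq (hh : BddMeas h) (μ : Measure α) [IsFiniteMeasure μ] :
    Integrable (fun a => ‖h a‖ ^ 2) μ := by
  obtain ⟨C, hC⟩ := hh.bdd
  refine Integrable.of_bound (hh.measurable.norm.pow_const 2).aestronglyMeasurable (C ^ 2)
    (.of_forall fun a => ?_)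
  rw [norm_of_nonneg (by positivity)]
  exact pow_le_pow_left₀ (norm_nonneg _) (hC a) 2

lemma simpleFunc (s : SimpleFunc α ℂ) : BddMeas s := ⟨s.measurable, s.exists_forall_norm_le⟩

lemma resolvent {h : α → ℝ} (hh : Measurable h) : BddMeas fun a => ((h a : ℂ) - I)⁻¹ := by
  refine ⟨((measurable_ofReal.comp hh).sub_const _).inv, 1, fun a => ?_⟩
  rw [norm_inv]
  refine inv_le_one_of_one_le₀ ?_
  have := Complex.abs_im_le_norm ((h a : ℂ) - I)
  simpa using this

end BddMeas

namespace ProjectionValuedMeasure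

variable {α F : Type*} [MeasurableSpace α] [NormedAddCommGroup F] [InnerProductSpace ℂ F]
  [CompleteSpace F] (E : ProjectionValuedMeasure α F)

lemma inner_proj_left {B : Set α} (hB : MeasurableSet B) (f g : F) :
    inner ℂ (E.proj B f) g = inner ℂ f (E.proj B g) := by
  rw [← adjoint_inner_left, ← star_eq_adjoint, (E.isStarProjection B hB).isSelfAdjoint.star_eq]

lemma proj_proj {A B : Set α} (hA : MeasurableSet A) (hB : MeasurableSet B) (f : F) :
    E.proj A (E.proj B f) = E.proj (A ∩ B) f := by
  rw [E.proj_inter A B hA hB]; rfl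

lemma inner_proj_self {B : Set α} (hB : MeasurableSet B) (f : F) :
    inner ℂ f (E.proj B f) = ((‖E.proj B f‖ ^ 2 : ℝ) : ℂ) := by
  conv_lhs => rw [← inter_self B, ← E.proj_proj hB hB, ← E.inner_proj_left hB]
  rw [inner_self_eq_norm_sq_to_K]; simp

lemma scalarMeasure_apply' (f : F) {B : Set α} (hB : MeasurableSet B) :
    E.scalarMeasure f B = ofReal (‖E.proj B f‖ ^ 2) := by
  rw [E.scalarMeasure_apply f hB, E.inner_proj_self hB, ofReal_re]

lemma scalarMeasure_univ (f : F) : E.scalarMeasure f univ = ofReal (‖f‖ ^ 2) := by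
  rw [E.scalarMeasure_apply' f MeasurableSet.univ, E.proj_univ]; rfl

instance (f : F) : IsFiniteMeasure (E.scalarMeasure f) :=
  ⟨by rw [E.scalarMeasure_univ]; exact ofReal_lt_top⟩

lemma scalarMeasure_real (f : F) {B : Set α} (hB : MeasurableSet B) :
    (E.scalarMeasure f).real B = ‖E.proj B f‖ ^ 2 := by
  rw [Measure.real, E.scalarMeasure_apply' f hB, toReal_ofReal (by positivity)]

/-- This makes the domain of an unbounded integral closed under sums. -/
lemma scalarMeasure_add_le (f g : F) :
    E.scalarMeasure (f + g) ≤ (2 : ENNReal) • (E.scalarMeasure f + E.scalarMeasure g) := by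
  refine Measure.le_iff.2 fun B hB => ?_
  rw [Measure.smul_apply, Measure.add_apply, E.scalarMeasure_apply' _ hB,
    E.scalarMeasure_apply' _ hB, E.scalarMeasure_apply' _ hB,
    ← ENNReal.ofReal_add (by positivity) (by positivity), smul_eq_mul,
    show (2 : ENNReal) = ofReal 2 by simp, ← ofReal_mul (by norm_num)]
  refine ofReal_le_ofReal ?_
  rw [map_add]
  have := norm_add_le (E.proj B f) (E.proj B g)
  nlinarith [norm_nonneg (E.proj B f + E.proj B g), sq_nonneg (‖E.proj B f‖ - ‖E.proj B g‖)]

lemma scalarMeasure_smul (c : ℂ) (hc : ‖c‖ = 1) (f : F) :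
    E.scalarMeasure (c • f) = E.scalarMeasure f := by
  ext B hB
  rw [E.scalarMeasure_apply' _ hB, E.scalarMeasure_apply' _ hB, map_smul, norm_smul, hc, one_mul]

lemma IsIntegral.add {h k : α → ℂ} {S T : F →L[ℂ] F} (hh : BddMeas h)
    (hk : BddMeas k) (hS : E.IsIntegral h S) (hT : E.IsIntegral k T) :
    E.IsIntegral (fun a => h a + k a) (S + T) := fun f => by
  rw [integral_add (hh.integrable _) (hk.integrable _), ← hS f, ← hT f, ← inner_add_right]; rfl

lemma IsIntegral.smul {h : α → ℂ} {S : F →L[ℂ] F} (c : ℂ) (hS : E.IsIntegral h S) :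
    E.IsIntegral (fun a => c * h a) (c • S) := fun f => by
  rw [integral_const_mul, ← hS f, ← inner_smul_right]; rfl

lemma IsIntegral.adjoint {h : α → ℂ} {S : F →L[ℂ] F} (hS : E.IsIntegral h S) :
    E.IsIntegral (fun a => conj (h a)) (ContinuousLinearMap.adjoint S) := fun f => by
  rw [integral_conj, ← hS f, inner_conj_symm, adjoint_inner_right]

/-- The integral of a simple function. -/
def simpleOp (s : SimpleFunc α ℂ) : F →L[ℂ] F := ∑ c ∈ s.range, c • E.proj (s ⁻¹' {c})

lemma isIntegral_simpleOp (s : SimpleFunc α ℂ) : E.IsIntegral s (E.simpleOp s) := fun f => by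
  rw [SimpleFunc.integral_eq_sum s ((BddMeas.simpleFunc s).integrable _), simpleOp,
    ContinuousLinearMap.sum_apply, inner_sum]
  refine sum_congr rfl fun c _ => ?_
  rw [ContinuousLinearMap.smul_apply, inner_smul_right, E.inner_proj_self (s.measurableSet_fiber c),
    E.scalarMeasure_real f (s.measurableSet_fiber c), mul_comm, real_smul]

/-- Distinct fibres of `s` have orthogonal projections, so only the diagonal terms survive. This
isometry property is what lets the integral pass to limits of simple functions. -/
lemma norm_sq_simpleOp (s : SimpleFunc α ℂ) (f : F) :
    ‖E.simpleOp s f‖ ^ 2 = ∫ a, ‖s a‖ ^ 2 ∂(E.scalarMeasure f) := by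
  have h1 : ∫ a, ‖s a‖ ^ 2 ∂(E.scalarMeasure f)
      = ∑ c ∈ s.range, (E.scalarMeasure f).real (s ⁻¹' {c}) • ‖c‖ ^ 2 := by
    have := SimpleFunc.map_integral s (fun c => ‖c‖ ^ 2)
      ((BddMeas.simpleFunc s).integrable (E.scalarMeasure f)) (by simp)
    rw [← this, SimpleFunc.integral_eq_integral]
    · rfl
    · exact (BddMeas.simpleFunc s).integrable_sq _
  rw [h1]
  have h2 : ((‖E.simpleOp s f‖ ^ 2 : ℝ) : ℂ) = inner ℂ (E.simpleOp s f) (E.simpleOp s f) := by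
    rw [inner_self_eq_norm_sq_to_K]; simp
  apply ofReal_injective
  rw [h2, simpleOp, ContinuousLinearMap.sum_apply, sum_inner, ofReal_sum]
  refine sum_congr rfl fun c hc => ?_
  rw [inner_sum, Finset.sum_eq_single c]
  · rw [ContinuousLinearMap.smul_apply, inner_smul_right, inner_smul_left,
      E.inner_proj_left (s.measurableSet_fiber c),
      E.proj_proj (s.measurableSet_fiber c) (s.measurableSet_fiber c), inter_self,
      E.inner_proj_self (s.measurableSet_fiber c), E.scalarMeasure_real f (s.measurableSet_fiber c),
      ← mul_assoc, mul_conj, smul_eq_mul, normSq_eq_norm_sq]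
    push_cast; ring
  · intro d _ hd
    rw [ContinuousLinearMap.smul_apply, ContinuousLinearMap.smul_apply, inner_smul_right,
      inner_smul_left, E.inner_proj_left (s.measurableSet_fiber c),
      E.proj_proj (s.measurableSet_fiber c) (s.measurableSet_fiber d)]
    have : (s ⁻¹' {c} ∩ s ⁻¹' {d}) = ∅ := by
      ext a; simp only [mem_inter_iff, mem_preimage, mem_singleton_iff, mem_empty_iff_false, iff_false]
      rintro ⟨h1, h2⟩; exact hd (h2.symm.trans h1)
    rw [this, E.proj_empty]; simp
  · exact fun h => absurd hc h

lemma cauchySeq_of_norm_sub_sq_le {x : ℕ → F} {b : ℕ → ℝ} (hb : Tendsto b atTop (𝓝 0))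
    (h : ∀ n m, ‖x n - x m‖ ^ 2 ≤ b n + b m) : CauchySeq x := by
  rw [Metric.cauchySeq_iff]
  intro ε hε
  have h1 : ∀ᶠ n in atTop, b n < ε ^ 2 / 2 := hb.eventually_lt_const (by positivity)
  obtain ⟨N, hN⟩ := eventually_atTop.1 h1
  refine ⟨N, fun m hm n hn => ?_⟩
  rw [dist_eq_norm]
  refine lt_of_pow_lt_pow_left₀ 2 hε.le ((h m n).trans_lt ?_)
  linarith [hN m hm, hN n hn]

lemma exists_isIntegral {h : α → ℂ} (hh : BddMeas h) :
    ∃ T : F →L[ℂ] F, E.IsIntegral h T ∧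
      ∀ f, ‖T f‖ ^ 2 = ∫ a, ‖h a‖ ^ 2 ∂(E.scalarMeasure f) := by
  obtain ⟨C, hC⟩ := hh.bdd
  rcases isEmpty_or_nonempty α with hα | ⟨⟨a0⟩⟩
  · refine ⟨0, fun f => by simp [Measure.eq_zero_of_isEmpty], fun f => by
      simp [Measure.eq_zero_of_isEmpty]⟩
  have hC0 : 0 ≤ C := (norm_nonneg _).trans (hC a0)
  have hsm := hh.measurable.stronglyMeasurable
  set s : ℕ → SimpleFunc α ℂ := hsm.approxBounded C with hs
  have hlim : ∀ a, Tendsto (fun n => s n a) atTop (𝓝 (h a)) :=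
    fun a => hsm.tendsto_approxBounded_of_norm_le (hC a)
  have hbd : ∀ n a, ‖s n a‖ ≤ C := fun n a => hsm.norm_approxBounded_le hC0 n a
  have hdiff : ∀ f, Tendsto (fun n => 2 * ∫ a, ‖s n a - h a‖ ^ 2 ∂(E.scalarMeasure f)) atTop
      (𝓝 0) := by
    intro f
    have : Tendsto (fun n => ∫ a, ‖s n a - h a‖ ^ 2 ∂(E.scalarMeasure f)) atTop
        (𝓝 (∫ a, (0 : ℝ) ∂(E.scalarMeasure f))) := by
      refine tendsto_integral_of_dominated_convergence (fun _ => (2 * C) ^ 2)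
        (fun n => ((((s n).measurable.sub hh.measurable).norm).pow_const 2).aestronglyMeasurable)
        (integrable_const _) (fun n => .of_forall fun a => ?_)
        (.of_forall fun a => ?_)
      · rw [norm_of_nonneg (by positivity)]
        refine pow_le_pow_left₀ (norm_nonneg _) ((norm_sub_le _ _).trans ?_) 2
        linarith [hbd n a, hC a]
      · have := ((hlim a).sub_const (h a)).norm.pow 2
        simpa using this
    simpa using this.const_mul 2
  have hcau : ∀ f, CauchySeq fun n => E.simpleOp (s n) f := by
    intro f
    refine cauchySeq_of_norm_sub_sq_le (hdiff f) fun n m => ?_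
    -- Linearity is not visible from the sum over the range; it follows because an operator is
    -- determined by its quadratic form.
    have h1 : E.simpleOp (s n) - E.simpleOp (s m) = E.simpleOp (s n - s m) := by
      refine IsIntegral.unique (E := E) (h := fun a => s n a - s m a) ?_ ?_
      · have := (E.isIntegral_simpleOp (s n)).add E (BddMeas.simpleFunc _)
          ((BddMeas.const (-1)).mul (BddMeas.simpleFunc (s m)))
          ((E.isIntegral_simpleOp (s m)).smul E (-1))
        simpa [sub_eq_add_neg] using this
      · exact E.isIntegral_simpleOp (s n - s m)
    have h2 : E.simpleOp (s n) f - E.simpleOp (s m) f = E.simpleOp (s n - s m) f := by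
      rw [← h1]; rfl
    have hi : ∀ j, Integrable (fun a => ‖s j a - h a‖ ^ 2) (E.scalarMeasure f) := fun j =>
      ((BddMeas.simpleFunc (s j)).sub hh).integrable_sq _
    rw [h2, norm_sq_simpleOp, ← integral_const_mul, ← integral_const_mul, ← integral_add
      ((hi n).const_mul _) ((hi m).const_mul _)]
    refine integral_mono ((BddMeas.simpleFunc (s n - s m)).integrable_sq _)
      (((hi n).const_mul _).add ((hi m).const_mul _)) fun a => ?_
    have e : (s n - s m) a = (s n a - h a) - (s m a - h a) := by simp
    have := norm_sub_le (s n a - h a) (s m a - h a)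
    simp only [e]
    nlinarith [norm_nonneg ((s n a - h a) - (s m a - h a)),
      sq_nonneg (‖s n a - h a‖ - ‖s m a - h a‖)]
  choose T hT using fun f => cauchySeq_tendsto_of_complete (hcau f)
  have hT' : Tendsto (fun n f => E.simpleOp (s n) f) atTop (𝓝 T) := tendsto_pi_nhds.2 hT
  refine ⟨continuousLinearMapOfTendsto (fun n => E.simpleOp (s n)) hT', fun f => ?_, fun f => ?_⟩
  · have h1 : Tendsto (fun n => inner ℂ f (E.simpleOp (s n) f)) atTop (𝓝 (inner ℂ f (T f))) :=
      tendsto_const_nhds.inner (hT f)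
    refine tendsto_nhds_unique h1 ?_
    simp_rw [(E.isIntegral_simpleOp _) f]
    exact tendsto_integral_of_dominated_convergence (fun _ => C)
      (fun n => (s n).measurable.aestronglyMeasurable) (integrable_const _)
      (fun n => .of_forall (hbd n)) (.of_forall hlim)
  · have h1 : Tendsto (fun n => ‖E.simpleOp (s n) f‖ ^ 2) atTop (𝓝 (‖T f‖ ^ 2)) := (hT f).norm.pow 2
    refine tendsto_nhds_unique h1 ?_
    simp_rw [norm_sq_simpleOp]
    refine tendsto_integral_of_dominated_convergence (fun _ => C ^ 2)
      (fun n => ((s n).measurable.norm.pow_const 2).aestronglyMeasurable) (integrable_const _)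
      (fun n => .of_forall fun a => ?_) (.of_forall fun a => (hlim a).norm.pow 2)
    rw [norm_of_nonneg (by positivity)]
    exact pow_le_pow_left₀ (norm_nonneg _) (hbd n a) 2

open Classical in
/-- The operator `∫ h dE` for a bounded measurable function `h` (and `0` otherwise). -/
def op (h : α → ℂ) : F →L[ℂ] F :=
  if hh : BddMeas h then (E.exists_isIntegral hh).choose else 0

lemma isIntegral_op {h : α → ℂ} (hh : BddMeas h) : E.IsIntegral h (E.op h) := by
  rw [op, dif_pos hh]; exact (E.exists_isIntegral hh).choose_spec.1

lemma norm_sq_op {h : α → ℂ} (hh : BddMeas h) (f : F) :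
    ‖E.op h f‖ ^ 2 = ∫ a, ‖h a‖ ^ 2 ∂(E.scalarMeasure f) := by
  rw [op, dif_pos hh]; exact (E.exists_isIntegral hh).choose_spec.2 f

lemma op_eq {h : α → ℂ} (hh : BddMeas h) {T : F →L[ℂ] F} (hT : E.IsIntegral h T) :
    E.op h = T := IsIntegral.unique (E.isIntegral_op hh) hT

lemma op_add {h k : α → ℂ} (hh : BddMeas h) (hk : BddMeas k) :
    E.op (fun a => h a + k a) = E.op h + E.op k :=
  E.op_eq (hh.add hk) ((E.isIntegral_op hh).add E hh hk (E.isIntegral_op hk))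

lemma op_smul {h : α → ℂ} (hh : BddMeas h) (c : ℂ) : E.op (fun a => c * h a) = c • E.op h :=
  E.op_eq ((BddMeas.const c).mul hh) ((E.isIntegral_op hh).smul E c)

lemma op_sub {h k : α → ℂ} (hh : BddMeas h) (hk : BddMeas k) :
    E.op (fun a => h a - k a) = E.op h - E.op k := by
  have h1 := E.op_add hh ((BddMeas.const (-1)).mul hk)
  rw [E.op_smul hk] at h1
  simpa [sub_eq_add_neg] using h1

lemma op_conj {h : α → ℂ} (hh : BddMeas h) :
    E.op (fun a => conj (h a)) = ContinuousLinearMap.adjoint (E.op h) :=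
  E.op_eq hh.star ((E.isIntegral_op hh).adjoint E)

lemma op_const (c : ℂ) : E.op (fun _ => c) = c • 1 := by
  refine E.op_eq (BddMeas.const c) fun f => ?_
  rw [ContinuousLinearMap.smul_apply, inner_smul_right, ContinuousLinearMap.one_apply,
    inner_self_eq_norm_sq_to_K, integral_const, Measure.real, E.scalarMeasure_univ,
    toReal_ofReal (by positivity), real_smul, mul_comm]
  simp

lemma op_one : E.op (fun _ => 1) = 1 := by rw [op_const, one_smul]

/-- Polarization of `norm_sq_op`, applied to `h + k`. With the imaginary part this yields the
multiplicativity of the calculus. -/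
lemma re_inner_op_op {h k : α → ℂ} (hh : BddMeas h) (hk : BddMeas k) (f : F) :
    (inner ℂ (E.op h f) (E.op k f)).re
      = (∫ a, conj (h a) * k a ∂(E.scalarMeasure f)).re := by
  have h1 := E.norm_sq_op (hh.add hk) f
  rw [E.op_add hh hk, ContinuousLinearMap.add_apply, @norm_add_sq ℂ, E.norm_sq_op hh,
    E.norm_sq_op hk] at h1
  have hi : Integrable (fun a => conj (h a) * k a) (E.scalarMeasure f) :=
    (hh.star.mul hk).integrable _
  have h2 : ∫ a, ‖h a + k a‖ ^ 2 ∂(E.scalarMeasure f) = ∫ a, ‖h a‖ ^ 2 ∂(E.scalarMeasure f)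
      + 2 * (∫ a, conj (h a) * k a ∂(E.scalarMeasure f)).re
      + ∫ a, ‖k a‖ ^ 2 ∂(E.scalarMeasure f) := by
    have h3 : (∫ a, conj (h a) * k a ∂(E.scalarMeasure f)).re
        = ∫ a, (conj (h a) * k a).re ∂(E.scalarMeasure f) := (integral_re hi).symm
    have hi' : Integrable (fun a => 2 * (conj (h a) * k a).re) (E.scalarMeasure f) :=
      hi.re.const_mul 2
    rw [h3, ← integral_const_mul, ← integral_add (hh.integrable_sq _) hi',
      ← integral_add (f := fun a => ‖h a‖ ^ 2 + 2 * (conj (h a) * k a).re)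
        ((hh.integrable_sq _).add hi') (hk.integrable_sq _)]
    congr 1; ext a
    have := @norm_add_sq ℂ ℂ _ _ _ (h a) (k a)
    simp only [RCLike.inner_apply] at this
    rw [this, mul_comm (k a)]; rfl
  rw [h2] at h1
  have h4 : RCLike.re (inner ℂ (E.op h f) (E.op k f)) = (inner ℂ (E.op h f) (E.op k f)).re := rfl
  rw [h4] at h1
  linarith

lemma inner_op_op {h k : α → ℂ} (hh : BddMeas h) (hk : BddMeas k) (f : F) :
    inner ℂ (E.op h f) (E.op k f) = ∫ a, conj (h a) * k a ∂(E.scalarMeasure f) := by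
  apply Complex.ext
  · exact E.re_inner_op_op hh hk f
  -- The imaginary part of `z` is the real part of `-i z`.
  · have h1 := E.re_inner_op_op hh ((BddMeas.const (-I)).mul hk) f
    rw [E.op_smul hk, ContinuousLinearMap.smul_apply, inner_smul_right] at h1
    have h2 : ∀ a, conj (h a) * (-I * k a)
        = -I * (conj (h a) * k a) := fun a => by ring
    simp_rw [h2] at h1
    rw [integral_const_mul] at h1
    simpa using h1

lemma op_mul {h k : α → ℂ} (hh : BddMeas h) (hk : BddMeas k) :
    E.op (fun a => h a * k a) = E.op h * E.op k := by
  refine E.op_eq (hh.mul hk) fun f => ?_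
  rw [ContinuousLinearMap.mul_apply, ← adjoint_inner_left, ← E.op_conj hh, E.inner_op_op hh.star hk]
  simp

lemma op_mul_apply {h k : α → ℂ} (hh : BddMeas h) (hk : BddMeas k) (f : F) :
    E.op (fun a => h a * k a) f = E.op h (E.op k f) := by
  rw [E.op_mul hh hk]; rfl

lemma op_indicator_one {B : Set α} (hB : MeasurableSet B) :
    E.op (B.indicator fun _ => 1) = E.proj B := by
  refine E.op_eq ((BddMeas.const 1).indicator hB) fun f => ?_
  rw [integral_indicator hB, setIntegral_const, E.scalarMeasure_real f hB, E.inner_proj_self hB]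
  simp

lemma norm_op_le {h : α → ℂ} (hh : BddMeas h) {C : ℝ} (hC : 0 ≤ C)
    (hb : ∀ a, ‖h a‖ ≤ C) (f : F) : ‖E.op h f‖ ≤ C * ‖f‖ := by
  refine le_of_sq_le_sq ?_ (by positivity)
  rw [E.norm_sq_op hh, mul_pow]
  calc ∫ a, ‖h a‖ ^ 2 ∂(E.scalarMeasure f) ≤ ∫ _, C ^ 2 ∂(E.scalarMeasure f) :=
        integral_mono (hh.integrable_sq _) (integrable_const _)
          fun a => pow_le_pow_left₀ (norm_nonneg _) (hb a) 2
    _ = C ^ 2 * ‖f‖ ^ 2 := by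
        rw [integral_const, Measure.real, E.scalarMeasure_univ,
          toReal_ofReal (by positivity), smul_eq_mul, mul_comm]

lemma op_congr_ae {h k : α → ℂ} (hh : BddMeas h) (hk : BddMeas k) (f : F)
    (hhk : h =ᵐ[E.scalarMeasure f] k) : E.op h f = E.op k f := by
  rw [← sub_eq_zero, ← ContinuousLinearMap.sub_apply, ← E.op_sub hh hk, ← norm_eq_zero,
    ← sq_eq_zero_iff, E.norm_sq_op (hh.sub hk)]
  rw [integral_eq_zero_of_ae]
  filter_upwards [hhk] with a ha
  simp [ha]

lemma scalarMeasure_op {h : α → ℂ} (hh : BddMeas h) (f : F) :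
    E.scalarMeasure (E.op h f) = (E.scalarMeasure f).withDensity fun a => ‖h a‖ₑ ^ 2 := by
  ext B hB
  rw [E.scalarMeasure_apply' _ hB, withDensity_apply _ hB, ← E.op_indicator_one hB,
    ← E.op_mul_apply ((BddMeas.const 1).indicator hB) hh,
    E.norm_sq_op (((BddMeas.const 1).indicator hB).mul hh),
    ofReal_integral_eq_lintegral_ofReal ((((BddMeas.const 1).indicator hB).mul hh).integrable_sq _)
      (.of_forall fun a => by positivity), ← lintegral_indicator hB]
  refine lintegral_congr fun a => ?_
  by_cases ha : a ∈ B
  · simp [ha, ofReal_pow]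
  · simp [ha]

/-- Bounded pointwise convergence implies strong convergence. -/
lemma tendsto_op {h : ℕ → α → ℂ} {k : α → ℂ} (hh : ∀ n, BddMeas (h n))
    (hk : BddMeas k) {C : ℝ} (hC : ∀ n a, ‖h n a‖ ≤ C) (f : F)
    (hlim : ∀ᵐ a ∂(E.scalarMeasure f), Tendsto (fun n => h n a) atTop (𝓝 (k a))) :
    Tendsto (fun n => E.op (h n) f) atTop (𝓝 (E.op k f)) := by
  rw [tendsto_iff_norm_sub_tendsto_zero]
  have : Tendsto (fun n => ∫ a, ‖h n a - k a‖ ^ 2 ∂(E.scalarMeasure f)) atTop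
      (𝓝 (∫ a, (0 : ℝ) ∂(E.scalarMeasure f))) := by
    obtain ⟨D, hD⟩ := hk.bdd
    refine tendsto_integral_of_dominated_convergence (fun _ => (C + D) ^ 2)
      (fun n => ((((hh n).measurable.sub hk.measurable).norm).pow_const 2).aestronglyMeasurable)
      (integrable_const _) (fun n => .of_forall fun a => ?_) ?_
    · rw [norm_of_nonneg (by positivity)]
      refine pow_le_pow_left₀ (norm_nonneg _) ((norm_sub_le _ _).trans ?_) 2
      linarith [hC n a, hD a]
    · filter_upwards [hlim] with a ha
      have := (ha.sub_const (k a)).norm.pow 2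
      simpa using this
  simp_rw [← E.norm_sq_op ((hh _).sub hk), E.op_sub (hh _) hk] at this
  have h2 := this.sqrt
  simpa using h2

/-! ### Unbounded integrals -/

lemma add_mem_spectralDomain {h : α → ℝ} (hh : Measurable h) {f g : F}
    (hf : f ∈ E.spectralDomain h) (hg : g ∈ E.spectralDomain h) : f + g ∈ E.spectralDomain h := by
  refine (lintegral_mono' (E.scalarMeasure_add_le f g) le_rfl).trans_lt ?_
  rw [lintegral_smul_measure, lintegral_add_measure]
  exact ENNReal.mul_lt_top (by simp) (ENNReal.add_lt_top.2 ⟨hf, hg⟩)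

lemma smul_mem_spectralDomain {h : α → ℝ} {f : F} (c : ℂ) (hc : ‖c‖ = 1)
    (hf : f ∈ E.spectralDomain h) : c • f ∈ E.spectralDomain h := by
  rw [spectralDomain, mem_setOf_eq, E.scalarMeasure_smul c hc]; exact hf

lemma integrable_of_mem_spectralDomain {h : α → ℝ} (hh : Measurable h) {f : F}
    (hf : f ∈ E.spectralDomain h) : Integrable (fun a => (h a : ℂ)) (E.scalarMeasure f) := by
  have h1 : MemLp h 2 (E.scalarMeasure f) := by
    rw [memLp_two_iff_integrable_sq hh.aestronglyMeasurable]
    refine ⟨(hh.pow_const 2).aestronglyMeasurable, ?_⟩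
    rw [hasFiniteIntegral_iff_ofReal (.of_forall fun a => sq_nonneg _)]
    exact hf
  exact (h1.integrable (by norm_num)).ofReal

/-- The truncation `h · 1_{|h| ≤ n}`. -/
def trunc (h : α → ℝ) (n : ℕ) (a : α) : ℂ := {a | |h a| ≤ n}.indicator (fun a => (h a : ℂ)) a

lemma bddMeas_trunc {h : α → ℝ} (hh : Measurable h) (n : ℕ) : BddMeas (trunc h n) := by
  have hm : MeasurableSet {a | |h a| ≤ n} := measurableSet_le hh.abs measurable_const
  refine ⟨(measurable_ofReal.comp hh).indicator hm, n, fun a => ?_⟩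
  by_cases ha : a ∈ {a | |h a| ≤ n}
  · rw [trunc, indicator_of_mem ha, norm_real]; exact ha
  · rw [trunc, indicator_of_notMem ha, norm_zero]; positivity

lemma trunc_eq {h : α → ℝ} {n : ℕ} {a : α} (hn : |h a| ≤ n) : trunc h n a = h a :=
  indicator_of_mem (s := {a | |h a| ≤ n}) hn _

lemma tendsto_trunc (h : α → ℝ) (a : α) : Tendsto (fun n => trunc h n a) atTop (𝓝 (h a : ℂ)) := by
  refine tendsto_const_nhds.congr' ?_
  obtain ⟨N, hN⟩ := exists_nat_ge |h a|
  filter_upwards [eventually_ge_atTop N] with n hn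
  exact (trunc_eq (hN.trans (by exact_mod_cast hn))).symm

lemma norm_trunc_le (h : α → ℝ) (n : ℕ) (a : α) : ‖trunc h n a‖ ≤ |h a| := by
  refine (norm_indicator_le_norm_self _ _).trans ?_
  simp

lemma inner_eq_crossIntegral {h : α → ℂ} (hh : BddMeas h) (f' f : F) :
    inner ℂ f' (E.op h f) = E.crossIntegral h f' f := by
  have hI := E.isIntegral_op hh
  rw [crossIntegral, ← hI, ← hI, ← hI, ← hI]
  simp only [map_add, map_sub, map_smul, inner_add_left, inner_add_right, inner_sub_left,
    inner_sub_right, inner_smul_left, inner_smul_right, conj_I]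
  ring_nf
  simp only [I_sq]
  ring

/-- The cross integral is defined by polarization, so its sesquilinearity is not apparent. Writing
it as a limit of matrix coefficients of bounded operators gives access to the bounded calculus. -/
lemma tendsto_crossIntegral {h : α → ℝ} (hh : Measurable h) {f' f : F}
    (hf' : f' ∈ E.spectralDomain h) (hf : f ∈ E.spectralDomain h) :
    Tendsto (fun n => inner ℂ f' (E.op (trunc h n) f)) atTop
      (𝓝 (E.crossIntegral (fun a => (h a : ℂ)) f' f)) := by
  simp_rw [E.inner_eq_crossIntegral (bddMeas_trunc hh _)]
  have key : ∀ g ∈ E.spectralDomain h, Tendsto (fun n => ∫ a, trunc h n a ∂(E.scalarMeasure g))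
      atTop (𝓝 (∫ a, (h a : ℂ) ∂(E.scalarMeasure g))) := by
    intro g hg
    exact tendsto_integral_of_dominated_convergence (fun a => |h a|)
      (fun n => (bddMeas_trunc hh n).measurable.aestronglyMeasurable)
      (by simpa using (E.integrable_of_mem_spectralDomain hh hg).norm)
      (fun n => .of_forall (norm_trunc_le h n)) (.of_forall (tendsto_trunc h))
  have hI : I • f ∈ E.spectralDomain h := E.smul_mem_spectralDomain _ (by simp) hf
  have hneg : ∀ {g}, g ∈ E.spectralDomain h → -g ∈ E.spectralDomain h := fun {g} hg => by
    rw [← neg_one_smul ℂ g]; exact E.smul_mem_spectralDomain _ (by simp) hg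
  refine Tendsto.div_const (Tendsto.add (Tendsto.sub (Tendsto.sub ?_ ?_)
    (Tendsto.const_mul _ ?_)) (Tendsto.const_mul _ ?_)) _
  · exact key _ (E.add_mem_spectralDomain hh hf' hf)
  · exact key _ (by rw [sub_eq_add_neg]; exact E.add_mem_spectralDomain hh hf' (hneg hf))
  · exact key _ (E.add_mem_spectralDomain hh hf' hI)
  · exact key _ (by rw [sub_eq_add_neg]; exact E.add_mem_spectralDomain hh hf' (hneg hI))

/-- The resolvent `(∫ h dE - i)⁻¹`. -/
def res (h : α → ℝ) : F →L[ℂ] F := E.op fun a => ((h a : ℂ) - I)⁻¹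

lemma sub_I_ne_zero (x : ℝ) : (x : ℂ) - I ≠ 0 := fun h => by
  simpa using congrArg Complex.im h

lemma op_mem_spectralDomain {h : α → ℝ} (hh : Measurable h) {k : α → ℂ} (hk : BddMeas k)
    (hhk : BddMeas fun a => h a * k a) (g : F) : E.op k g ∈ E.spectralDomain h := by
  rw [spectralDomain, mem_setOf_eq, E.scalarMeasure_op hk, lintegral_withDensity_eq_lintegral_mul₀]
  · have h1 := (hhk.integrable_sq (E.scalarMeasure g)).lintegral_lt_top
    refine lt_of_eq_of_lt (lintegral_congr fun a => ?_) h1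
    rw [Pi.mul_apply, norm_mul, mul_pow, ofReal_mul (by positivity), mul_comm]
    simp [ofReal_pow]
  · exact (hk.measurable.enorm.pow_const 2).aemeasurable
  · exact (hh.pow_const 2).ennreal_ofReal.aemeasurable

lemma tendsto_op_trunc {h : α → ℝ} (hh : Measurable h) {k : α → ℂ} (hk : BddMeas k)
    (hhk : BddMeas fun a => h a * k a) (g : F) :
    Tendsto (fun n => E.op (trunc h n) (E.op k g)) atTop (𝓝 (E.op (fun a => h a * k a) g)) := by
  simp_rw [← E.op_mul_apply (bddMeas_trunc hh _) hk]
  obtain ⟨C, hC⟩ := hhk.bdd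
  refine E.tendsto_op (C := C) (fun n => (bddMeas_trunc hh n).mul hk) hhk (fun n a => ?_) g
    (.of_forall fun a => (tendsto_trunc h a).mul_const _)
  refine le_trans ?_ (hC a)
  rw [norm_mul, norm_mul, norm_real]
  exact mul_le_mul_of_nonneg_right (norm_trunc_le h n a) (norm_nonneg _)

/-- A supply of elements of the graph: vectors cut down by a function `k` for which `h k` stays
bounded. -/
lemma op_mem_spectralGraph {h : α → ℝ} (hh : Measurable h) {k : α → ℂ} (hk : BddMeas k)
    (hhk : BddMeas fun a => h a * k a) (g : F) :
    (E.op k g, E.op (fun a => h a * k a) g) ∈ E.spectralGraph h := by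
  have hd := E.op_mem_spectralDomain hh hk hhk g
  refine ⟨hd, fun f' hf' => ?_⟩
  exact tendsto_nhds_unique (tendsto_const_nhds.inner (E.tendsto_op_trunc hh hk hhk g))
    (E.tendsto_crossIntegral hh hf' hd)

lemma bddMeas_mul_res {h : α → ℝ} (hh : Measurable h) :
    BddMeas fun a => (h a : ℂ) * ((h a : ℂ) - I)⁻¹ := by
  have h1 : (fun a => (h a : ℂ) * ((h a : ℂ) - I)⁻¹)
      = fun a => 1 + I * ((h a : ℂ) - I)⁻¹ := by
    ext a
    field_simp [sub_I_ne_zero (h a)]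
    ring
  rw [h1]
  exact (BddMeas.const 1).add ((BddMeas.const I).mul (BddMeas.resolvent hh))

lemma op_mul_res {h : α → ℝ} (hh : Measurable h) (g : F) :
    E.op (fun a => (h a : ℂ) * ((h a : ℂ) - I)⁻¹) g = g + I • E.res h g := by
  have h1 : (fun a => (h a : ℂ) * ((h a : ℂ) - I)⁻¹)
      = fun a => 1 + I * ((h a : ℂ) - I)⁻¹ := by
    ext a
    field_simp [sub_I_ne_zero (h a)]
    ring
  rw [h1, E.op_add (BddMeas.const 1) ((BddMeas.const I).mul (BddMeas.resolvent hh)),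
    E.op_smul (BddMeas.resolvent hh), E.op_one]
  rfl

/-- Everything about the unbounded operator is reduced here to its bounded resolvent at `i`. For the
forward direction the graph relation is tested on `E.op R' m`, where `R'` is the conjugate resolvent
function; such vectors lie in the domain for all `m`. -/
lemma mem_spectralGraph_iff {h : α → ℝ} (hh : Measurable h) (f g : F) :
    (f, g) ∈ E.spectralGraph h ↔ E.res h (g - I • f) = f := by
  have hr := BddMeas.resolvent hh
  constructor
  · rintro ⟨hf, hfg⟩
    simp only at hf hfg
    refine ext_inner_left ℂ fun m => ?_
    set R' := fun a => conj (((h a : ℂ) - I)⁻¹) with hR'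
    have hR'b : BddMeas R' := hr.star
    have hhR' : BddMeas fun a => h a * R' a := by
      have := (bddMeas_mul_res hh).star
      simpa [hR'] using this
    have hm := E.op_mem_spectralDomain hh hR'b hhR' m
    have h1 := hfg _ hm
    have h2 : Tendsto (fun n => inner ℂ (E.op R' m) (E.op (trunc h n) f)) atTop
        (𝓝 (inner ℂ (E.op (fun a => h a * R' a) m) f)) := by
      have h3 : ∀ n, inner ℂ (E.op R' m) (E.op (trunc h n) f)
          = inner ℂ (E.op (trunc h n) (E.op R' m)) f := by
        intro n
        rw [← adjoint_inner_left, ← E.op_conj (bddMeas_trunc hh n)]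
        congr 3
        ext a
        by_cases ha : |h a| ≤ n
        · simp [trunc_eq ha]
        · rw [trunc, indicator_of_notMem (by simpa using ha), map_zero]
      simp_rw [h3]
      exact (E.tendsto_op_trunc hh hR'b hhR' m).inner tendsto_const_nhds
    have h4 := tendsto_nhds_unique h2 (E.tendsto_crossIntegral hh hm hf)
    rw [← h1] at h4
    have h5 : (fun a => (h a : ℂ) * R' a) = fun a => starRingEnd ℂ
        ((h a : ℂ) * ((h a : ℂ) - I)⁻¹) := by
      ext a; simp [hR']
    rw [h5, E.op_conj (bddMeas_mul_res hh), E.op_conj hr, adjoint_inner_left, adjoint_inner_left,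
      E.op_mul_res hh] at h4
    change inner ℂ m (f + I • E.res h f) = inner ℂ m (E.res h g) at h4
    rw [map_sub, map_smul, inner_sub_right, ← h4, inner_add_right]
    ring
  · intro h1
    have h2 := E.op_mem_spectralGraph hh hr (bddMeas_mul_res hh) (g - I • f)
    rw [E.op_mul_res hh] at h2
    change (E.res h _, _ + _ • E.res h _) ∈ _ at h2
    rw [h1] at h2
    simpa using h2

/-- The image of a projection-valued measure under a measurable map. -/
def map {β : Type*} [MeasurableSpace β] (φ : α → β) (hφ : Measurable φ) :
    ProjectionValuedMeasure β F where
  proj B := E.proj (φ ⁻¹' B)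
  isStarProjection B hB := E.isStarProjection _ (hφ hB)
  proj_univ := by rw [preimage_univ, E.proj_univ]
  proj_inter A B hA hB := by rw [preimage_inter, E.proj_inter _ _ (hφ hA) (hφ hB)]
  hasSum_iUnion B hB hd f := by
    rw [preimage_iUnion]
    exact E.hasSum_iUnion _ (fun i => hφ (hB i)) (fun i j hij => (hd hij).preimage φ) f

lemma scalarMeasure_map {β : Type*} [MeasurableSpace β] (φ : α → β) (hφ : Measurable φ) (f : F) :
    (E.map φ hφ).scalarMeasure f = (E.scalarMeasure f).map φ := by
  ext B hB
  rw [Measure.map_apply hφ hB, scalarMeasure_apply _ _ hB, scalarMeasure_apply _ _ (hφ hB)]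
  rfl

lemma op_map {β : Type*} [MeasurableSpace β] (φ : α → β) (hφ : Measurable φ) {h : β → ℂ}
    (hh : BddMeas h) : (E.map φ hφ).op h = E.op fun a => h (φ a) := by
  refine op_eq _ hh fun f => ?_
  rw [scalarMeasure_map, integral_map hφ.aemeasurable hh.measurable.aestronglyMeasurable]
  exact E.isIntegral_op (hh.comp hφ) f

lemma res_map {β : Type*} [MeasurableSpace β] (φ : α → β) (hφ : Measurable φ) {h : β → ℝ}
    (hh : Measurable h) : (E.map φ hφ).res h = E.res fun a => h (φ a) :=
  E.op_map φ hφ (BddMeas.resolvent hh)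

/-! ### Intertwining operators -/

section Intertwine

variable {F' : Type*} [NormedAddCommGroup F'] [InnerProductSpace ℂ F'] [CompleteSpace F']

/-- If `Φ` intertwines the resolvents of a family of functions that separates the points,
then it intertwines the projection-valued measures. -/
lemma scalarMeasure_of_intertwine [MetricSpace α] [BorelSpace α] [CompleteSpace α]
    [SecondCountableTopology α] (E' : ProjectionValuedMeasure α F') (Φ : F ≃ₗᵢ[ℂ] F')
    {ι : Type*} (h : ι → α → ℝ) (hc : ∀ i, Continuous (h i))
    (hsep : ∀ a b, (∀ i, h i a = h i b) → a = b)
    (hΦ : ∀ i f, Φ (E.res (h i) f) = E'.res (h i) (Φ f)) (f : F) :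
    E'.scalarMeasure (Φ f) = E.scalarMeasure f := by
  have hbm : ∀ a : BoundedContinuousFunction α ℂ, BddMeas a := fun a =>
    ⟨a.continuous.measurable, ‖a‖, a.norm_coe_le_norm⟩
  -- The functions whose operators are intertwined by `Φ` form a star algebra. It contains the
  -- resolvent functions of the `h i`, so it separates points and determines finite measures.
  let A : StarSubalgebra ℂ (BoundedContinuousFunction α ℂ) :=
    { carrier := {a | ∀ f, Φ (E.op a f) = E'.op a (Φ f)}
      mul_mem' := fun {a b} ha hb f => by
        have e1 := E.op_mul_apply (hbm a) (hbm b) f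
        have e2 := E'.op_mul_apply (hbm a) (hbm b) (Φ f)
        rw [BoundedContinuousFunction.coe_mul]
        exact (congrArg Φ e1).trans (((ha _).trans (congrArg _ (hb f))).trans e2.symm)
      add_mem' := fun {a b} ha hb f => by
        have e1 := E.op_add (hbm a) (hbm b)
        have e2 := E'.op_add (hbm a) (hbm b)
        rw [BoundedContinuousFunction.coe_add]
        change Φ (E.op (fun x => a x + b x) f) = E'.op (fun x => a x + b x) (Φ f)
        rw [e1, e2, ContinuousLinearMap.add_apply, map_add, ha, hb]; rfl
      algebraMap_mem' := fun c f => by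
        have e1 := E.op_const c
        have e2 := E'.op_const c
        change Φ (E.op (fun x => c) f) = E'.op (fun x => c) (Φ f)
        rw [e1, e2]; simp
      star_mem' := fun {a} ha f => by
        have e1 := E.op_conj (hbm a)
        have e2 := E'.op_conj (hbm a)
        change Φ (E.op (fun x => conj (a x)) f) = E'.op (fun x => conj (a x)) (Φ f)
        rw [e1, e2]
        refine ext_inner_left ℂ fun m => ?_
        obtain ⟨m, rfl⟩ := Φ.surjective m
        rw [adjoint_inner_right, ← ha m, Φ.inner_map_map, Φ.inner_map_map, adjoint_inner_right] }
  symm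
  refine ext_of_forall_mem_subalgebra_integral_eq_of_pseudoEMetric_complete_countable
    (𝕜 := ℂ) (A := A) ?_ ?_
  · intro a b hab
    by_contra hcon
    apply hab
    refine hsep a b fun i => ?_
    by_contra hne
    apply hcon
    have hbnd := BddMeas.resolvent (hc i).measurable
    have hcont : Continuous fun a => ((h i a : ℂ) - I)⁻¹ :=
      ((continuous_ofReal.comp (hc i)).sub continuous_const).inv₀ fun a => sub_I_ne_zero _
    let r : BoundedContinuousFunction α ℂ := BoundedContinuousFunction.ofNormedAddCommGroup
      (fun a => ((h i a : ℂ) - I)⁻¹) hcont hbnd.bdd.choose hbnd.bdd.choose_spec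
    refine ⟨r, ⟨r.toContinuousMap, ⟨r, fun f => hΦ i f, rfl⟩, rfl⟩, fun hr => hne ?_⟩
    have hr' : ((h i a : ℂ) - I)⁻¹ = ((h i b : ℂ) - I)⁻¹ := hr
    have := inv_injective hr'
    exact_mod_cast sub_left_injective this
  · intro a ha
    rw [← E.isIntegral_op (hbm a), ← E'.isIntegral_op (hbm a), ← ha f, Φ.inner_map_map]

lemma op_of_scalarMeasure_eq (E' : ProjectionValuedMeasure α F') (Φ : F ≃ₗᵢ[ℂ] F')
    (hΦ : ∀ f, E'.scalarMeasure (Φ f) = E.scalarMeasure f) {h : α → ℂ} (hh : BddMeas h)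
    (f : F) : Φ (E.op h f) = E'.op h (Φ f) := by
  have h1 : E.op h = (Φ.symm.toContinuousLinearEquiv.toContinuousLinearMap ∘L E'.op h) ∘L
      Φ.toContinuousLinearEquiv.toContinuousLinearMap := by
    refine E.op_eq hh fun f => ?_
    rw [← hΦ f, ← E'.isIntegral_op hh]
    change inner ℂ f (Φ.symm (E'.op h (Φ f))) = _
    rw [← Φ.inner_map_map, Φ.apply_symm_apply]
  rw [h1]
  exact Φ.apply_symm_apply _

end Intertwine

end ProjectionValuedMeasure

/-! ### The spectral theorem for commuting self-adjoint operators -/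

section RepresentationOfContinuousFunctions

variable {K F : Type*} [MetricSpace K] [CompactSpace K] [MeasurableSpace K] [BorelSpace K]
  [NormedAddCommGroup F] [InnerProductSpace ℂ F] [CompleteSpace F]
  (ρ : C(K, ℂ) →⋆ₐ[ℂ] (F →L[ℂ] F))

lemma inner_rep_rep (a b : C(K, ℂ)) (f : F) :
    inner ℂ (ρ a f) (ρ b f) = inner ℂ f (ρ (star a * b) f) := by
  rw [map_mul, map_star, star_eq_adjoint, ContinuousLinearMap.mul_apply, adjoint_inner_right]

/-- Real-valued continuous functions as complex-valued ones. -/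
def ofRealContinuousMap (a : C(K, ℝ)) : C(K, ℂ) := ⟨fun x => (a x : ℂ), by fun_prop⟩

-- Riesz–Markov for `a ↦ ⟨f, ρ(a) f⟩`. The functional is positive because a nonnegative `a` equals
-- `b* b` with `b = √a`, which gives `‖ρ(b) f‖²`.
open CompactlySupported in
lemma exists_repMeasure (f : F) : ∃ μ : Measure K, IsFiniteMeasure μ ∧
    ∀ a : C(K, ℂ), inner ℂ f (ρ a f) = ∫ x, a x ∂μ := by
  let Λ₀ : C_c(K, ℝ) →ₗ[ℝ] ℝ :=
    { toFun := fun a => (inner ℂ f (ρ (ofRealContinuousMap a.toContinuousMap) f)).re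
      map_add' := fun a b => by
        have : ofRealContinuousMap (a + b).toContinuousMap
            = ofRealContinuousMap a.toContinuousMap + ofRealContinuousMap b.toContinuousMap := by
          ext x; simp [ofRealContinuousMap]
        rw [this, map_add, ContinuousLinearMap.add_apply, inner_add_right, Complex.add_re]
      map_smul' := fun c a => by
        have : ofRealContinuousMap (c • a).toContinuousMap
            = (c : ℂ) • ofRealContinuousMap a.toContinuousMap := by
          ext x; simp [ofRealContinuousMap]
        rw [this, map_smul, ContinuousLinearMap.smul_apply, inner_smul_right]
        simp }
  have hΛ₀ : ∀ a : C_c(K, ℝ), 0 ≤ a → 0 ≤ Λ₀ a := by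
    intro a ha
    let b : C(K, ℂ) := ⟨fun x => (sqrt (a x) : ℂ), by fun_prop⟩
    have : ofRealContinuousMap a.toContinuousMap = star b * b := by
      ext x
      have h0 : 0 ≤ a x := ha x
      simp only [ofRealContinuousMap, ContinuousMap.coe_mk, ContinuousMap.mul_apply,
        ContinuousMap.star_apply, b, RCLike.star_def, conj_ofReal]
      rw [← Complex.ofReal_mul, Real.mul_self_sqrt h0]; rfl
    change 0 ≤ (inner ℂ f (ρ (ofRealContinuousMap a.toContinuousMap) f)).re
    rw [this, ← inner_rep_rep]
    exact inner_self_nonneg (𝕜 := ℂ)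
  let Λ : C_c(K, ℝ) →ₚ[ℝ] ℝ := PositiveLinearMap.mk₀ Λ₀ hΛ₀
  refine ⟨RealRMK.rieszMeasure Λ, inferInstance, fun a => ?_⟩
  have hreal : ∀ b : C(K, ℝ), inner ℂ f (ρ (ofRealContinuousMap b) f)
      = ((∫ x, b x ∂(RealRMK.rieszMeasure Λ) : ℝ) : ℂ) := by
    intro b
    have h1 := RealRMK.integral_rieszMeasure Λ ⟨b, HasCompactSupport.of_compactSpace _⟩
    have h2 : (inner ℂ f (ρ (ofRealContinuousMap b) f)).im = 0 := by
      have hs : star (ofRealContinuousMap b) = ofRealContinuousMap b := by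
        ext x; simp [ofRealContinuousMap]
      have h3 : inner ℂ f (ρ (ofRealContinuousMap b) f)
          = inner ℂ (ρ (ofRealContinuousMap b) f) f := by
        conv_lhs => rw [← hs, map_star, star_eq_adjoint, adjoint_inner_right]
      rw [← inner_conj_symm] at h3
      have := congrArg Complex.im h3
      rw [conj_im] at this
      have h4 : (inner ℂ (ρ (ofRealContinuousMap b) f) f).im
        = -(inner ℂ f (ρ (ofRealContinuousMap b) f)).im := by
        rw [← inner_conj_symm, conj_im]
      linarith
    apply Complex.ext
    · rw [ofReal_re]; exact h1.symm
    · rw [h2, ofReal_im]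
  let ar : C(K, ℝ) := ⟨fun x => (a x).re, by fun_prop⟩
  let ai : C(K, ℝ) := ⟨fun x => (a x).im, by fun_prop⟩
  have hdec : a = ofRealContinuousMap ar + I • ofRealContinuousMap ai := by
    ext x
    simp only [ofRealContinuousMap, ContinuousMap.add_apply, ContinuousMap.smul_apply,
      ContinuousMap.coe_mk, ar, ai, smul_eq_mul]
    rw [mul_comm, Complex.re_add_im]
  have hint : Integrable a (RealRMK.rieszMeasure Λ) :=
    Integrable.of_bound a.continuous.measurable.aestronglyMeasurable ‖a‖
      (.of_forall a.norm_coe_le_norm)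
  conv_lhs => rw [hdec]
  rw [map_add, map_smul, ContinuousLinearMap.add_apply, ContinuousLinearMap.smul_apply,
    inner_add_right, inner_smul_right, hreal, hreal, ← integral_re_add_im hint, mul_comm]
  rfl

/-- The scalar spectral measures of a representation of `C(K)`. -/
def repMeasure (f : F) : Measure K := (exists_repMeasure ρ f).choose

instance (f : F) : IsFiniteMeasure (repMeasure ρ f) := (exists_repMeasure ρ f).choose_spec.1

lemma inner_rep (a : C(K, ℂ)) (f : F) : inner ℂ f (ρ a f) = ∫ x, a x ∂(repMeasure ρ f) :=
  (exists_repMeasure ρ f).choose_spec.2 a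

lemma bddMeas_continuousMap (a : C(K, ℂ)) : BddMeas a :=
  ⟨a.continuous.measurable, ‖a‖, a.norm_coe_le_norm⟩

lemma norm_sq_rep (a : C(K, ℂ)) (f : F) : ‖ρ a f‖ ^ 2 = ∫ x, ‖a x‖ ^ 2 ∂(repMeasure ρ f) := by
  apply ofReal_injective
  have h2 : ((‖ρ a f‖ ^ 2 : ℝ) : ℂ) = inner ℂ (ρ a f) (ρ a f) := by
    rw [inner_self_eq_norm_sq_to_K]; simp
  rw [h2, inner_rep_rep, inner_rep, ← integral_complex_ofReal]
  congr 1; ext x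
  simp only [ContinuousMap.mul_apply, ContinuousMap.star_apply, RCLike.star_def]
  rw [mul_comm, mul_conj, normSq_eq_norm_sq]

lemma repMeasure_univ_le (f : F) : (repMeasure ρ f).real univ = ‖f‖ ^ 2 := by
  have := norm_sq_rep ρ 1 f
  simpa using this.symm

/-- The indicator function of a set. -/
def oneOn {α : Type*} (B : Set α) : α → ℂ := B.indicator fun _ => 1

lemma bddMeas_oneOn {α : Type*} [MeasurableSpace α] {B : Set α} (hB : MeasurableSet B) :
    BddMeas (oneOn B) := (BddMeas.const 1).indicator hB

lemma norm_oneOn_le {α : Type*} (B : Set α) (x : α) : ‖oneOn B x‖ ≤ 1 :=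
  (norm_indicator_le_norm_self _ _).trans (by simp)

/-- The squared `L²` distance to an indicator function. -/
def distSq (μ : Measure K) (B : Set K) (a : C(K, ℂ)) : ℝ := ∫ x, ‖a x - oneOn B x‖ ^ 2 ∂μ

lemma exists_distSq_le (μ : Measure K) [IsFiniteMeasure μ] {B : Set K} (hB : MeasurableSet B)
    {ε : ℝ} (hε : 0 < ε) : ∃ a : C(K, ℂ), distSq μ B a ≤ ε := by
  have h1 : MemLp (oneOn B) (ofReal 2) μ := by
    obtain ⟨C, hC⟩ := (bddMeas_oneOn hB).bdd
    exact MemLp.of_bound (bddMeas_oneOn hB).measurable.aestronglyMeasurable C (.of_forall hC)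
  obtain ⟨g, hg, -⟩ := h1.exists_boundedContinuous_integral_rpow_sub_le (by norm_num) hε
  refine ⟨g.toContinuousMap, le_trans (le_of_eq ?_) hg⟩
  refine integral_congr_ae (.of_forall fun x => ?_)
  simp only [BoundedContinuousFunction.coe_toContinuousMap, norm_sub_rev, rpow_two]

lemma distSq_add (μ ν : Measure K) [IsFiniteMeasure μ] [IsFiniteMeasure ν] {B : Set K}
    (hB : MeasurableSet B) (a : C(K, ℂ)) :
    distSq (μ + ν) B a = distSq μ B a + distSq ν B a := by
  have := (bddMeas_continuousMap a).sub (bddMeas_oneOn hB)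
  exact integral_add_measure (this.integrable_sq _) (this.integrable_sq _)

lemma distSq_nonneg (μ : Measure K) (B : Set K) (a : C(K, ℂ)) : 0 ≤ distSq μ B a :=
  integral_nonneg fun x => by positivity

lemma norm_sub_rep_sq_le (a b : C(K, ℂ)) (f : F) {B : Set K} (hB : MeasurableSet B) :
    ‖ρ a f - ρ b f‖ ^ 2
      ≤ 2 * distSq (repMeasure ρ f) B a + 2 * distSq (repMeasure ρ f) B b := by
  rw [← ContinuousLinearMap.sub_apply, ← map_sub, norm_sq_rep, distSq, distSq,
    ← integral_const_mul, ← integral_const_mul]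
  have h1 := ((bddMeas_continuousMap a).sub (bddMeas_oneOn hB)).integrable_sq (repMeasure ρ f)
  have h2 := ((bddMeas_continuousMap b).sub (bddMeas_oneOn hB)).integrable_sq (repMeasure ρ f)
  rw [← integral_add (h1.const_mul 2) (h2.const_mul 2)]
  refine integral_mono ((bddMeas_continuousMap (a - b)).integrable_sq _)
    ((h1.const_mul 2).add (h2.const_mul 2)) fun x => ?_
  have e : (a - b) x = (a x - oneOn B x) - (b x - oneOn B x) := by simp
  have := norm_sub_le (a x - oneOn B x) (b x - oneOn B x)
  simp only [e]
  nlinarith [norm_nonneg ((a x - oneOn B x) - (b x - oneOn B x)),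
    sq_nonneg (‖a x - oneOn B x‖ - ‖b x - oneOn B x‖)]

/-- The vector `y` is the limit of `ρ (a n) f` for continuous `a n` tending to the indicator of `B`
in `L²` of the measure of `f`. The estimate for every continuous `a` is the usable form: linearity
in `f` follows by choosing one `a` that is good for the sum of the measures involved. -/
lemma exists_repProj_apply (f : F) {B : Set K} (hB : MeasurableSet B) :
    ∃ y : F, ∀ a : C(K, ℂ), ‖ρ a f - y‖ ^ 2 ≤ 2 * distSq (repMeasure ρ f) B a := by
  choose a ha using fun n : ℕ => exists_distSq_le (repMeasure ρ f) hB
    (ε := 1 / ((n : ℝ) + 1)) (by positivity)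
  have hlim : Tendsto (fun n => 2 * distSq (repMeasure ρ f) B (a n)) atTop (𝓝 0) := by
    have : Tendsto (fun n => distSq (repMeasure ρ f) B (a n)) atTop (𝓝 0) :=
      squeeze_zero (fun n => distSq_nonneg _ _ _) ha tendsto_one_div_add_atTop_nhds_zero_nat
    simpa using this.const_mul 2
  obtain ⟨y, hy⟩ := cauchySeq_tendsto_of_complete
    (ProjectionValuedMeasure.cauchySeq_of_norm_sub_sq_le hlim
      (fun n m => norm_sub_rep_sq_le ρ (a n) (a m) f hB))
  refine ⟨y, fun b => ?_⟩
  have h1 : Tendsto (fun n => ‖ρ b f - ρ (a n) f‖ ^ 2) atTop (𝓝 (‖ρ b f - y‖ ^ 2)) :=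
    (tendsto_const_nhds.sub hy).norm.pow 2
  have h2 : Tendsto (fun n => 2 * distSq (repMeasure ρ f) B b
      + 2 * distSq (repMeasure ρ f) B (a n)) atTop (𝓝 (2 * distSq (repMeasure ρ f) B b + 0)) :=
    tendsto_const_nhds.add hlim
  rw [add_zero] at h2
  exact le_of_tendsto_of_tendsto' h1 h2 fun n => norm_sub_rep_sq_le ρ b (a n) f hB

open Classical in
/-- The spectral projection on vectors. -/
def repProjFun (B : Set K) (f : F) : F :=
  if hB : MeasurableSet B then (exists_repProj_apply ρ f hB).choose else 0

lemma repProjFun_spec {B : Set K} (hB : MeasurableSet B) (f : F) (a : C(K, ℂ)) :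
    ‖ρ a f - repProjFun ρ B f‖ ^ 2 ≤ 2 * distSq (repMeasure ρ f) B a := by
  rw [repProjFun, dif_pos hB]; exact (exists_repProj_apply ρ f hB).choose_spec a

lemma norm_le_of_sq_le {x ε : ℝ} (hε : 0 ≤ ε) (h : x ^ 2 ≤ 2 * (ε ^ 2 / 2)) : x ≤ ε :=
  le_of_sq_le_sq (by linarith) hε

lemma repProjFun_add (B : Set K) (f g : F) :
    repProjFun ρ B (f + g) = repProjFun ρ B f + repProjFun ρ B g := by
  by_cases hB : MeasurableSet B
  swap; · simp [repProjFun, hB]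
  rw [← sub_eq_zero, ← norm_le_zero_iff]
  refine le_of_forall_pos_le_add fun ε hε => ?_
  obtain ⟨a, ha⟩ := exists_distSq_le (repMeasure ρ (f + g) + (repMeasure ρ f + repMeasure ρ g)) hB
    (ε := (ε / 3) ^ 2 / 2) (by positivity)
  rw [distSq_add _ _ hB, distSq_add _ _ hB] at ha
  have n1 := distSq_nonneg (repMeasure ρ (f + g)) B a
  have n2 := distSq_nonneg (repMeasure ρ f) B a
  have n3 := distSq_nonneg (repMeasure ρ g) B a
  have h1 : ‖ρ a (f + g) - repProjFun ρ B (f + g)‖ ≤ ε / 3 :=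
    norm_le_of_sq_le (by positivity) ((repProjFun_spec ρ hB _ a).trans (by linarith))
  have h2 : ‖ρ a f - repProjFun ρ B f‖ ≤ ε / 3 :=
    norm_le_of_sq_le (by positivity) ((repProjFun_spec ρ hB _ a).trans (by linarith))
  have h3 : ‖ρ a g - repProjFun ρ B g‖ ≤ ε / 3 :=
    norm_le_of_sq_le (by positivity) ((repProjFun_spec ρ hB _ a).trans (by linarith))
  have e : repProjFun ρ B (f + g) - (repProjFun ρ B f + repProjFun ρ B g)
      = (ρ a f - repProjFun ρ B f) + (ρ a g - repProjFun ρ B g)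
        - (ρ a (f + g) - repProjFun ρ B (f + g)) := by rw [map_add]; abel
  rw [e]
  refine (norm_sub_le _ _).trans ((add_le_add_left (norm_add_le _ _) _).trans ?_)
  linarith

lemma repProjFun_smul (B : Set K) (c : ℂ) (f : F) :
    repProjFun ρ B (c • f) = c • repProjFun ρ B f := by
  by_cases hB : MeasurableSet B
  swap; · simp [repProjFun, hB]
  rw [← sub_eq_zero, ← norm_le_zero_iff]
  refine le_of_forall_pos_le_add fun ε hε => ?_
  obtain ⟨a, ha⟩ := exists_distSq_le (repMeasure ρ (c • f) + repMeasure ρ f) hB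
    (ε := (ε / (1 + ‖c‖)) ^ 2 / 2) (by positivity)
  rw [distSq_add _ _ hB] at ha
  have n1 := distSq_nonneg (repMeasure ρ (c • f)) B a
  have n2 := distSq_nonneg (repMeasure ρ f) B a
  have h1 : ‖ρ a (c • f) - repProjFun ρ B (c • f)‖ ≤ ε / (1 + ‖c‖) :=
    norm_le_of_sq_le (by positivity) ((repProjFun_spec ρ hB _ a).trans (by linarith))
  have h2 : ‖ρ a f - repProjFun ρ B f‖ ≤ ε / (1 + ‖c‖) :=
    norm_le_of_sq_le (by positivity) ((repProjFun_spec ρ hB _ a).trans (by linarith))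
  have e : repProjFun ρ B (c • f) - c • repProjFun ρ B f
      = c • (ρ a f - repProjFun ρ B f) - (ρ a (c • f) - repProjFun ρ B (c • f)) := by
    rw [map_smul, smul_sub]; abel
  rw [e]
  refine (norm_sub_le _ _).trans ?_
  rw [norm_smul]
  have h3 := mul_le_mul_of_nonneg_left h2 (norm_nonneg c)
  have h4 : ‖c‖ * (ε / (1 + ‖c‖)) + ε / (1 + ‖c‖) = ε := by field_simp; ring
  linarith

lemma norm_repProjFun_le (B : Set K) (f : F) : ‖repProjFun ρ B f‖ ≤ 2 * ‖f‖ := by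
  by_cases hB : MeasurableSet B
  swap; · simp [repProjFun, hB]
  -- Comparison with `a = 0`. The resulting constant is not sharp; it only serves to make the map
  -- continuous.
  have h1 := repProjFun_spec ρ hB f 0
  rw [map_zero, ContinuousLinearMap.zero_apply, zero_sub, norm_neg] at h1
  have h2 : distSq (repMeasure ρ f) B 0 ≤ ‖f‖ ^ 2 := by
    rw [← repMeasure_univ_le ρ f]
    have : distSq (repMeasure ρ f) B 0 ≤ ∫ _, (1 : ℝ) ∂(repMeasure ρ f) := by
      refine integral_mono (((bddMeas_continuousMap (0 : C(K, ℂ))).sub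
        (bddMeas_oneOn hB)).integrable_sq _) (integrable_const _) fun x => ?_
      have := norm_oneOn_le B x
      simp only [ContinuousMap.zero_apply, zero_sub, norm_neg]
      exact pow_le_one₀ (norm_nonneg _) this
    simpa using this
  refine le_of_sq_le_sq ?_ (by positivity)
  nlinarith [sq_nonneg ‖f‖]

/-- The spectral projections of a representation of `C(K)`. -/
def repProj (B : Set K) : F →L[ℂ] F := mkContinuous
    { toFun := repProjFun ρ B
      map_add' := repProjFun_add ρ B
      map_smul' := repProjFun_smul ρ B } 2 (norm_repProjFun_le ρ B)

lemma repProj_spec {B : Set K} (hB : MeasurableSet B) (f : F) (a : C(K, ℂ)) :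
    ‖ρ a f - repProj ρ B f‖ ^ 2 ≤ 2 * distSq (repMeasure ρ f) B a := repProjFun_spec ρ hB f a

lemma repProj_mul {A B : Set K} (hA : MeasurableSet A) (hB : MeasurableSet B) :
    repProj ρ (A ∩ B) = repProj ρ A * repProj ρ B := by
  ext f
  rw [← sub_eq_zero, ← norm_le_zero_iff]
  refine le_of_forall_pos_le_add fun ε hε => ?_
  set y := repProj ρ B f with hy
  obtain ⟨a, ha⟩ := exists_distSq_le (repMeasure ρ y + repMeasure ρ f) hA
    (ε := (ε / 6) ^ 2 / 2) (by positivity)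
  rw [distSq_add _ _ hA] at ha
  have n1 := distSq_nonneg (repMeasure ρ y) A a
  have n2 := distSq_nonneg (repMeasure ρ f) A a
  -- The function `b` is chosen after `a`, with a tolerance that survives multiplication by `a`
  -- pointwise and by `ρ a` in operator norm. Then `a * b` approximates the indicator of `A ∩ B`.
  obtain ⟨b, hb⟩ := exists_distSq_le (repMeasure ρ f) hB
    (ε := (ε / (6 * (1 + ‖a‖ + ‖ρ a‖))) ^ 2 / 2) (by positivity)
  have hpos : 0 < 1 + ‖a‖ + ‖ρ a‖ := by positivity
  have h1 : ‖ρ a y - repProj ρ A y‖ ≤ ε / 6 :=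
    norm_le_of_sq_le (by positivity) ((repProj_spec ρ hA _ a).trans (by linarith))
  have h2 : ‖ρ b f - y‖ ≤ ε / (6 * (1 + ‖a‖ + ‖ρ a‖)) :=
    norm_le_of_sq_le (by positivity) ((repProj_spec ρ hB _ b).trans (by linarith))
  have h3 : ‖ρ a (ρ b f) - ρ a y‖ ≤ ε / 6 := by
    rw [← map_sub]
    refine ((ρ a).le_opNorm _).trans ((mul_le_mul_of_nonneg_left h2 (norm_nonneg _)).trans ?_)
    rw [mul_div_assoc', div_le_div_iff₀ (by positivity) (by norm_num)]
    nlinarith [norm_nonneg a, norm_nonneg (ρ a)]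
  have h4 : ‖ρ (a * b) f - repProj ρ (A ∩ B) f‖ ≤ ε / 3 := by
    refine norm_le_of_sq_le (by positivity) ((repProj_spec ρ (hA.inter hB) _ _).trans ?_)
    have hle : distSq (repMeasure ρ f) (A ∩ B) (a * b)
        ≤ 2 * ‖a‖ ^ 2 * distSq (repMeasure ρ f) B b + 2 * distSq (repMeasure ρ f) A a := by
      have i1 := ((bddMeas_continuousMap a).sub (bddMeas_oneOn hA)).integrable_sq (repMeasure ρ f)
      have i2 := ((bddMeas_continuousMap b).sub (bddMeas_oneOn hB)).integrable_sq (repMeasure ρ f)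
      rw [distSq, distSq, distSq, ← integral_const_mul, ← integral_const_mul,
        ← integral_add (i2.const_mul _) (i1.const_mul _)]
      refine integral_mono (((bddMeas_continuousMap (a * b)).sub
        (bddMeas_oneOn (hA.inter hB))).integrable_sq _)
        ((i2.const_mul _).add (i1.const_mul _)) fun x => ?_
      have e : (a * b) x - oneOn (A ∩ B) x
          = a x * (b x - oneOn B x) + (a x - oneOn A x) * oneOn B x := by
        have : oneOn (A ∩ B) x = oneOn A x * oneOn B x := by
          rw [oneOn, oneOn, oneOn]
          by_cases h1 : x ∈ A <;> by_cases h2 : x ∈ B <;> simp [h1, h2]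
        rw [this, ContinuousMap.mul_apply]; ring
      have e2 : ‖(a * b) x - oneOn (A ∩ B) x‖
          ≤ ‖a‖ * ‖b x - oneOn B x‖ + ‖a x - oneOn A x‖ := by
        rw [e]
        refine (norm_add_le _ _).trans ?_
        rw [norm_mul, norm_mul]
        refine add_le_add (mul_le_mul_of_nonneg_right (a.norm_coe_le_norm x) (norm_nonneg _)) ?_
        exact mul_le_of_le_one_right (norm_nonneg _) (norm_oneOn_le B x)
      have e3 := pow_le_pow_left₀ (norm_nonneg _) e2 2
      simp only
      nlinarith [sq_nonneg (‖a‖ * ‖b x - oneOn B x‖ - ‖a x - oneOn A x‖)]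
    have h5 : 2 * ‖a‖ ^ 2 * distSq (repMeasure ρ f) B b ≤ (ε / 6) ^ 2 := by
      have h6 : 2 * ‖a‖ ^ 2 * distSq (repMeasure ρ f) B b
          ≤ 2 * ‖a‖ ^ 2 * ((ε / (6 * (1 + ‖a‖ + ‖ρ a‖))) ^ 2 / 2) :=
        mul_le_mul_of_nonneg_left hb (by positivity)
      refine h6.trans ?_
      have h7 : ‖a‖ / (1 + ‖a‖ + ‖ρ a‖) ≤ 1 := by
        rw [div_le_one hpos]; linarith [norm_nonneg (ρ a)]
      have h8 : 2 * ‖a‖ ^ 2 * ((ε / (6 * (1 + ‖a‖ + ‖ρ a‖))) ^ 2 / 2)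
          = (ε / 6) ^ 2 * (‖a‖ / (1 + ‖a‖ + ‖ρ a‖)) ^ 2 := by field_simp
      rw [h8]
      exact mul_le_of_le_one_right (by positivity) (pow_le_one₀ (by positivity) h7)
    nlinarith
  have e : repProj ρ (A ∩ B) f - (repProj ρ A * repProj ρ B) f
      = (ρ a (ρ b f) - ρ a y) + (ρ a y - repProj ρ A y)
        - (ρ (a * b) f - repProj ρ (A ∩ B) f) := by
    rw [map_mul, ContinuousLinearMap.mul_apply, ContinuousLinearMap.mul_apply, ← hy]; abel
  rw [e]
  refine (norm_sub_le _ _).trans ((add_le_add_left (norm_add_le _ _) _).trans ?_)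
  linarith

/-- Both sides are close to `∫ a` for continuous `a` near the indicator: the left by definition of
the projection, the right by Cauchy–Schwarz on a finite measure. -/
lemma inner_repProj {B : Set K} (hB : MeasurableSet B) (f : F) :
    inner ℂ f (repProj ρ B f) = (((repMeasure ρ f).real B : ℝ) : ℂ) := by
  rw [← sub_eq_zero, ← norm_le_zero_iff]
  refine le_of_forall_pos_le_add fun ε hε => ?_
  obtain ⟨a, ha⟩ := exists_distSq_le (repMeasure ρ f) hB
    (ε := (ε / (2 * (1 + ‖f‖))) ^ 2 / 2) (by positivity)
  have h1 : ‖ρ a f - repProj ρ B f‖ ≤ ε / (2 * (1 + ‖f‖)) :=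
    norm_le_of_sq_le (by positivity) ((repProj_spec ρ hB _ a).trans (by linarith))
  have hb := (bddMeas_continuousMap a).sub (bddMeas_oneOn hB)
  have h2 : ‖∫ x, (a x - oneOn B x) ∂(repMeasure ρ f)‖ ≤ ‖f‖ * (ε / (2 * (1 + ‖f‖))) := by
    refine (norm_integral_le_integral_norm _).trans ?_
    refine le_of_sq_le_sq ?_ (by positivity)
    have hv : MemLp (fun x => ‖a x - oneOn B x‖) 2 (repMeasure ρ f) := by
      obtain ⟨C, hC⟩ := hb.bdd
      exact MemLp.of_bound hb.measurable.norm.aestronglyMeasurable C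
        (.of_forall fun x => by simpa using hC x)
    have h3 := integral_mul_le_Lp_mul_Lq_of_nonneg (μ := repMeasure ρ f) Real.HolderConjugate.two_two
      (f := fun x => ‖a x - oneOn B x‖) (g := fun _ => (1 : ℝ))
      (.of_forall fun x => norm_nonneg _) (.of_forall fun x => zero_le_one)
      (by simpa using hv) (by simpa using memLp_const (1 : ℝ))
    simp only [mul_one, rpow_two, one_pow, integral_const, smul_eq_mul,
      repMeasure_univ_le] at h3
    have h4 : (∫ x, ‖a x - oneOn B x‖ ∂(repMeasure ρ f)) ^ 2
        ≤ distSq (repMeasure ρ f) B a * ‖f‖ ^ 2 := by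
      refine (pow_le_pow_left₀ (integral_nonneg fun x => norm_nonneg _) h3 2).trans (le_of_eq ?_)
      rw [mul_pow, ← sqrt_eq_rpow, ← sqrt_eq_rpow, sq_sqrt
        (integral_nonneg fun x => by positivity), sq_sqrt (by positivity)]; rfl
    refine h4.trans ?_
    nlinarith [mul_le_mul_of_nonneg_right ha (sq_nonneg ‖f‖), distSq_nonneg (repMeasure ρ f) B a,
      sq_nonneg (ε / (2 * (1 + ‖f‖)) * ‖f‖)]
  have h5 : (((repMeasure ρ f).real B : ℝ) : ℂ) = ∫ x, oneOn B x ∂(repMeasure ρ f) := by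
    rw [oneOn, integral_indicator hB, setIntegral_const]; simp
  have e : inner ℂ f (repProj ρ B f) - (((repMeasure ρ f).real B : ℝ) : ℂ)
      = (∫ x, (a x - oneOn B x) ∂(repMeasure ρ f)) - inner ℂ f (ρ a f - repProj ρ B f) := by
    rw [integral_sub ((bddMeas_continuousMap a).integrable _)
      ((bddMeas_oneOn hB).integrable _), h5, ← inner_rep, inner_sub_right]; ring
  rw [e]
  refine (norm_sub_le _ _).trans ?_
  have h6 := (norm_inner_le_norm (𝕜 := ℂ) f (ρ a f - repProj ρ B f)).trans
    (mul_le_mul_of_nonneg_left h1 (norm_nonneg f))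
  have h7 : ‖f‖ * (ε / (2 * (1 + ‖f‖))) + ‖f‖ * (ε / (2 * (1 + ‖f‖))) ≤ ε := by
    have h9 : ‖f‖ * (ε / (2 * (1 + ‖f‖))) + ‖f‖ * (ε / (2 * (1 + ‖f‖)))
      = ε * (‖f‖ / (1 + ‖f‖)) := by field_simp; ring
    rw [h9]
    exact mul_le_of_le_one_right hε.le ((div_le_one (by positivity)).2 (by linarith))
  linarith

lemma eq_of_inner_self {S T : F →L[ℂ] F} (h : ∀ f, inner ℂ f (S f) = inner ℂ f (T f)) : S = T := by
  have key : (S : F →ₗ[ℂ] F) = (T : F →ₗ[ℂ] F) := by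
    rw [← ext_inner_map]
    intro f
    have h2 := congrArg conj (h f)
    rw [inner_conj_symm, inner_conj_symm] at h2
    exact h2
  exact ContinuousLinearMap.coe_injective key

lemma isStarProjection_repProj {B : Set K} (hB : MeasurableSet B) :
    IsStarProjection (repProj ρ B) := by
  refine ⟨by rw [IsIdempotentElem, ← repProj_mul ρ hB hB, inter_self], ?_⟩
  rw [IsSelfAdjoint, star_eq_adjoint]
  refine eq_of_inner_self fun f => ?_
  rw [adjoint_inner_right, ← inner_conj_symm, inner_repProj ρ hB, conj_ofReal]

lemma norm_sq_repProj {B : Set K} (hB : MeasurableSet B) (f : F) :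
    ‖repProj ρ B f‖ ^ 2 = (repMeasure ρ f).real B := by
  apply ofReal_injective
  have h2 : ((‖repProj ρ B f‖ ^ 2 : ℝ) : ℂ) = inner ℂ (repProj ρ B f) (repProj ρ B f) := by
    rw [inner_self_eq_norm_sq_to_K]; simp
  rw [h2, ← inner_repProj ρ hB]
  conv_lhs => rw [← adjoint_inner_right, ← star_eq_adjoint,
    (isStarProjection_repProj ρ hB).isSelfAdjoint.star_eq, ← ContinuousLinearMap.mul_apply,
    ← repProj_mul ρ hB hB, inter_self]

/-- The projection-valued measure of a representation of `C(K)`. -/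
def repPVM : ProjectionValuedMeasure K F where
  proj := repProj ρ
  isStarProjection _ hB := isStarProjection_repProj ρ hB
  proj_univ := by
    refine eq_of_inner_self fun f => ?_
    rw [inner_repProj ρ MeasurableSet.univ, repMeasure_univ_le, ContinuousLinearMap.one_apply,
      inner_self_eq_norm_sq_to_K]
    simp
  proj_inter _ _ hA hB := repProj_mul ρ hA hB
  hasSum_iUnion B hB hd f := by
    have hm : ∀ s : Finset ℕ, MeasurableSet (⋃ i ∈ s, B i) := fun s =>
      s.measurableSet_biUnion fun i _ => hB i
    have hreal : ∀ (s : Finset ℕ) (f : F), (repMeasure ρ f).real (⋃ i ∈ s, B i)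
        = ∑ i ∈ s, (repMeasure ρ f).real (B i) := fun s f =>
      measureReal_biUnion_finset (fun i _ j _ hij => hd hij) fun i _ => hB i
    have hfin : ∀ s : Finset ℕ, repProj ρ ((⋃ i, B i) \ ⋃ i ∈ s, B i)
        = repProj ρ (⋃ i, B i) - ∑ i ∈ s, repProj ρ (B i) := fun s => by
      refine eq_of_inner_self fun f => ?_
      rw [inner_repProj ρ ((MeasurableSet.iUnion hB).diff (hm s)), ContinuousLinearMap.sub_apply,
        inner_sub_right, inner_repProj ρ (MeasurableSet.iUnion hB), ContinuousLinearMap.sum_apply,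
        inner_sum, measureReal_diff (iUnion₂_subset_iUnion _ _) (hm s), hreal]
      push_cast
      congr 1
      exact sum_congr rfl fun i _ => (inner_repProj ρ (hB i) f).symm
    have hsum : HasSum (fun i => (repMeasure ρ f).real (B i)) ((repMeasure ρ f).real (⋃ i, B i)) := by
      have hu := measure_iUnion (μ := repMeasure ρ f) (fun i j hij => hd hij) hB
      have hne : ∑' i, repMeasure ρ f (B i) ≠ ⊤ := hu ▸ measure_ne_top _ _
      rw [Measure.real, hu, ENNReal.tsum_toReal_eq fun i => measure_ne_top _ _]
      exact ENNReal.hasSum_toReal hne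
    have h0 : Tendsto (fun s : Finset ℕ => (repMeasure ρ f).real (⋃ i, B i)
        - ∑ i ∈ s, (repMeasure ρ f).real (B i)) atTop (𝓝 0) := by
      have := (tendsto_const_nhds (x := (repMeasure ρ f).real (⋃ i, B i))).sub hsum
      simpa using this
    rw [HasSum, tendsto_iff_norm_sub_tendsto_zero]
    -- The error of a partial sum is the projection on the remaining set, and its squared norm is
    -- the measure of that set.
    have h1 : ∀ s : Finset ℕ, ‖∑ i ∈ s, repProj ρ (B i) f - repProj ρ (⋃ i, B i) f‖
        = sqrt ((repMeasure ρ f).real (⋃ i, B i)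
          - ∑ i ∈ s, (repMeasure ρ f).real (B i)) := fun s => by
      rw [norm_sub_rev, ← hreal, ← measureReal_diff (iUnion₂_subset_iUnion _ _) (hm s),
        ← norm_sq_repProj ρ ((MeasurableSet.iUnion hB).diff (hm s)), sqrt_sq (norm_nonneg _),
        hfin, ContinuousLinearMap.sub_apply, ContinuousLinearMap.sum_apply]
    simp only [SummationFilter.unconditional_filter]
    simp_rw [h1]
    simpa using h0.sqrt

lemma scalarMeasure_repPVM (f : F) : (repPVM ρ).scalarMeasure f = repMeasure ρ f := by
  ext B hB
  rw [ProjectionValuedMeasure.scalarMeasure_apply _ f hB]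
  change ofReal (inner ℂ f (repProj ρ B f)).re = _
  rw [inner_repProj ρ hB, ofReal_re, ofReal_measureReal]

lemma op_repPVM (a : C(K, ℂ)) : (repPVM ρ).op a = ρ a := by
  refine (repPVM ρ).op_eq (bddMeas_continuousMap a) fun f => ?_
  rw [scalarMeasure_repPVM, inner_rep]

end RepresentationOfContinuousFunctions

section SpectralTheorem

open WeakDual

variable {F : Type*} [NormedAddCommGroup F] [InnerProductSpace ℂ F] [CompleteSpace F]

/-- Finitely many commuting resolvents of self-adjoint operators are diagonalized by a
projection-valued measure. -/
lemma exists_projectionValuedMeasure {ι : Type*} [Fintype ι] (R : ι → F →L[ℂ] F)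
    (hcomm : ∀ i j, R i * R j = R j * R i) (hcomm_star : ∀ i j, R i * star (R j) = star (R j) * R i)
    (hres : ∀ i, R i - star (R i) = (2 * I) • (star (R i) * R i))
    (hker : ∀ i f, R i f = 0 → f = 0) :
    ∃ E : ProjectionValuedMeasure (ι → ℝ) F, ∀ i, E.res (fun x => x i) = R i := by
  -- The C*-algebra generated by the resolvents is commutative, so Gelfand duality represents it by
  -- continuous functions on its characters.
  let S₀ : StarSubalgebra ℂ (F →L[ℂ] F) := StarAlgebra.adjoin ℂ (range R)
  letI c₀ : CommRing S₀ := StarAlgebra.adjoinCommRingOfComm ℂ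
    (by rintro _ ⟨i, rfl⟩ _ ⟨j, rfl⟩; exact hcomm i j)
    (by rintro _ ⟨i, rfl⟩ _ ⟨j, rfl⟩; exact hcomm_star i j)
  let S : StarSubalgebra ℂ (F →L[ℂ] F) := S₀.topologicalClosure
  have hcl : IsClosed (S : Set (F →L[ℂ] F)) := StarSubalgebra.isClosed_topologicalClosure S₀
  have hmc : ∀ x y : S, x * y = y * x := by
    let c₁ : CommRing S := StarSubalgebra.commRingTopologicalClosure S₀ (fun x y => c₀.mul_comm x y)
    exact fun x y => c₁.mul_comm x y
  letI c₂ : CommCStarAlgebra S := { StarSubalgebra.cstarAlgebra S with mul_comm := hmc }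
  let r : ι → S := fun i => ⟨R i, S₀.le_topologicalClosure (StarAlgebra.subset_adjoin ℂ _ ⟨i, rfl⟩)⟩
  let j₀ : characterSpace ℂ S → ι → ℂ := fun φ i => φ (r i)
  have hj₀ : Continuous j₀ := continuous_pi fun i => (gelfandStarTransform S (r i)).continuous
  -- The joint spectrum of the generators. Passing from characters to their values on the generators
  -- gives a compact metrizable space, on which `z i` is a coordinate function with `ρ (z i) = R i`.
  let K : Set (ι → ℂ) := range j₀
  haveI : CompactSpace K := isCompact_iff_compactSpace.1 (isCompact_range hj₀)
  let j : C(characterSpace ℂ S, K) := ⟨fun φ => ⟨j₀ φ, mem_range_self φ⟩, hj₀.subtype_mk _⟩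
  let ρ : C(K, ℂ) →⋆ₐ[ℂ] (F →L[ℂ] F) := (S.subtype.comp
    ((gelfandStarTransform S).symm : C(characterSpace ℂ S, ℂ) →⋆ₐ[ℂ] S)).comp
      (ContinuousMap.compStarAlgHom' ℂ ℂ j)
  let z : ι → C(K, ℂ) := fun i => ⟨fun x => x.1 i, (continuous_apply i).comp continuous_subtype_val⟩
  have hz : ∀ i, ρ (z i) = R i := by
    intro i
    have : ContinuousMap.compStarAlgHom' ℂ ℂ j (z i) = gelfandStarTransform S (r i) := by
      ext φ; rfl
    change ((gelfandStarTransform S).symm (ContinuousMap.compStarAlgHom' ℂ ℂ j (z i)) : F →L[ℂ] F)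
      = R i
    rw [this, StarAlgEquiv.symm_apply_apply]
  let P := repPVM ρ
  -- A resolvent value is `z = (x - i)⁻¹`, so the spectral parameter is recovered as `x = Re z⁻¹`.
  -- The following two almost everywhere statements show that `z` really has this form.
  have hφ : Measurable fun (x : K) (i : ι) => ((x.1 i)⁻¹).re :=
    measurable_pi_lambda _ fun i => Complex.measurable_re.comp
      ((measurable_pi_apply i).comp measurable_subtype_coe).inv
  have hop : ∀ i, P.op (z i) = R i := fun i => (op_repPVM ρ (z i)).trans (hz i)
  refine ⟨P.map _ hφ, fun i => ?_⟩
  rw [P.res_map _ hφ (measurable_pi_apply i)]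
  have hzb := bddMeas_continuousMap (z i)
  have hrb := BddMeas.resolvent (h := fun x : K => ((x.1 i)⁻¹).re) ((measurable_pi_apply i).comp hφ)
  ext f
  rw [← hop i]
  refine P.op_congr_ae hrb hzb f ?_
  -- The range of the projection on `z i = 0` is killed by `R i`, which is injective.
  have hne : ∀ᵐ x ∂(P.scalarMeasure f), z i x ≠ 0 := by
    have hB : MeasurableSet {x | z i x = 0} :=
      (isClosed_singleton.preimage (z i).continuous).measurableSet
    rw [ae_iff]
    have hset : {x | ¬z i x ≠ 0} = {x | z i x = 0} := by ext x; simp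
    rw [hset, P.scalarMeasure_apply' f hB]
    have h0 : R i (P.proj {x | z i x = 0} f) = 0 := by
      rw [← hop, ← P.op_indicator_one hB, ← P.op_mul_apply hzb ((BddMeas.const 1).indicator hB)]
      have : (fun a => z i a * {x | z i x = 0}.indicator (fun _ => (1 : ℂ)) a) = fun _ => 0 := by
        ext a
        by_cases ha : z i a = 0
        · simp [ha]
        · simp [ha]
      rw [this, P.op_const]; simp
    rw [hker i _ h0]; simp
  -- The resolvent identity `hres` puts the value on the circle `z - z̄ = 2i|z|²`, that is, `Im z⁻¹
  -- = -1`.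
  have hcirc : ∀ᵐ x ∂(P.scalarMeasure f),
      z i x - conj (z i x) - (2 * I) * (conj (z i x) * z i x) = 0 := by
    have hb1 := (hzb.sub hzb.star).sub ((BddMeas.const (2 * I)).mul (hzb.star.mul hzb))
    have h1 := P.norm_sq_op hb1 f
    rw [P.op_sub (hzb.sub hzb.star) ((BddMeas.const (2 * I)).mul (hzb.star.mul hzb)),
      P.op_sub hzb hzb.star, P.op_smul (hzb.star.mul hzb), P.op_mul hzb.star hzb, P.op_conj hzb,
      hop, ← star_eq_adjoint, hres i, sub_self] at h1
    rw [ContinuousLinearMap.zero_apply, norm_zero, zero_pow two_ne_zero, eq_comm,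
      integral_eq_zero_iff_of_nonneg (fun x => by positivity) (hb1.integrable_sq _)] at h1
    filter_upwards [h1] with x hx
    simpa using hx
  filter_upwards [hne, hcirc] with x hx1 hx2
  change (((((z i x)⁻¹).re : ℝ) : ℂ) - I)⁻¹ = z i x
  generalize z i x = w at hx1 hx2
  rw [inv_eq_iff_eq_inv]
  have hw : conj w ≠ 0 := by simpa using hx1
  have h3 : conj (w⁻¹) - w⁻¹ = 2 * I := by
    rw [map_inv₀]
    field_simp
    linear_combination hx2
  have h4 := congrArg Complex.im h3
  simp only [Complex.sub_im, conj_im, Complex.mul_im, Complex.re_ofNat, I_im,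
    Complex.im_ofNat, Complex.I_re] at h4
  apply Complex.ext
  · simp
  · simp only [Complex.sub_im, ofReal_im, I_im]; linarith

end SpectralTheorem

/-! ### Generic factorization of the characteristic polynomials -/

section MultiplicityProfile

open Polynomial

/-- The number of elements of `s` that are zero or of multiplicity at least `k`. -/
def multCount (k : ℕ) (s : Multiset ℝ) : ℕ := s.countP fun a => a = 0 ∨ k ≤ s.count a

lemma Multiset.countP_eq_sum_count {α : Type*} [DecidableEq α] (s : Multiset α) (q : α → Prop)
    [DecidablePred q] : s.countP q = ∑ a ∈ s.toFinset with q a, s.count a := by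
  rw [countP_eq_card_filter, ← toFinset_sum_count_eq, toFinset_filter]
  refine sum_congr rfl fun a ha => count_filter_of_pos (mem_filter.1 ha).2

/-- What is counted at level `k` but not at `k + 1` are the nonzero elements of multiplicity exactly
`k`, each counted `k` times. Hence the counts determine how many nonzero elements have each
multiplicity. -/
lemma multCount_eq_add (k : ℕ) (s : Multiset ℝ) : multCount k s = multCount (k + 1) s
      + k * ((s.toFinset.erase 0).filter fun a => s.count a = k).card := by
  have h1 : ((s.toFinset.erase 0).filter fun a => s.count a = k)
      = s.toFinset.filter fun a => a ≠ 0 ∧ s.count a = k := by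
    ext a; simp only [mem_filter, mem_erase]; tauto
  have h2 : k * (s.toFinset.filter fun a => a ≠ 0 ∧ s.count a = k).card
      = ∑ a ∈ s.toFinset with a ≠ 0 ∧ s.count a = k, s.count a := by
    rw [Finset.sum_const_nat (m := k) fun a ha => (mem_filter.1 ha).2.2, mul_comm]
  rw [h1, h2, multCount, multCount, Multiset.countP_eq_sum_count, Multiset.countP_eq_sum_count]
  simp only [Finset.sum_filter]
  rw [← sum_add_distrib]
  refine sum_congr rfl fun a _ => ?_
  by_cases h : a = 0
  · simp [h]
  · simp only [h, false_or, ne_eq, not_false_eq_true, true_and]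
    split_ifs <;> omega

lemma multCount_card_succ (s : Multiset ℝ) : multCount (s.card + 1) s = s.count 0 := by
  rw [multCount, Multiset.count]
  refine Multiset.countP_congr rfl fun a _ => ?_
  have := s.count_le_card a
  simp only [eq_comm (a := (0 : ℝ))]
  exact propext (or_iff_left (by omega))

lemma multCount_map_mul {c : ℝ} (hc : c ≠ 0) (k : ℕ) (s : Multiset ℝ) :
    multCount k (s.map (c * ·)) = multCount k s := by
  rw [multCount, multCount, Multiset.countP_map, Multiset.countP_eq_card_filter]
  congr 1
  refine Multiset.filter_congr fun a _ => ?_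
  rw [Multiset.count_map_eq_count' _ _ (mul_right_injective₀ hc)]
  simp [hc]

/-- Multisets with the same multiplicity profile correspond to each other. -/
lemma exists_equiv_of_multCount_eq {s s' : Multiset ℝ} (hcard : s'.card = s.card)
    (h : ∀ k ≤ s.card + 1, multCount k s' = multCount k s) :
    s'.count 0 = s.count 0 ∧ ∃ e : (s.toFinset.erase 0) ≃ (s'.toFinset.erase 0),
      ∀ a, s'.count (e a : ℝ) = s.count (a : ℝ) := by
  refine ⟨by rw [← multCount_card_succ, ← multCount_card_succ, hcard, h _ le_rfl], ?_⟩
  have hN : ∀ k, ((s.toFinset.erase 0).filter fun a => s.count a = k).card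
      = ((s'.toFinset.erase 0).filter fun a => s'.count a = k).card := fun k => by
    rcases Nat.eq_zero_or_pos k with rfl | hk
    · have e : ∀ t : Multiset ℝ, (t.toFinset.erase 0).filter (fun a => t.count a = 0) = ∅ :=
        fun t => Finset.filter_eq_empty_iff.2 fun a ha => by
          simpa using (mem_erase.1 ha).2
      rw [e, e]
    by_cases hk2 : k ≤ s.card
    · have h1 := multCount_eq_add k s
      have h2 := multCount_eq_add k s'
      rw [h k (by omega), h (k + 1) (by omega)] at h2
      exact Nat.eq_of_mul_eq_mul_left hk (by omega)
    · have e : ∀ t : Multiset ℝ, t.card = s.card →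
          (t.toFinset.erase 0).filter (fun a => t.count a = k) = ∅ :=
        fun t ht => Finset.filter_eq_empty_iff.2 fun a _ h0 => by
          have := t.count_le_card a
          omega
      rw [e s rfl, e s' hcard]
  -- The sets of elements of a given multiplicity have equal size; bijections between them are glued
  -- over all `k`.
  have hE : ∀ k, Nonempty ({a : s.toFinset.erase 0 // s.count (a : ℝ) = k} ≃
      {a : s'.toFinset.erase 0 // s'.count (a : ℝ) = k}) := fun k => by
    rw [← Fintype.card_eq, Fintype.card_subtype, Fintype.card_subtype]
    have e : ∀ t : Finset ℝ, ∀ f : ℝ → ℕ, (Finset.univ.filter fun a : t => f a = k).card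
        = (t.filter fun a => f a = k).card := fun t f => by
      rw [← Finset.card_map (Function.Embedding.subtype _)]
      congr 1
      ext a
      simp [and_comm]
    rw [e _ fun a => s.count a, e _ fun a => s'.count a, hN k]
  let E := fun k => (hE k).some
  refine ⟨(Equiv.sigmaFiberEquiv fun a : s.toFinset.erase 0 => s.count (a : ℝ)).symm.trans
    ((Equiv.sigmaCongrRight E).trans
      (Equiv.sigmaFiberEquiv fun a : s'.toFinset.erase 0 => s'.count (a : ℝ))), fun a => ?_⟩
  exact (E (s.count (a : ℝ)) ⟨a, rfl⟩).2

/-- A polynomial whose roots among the eigenvalues are `0` and those of multiplicity at least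
`k`. -/
def multPoly {R : Type*} [CommRing R] (k : ℕ) (p : R[X]) : R[X] :=
  X * ∑ j ∈ Finset.range k, (derivative^[j] p) ^ 2

lemma map_multPoly {R R' : Type*} [CommRing R] [CommRing R'] (φ : R →+* R') (k : ℕ) (p : R[X]) :
    (multPoly k p).map φ = multPoly k (p.map φ) := by
  simp [multPoly, Polynomial.map_sum, Polynomial.iterate_derivative_map]

/-- Over the reals a sum of squares of derivatives vanishes only if each one does, which is the
criterion for a multiple root. -/
lemma eval_multPoly_eq_zero {p : ℝ[X]} (hp : p ≠ 0) (k : ℕ) (a : ℝ) :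
    (multPoly k p).eval a = 0 ↔ a = 0 ∨ k ≤ p.rootMultiplicity a := by
  rw [multPoly, eval_mul, eval_X, mul_eq_zero, eval_finset_sum]
  refine or_congr Iff.rfl ?_
  simp only [eval_pow]
  rw [Finset.sum_eq_zero_iff_of_nonneg fun j _ => sq_nonneg _]
  rcases k with _ | k
  · simp
  rw [Nat.succ_le_iff, lt_rootMultiplicity_iff_isRoot_iterate_derivative hp]
  simp only [Finset.mem_range, Nat.lt_succ_iff, sq_eq_zero_iff, IsRoot.def]

/-- All constructions commute with a change of the coefficient ring. With polynomial entries in `η`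
this gives one generic polynomial that specializes at every `η`. -/
lemma Matrix.map_aeval_multPoly {R R' n : Type*} [CommRing R] [CommRing R'] [Fintype n]
    [DecidableEq n] (φ : R →+* R') (k : ℕ) (A : Matrix n n R) :
    (aeval A (multPoly k A.charpoly)).charpoly.map φ
      = (aeval (A.map φ) (multPoly k (A.map φ).charpoly)).charpoly := by
  rw [← Matrix.charpoly_map, Matrix.charpoly_map A, ← map_multPoly]
  congr 1
  refine Polynomial.map_aeval_eq_aeval_map (S := Matrix n n R) (U := Matrix n n R')
    (ψ := φ.mapMatrix) ?_ _ _
  ext r i j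
  simp [Matrix.algebraMap_matrix_apply, apply_ite φ]

lemma LinearMap.IsSymmetric.charpoly_aeval {V : Type*} [NormedAddCommGroup V]
    [InnerProductSpace ℝ V] [FiniteDimensional ℝ V] {T : V →ₗ[ℝ] V} (hT : T.IsSymmetric)
    (p : ℝ[X]) : (aeval T p).charpoly.roots = T.charpoly.roots.map fun a => p.eval a := by
  set b := hT.eigenvectorBasis rfl with hb
  have h1 : (aeval T p).toMatrix b.toBasis b.toBasis
      = Matrix.diagonal fun i => p.eval (hT.eigenvalues rfl i) := by
    have h2 : ∀ j, aeval T p (b j) = p.eval (hT.eigenvalues rfl j) • b j := fun j =>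
      End.aeval_apply_of_hasEigenvector (hT.hasEigenvector_eigenvectorBasis rfl j)
    ext i j
    simp [toMatrix_apply, Matrix.diagonal_apply, h2]
    grind
  rw [hT.roots_charpoly_eq_eigenvalues rfl, ← charpoly_toMatrix _ b.toBasis, h1,
    Matrix.charpoly_diagonal, roots_prod _ _ (by
      simp [prod_ne_zero_iff, X_sub_C_ne_zero])]
  simp [Function.comp_def]

/-- This makes `multCount` algebraic. The eigenvalues killed by `multPoly` are those being counted,
so their number is the order of vanishing at `0` of the characteristic polynomial of `multPoly`
evaluated at `T`. -/
lemma LinearMap.IsSymmetric.natTrailingDegree_charpoly {V : Type*} [NormedAddCommGroup V]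
    [InnerProductSpace ℝ V] [FiniteDimensional ℝ V] {T : V →ₗ[ℝ] V} (hT : T.IsSymmetric) (k : ℕ) :
    (aeval T (multPoly k T.charpoly)).charpoly.natTrailingDegree
      = multCount k T.charpoly.roots := by
  rw [← rootMultiplicity_eq_natTrailingDegree', ← count_roots, hT.charpoly_aeval, Multiset.count_map,
    multCount, Multiset.countP_eq_card_filter]
  congr 1
  refine Multiset.filter_congr fun a _ => ?_
  rw [eq_comm, eval_multPoly_eq_zero T.charpoly_monic.ne_zero, count_roots]

end MultiplicityProfile

/-! ### Calculus on the group -/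

namespace IsTest

variable {M : Type*} [NormedAddCommGroup M] [NormedSpace ℝ M] {φ ψ : M → ℂ}

lemma contDiff (hφ : IsTest φ) : ContDiff ℝ ∞ φ := hφ.1

lemma continuous (hφ : IsTest φ) : Continuous φ := hφ.1.continuous

lemma differentiable (hφ : IsTest φ) : Differentiable ℝ φ := hφ.1.differentiable (by simp)

lemma mul_right (hφ : IsTest φ) (hψ : ContDiff ℝ ∞ ψ) : IsTest fun p => φ p * ψ p :=
  ⟨hφ.1.mul hψ, hφ.2.mul_right⟩

lemma mul_left (hφ : ContDiff ℝ ∞ φ) (hψ : IsTest ψ) : IsTest fun p => φ p * ψ p :=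
  ⟨hφ.mul hψ.1, hψ.2.mul_left⟩

lemma add (hφ : IsTest φ) (hψ : IsTest ψ) : IsTest fun p => φ p + ψ p :=
  ⟨hφ.1.add hψ.1, hφ.2.add hψ.2⟩

lemma neg (hφ : IsTest φ) : IsTest fun p => - φ p :=
  ⟨hφ.1.neg, by simpa using (hφ.mul_left (φ := fun _ => -1) contDiff_const).2⟩

lemma const_mul (hφ : IsTest φ) (c : ℂ) : IsTest fun p => c * φ p :=
  hφ.mul_left (φ := fun _ => c) contDiff_const

lemma sum {ι : Type*} (s : Finset ι) {φ : ι → M → ℂ} (h : ∀ i ∈ s, IsTest (φ i)) :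
    IsTest fun p => ∑ i ∈ s, φ i p := by
  classical
  induction s using Finset.induction_on with
  | empty => simpa using ⟨contDiff_const, HasCompactSupport.zero⟩
  | insert i s hi ih =>
    simp_rw [Finset.sum_insert hi]
    exact (h i (Finset.mem_insert_self _ _)).add (ih fun j hj => h j (Finset.mem_insert_of_mem hj))

lemma star (hφ : IsTest φ) : IsTest fun p => conj (φ p) :=
  ⟨conjCLE.contDiff.comp hφ.1, hφ.2.comp_left (g := starRingEnd ℂ) (map_zero _)⟩

lemma ofReal {χ : M → ℝ} (h1 : ContDiff ℝ ∞ χ) (h2 : HasCompactSupport χ) :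
    IsTest fun p => (χ p : ℂ) :=
  ⟨ofRealCLM.contDiff.comp h1, h2.comp_left (g := fun x : ℝ => (x : ℂ)) Complex.ofReal_zero⟩

lemma exists_norm_le (hφ : IsTest φ) : ∃ C, 0 ≤ C ∧ ∀ p, ‖φ p‖ ≤ C := by
  obtain ⟨C, hC⟩ := hφ.2.exists_bound_of_continuous hφ.continuous
  exact ⟨C, (norm_nonneg _).trans (hC 0), hC⟩

variable [MeasurableSpace M] [BorelSpace M] {ν : Measure M} [IsFiniteMeasureOnCompacts ν]

lemma memLp [FiniteDimensional ℝ M] (hφ : IsTest φ) (p : ENNReal) : MemLp φ p ν :=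
  hφ.continuous.memLp_of_hasCompactSupport hφ.2

lemma integrable (hφ : IsTest φ) : Integrable φ ν :=
  hφ.continuous.integrable_of_hasCompactSupport hφ.2

end IsTest

/-- The class in `L²` of a test function (`0` for other functions). -/
def testLp {M : Type*} [NormedAddCommGroup M] [NormedSpace ℝ M]
    [MeasurableSpace M] (ν : Measure M) (φ : M → ℂ) : Lp ℂ 2 ν :=
  open Classical in if h : MemLp φ 2 ν then h.toLp φ else 0

lemma inner_Lp_eq {M : Type*} [MeasurableSpace M] {ν : Measure M} (f h : Lp ℂ 2 ν) :
    inner ℂ f h = ∫ p, conj (f p) * h p ∂ν := by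
  rw [L2.inner_def]
  simp only [RCLike.inner_apply]
  simp_rw [mul_comm]

section TestLp

variable {M : Type*} [NormedAddCommGroup M] [NormedSpace ℝ M] [FiniteDimensional ℝ M]
  [MeasurableSpace M] [BorelSpace M] {ν : Measure M} [IsFiniteMeasureOnCompacts ν]

lemma coeFn_testLp_of_memLp {φ : M → ℂ} (hφ : MemLp φ 2 ν) : testLp ν φ =ᵐ[ν] φ := by
  rw [testLp, dif_pos hφ]; exact hφ.coeFn_toLp

lemma coeFn_testLp {φ : M → ℂ} (hφ : IsTest φ) : testLp ν φ =ᵐ[ν] φ :=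
  coeFn_testLp_of_memLp (hφ.memLp 2)

lemma eq_testLp {φ : M → ℂ} (hφ : IsTest φ) {f : Lp ℂ 2 ν} (hf : f =ᵐ[ν] φ) :
    f = testLp ν φ := Lp.ext (hf.trans (coeFn_testLp hφ).symm)

lemma inner_testLp_right (f : Lp ℂ 2 ν) {φ : M → ℂ} (hφ : IsTest φ) :
    inner ℂ f (testLp ν φ) = ∫ p, conj (f p) * φ p ∂ν := by
  rw [inner_Lp_eq]
  refine integral_congr_ae ?_
  filter_upwards [coeFn_testLp (ν := ν) hφ] with p hp
  rw [hp]

lemma inner_testLp_left (f : Lp ℂ 2 ν) {φ : M → ℂ} (hφ : IsTest φ) :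
    inner ℂ (testLp ν φ) f = ∫ p, conj (φ p) * f p ∂ν := by
  rw [inner_Lp_eq]
  refine integral_congr_ae ?_
  filter_upwards [coeFn_testLp (ν := ν) hφ] with p hp
  rw [hp]

lemma dense_testLp : Dense {f : Lp ℂ 2 ν | ∃ φ, IsTest φ ∧ f = testLp ν φ} := by
  refine (Lp.dense_hasCompactSupport_contDiff (F := ℂ) (μ := ν) (p := 2) (by simp)).mono ?_
  rintro f ⟨φ, hf, h2, h1⟩
  exact ⟨φ, ⟨h1, h2⟩, eq_testLp ⟨h1, h2⟩ hf⟩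

lemma eq_zero_of_inner_testLp {f : Lp ℂ 2 ν}
    (h : ∀ φ, IsTest φ → inner ℂ (testLp ν φ) f = 0) : f = 0 := by
  have hd := dense_testLp (ν := ν)
  have h1 : Continuous fun y : Lp ℂ 2 ν => inner ℂ y f := continuous_id.inner continuous_const
  have h2 := (isClosed_singleton (x := (0 : ℂ))).preimage h1
  have h3 : ∀ y : Lp ℂ 2 ν, inner ℂ y f = 0 := fun y => by
    have hs : {f : Lp ℂ 2 ν | ∃ φ, IsTest φ ∧ f = testLp ν φ}
        ⊆ (fun y : Lp ℂ 2 ν => inner ℂ y f) ⁻¹' {0} := by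
      rintro _ ⟨φ, hφ, rfl⟩; exact h φ hφ
    exact h2.closure_subset_iff.2 hs (hd y)
  exact inner_self_eq_zero.1 (h3 f)

lemma testLp_add {φ ψ : M → ℂ} (hφ : IsTest φ) (hψ : IsTest ψ) :
    testLp ν (fun p => φ p + ψ p) = testLp ν φ + testLp ν ψ := by
  symm
  refine eq_testLp (hφ.add hψ) ?_
  filter_upwards [Lp.coeFn_add (testLp ν φ) (testLp ν ψ), coeFn_testLp (ν := ν) hφ,
    coeFn_testLp (ν := ν) hψ] with p h1 h2 h3
  rw [h1, Pi.add_apply, h2, h3]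

lemma testLp_smul {φ : M → ℂ} (hφ : IsTest φ) (c : ℂ) :
    testLp ν (fun p => c * φ p) = c • testLp ν φ := by
  symm
  refine eq_testLp (hφ.const_mul c) ?_
  filter_upwards [Lp.coeFn_smul c (testLp ν φ), coeFn_testLp (ν := ν) hφ] with p h1 h2
  rw [h1, Pi.smul_apply, h2, smul_eq_mul]

lemma mem_testGraph_iff {A : (M → ℂ) → M → ℂ} (hA : ∀ φ, IsTest φ → IsTest (A φ))
    (q : Lp ℂ 2 ν × Lp ℂ 2 ν) :
    q ∈ testGraph ν A ↔ ∃ φ, IsTest φ ∧ q = (testLp ν φ, testLp ν (A φ)) := by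
  constructor
  · rintro ⟨φ, hφ, h1, h2⟩
    exact ⟨φ, hφ, Prod.ext (eq_testLp hφ h1) (eq_testLp (hA φ hφ) h2)⟩
  · rintro ⟨φ, hφ, rfl⟩
    exact ⟨φ, hφ, coeFn_testLp hφ, coeFn_testLp (hA φ hφ)⟩

end TestLp

namespace TwoStepAlgebra

section Calculus

variable {V W : Type*} [NormedAddCommGroup V] [InnerProductSpace ℝ V] [FiniteDimensional ℝ V]
  [NormedAddCommGroup W] [NormedSpace ℝ W] [FiniteDimensional ℝ W] (g : TwoStepAlgebra V W)

/-- The bracket as a continuous bilinear map. -/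
def bracketL : V →L[ℝ] V →L[ℝ] W :=
  toContinuousLinearMap (toContinuousLinearMap.toLinearMap ∘ₗ g.bracket)

@[simp] lemma bracketL_apply (x y : V) : g.bracketL x y = g.bracket x y := rfl

lemma contDiff_bracket {P : Type*} [NormedAddCommGroup P] [NormedSpace ℝ P] {n : WithTop ℕ∞}
    {a b : P → V} (ha : ContDiff ℝ n a) (hb : ContDiff ℝ n b) :
    ContDiff ℝ n fun p => g.bracket (a p) (b p) :=
  (g.bracketL.contDiff.comp ha).clm_apply hb

lemma continuous_bracket {P : Type*} [TopologicalSpace P]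
    {a b : P → V} (ha : Continuous a) (hb : Continuous b) :
    Continuous fun p => g.bracket (a p) (b p) :=
  (g.bracketL.continuous.comp ha).clm_apply hb

lemma contDiff_mul {P : Type*} [NormedAddCommGroup P] [NormedSpace ℝ P] {n : WithTop ℕ∞}
    {a b : P → V × W} (ha : ContDiff ℝ n a) (hb : ContDiff ℝ n b) :
    ContDiff ℝ n fun p => g.mul (a p) (b p) :=
  (ha.fst.add hb.fst).prodMk
    ((ha.snd.add hb.snd).add (contDiff_const.smul (g.contDiff_bracket ha.fst hb.fst)))

lemma continuous_mul {P : Type*} [TopologicalSpace P]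
    {a b : P → V × W} (ha : Continuous a) (hb : Continuous b) :
    Continuous fun p => g.mul (a p) (b p) :=
  (ha.fst.add hb.fst).prodMk
    ((ha.snd.add hb.snd).add (continuous_const.smul (g.continuous_bracket ha.fst hb.fst)))

lemma mul_inv (p : V × W) : g.mul p (g.inv p) = 0 := by
  ext <;> simp [mul, inv, g.bracket_self]

lemma inv_inv (p : V × W) : g.inv (g.inv p) = p := neg_neg p

lemma inv_mul_cancel_left (p q : V × W) : g.mul (g.inv p) (g.mul p q) = q := by
  rw [← mul_assoc, inv_mul, zero_mul]

lemma mul_inv_cancel_left (p q : V × W) : g.mul p (g.mul (g.inv p) q) = q := by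
  rw [← mul_assoc, mul_inv, zero_mul]

lemma bracket_swap (x y : V) : g.bracket x y = - g.bracket y x := by
  have h := g.bracket_self (x + y)
  simp only [map_add, LinearMap.add_apply, g.bracket_self, zero_add, add_zero] at h
  exact eq_neg_of_add_eq_zero_right h

lemma inv_mul_rev (p q : V × W) : g.inv (g.mul p q) = g.mul (g.inv q) (g.inv p) := by
  ext
  · simp [mul, inv, add_comm]
  · simp only [mul, inv, Prod.snd_neg, Prod.fst_neg, map_neg, LinearMap.neg_apply, neg_neg]
    rw [g.bracket_swap q.1 p.1]
    module

/-- The value at `p` of the left-invariant vector field `Z`. -/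
def field (Z p : V × W) : V × W := (Z.1, Z.2 + (1 / 2 : ℝ) • g.bracket p.1 Z.1)

lemma mul_smul_eq (p Z : V × W) (t : ℝ) : g.mul p (t • Z) = p + t • g.field Z p := by
  ext
  · simp [mul, field]
  · simp only [mul, field, Prod.snd_add, Prod.smul_snd, Prod.smul_fst, map_smul]
    module

/-- By `[Z, Z] = 0` the field is constant along its own integral curves, which are therefore
straight lines. -/
lemma field_mul_smul (p Z : V × W) (t : ℝ) : g.field Z (g.mul p (t • Z)) = g.field Z p := by
  ext
  · simp [mul, field]
  · simp [mul, field, g.bracket_self]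

lemma contDiff_field (Z : V × W) {n : WithTop ℕ∞} : ContDiff ℝ n (g.field Z) :=
  contDiff_const.prodMk (contDiff_const.add
    (contDiff_const.smul (g.contDiff_bracket contDiff_fst contDiff_const)))

lemma hasDerivAt_mul_smul {φ : V × W → ℂ} (hφ : Differentiable ℝ φ) (p Z : V × W) (t : ℝ) :
    HasDerivAt (fun s : ℝ => φ (g.mul p (s • Z))) (fderiv ℝ φ (g.mul p (t • Z)) (g.field Z p)) t := by
  have h1 : HasDerivAt (fun s : ℝ => g.mul p (s • Z)) (g.field Z p) t := by
    simp_rw [g.mul_smul_eq]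
    simpa using ((hasDerivAt_id t).smul_const (g.field Z p)).const_add p
  exact (hφ _).hasFDerivAt.comp_hasDerivAt t h1

lemma leftInv_eq {φ : V × W → ℂ} (hφ : Differentiable ℝ φ) (Z p : V × W) :
    g.leftInv Z φ p = fderiv ℝ φ p (g.field Z p) := by
  have := g.hasDerivAt_mul_smul hφ p Z 0
  rw [zero_smul, g.mul_zero] at this
  exact this.deriv

lemma hasDerivAt_leftInv {φ : V × W → ℂ} (hφ : Differentiable ℝ φ) (Z p : V × W) (t : ℝ) :
    HasDerivAt (fun s : ℝ => φ (g.mul p (s • Z))) (g.leftInv Z φ (g.mul p (t • Z))) t := by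
  rw [g.leftInv_eq hφ, g.field_mul_smul]
  exact g.hasDerivAt_mul_smul hφ p Z t

lemma contDiff_leftInv {φ : V × W → ℂ} (hφ : ContDiff ℝ ∞ φ) (Z : V × W) :
    ContDiff ℝ ∞ (g.leftInv Z φ) := by
  have : g.leftInv Z φ = fun p => fderiv ℝ φ p (g.field Z p) :=
    funext fun p => g.leftInv_eq (hφ.differentiable (by simp)) Z p
  rw [this]
  exact (hφ.fderiv_right (m := ∞) (by simp)).clm_apply (g.contDiff_field Z)

lemma isTest_leftInv {φ : V × W → ℂ} (hφ : IsTest φ) (Z : V × W) : IsTest (g.leftInv Z φ) := by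
  refine ⟨g.contDiff_leftInv hφ.1 Z, ?_⟩
  refine (hφ.2.fderiv (𝕜 := ℝ)).mono fun p hp => ?_
  rw [Function.mem_support] at hp ⊢
  rw [g.leftInv_eq hφ.differentiable] at hp
  exact fun h => hp (by rw [h]; rfl)

lemma leftInv_mul {φ ψ : V × W → ℂ} (hφ : Differentiable ℝ φ) (hψ : Differentiable ℝ ψ)
    (Z p : V × W) : g.leftInv Z (fun p => φ p * ψ p) p
      = g.leftInv Z φ p * ψ p + φ p * g.leftInv Z ψ p := by
  have h := (g.hasDerivAt_leftInv hφ Z p 0).mul (g.hasDerivAt_leftInv hψ Z p 0)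
  simp only [zero_smul, g.mul_zero] at h
  exact h.deriv

lemma leftInv_conj {φ : V × W → ℂ} (hφ : Differentiable ℝ φ) (Z p : V × W) :
    g.leftInv Z (fun p => conj (φ p)) p = conj (g.leftInv Z φ p) := by
  have h := g.hasDerivAt_leftInv hφ Z p 0
  rw [zero_smul, g.mul_zero] at h
  exact (h.star).deriv

lemma isTest_sublaplacian {ι : Type*} [Fintype ι] (X : ι → V) {φ : V × W → ℂ} (hφ : IsTest φ) :
    IsTest (g.sublaplacian X φ) :=
  (IsTest.sum Finset.univ fun i _ => g.isTest_leftInv (g.isTest_leftInv hφ (X i, 0)) (X i, 0)).neg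

lemma isTest_centralDeriv (u : W) {φ : V × W → ℂ} (hφ : IsTest φ) : IsTest (g.centralDeriv u φ) :=
  (g.isTest_leftInv hφ (0, u)).const_mul _

lemma leftInv_comp_leftMul (Z q : V × W) (φ : V × W → ℂ) :
    g.leftInv Z (fun p => φ (g.mul q p)) = fun p => g.leftInv Z φ (g.mul q p) := by
  ext p
  simp only [leftInv, g.mul_assoc]

lemma isTest_comp_leftMul {φ : V × W → ℂ} (hφ : IsTest φ) (q : V × W) :
    IsTest fun p => φ (g.mul q p) := by
  refine ⟨hφ.1.comp (g.contDiff_mul contDiff_const contDiff_id), ?_⟩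
  let e : (V × W) ≃ₜ (V × W) :=
    { toFun := g.mul q
      invFun := g.mul (g.inv q)
      left_inv := g.inv_mul_cancel_left q
      right_inv := g.mul_inv_cancel_left q
      continuous_toFun := g.continuous_mul continuous_const continuous_id
      continuous_invFun := g.continuous_mul continuous_const continuous_id }
  exact hφ.2.comp_homeomorph e

end Calculus

end TwoStepAlgebra

variable {V W : Type*} [NormedAddCommGroup V] [InnerProductSpace ℝ V] [FiniteDimensional ℝ V]
  [MeasurableSpace V] [BorelSpace V] [NormedAddCommGroup W] [NormedSpace ℝ W]
  [FiniteDimensional ℝ W] [MeasurableSpace W] [BorelSpace W] {ι κ : Type*} [Fintype ι] [Fintype κ]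
  (g : TwoStepAlgebra V W) (U : Basis κ ℝ W) {X : OrthonormalBasis ι ℝ V}
  {E : ProjectionValuedMeasure (ℝ × (κ → ℝ)) (Lp ℂ 2 (g.haar U))}
  {φ ψ f F χ e k K K' : V × W → ℂ} {s t a : ℝ} (η : κ → ℝ)

local notation "𝔪" => TwoStepAlgebra.haar g U

/-! ### Invariance of the Haar measure and integration by parts. -/

namespace TwoStepAlgebra

/-- A left translation is a translation of `V` combined, over each point of `V`, with a translation
of `W`. -/
lemma measurePreserving_leftMul (q : V × W) : MeasurePreserving (g.mul q) 𝔪 𝔪 := by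
  have hc : Continuous fun p : V × W => q.2 + p.2 + (1 / 2 : ℝ) • g.bracket q.1 p.1 :=
    (continuous_const.add continuous_snd).add
      (continuous_const.smul (g.continuous_bracket continuous_const continuous_fst))
  refine (measurePreserving_add_left (volume : Measure V) q.1).skew_product
    (g := fun x u => q.2 + u + (1 / 2 : ℝ) • g.bracket q.1 x) hc.measurable
    (.of_forall fun x => ?_)
  have : (fun u : W => q.2 + u + (1 / 2 : ℝ) • g.bracket q.1 x)
      = fun u => (q.2 + (1 / 2 : ℝ) • g.bracket q.1 x) + u := by ext u; abel
  rw [this]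
  exact (measurePreserving_add_left U.addHaar _).map_eq

lemma measurePreserving_rightMul (q : V × W) : MeasurePreserving (fun p => g.mul p q) 𝔪 𝔪 := by
  have hc : Continuous fun p : V × W => p.2 + q.2 + (1 / 2 : ℝ) • g.bracket p.1 q.1 :=
    (continuous_snd.add continuous_const).add
      (continuous_const.smul (g.continuous_bracket continuous_fst continuous_const))
  refine (measurePreserving_add_right (volume : Measure V) q.1).skew_product
    (g := fun x u => u + q.2 + (1 / 2 : ℝ) • g.bracket x q.1) hc.measurable
    (.of_forall fun x => ?_)
  have : (fun u : W => u + q.2 + (1 / 2 : ℝ) • g.bracket x q.1)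
      = fun u => u + (q.2 + (1 / 2 : ℝ) • g.bracket x q.1) := by ext u; abel
  rw [this]
  exact (measurePreserving_add_right U.addHaar _).map_eq

lemma measurePreserving_inv : MeasurePreserving g.inv 𝔪 𝔪 := by
  haveI : (𝔪).Regular := inferInstance
  haveI : (𝔪).IsNegInvariant := inferInstance
  exact Measure.measurePreserving_neg 𝔪

lemma measurableEmbedding_leftMul (q : V × W) : MeasurableEmbedding (g.mul q) := by
  let e : (V × W) ≃ₜ (V × W) :=
    { toFun := g.mul q
      invFun := g.mul (g.inv q)
      left_inv := g.inv_mul_cancel_left q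
      right_inv := g.mul_inv_cancel_left q
      continuous_toFun := g.continuous_mul continuous_const continuous_id
      continuous_invFun := g.continuous_mul continuous_const continuous_id }
  exact e.measurableEmbedding

lemma mul_inv_cancel_right (p q : V × W) : g.mul (g.mul p q) (g.inv q) = p := by
  rw [mul_assoc, mul_inv, mul_zero]

lemma inv_mul_cancel_right (p q : V × W) : g.mul (g.mul p (g.inv q)) q = p := by
  rw [mul_assoc, inv_mul, mul_zero]

lemma measurableEmbedding_rightMul (q : V × W) : MeasurableEmbedding fun p => g.mul p q := by
  let e : (V × W) ≃ₜ (V × W) :=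
    { toFun := fun p => g.mul p q
      invFun := fun p => g.mul p (g.inv q)
      left_inv := fun p => g.mul_inv_cancel_right p q
      right_inv := fun p => g.inv_mul_cancel_right p q
      continuous_toFun := g.continuous_mul continuous_id continuous_const
      continuous_invFun := g.continuous_mul continuous_id continuous_const }
  exact e.measurableEmbedding

lemma integral_leftMul (q : V × W) (f : V × W → ℂ) : ∫ p, f (g.mul q p) ∂𝔪 = ∫ p, f p ∂𝔪 :=
  (g.measurePreserving_leftMul U q).integral_comp (g.measurableEmbedding_leftMul q) f

lemma integral_rightMul (q : V × W) (f : V × W → ℂ) : ∫ p, f (g.mul p q) ∂𝔪 = ∫ p, f p ∂𝔪 :=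
  (g.measurePreserving_rightMul U q).integral_comp (g.measurableEmbedding_rightMul q) f

lemma integral_inv : ∫ p, f (g.inv p) ∂𝔪 = ∫ p, f p ∂𝔪 :=
  (g.measurePreserving_inv U).integral_comp (MeasurableEquiv.neg (V × W)).measurableEmbedding f

/-- By right invariance `t ↦ ∫ h(p exp(tZ)) dp` is constant; its derivative at `0` is the integral
in question. -/
lemma integral_leftInv {h : V × W → ℂ} (hh : IsTest h) (Z : V × W) :
    ∫ p, g.leftInv Z h p ∂𝔪 = 0 := by
  obtain ⟨C, hC0, hC⟩ := (g.isTest_leftInv hh Z).exists_norm_le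
  have hK : IsCompact ((fun r : ℝ × (V × W) => g.mul r.2 (-r.1 • Z)) ''
      (Icc (-1) 1 ×ˢ tsupport (g.leftInv Z h))) :=
    (isCompact_Icc.prod (g.isTest_leftInv hh Z).2).image
      (g.continuous_mul continuous_snd (continuous_fst.neg.smul continuous_const))
  -- For `|t| ≤ 1` the translated functions are all supported in this compact set, which provides
  -- the dominating function.
  set K := (fun r : ℝ × (V × W) => g.mul r.2 (-r.1 • Z)) ''
      (Icc (-1) 1 ×ˢ tsupport (g.leftInv Z h)) with hKdef
  have hcont : ∀ {k : V × W → ℂ}, Continuous k → ∀ t : ℝ,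
      Continuous fun p => k (g.mul p (t • Z)) := fun hk t =>
    hk.comp (g.continuous_mul continuous_id continuous_const)
  have key := hasDerivAt_integral_of_dominated_loc_of_deriv_le (μ := 𝔪) (x₀ := (0 : ℝ))
    (s := Ioo (-1) 1) (F := fun t p => h (g.mul p (t • Z)))
    (F' := fun t p => g.leftInv Z h (g.mul p (t • Z))) (bound := K.indicator fun _ => C)
    (Ioo_mem_nhds (by norm_num) (by norm_num))
    (.of_forall fun t => (hcont hh.continuous t).aestronglyMeasurable)
    (by simpa [g.mul_zero] using hh.integrable)
    (hcont (g.isTest_leftInv hh Z).continuous 0).aestronglyMeasurable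
    (.of_forall fun p t ht => by
      by_cases hp : g.mul p (t • Z) ∈ tsupport (g.leftInv Z h)
      · have : p ∈ K := ⟨(t, g.mul p (t • Z)), ⟨⟨ht.1.le, ht.2.le⟩, hp⟩, by
          have := g.mul_inv_cancel_right p (t • Z)
          simpa [inv] using this⟩
        rw [indicator_of_mem this]; exact hC _
      · rw [image_eq_zero_of_notMem_tsupport hp, norm_zero]
        exact indicator_nonneg (fun _ _ => hC0) _)
    ((integrable_indicator_iff hK.measurableSet).2 (integrableOn_const hK.measure_lt_top.ne))
    (.of_forall fun p t _ => g.hasDerivAt_leftInv hh.differentiable Z p t)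
  have h2 := key.2
  simp_rw [g.integral_rightMul U _ h] at h2
  simp only [zero_smul, g.mul_zero] at h2
  exact h2.unique (hasDerivAt_const _ _)

/-- Integration by parts. -/
lemma integral_leftInv_mul (hφ : IsTest φ) (he : ContDiff ℝ ∞ e)
    (Z : V × W) : ∫ p, e p * g.leftInv Z φ p ∂𝔪
      = - ∫ p, g.leftInv Z e p * φ p ∂𝔪 := by
  have h1 := g.integral_leftInv U (IsTest.mul_left he hφ) Z
  simp_rw [g.leftInv_mul (he.differentiable (by simp)) hφ.differentiable] at h1
  rw [integral_add ((hφ.mul_left (g.contDiff_leftInv he Z)).integrable)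
    (((g.isTest_leftInv hφ Z).mul_left he).integrable)] at h1
  exact eq_neg_of_add_eq_zero_right h1

/-! ### Left convolution and essential self-adjointness -/

/-- The convolution `φ * f` on the group. -/
def conv (φ f : V × W → ℂ) (p : V × W) : ℂ := ∫ q, φ q * f (g.mul (g.inv q) p) ∂𝔪

lemma conv_eq (φ f : V × W → ℂ) (p : V × W) :
    g.conv U φ f p = ∫ q, φ (g.mul p (g.inv q)) * f q ∂𝔪 := by
  rw [conv, ← g.integral_leftMul U p fun q => φ q * f (g.mul (g.inv q) p), ← g.integral_inv U]
  congr 1; ext q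
  rw [g.inv_mul_rev, g.inv_inv, g.mul_assoc q, g.inv_mul, g.mul_zero]

/-- With `z = p - q` one has `p q⁻¹ = (z.1, z.2 + ½[p.1, z.1])`. The group convolution is therefore
an additive convolution whose kernel `ψ p` depends smoothly on the parameter `p`, evaluated on the
diagonal. Restricting `p` to a ball keeps the supports in one compact set. -/
lemma contDiff_conv (hφ : IsTest φ) (hf : LocallyIntegrable f 𝔪) : ContDiff ℝ ∞ (g.conv U φ f) := by
  rw [contDiff_iff_contDiffAt]
  intro p₀
  let ψ : V × W → V × W → ℂ := fun p z => φ (z.1, z.2 + (1 / 2 : ℝ) • g.bracket p.1 z.1)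
  have hψ : ContDiff ℝ ∞ fun r : (V × W) × (V × W) =>
      ((r.2.1, r.2.2 + (1 / 2 : ℝ) • g.bracket r.1.1 r.2.1) : V × W) :=
    contDiff_snd.fst.prodMk (contDiff_snd.snd.add
      (contDiff_const.smul (g.contDiff_bracket contDiff_fst.fst contDiff_snd.fst)))
  let m : (V × W) × (V × W) → V × W := fun r =>
    (r.2.1, r.2.2 - (1 / 2 : ℝ) • g.bracket r.1.1 r.2.1)
  have hm : Continuous m := continuous_snd.fst.prodMk (continuous_snd.snd.sub
    (continuous_const.smul (g.continuous_bracket continuous_fst.fst continuous_snd.fst)))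
  have hk : IsCompact (m '' (Metric.closedBall 0 (‖p₀‖ + 1) ×ˢ tsupport φ)) :=
    ((isCompact_closedBall _ _).prod hφ.2).image hm
  have key := contDiffOn_convolution_right_with_param (𝕜 := ℝ) (n := ⊤)
    (ContinuousLinearMap.mul ℝ ℂ) (μ := 𝔪) (g := ψ) (s := Metric.ball 0 (‖p₀‖ + 1))
    Metric.isOpen_ball hk (fun p z hp hz => by
      by_contra hne
      apply hz
      refine ⟨(p, (z.1, z.2 + (1 / 2 : ℝ) • g.bracket p.1 z.1)),
        ⟨Metric.ball_subset_closedBall hp, subset_tsupport _ hne⟩, ?_⟩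
      ext <;> simp [m]) hf (hφ.1.comp hψ).contDiffOn
  have h2 : g.conv U φ f = (fun q : (V × W) × (V × W) =>
      (convolution f (ψ q.1) (ContinuousLinearMap.mul ℝ ℂ) 𝔪) q.2) ∘ fun p => (p, p) := by
    ext p
    rw [conv_eq, comp_apply, convolution_def]
    congr 1; ext q
    rw [ContinuousLinearMap.mul_apply', mul_comm]
    congr 2
    ext
    · simp [mul, inv, sub_eq_add_neg]
    · simp only [mul, inv, Prod.fst_neg, Prod.snd_neg, Prod.fst_sub, Prod.snd_sub, map_sub,
        map_neg, g.bracket_self]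
      module
  rw [h2]
  refine ContDiffAt.comp p₀ (key.contDiffAt ?_) (contDiff_id.prodMk contDiff_id).contDiffAt
  refine (Metric.isOpen_ball.prod isOpen_univ).mem_nhds ⟨?_, mem_univ _⟩
  simp

lemma isTest_conv (hφ : IsTest φ) (hf : IsTest f) : IsTest (g.conv U φ f) := by
  refine ⟨g.contDiff_conv U hφ hf.continuous.locallyIntegrable, ?_⟩
  have hK : IsCompact ((fun r : (V × W) × (V × W) => g.mul r.1 r.2) '' (tsupport φ ×ˢ tsupport f)) :=
    (hφ.2.prod hf.2).image (g.continuous_mul continuous_fst continuous_snd)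
  refine HasCompactSupport.intro hK fun p hp => ?_
  refine integral_eq_zero_of_ae (.of_forall fun q => ?_)
  by_contra hne
  have h1 := left_ne_zero_of_mul hne
  have h2 := right_ne_zero_of_mul hne
  exact hp ⟨(q, g.mul (g.inv q) p), ⟨subset_tsupport _ h1, subset_tsupport _ h2⟩,
    g.mul_inv_cancel_left q p⟩

lemma integrable_conv_integrand (hφ : IsTest φ) (hf : IsTest f) (p : V × W) :
    Integrable (fun q => φ q * f (g.mul (g.inv q) p)) 𝔪 := by
  have hc : Continuous fun q => f (g.mul (g.inv q) p) :=
    hf.continuous.comp (g.continuous_mul continuous_neg continuous_const)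
  exact (hφ.continuous.mul hc).integrable_of_hasCompactSupport hφ.2.mul_right

/-- The convolution is a superposition of left translates of `f`, and these are respected by
left-invariant fields. -/
lemma leftInv_conv (hφ : IsTest φ) (hf : IsTest f) (Z : V × W) :
    g.leftInv Z (g.conv U φ f) = g.conv U φ (g.leftInv Z f) := by
  ext p
  obtain ⟨C, hC0, hC⟩ := (g.isTest_leftInv hf Z).exists_norm_le
  have hc : ∀ t : ℝ, Continuous fun q => f (g.mul (g.mul (g.inv q) p) (t • Z)) := fun t =>
    hf.continuous.comp (g.continuous_mul (g.continuous_mul continuous_neg continuous_const)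
      continuous_const)
  have key := hasDerivAt_integral_of_dominated_loc_of_deriv_le (μ := 𝔪) (x₀ := (0 : ℝ))
    (s := univ) (F := fun t q => φ q * f (g.mul (g.mul (g.inv q) p) (t • Z)))
    (F' := fun t q => φ q * g.leftInv Z f (g.mul (g.mul (g.inv q) p) (t • Z)))
    (bound := fun q => ‖φ q‖ * C) univ_mem
    (.of_forall fun t => (hφ.continuous.mul (hc t)).aestronglyMeasurable)
    (by simpa [g.mul_zero] using g.integrable_conv_integrand U hφ hf p)
    (by simpa [g.mul_zero] using
      (g.integrable_conv_integrand U hφ (g.isTest_leftInv hf Z) p).aestronglyMeasurable)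
    (.of_forall fun q t _ => by
      rw [norm_mul]; exact mul_le_mul_of_nonneg_left (hC _) (norm_nonneg _))
    (hφ.integrable.norm.mul_const C)
    (.of_forall fun q t _ =>
      (g.hasDerivAt_leftInv hf.differentiable Z _ t).const_mul (φ q))
  have h2 := key.2
  simp only [zero_smul, g.mul_zero] at h2
  rw [leftInv]
  simp only [conv, ← g.mul_assoc]
  exact h2.deriv

lemma conv_neg (φ f : V × W → ℂ) (p : V × W) :
    g.conv U φ (fun p => - f p) p = - g.conv U φ f p := by
  rw [conv, conv, ← integral_neg]; congr 1; ext q; ring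

lemma conv_const_mul (φ f : V × W → ℂ) (c : ℂ) (p : V × W) :
    g.conv U φ (fun p => c * f p) p = c * g.conv U φ f p := by
  rw [conv, conv, ← integral_const_mul]; congr 1; ext q; ring

lemma sublaplacian_conv {ι : Type*} [Fintype ι] (X : ι → V) (hφ : IsTest φ)
    (hf : IsTest f) : g.sublaplacian X (g.conv U φ f) = g.conv U φ (g.sublaplacian X f) := by
  ext p
  have h1 : ∀ j, g.leftInv (X j, 0) (g.leftInv (X j, 0) (g.conv U φ f)) p
      = g.conv U φ (g.leftInv (X j, 0) (g.leftInv (X j, 0) f)) p := fun j => by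
    rw [g.leftInv_conv U hφ hf, g.leftInv_conv U hφ (g.isTest_leftInv hf _)]
  simp only [sublaplacian, h1]
  refine Eq.trans ?_
    (g.conv_neg U φ (fun p => ∑ j, g.leftInv (X j, 0) (g.leftInv (X j, 0) f) p) p).symm
  congr 1
  simp only [conv, mul_sum]
  rw [integral_finsetSum]
  exact fun j _ => g.integrable_conv_integrand U hφ (g.isTest_leftInv (g.isTest_leftInv hf _) _) p

lemma centralDeriv_conv (u : W) (hφ : IsTest φ) (hf : IsTest f) :
    g.centralDeriv u (g.conv U φ f) = g.conv U φ (g.centralDeriv u f) := by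
  ext p
  rw [centralDeriv, g.leftInv_conv U hφ hf]
  exact (g.conv_const_mul U _ _ _ _).symm

/-! ### Left translations and convolution operators on `L²`. -/

/-- Left translations on `L²`. -/
def leftTrans (q : V × W) : Lp ℂ 2 𝔪 ≃ₗᵢ[ℂ] Lp ℂ 2 𝔪 := LinearIsometryEquiv.ofSurjective
    (Lp.compMeasurePreservingₗᵢ ℂ _ (g.measurePreserving_leftMul U (g.inv q))) fun f => by
      refine ⟨Lp.compMeasurePreservingₗᵢ ℂ _ (g.measurePreserving_leftMul U q) f, ?_⟩
      refine Lp.ext ?_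
      have h1 := Lp.coeFn_compMeasurePreserving (Lp.compMeasurePreserving _
        (g.measurePreserving_leftMul U q) f) (g.measurePreserving_leftMul U (g.inv q))
      have h2 := (g.measurePreserving_leftMul U (g.inv q)).quasiMeasurePreserving.ae_eq_comp
        (Lp.coeFn_compMeasurePreserving f (g.measurePreserving_leftMul U q))
      refine (h1.trans h2).trans (.of_forall fun p => ?_)
      simp only [comp_apply, g.mul_inv_cancel_left]

lemma coeFn_leftTrans (q : V × W) (f : Lp ℂ 2 𝔪) :
    g.leftTrans U q f =ᵐ[𝔪] fun p => f (g.mul (g.inv q) p) :=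
  Lp.coeFn_compMeasurePreserving f (g.measurePreserving_leftMul U (g.inv q))

lemma leftTrans_testLp (q : V × W) (hφ : IsTest φ) :
    g.leftTrans U q (testLp _ φ) = testLp _ fun p => φ (g.mul (g.inv q) p) := by
  refine eq_testLp (g.isTest_comp_leftMul hφ _) ?_
  refine (g.coeFn_leftTrans U q _).trans ?_
  exact (g.measurePreserving_leftMul U (g.inv q)).quasiMeasurePreserving.ae_eq_comp
    (coeFn_testLp hφ)

lemma inner_leftTrans (q : V × W) (f h : Lp ℂ 2 𝔪) :
    inner ℂ (g.leftTrans U q f) h = inner ℂ f (g.leftTrans U (g.inv q) h) := by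
  rw [inner_Lp_eq, inner_Lp_eq, ← g.integral_leftMul U q]
  refine integral_congr_ae ?_
  have h1 := (g.measurePreserving_leftMul U q).quasiMeasurePreserving.ae_eq_comp
    (g.coeFn_leftTrans U q f)
  filter_upwards [h1, g.coeFn_leftTrans U (g.inv q) h] with p h2 h3
  simp only [comp_apply, g.inv_mul_cancel_left] at h2
  rw [h2, h3, g.inv_inv]

lemma continuous_leftTrans (f : Lp ℂ 2 𝔪) : Continuous fun q => g.leftTrans U q f := by
  let m : C((V × W) × (V × W), V × W) := ⟨fun r => g.mul (g.inv r.1) r.2,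
    g.continuous_mul continuous_fst.neg continuous_snd⟩
  exact Continuous.compMeasurePreservingLp (f := fun _ : V × W => f) (g := m.curry)
    continuous_const m.curry.continuous (fun q => g.measurePreserving_leftMul U (g.inv q)) (by simp)

lemma integrable_smul_leftTrans (hψ : IsTest ψ) (f : Lp ℂ 2 𝔪) :
    Integrable (fun q => ψ q • g.leftTrans U q f) 𝔪 :=
  (hψ.continuous.smul (g.continuous_leftTrans U f)).integrable_of_hasCompactSupport hψ.2.smul_right

/-- Left convolution with a test function on `L²`. -/
def convL (hψ : IsTest ψ) : Lp ℂ 2 𝔪 →L[ℂ] Lp ℂ 2 𝔪 := mkContinuous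
    { toFun := fun f => ∫ q, ψ q • g.leftTrans U q f ∂𝔪
      map_add' := fun f h => by
        rw [← integral_add (g.integrable_smul_leftTrans U hψ f) (g.integrable_smul_leftTrans U hψ h)]
        simp
      map_smul' := fun c f => by
        rw [RingHom.id_apply, ← integral_smul]
        congr 1; ext1 q
        rw [map_smul, smul_comm] }
    (∫ q, ‖ψ q‖ ∂𝔪) fun f => by
      refine (norm_integral_le_integral_norm _).trans (le_of_eq ?_)
      rw [← integral_mul_const]
      congr 1; ext q
      rw [norm_smul, LinearIsometryEquiv.norm_map]

lemma convL_apply (hψ : IsTest ψ) (f : Lp ℂ 2 𝔪) :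
    g.convL U hψ f = ∫ q, ψ q • g.leftTrans U q f ∂𝔪 := rfl

lemma inner_convL (hψ : IsTest ψ) (h f : Lp ℂ 2 𝔪) :
    inner ℂ h (g.convL U hψ f) = ∫ q, ψ q * inner ℂ h (g.leftTrans U q f) ∂𝔪 := by
  rw [convL_apply, ← integral_inner (g.integrable_smul_leftTrans U hψ f)]
  simp_rw [inner_smul_right]

/-- The Fubini hypothesis for comparing the vector-valued integral `convL` with the pointwise
`conv`. The inner integral is bounded uniformly in `q` by `|ab| ≤ a² + b²` and left invariance. -/
lemma integrable_conv_prod {ψ η : V × W → ℂ} (hψ : IsTest ψ) (hη : IsTest η) (f : Lp ℂ 2 𝔪) :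
    Integrable (fun r : (V × W) × (V × W) => ψ r.1 * (η r.2 * f (g.mul (g.inv r.1) r.2)))
      ((𝔪).prod 𝔪) := by
  have hq : Measure.QuasiMeasurePreserving (fun r : (V × W) × (V × W) => g.mul (g.inv r.1) r.2)
      ((𝔪).prod 𝔪) 𝔪 :=
    QuasiMeasurePreserving.prod_of_right
      (g.continuous_mul continuous_fst.neg continuous_snd).measurable
      (.of_forall fun q => (g.measurePreserving_leftMul U (g.inv q)).quasiMeasurePreserving)
  have hm : AEStronglyMeasurable
      (fun r : (V × W) × (V × W) => ψ r.1 * (η r.2 * f (g.mul (g.inv r.1) r.2)))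
      ((𝔪).prod 𝔪) :=
    (hψ.continuous.comp continuous_fst).aestronglyMeasurable.mul
      ((hη.continuous.comp continuous_snd).aestronglyMeasurable.mul
        ((Lp.aestronglyMeasurable f).comp_quasiMeasurePreserving hq))
  have hfq : ∀ q, MemLp (fun p => f (g.mul (g.inv q) p)) 2 𝔪 := fun q =>
    (Lp.memLp f).comp_measurePreserving (g.measurePreserving_leftMul U (g.inv q))
  have hi : ∀ q, Integrable (fun p => η p * f (g.mul (g.inv q) p)) 𝔪 := fun q =>
    (hη.memLp 2).integrable_mul (hfq q)
  rw [integrable_prod_iff hm]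
  refine ⟨.of_forall fun q => (hi q).const_mul (ψ q), ?_⟩
  have hηs := ((hη.memLp (ν := 𝔪) 2).integrable_norm_pow (by simp))
  have hfs := ((Lp.memLp f).integrable_norm_pow (by simp))
  refine Integrable.mono' (g := fun q => ‖ψ q‖ * (∫ p, ‖η p‖ ^ (2 : ℕ) ∂𝔪
    + ∫ p, ‖f p‖ ^ (2 : ℕ) ∂𝔪))
    (hψ.integrable.norm.mul_const _) hm.norm.integral_prod_right' (.of_forall fun q => ?_)
  rw [norm_of_nonneg (integral_nonneg fun p => norm_nonneg _)]
  simp_rw [norm_mul (ψ q)]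
  rw [integral_const_mul]
  refine mul_le_mul_of_nonneg_left ?_ (norm_nonneg _)
  have hfs' := (hfq q).integrable_norm_pow (by simp)
  have e : ∫ p, ‖f p‖ ^ (2 : ℕ) ∂𝔪
      = ∫ p, ‖f (g.mul (g.inv q) p)‖ ^ (2 : ℕ) ∂𝔪 :=
    ((g.measurePreserving_leftMul U (g.inv q)).integral_comp
      (g.measurableEmbedding_leftMul (g.inv q)) fun p => ‖f p‖ ^ (2 : ℕ)).symm
  rw [e, ← integral_add hηs hfs']
  refine integral_mono (hi q).norm (hηs.add hfs') fun p => ?_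
  simp only [norm_mul, toReal_ofNat, rpow_two]
  nlinarith [sq_nonneg (‖η p‖ - ‖f (g.mul (g.inv q) p)‖), norm_nonneg (η p),
    norm_nonneg (f (g.mul (g.inv q) p))]

lemma locallyIntegrable_Lp (f : Lp ℂ 2 𝔪) : LocallyIntegrable f 𝔪 :=
  (Lp.memLp f).locallyIntegrable (by norm_num)

/-- Both sides are locally integrable and have the same integrals against smooth compactly supported
functions, by Fubini. -/
lemma coeFn_convL (hψ : IsTest ψ) (f : Lp ℂ 2 𝔪) : g.convL U hψ f =ᵐ[𝔪] g.conv U ψ f := by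
  have hc := (g.contDiff_conv U hψ (g.locallyIntegrable_Lp U f)).continuous
  have h0 : ∀ᵐ p ∂𝔪, (g.convL U hψ f p - g.conv U ψ f p) = 0 := by
    refine ae_eq_zero_of_integral_contDiff_smul_eq_zero
      ((g.locallyIntegrable_Lp U _).sub hc.locallyIntegrable) fun η h1 h2 => ?_
    have hη := IsTest.ofReal h1 h2
    have e1 : ∫ p, η p • (g.convL U hψ f p) ∂𝔪
        = ∫ q, ∫ p, ψ q * ((η p : ℂ) * f (g.mul (g.inv q) p)) ∂𝔪 ∂𝔪 := by
      have := g.inner_convL U hψ (testLp _ fun p => (η p : ℂ)) f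
      rw [inner_testLp_left _ hη] at this
      simp only [conj_ofReal] at this
      simp only [real_smul]
      rw [this]
      congr 1; ext q
      rw [inner_testLp_left _ hη, ← integral_const_mul]
      refine integral_congr_ae ?_
      filter_upwards [g.coeFn_leftTrans U q f] with p hp
      rw [hp, conj_ofReal]
    have e2 : ∫ p, η p • (g.conv U ψ f p) ∂𝔪
        = ∫ p, ∫ q, ψ q * ((η p : ℂ) * f (g.mul (g.inv q) p)) ∂𝔪 ∂𝔪 := by
      congr 1; ext p
      rw [conv, real_smul, ← integral_const_mul]
      congr 1; ext q; ring
    simp_rw [smul_sub]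
    rw [integral_sub, e1, e2, sub_eq_zero]
    · exact integral_integral_swap (g.integrable_conv_prod U hψ hη f)
    · exact (g.locallyIntegrable_Lp U _).integrable_smul_left_of_hasCompactSupport h1.continuous h2
    · exact hc.locallyIntegrable.integrable_smul_left_of_hasCompactSupport h1.continuous h2
  filter_upwards [h0] with p hp using sub_eq_zero.1 hp

lemma isTest_comp_inv (hφ : IsTest φ) : IsTest fun p => φ (g.inv p) :=
  ⟨hφ.1.comp contDiff_neg, hφ.2.comp_homeomorph (Homeomorph.neg _)⟩

lemma isTest_conjInv (hφ : IsTest φ) :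
    IsTest fun p => conj (φ (g.inv p)) := (g.isTest_comp_inv hφ).star

lemma inner_convL_left (hψ : IsTest ψ) (f h : Lp ℂ 2 𝔪) :
    inner ℂ (g.convL U hψ f) h = inner ℂ f (g.convL U (g.isTest_conjInv hψ) h) := by
  rw [← inner_conj_symm, inner_convL, inner_convL, ← integral_conj, ← g.integral_inv U]
  congr 1; ext q
  rw [map_mul, inner_conj_symm, inner_leftTrans, g.inv_inv]

lemma convL_testLp (hψ : IsTest ψ) (hφ : IsTest φ) :
    g.convL U hψ (testLp _ φ) = testLp _ (g.conv U ψ φ) := by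
  refine eq_testLp (g.isTest_conv U hψ hφ) ((g.coeFn_convL U hψ _).trans ?_)
  refine .of_forall fun p => ?_
  rw [conv_eq, conv_eq]
  refine integral_congr_ae ?_
  filter_upwards [coeFn_testLp (ν := 𝔪) hφ] with q hq
  rw [hq]

/-- For `ψ = η ∘ inv` the value of `ψ * f` at the identity is `∫ η f`. The convolution is
continuous, so vanishing almost everywhere means vanishing at that point. -/
lemma ae_eq_zero_of_conv (hf : LocallyIntegrable f 𝔪)
    (h : ∀ ψ, IsTest ψ → g.conv U ψ f =ᵐ[𝔪] 0) : f =ᵐ[𝔪] 0 := by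
  refine ae_eq_zero_of_integral_contDiff_smul_eq_zero hf fun η h1 h2 => ?_
  have hη := g.isTest_comp_inv (IsTest.ofReal h1 h2)
  have h3 := (g.contDiff_conv U hη hf).continuous.ae_eq_iff_eq 𝔪 continuous_const |>.1 (h _ hη)
  have h4 := congrFun h3 0
  rw [conv_eq] at h4
  simp only [g.zero_mul, g.inv_inv] at h4
  exact h4

/-! #### Cutoff estimates -/

lemma leftInv_sq_mul (hχ : ContDiff ℝ ∞ χ) (hF : ContDiff ℝ ∞ F)
    (Z p : V × W) : g.leftInv Z (fun p => χ p * χ p * F p) p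
      = 2 * χ p * g.leftInv Z χ p * F p + χ p * χ p * g.leftInv Z F p := by
  have h1 := hχ.differentiable (by simp)
  have h2 : Differentiable ℝ fun p => χ p * χ p := h1.mul h1
  rw [g.leftInv_mul h2 (hF.differentiable (by simp)), g.leftInv_mul h1 h1]
  ring

lemma integrable_comp_test_mul (hψ : IsTest ψ) {k : ℂ → ℝ} (hk : Continuous k)
    (hk0 : k 0 = 0) {G : V × W → ℝ} (hG : Continuous G) :
    Integrable (fun p => k (ψ p) * G p) 𝔪 := by
  have h1 : Continuous fun p => k (ψ p) * G p := (hk.comp hψ.continuous).mul hG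
  have h2 : HasCompactSupport fun p => k (ψ p) := hψ.2.comp_left hk0
  have h3 : HasCompactSupport fun p => k (ψ p) * G p := h2.mul_right
  exact h1.integrable_of_hasCompactSupport h3

/-- The difference is the cross term alone, and `2|x||w||d||y| ≤ x²|w|²/2 + 2|d|²|y|²`. The factor
`1/2` lets the main term be absorbed later. -/
lemma norm_cutoff_sub_le (x : ℝ) (w d y : ℂ) :
    ‖conj w * (2 * (x : ℂ) * d * y + (x : ℂ) * (x : ℂ) * w)
      - ((x ^ 2 * ‖w‖ ^ 2 : ℝ) : ℂ)‖ ≤ x ^ 2 * ‖w‖ ^ 2 / 2 + 2 * (‖d‖ ^ 2 * ‖y‖ ^ 2) := by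
  have : conj w * (2 * (x : ℂ) * d * y + (x : ℂ) * (x : ℂ) * w)
      - ((x ^ 2 * ‖w‖ ^ 2 : ℝ) : ℂ) = 2 * (x : ℂ) * d * y * conj w := by
    have h3 := mul_conj w
    rw [normSq_eq_norm_sq] at h3
    push_cast at h3 ⊢
    rw [← h3]; ring
  rw [this]
  simp only [norm_mul, RCLike.norm_conj, norm_real, Complex.norm_ofNat, norm_eq_abs]
  have h := sq_nonneg (|x| * ‖w‖ - 2 * (‖d‖ * ‖y‖))
  have h' : (|x| * ‖w‖) ^ 2 = x ^ 2 * ‖w‖ ^ 2 := by rw [mul_pow, sq_abs]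
  nlinarith [h, h']

-- A Caccioppoli inequality for a smooth weak solution of `L F = ∓i F`, tested with `χ² F`. Up to
-- the cross terms, the left side is `Σ ∫ χ²|X_j F|²`, which is real, while the right side is purely
-- imaginary. The real part bounds the energy `Σ a_j` by `4 Σ b_j`, and then the imaginary part
-- bounds `∫ χ²|F|²` by the same quantity.
set_option maxHeartbeats 1000000 in
lemma cutoff_estimate_sublaplacian {ι : Type*} [Fintype ι] (X : ι → V) 
    (hF : ContDiff ℝ ∞ F) {z : ℂ} (hz : z = I ∨ z = -I)
    (h : ∀ φ, IsTest φ → ∫ p, conj (F p) * g.sublaplacian X φ p ∂𝔪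
      = z * ∫ p, conj (F p) * φ p ∂𝔪)
    {χ : V × W → ℝ} (h1 : ContDiff ℝ ∞ χ) (h2 : HasCompactSupport χ) :
    ∫ p, χ p ^ 2 * ‖F p‖ ^ 2 ∂𝔪
      ≤ ∑ j, ∫ p, 4 * ‖g.leftInv (X j, 0) (fun p => (χ p : ℂ)) p‖ ^ 2 * ‖F p‖ ^ 2 ∂𝔪 := by
  have hχ := IsTest.ofReal h1 h2
  set c : V × W → ℂ := fun p => (χ p : ℂ) with hc
  have hφ : IsTest fun p => c p * c p * F p := (hχ.mul_right hχ.1).mul_right hF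
  have hFd := hF.differentiable (by simp)
  have hFc : ContDiff ℝ ∞ fun p => conj (F p) := conjCLE.contDiff.comp hF
  have e1 := h _ hφ
  have hint1 : ∀ j, Integrable (fun p => conj (F p) * g.leftInv (X j, 0)
      (g.leftInv (X j, 0) fun p => c p * c p * F p) p) 𝔪 := fun j =>
    (IsTest.mul_left hFc (g.isTest_leftInv (g.isTest_leftInv hφ _) _)).integrable
  have e2 : ∫ p, conj (F p) * g.sublaplacian X (fun p => c p * c p * F p) p ∂𝔪
      = ∑ j, ∫ p, conj (g.leftInv (X j, 0) F p)
        * (2 * c p * g.leftInv (X j, 0) c p * F p + c p * c p * g.leftInv (X j, 0) F p)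
          ∂𝔪 := by
    simp only [sublaplacian, mul_neg, mul_sum]
    rw [integral_neg, integral_finsetSum _ fun j _ => hint1 j, ← sum_neg_distrib]
    refine sum_congr rfl fun j _ => ?_
    rw [g.integral_leftInv_mul U (g.isTest_leftInv hφ _) hFc, neg_neg]
    congr 1; ext p
    rw [g.leftInv_conj hFd, g.leftInv_sq_mul hχ.1 hF]
  have e3 : ∫ p, conj (F p) * (c p * c p * F p) ∂𝔪
      = ((∫ p, χ p ^ 2 * ‖F p‖ ^ 2 ∂𝔪 : ℝ) : ℂ) := by
    rw [← integral_complex_ofReal]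
    congr 1; ext p
    have : conj (F p) * (c p * c p * F p) = c p * c p * (F p * conj (F p)) := by
      ring
    rw [this, mul_conj, normSq_eq_norm_sq, hc]
    push_cast; ring
  rw [e2, e3] at e1
  have ha : ∀ j, Integrable (fun p => χ p ^ 2 * ‖g.leftInv (X j, 0) F p‖ ^ 2) 𝔪 := fun j => by
      have := g.integrable_comp_test_mul U hχ (k := fun x => x.re ^ 2) (by fun_prop) (by simp)
        ((g.contDiff_leftInv hF (X j, 0)).continuous.norm.pow 2)
      simpa [hc] using this
  have hb : ∀ j, Integrable (fun p => ‖g.leftInv (X j, 0) c p‖ ^ 2 * ‖F p‖ ^ 2) 𝔪 :=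
    fun j => g.integrable_comp_test_mul U (g.isTest_leftInv hχ _) (k := fun x => ‖x‖ ^ 2)
      (by fun_prop) (by simp) (hF.continuous.norm.pow 2)
  have hP : ∀ j, Integrable (fun p => conj (g.leftInv (X j, 0) F p)
      * (2 * c p * g.leftInv (X j, 0) c p * F p + c p * c p * g.leftInv (X j, 0) F p))
        𝔪 := fun j => by
    have : IsTest fun p => conj (g.leftInv (X j, 0) F p)
        * (g.leftInv (X j, 0) (fun p => c p * c p * F p) p) :=
      IsTest.mul_left (conjCLE.contDiff.comp (g.contDiff_leftInv hF _)) (g.isTest_leftInv hφ _)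
    simp only [g.leftInv_sq_mul hχ.1 hF] at this
    exact this.integrable
  set a : ι → ℝ := fun j => ∫ p, χ p ^ 2 * ‖g.leftInv (X j, 0) F p‖ ^ 2 ∂𝔪 with hadef
  set b : ι → ℝ := fun j => ∫ p, ‖g.leftInv (X j, 0) c p‖ ^ 2 * ‖F p‖ ^ 2 ∂𝔪 with hbdef
  set P : ι → ℂ := fun j => ∫ p, conj (g.leftInv (X j, 0) F p)
      * (2 * c p * g.leftInv (X j, 0) c p * F p + c p * c p * g.leftInv (X j, 0) F p)
        ∂𝔪 with hPdef
  have hPab : ∀ j, ‖P j - (a j : ℂ)‖ ≤ a j / 2 + 2 * b j := by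
    intro j
    simp only [hPdef, hadef, hbdef]
    have hao : Integrable (fun p => ((χ p ^ 2 * ‖g.leftInv (X j, 0) F p‖ ^ 2 : ℝ) : ℂ))
      𝔪 := (ha j).ofReal
    rw [← integral_complex_ofReal, ← integral_sub (hP j) hao, ← integral_div,
      ← integral_const_mul, ← integral_add ((ha j).div_const 2) ((hb j).const_mul 2)]
    refine norm_integral_le_of_norm_le (((ha j).div_const 2).add ((hb j).const_mul 2))
      (.of_forall fun p => ?_)
    exact norm_cutoff_sub_le (χ p) _ _ _
  have hS : ‖∑ j, P j - ((∑ j, a j : ℝ) : ℂ)‖ ≤ (∑ j, a j) / 2 + 2 * ∑ j, b j := by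
    rw [ofReal_sum, ← sum_sub_distrib]
    refine (norm_sum_le _ _).trans ((sum_le_sum fun j _ => hPab j).trans (le_of_eq ?_))
    rw [sum_add_distrib, Finset.sum_div, mul_sum]
  rw [e1] at hS
  have hgoal : ∑ j, ∫ p, 4 * ‖g.leftInv (X j, 0) c p‖ ^ 2 * ‖F p‖ ^ 2 ∂𝔪
      = 4 * ∑ j, b j := by
    rw [mul_sum]
    refine sum_congr rfl fun j _ => ?_
    rw [hbdef, ← integral_const_mul]
    simp_rw [_root_.mul_assoc]
  rw [hgoal]
  have hre := (Complex.abs_re_le_norm _).trans hS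
  have him := (Complex.abs_im_le_norm _).trans hS
  set m := ∫ p, χ p ^ 2 * ‖F p‖ ^ 2 ∂𝔪
  have hre' : ∑ j, a j ≤ (∑ j, a j) / 2 + 2 * ∑ j, b j := by
    rcases hz with rfl | rfl <;> simp at hre <;> linarith [le_abs_self (∑ j, a j)]
  have him' : m ≤ (∑ j, a j) / 2 + 2 * ∑ j, b j := by
    rcases hz with rfl | rfl <;> simp at him <;> linarith [le_abs_self m]
  linarith

-- The first-order analogue. In `2 I₀`, symmetrized by one integration by parts, the terms with a
-- derivative of `F` contribute nothing to the real part, and only the derivative of `χ²` remains.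
-- The equation forces `I₀ = i z ∫ χ²|F|²`, which is real for `z = ±i`.
set_option maxHeartbeats 1000000 in
lemma cutoff_estimate_centralDeriv (u : W)  (hF : ContDiff ℝ ∞ F) {z : ℂ} (hz : z = I ∨ z = -I)
    (h : ∀ φ, IsTest φ → ∫ p, conj (F p) * g.centralDeriv u φ p ∂𝔪
      = z * ∫ p, conj (F p) * φ p ∂𝔪)
    {χ : V × W → ℝ} (h1 : ContDiff ℝ ∞ χ) (h2 : HasCompactSupport χ) :
    ∫ p, χ p ^ 2 * ‖F p‖ ^ 2 ∂𝔪
      ≤ ∫ p, |χ p| * ‖g.leftInv (0, u) (fun p => (χ p : ℂ)) p‖ * ‖F p‖ ^ 2 ∂𝔪 := by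
  have hχ := IsTest.ofReal h1 h2
  set c : V × W → ℂ := fun p => (χ p : ℂ) with hc
  have hφ : IsTest fun p => c p * c p * F p := (hχ.mul_right hχ.1).mul_right hF
  have hFd := hF.differentiable (by simp)
  have hFc : ContDiff ℝ ∞ fun p => conj (F p) := conjCLE.contDiff.comp hF
  have e1 := h _ hφ
  set I₀ := ∫ p, conj (F p) * g.leftInv (0, u) (fun p => c p * c p * F p) p ∂𝔪 with hI₀
  have e2 : ∫ p, conj (F p) * g.centralDeriv u (fun p => c p * c p * F p) p ∂𝔪
      = -I * I₀ := by
    rw [hI₀, ← integral_const_mul]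
    congr 1; ext p
    simp only [centralDeriv]; ring
  have e3 : ∫ p, conj (F p) * (c p * c p * F p) ∂𝔪
      = ((∫ p, χ p ^ 2 * ‖F p‖ ^ 2 ∂𝔪 : ℝ) : ℂ) := by
    rw [← integral_complex_ofReal]
    congr 1; ext p
    have : conj (F p) * (c p * c p * F p) = c p * c p * (F p * conj (F p)) := by
      ring
    rw [this, mul_conj, normSq_eq_norm_sq, hc]
    push_cast; ring
  have e4 : I₀ = - ∫ p, conj (g.leftInv (0, u) F p) * (c p * c p * F p) ∂𝔪 := by
    rw [hI₀, g.integral_leftInv_mul U hφ hFc]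
    simp_rw [g.leftInv_conj hFd]
  have i1 : Integrable (fun p => conj (F p)
      * g.leftInv (0, u) (fun p => c p * c p * F p) p) 𝔪 :=
    (IsTest.mul_left hFc (g.isTest_leftInv hφ _)).integrable
  have i2 : Integrable (fun p => conj (g.leftInv (0, u) F p) * (c p * c p * F p))
      𝔪 := (IsTest.mul_left (conjCLE.contDiff.comp (g.contDiff_leftInv hF _))
        hφ).integrable
  have e5 : 2 * I₀ = ∫ p, (conj (F p) * g.leftInv (0, u) (fun p => c p * c p * F p) p
      - conj (g.leftInv (0, u) F p) * (c p * c p * F p)) ∂𝔪 := by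
    rw [integral_sub i1 i2]
    linear_combination e4
  have e6 : (2 * I₀).re = ∫ p, (2 * (c p * g.leftInv (0, u) c p)).re * ‖F p‖ ^ 2 ∂𝔪 := by
    rw [e5]
    have h3 := integral_re (i1.sub i2)
    simp only [Pi.sub_apply] at h3
    refine h3.symm.trans ?_
    congr 1; ext p
    rw [g.leftInv_sq_mul hχ.1 hF]
    have h4 : conj (F p) * (2 * c p * g.leftInv (0, u) c p * F p
        + c p * c p * g.leftInv (0, u) F p) - conj (g.leftInv (0, u) F p)
          * (c p * c p * F p) = 2 * (c p * g.leftInv (0, u) c p) * ((‖F p‖ ^ 2 : ℝ) : ℂ)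
        + ((χ p * χ p : ℝ) : ℂ) * (conj (F p) * g.leftInv (0, u) F p
          - conj (conj (F p) * g.leftInv (0, u) F p)) := by
      rw [← normSq_eq_norm_sq, ← mul_conj, hc, map_mul, conj_conj]
      push_cast; ring
    rw [h4]
    change (_ + _ : ℂ).re = _
    rw [Complex.add_re, Complex.re_mul_ofReal, Complex.re_ofReal_mul, Complex.sub_re,
      Complex.conj_re]
    ring
  rw [e2, e3] at e1
  set m := ∫ p, χ p ^ 2 * ‖F p‖ ^ 2 ∂𝔪
  have e7 : |(2 * I₀).re| = 2 * |m| := by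
    have : I₀ = I * z * m := by
      rw [_root_.mul_assoc, ← e1]; ring_nf; rw [I_sq]; ring
    rw [this]
    rcases hz with rfl | rfl <;>
      simp [abs_mul]
  have i3 : Integrable (fun p => 2 * (|χ p| * ‖g.leftInv (0, u) c p‖ * ‖F p‖ ^ 2)) 𝔪 := by
      have := g.integrable_comp_test_mul U hχ (k := fun x => ‖x‖) (by fun_prop) (by simp)
        ((g.contDiff_leftInv hχ.1 (0, u)).continuous.norm.mul (hF.continuous.norm.pow 2))
      refine Integrable.const_mul ?_ 2
      simpa [hc, _root_.mul_assoc] using this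
  have e8 : |(2 * I₀).re| ≤ ∫ p, 2 * (|χ p| * ‖g.leftInv (0, u) c p‖ * ‖F p‖ ^ 2) ∂𝔪 := by
    rw [e6, ← norm_eq_abs]
    refine norm_integral_le_of_norm_le i3 (.of_forall fun p => ?_)
    have h5 := Complex.abs_re_le_norm (2 * (c p * g.leftInv (0, u) c p))
    have h6 : ‖c p‖ = |χ p| := by rw [hc, norm_real, norm_eq_abs]
    rw [norm_mul, norm_mul, Complex.norm_ofNat, h6] at h5
    calc ‖(2 * (c p * g.leftInv (0, u) c p)).re * ‖F p‖ ^ 2‖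
        = |(2 * (c p * g.leftInv (0, u) c p)).re| * ‖F p‖ ^ 2 := by
          rw [norm_mul, norm_pow, norm_norm, norm_eq_abs]
      _ ≤ 2 * (|χ p| * ‖g.leftInv (0, u) c p‖) * ‖F p‖ ^ 2 :=
          mul_le_mul_of_nonneg_right h5 (sq_nonneg _)
      _ = _ := by ring
  rw [integral_const_mul, e7] at e8
  linarith [le_abs_self m]

/-- Automorphic dilations (by the factor `1 / R`). -/
def shrink (R : ℝ) (p : V × W) : V × W := (R⁻¹ • p.1, (R⁻¹ ^ 2) • p.2)

lemma contDiff_shrink (R : ℝ) {n : WithTop ℕ∞} : ContDiff ℝ n (shrink (V := V) (W := W) R) :=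
  (contDiff_const.smul contDiff_fst).prodMk (contDiff_const.smul contDiff_snd)

lemma shrink_field (R : ℝ) (Z p : V × W) :
    shrink R (g.field Z p) = g.field (shrink R Z) (shrink R p) := by
  ext
  · simp [shrink, field]
  · simp only [shrink, field, map_smul, LinearMap.smul_apply]
    module

lemma leftInv_comp_shrink (R : ℝ) (hχ : ContDiff ℝ ∞ χ) (Z p : V × W) :
    g.leftInv Z (fun p => χ (shrink R p)) p = g.leftInv (shrink R Z) χ (shrink R p) := by
  have hl : HasFDerivAt (shrink (V := V) (W := W) R)
      (((R⁻¹ • ContinuousLinearMap.fst ℝ V W).prod ((R⁻¹ ^ 2) • ContinuousLinearMap.snd ℝ V W))) p :=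
    ((R⁻¹ • ContinuousLinearMap.fst ℝ V W).prod
      ((R⁻¹ ^ 2) • ContinuousLinearMap.snd ℝ V W)).hasFDerivAt
  have hd := hχ.differentiable (by simp)
  have hd' : Differentiable ℝ fun p => χ (shrink R p) :=
    hd.comp ((contDiff_shrink R).differentiable (n := 1) (by simp))
  rw [g.leftInv_eq hd', g.leftInv_eq hd, ← g.shrink_field]
  have : HasFDerivAt (fun p => χ (shrink R p)) _ p := (hd (shrink R p)).hasFDerivAt.comp p hl
  rw [HasFDerivAt.fderiv this]
  rfl

lemma leftInv_smul (hχ : ContDiff ℝ ∞ χ) (c : ℝ) (Z p : V × W) :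
    g.leftInv (c • Z) χ p = c * g.leftInv Z χ p := by
  have hd := hχ.differentiable (by simp)
  rw [g.leftInv_eq hd, g.leftInv_eq hd]
  have : g.field (c • Z) p = c • g.field Z p := by
    ext
    · simp [field]
    · simp only [field, Prod.smul_fst, Prod.smul_snd, map_smul]
      module
  rw [this, map_smul, real_smul]

/-- The cut-offs are a bump function composed with dilations by `1/(n+1)`. A field in the first
layer scales by `1/(n+1)` and one in the second by its square, so the right side tends to `0` while
the left side tends to `∫ |F|²`. Requiring `Z j` to lie in one layer makes the dilation act on it as
a scalar. -/
lemma eq_zero_of_cutoff_estimate {ι : Type*} [Fintype ι] (Z : ι → V × W)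
    (hZ : ∀ j, (Z j).1 = 0 ∨ (Z j).2 = 0) (hF : Continuous F)
    (hF2 : MemLp F 2 𝔪)
    (h : ∀ χ : V × W → ℝ, ContDiff ℝ ∞ χ → HasCompactSupport χ → (∀ p, |χ p| ≤ 1) →
      ∫ p, χ p ^ 2 * ‖F p‖ ^ 2 ∂𝔪 ≤ ∑ j, ∫ p, (4 * ‖g.leftInv (Z j) (fun p => (χ p : ℂ)) p‖ ^ 2
          + ‖g.leftInv (Z j) (fun p => (χ p : ℂ)) p‖) * ‖F p‖ ^ 2 ∂𝔪) :
    F =ᵐ[𝔪] 0 := by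
  let bump : ContDiffBump (0 : V × W) := ⟨1, 2, by norm_num, by norm_num⟩
  have hb1 : ContDiff ℝ ∞ bump := bump.contDiff
  have hbT := IsTest.ofReal hb1 bump.hasCompactSupport
  have hF2' : Integrable (fun p => ‖F p‖ ^ 2) 𝔪 := by
    simpa using hF2.integrable_norm_pow (by simp)
  choose C hC0 hC using fun j => (g.isTest_leftInv hbT (Z j)).exists_norm_le
  let χ : ℕ → V × W → ℝ := fun n p => bump (shrink ((n : ℝ) + 1) p)
  have hR : ∀ n : ℕ, (0 : ℝ) < (n : ℝ) + 1 := fun n => by positivity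
  have hχ1 : ∀ n, ContDiff ℝ ∞ (χ n) := fun n => hb1.comp (contDiff_shrink _)
  have hχ2 : ∀ n, HasCompactSupport (χ n) := fun n => by
    let e : (V × W) ≃ₜ (V × W) :=
      { toFun := shrink ((n : ℝ) + 1)
        invFun := fun p => (((n : ℝ) + 1) • p.1, (((n : ℝ) + 1) ^ 2) • p.2)
        left_inv := fun p => by
          have := (hR n).ne'
          ext <;> simp [shrink, smul_smul, this]
        right_inv := fun p => by
          have := (hR n).ne'
          ext <;> simp [shrink, smul_smul, this]
        continuous_toFun := (contDiff_shrink (n := 0) _).continuous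
        continuous_invFun := (continuous_const.smul continuous_fst).prodMk
          (continuous_const.smul continuous_snd) }
    exact bump.hasCompactSupport.comp_homeomorph e
  have hχ3 : ∀ n p, |χ n p| ≤ 1 := fun n p => by
    rw [abs_of_nonneg bump.nonneg]; exact bump.le_one
  have hder : ∀ n j p, ‖g.leftInv (Z j) (fun p => (χ n p : ℂ)) p‖ ≤ C j / ((n : ℝ) + 1) := by
    intro n j p
    have h0 := g.leftInv_comp_shrink ((n : ℝ) + 1) hbT.1 (Z j) p
    have hinv : ((n : ℝ) + 1)⁻¹ ≤ 1 := inv_le_one_of_one_le₀ (by linarith [n.cast_nonneg (α := ℝ)])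
    have hinv0 : 0 ≤ ((n : ℝ) + 1)⁻¹ := (inv_pos.2 (hR n)).le
    have h1 : ∃ c : ℝ, 0 ≤ c ∧ c ≤ ((n : ℝ) + 1)⁻¹ ∧ shrink ((n : ℝ) + 1) (Z j) = c • Z j := by
      rcases hZ j with h1 | h1
      · exact ⟨((n : ℝ) + 1)⁻¹ ^ 2, by positivity, by nlinarith, by ext <;> simp [shrink, h1]⟩
      · exact ⟨((n : ℝ) + 1)⁻¹, hinv0, le_rfl, by ext <;> simp [shrink, h1]⟩
    obtain ⟨c, hc0, hc1, hc⟩ := h1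
    rw [hc, g.leftInv_smul hbT.1] at h0
    change ‖g.leftInv (Z j) (fun p => ((bump (shrink ((n : ℝ) + 1) p) : ℝ) : ℂ)) p‖ ≤ _
    rw [h0, norm_mul, norm_real, norm_of_nonneg hc0, div_eq_inv_mul]
    exact mul_le_mul hc1 (hC _ _) (norm_nonneg _) hinv0
  have hlim1 : Tendsto (fun n => ∫ p, χ n p ^ 2 * ‖F p‖ ^ 2 ∂𝔪) atTop (𝓝 (∫ p, ‖F p‖ ^ 2 ∂𝔪)) := by
    refine tendsto_integral_of_dominated_convergence (fun p => ‖F p‖ ^ 2)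
      (fun n => (((hχ1 n).continuous.pow 2).mul (hF.norm.pow 2)).aestronglyMeasurable) hF2'
      (fun n => .of_forall fun p => ?_) (.of_forall fun p => ?_)
    · rw [norm_mul, norm_pow, norm_pow, norm_norm, norm_eq_abs]
      exact mul_le_of_le_one_left (by positivity) (pow_le_one₀ (abs_nonneg _) (hχ3 n p))
    · have h1 : Tendsto (fun n : ℕ => shrink ((n : ℝ) + 1) p) atTop (𝓝 0) := by
        have h2 : Tendsto (fun n : ℕ => ((n : ℝ) + 1)⁻¹) atTop (𝓝 0) := by
          simpa using tendsto_one_div_add_atTop_nhds_zero_nat (𝕜 := ℝ)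
        have h3 := (h2.smul_const p.1).prodMk_nhds ((h2.pow 2).smul_const p.2)
        rw [zero_smul, zero_pow two_ne_zero, zero_smul] at h3
        exact h3
      have h4 : ∀ᶠ n in atTop, χ n p = 1 := by
        have h5 : Metric.closedBall (0 : V × W) 1 ∈ 𝓝 0 := Metric.closedBall_mem_nhds _ one_pos
        filter_upwards [h1 h5] with n hn
        exact bump.one_of_mem_closedBall hn
      refine tendsto_const_nhds.congr' ?_
      filter_upwards [h4] with n hn
      rw [hn]; simp
  have hbd : ∀ n : ℕ, ∫ p, χ n p ^ 2 * ‖F p‖ ^ 2 ∂𝔪 ≤ ∑ j,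
      (4 * (C j / ((n : ℝ) + 1)) ^ 2 + C j / ((n : ℝ) + 1)) * ∫ p, ‖F p‖ ^ 2 ∂𝔪 := by
    intro n
    refine (h _ (hχ1 n) (hχ2 n) (hχ3 n)).trans (sum_le_sum fun j _ => ?_)
    rw [← integral_const_mul]
    refine integral_mono_of_nonneg (.of_forall fun p => by positivity)
      (hF2'.const_mul _) (.of_forall fun p => ?_)
    have := hder n j p
    exact mul_le_mul_of_nonneg_right (by gcongr) (by positivity)
  have hlim2 : Tendsto (fun n : ℕ => ∑ j,
      (4 * (C j / ((n : ℝ) + 1)) ^ 2 + C j / ((n : ℝ) + 1)) * ∫ p, ‖F p‖ ^ 2 ∂𝔪)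
      atTop (𝓝 0) := by
    have h2 : ∀ j, Tendsto (fun n : ℕ => C j / ((n : ℝ) + 1)) atTop (𝓝 0) := fun j => by
      have := (tendsto_one_div_add_atTop_nhds_zero_nat (𝕜 := ℝ)).const_mul (C j)
      simpa [div_eq_mul_inv] using this
    have h3 := tendsto_finsetSum (Finset.univ : Finset ι) fun j _ =>
      ((((h2 j).pow 2).const_mul 4).add (h2 j)).mul_const (∫ p, ‖F p‖ ^ 2 ∂𝔪)
    simpa using h3
  have h0 : ∫ p, ‖F p‖ ^ 2 ∂𝔪 ≤ 0 := le_of_tendsto_of_tendsto' hlim1 hlim2 hbd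
  have h0' : ∫ p, ‖F p‖ ^ 2 ∂𝔪 = 0 := le_antisymm h0 (integral_nonneg fun p => by positivity)
  rw [integral_eq_zero_iff_of_nonneg (fun p => by positivity) hF2'] at h0'
  filter_upwards [h0'] with p hp
  simpa using hp

/-- The mollification argument: orthogonality to the range of `D - z` passes to convolutions. -/
lemma eq_zero_of_mollified (D : (V × W → ℂ) → V × W → ℂ) (hDT : ∀ φ, IsTest φ → IsTest (D φ))
    (hD : ∀ ψ φ, IsTest ψ → IsTest φ → D (g.conv U ψ φ) = g.conv U ψ (D φ)) (z : ℂ)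
    (hmol : ∀ F : V × W → ℂ, ContDiff ℝ ∞ F → MemLp F 2 𝔪 →
      (∀ φ, IsTest φ → ∫ p, conj (F p) * D φ p ∂𝔪
        = z * ∫ p, conj (F p) * φ p ∂𝔪) → F =ᵐ[𝔪] 0)
    (f : Lp ℂ 2 𝔪)
    (hf : ∀ φ, IsTest φ → inner ℂ f (testLp 𝔪 (D φ)) = z * inner ℂ f (testLp 𝔪 φ)) : f = 0 := by
  have hz : f =ᵐ[𝔪] 0 := by
    refine g.ae_eq_zero_of_conv U (g.locallyIntegrable_Lp U f) fun ψ hψ => ?_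
    have hae := g.coeFn_convL U hψ f
    refine hmol _ (g.contDiff_conv U hψ (g.locallyIntegrable_Lp U f))
      ((Lp.memLp (g.convL U hψ f)).ae_eq hae) fun φ hφ => ?_
    -- The adjoint of convolution with `ψ` is convolution with the conjugate of `ψ ∘ inv`. It
    -- preserves test functions and commutes with `D`, so orthogonality passes to the smooth
    -- function `ψ * f`.
    have key : ∀ φ, IsTest φ → ∫ p, conj (g.conv U ψ f p) * φ p ∂𝔪
        = inner ℂ f (testLp 𝔪 (g.conv U (fun p => conj (ψ (g.inv p))) φ)) := by
      intro φ hφ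
      rw [← g.convL_testLp U (g.isTest_conjInv hψ) hφ, ← g.inner_convL_left U hψ,
        inner_testLp_right _ hφ]
      refine integral_congr_ae ?_
      filter_upwards [hae] with p hp
      rw [hp]
    rw [key _ (hDT φ hφ), key _ hφ, ← hD _ _ (g.isTest_conjInv hψ) hφ,
      hf _ (g.isTest_conv U (g.isTest_conjInv hψ) hφ)]
  exact Lp.ext (hz.trans (Lp.coeFn_zero _ _ _).symm)

/-- Triviality of the deficiency spaces, that is, essential self-adjointness of `L` on test
functions. -/
lemma eq_zero_of_orthogonal_sublaplacian {ι : Type*} [Fintype ι] (X : ι → V) {z : ℂ}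
    (hz : z = I ∨ z = -I) (f : Lp ℂ 2 𝔪)
    (hf : ∀ φ, IsTest φ → inner ℂ f (testLp 𝔪 (g.sublaplacian X φ)) = z * inner ℂ f (testLp 𝔪 φ)) :
    f = 0 := by
  refine g.eq_zero_of_mollified U (g.sublaplacian X) (fun φ hφ => g.isTest_sublaplacian X hφ)
    (fun ψ φ hψ hφ => g.sublaplacian_conv U X hψ hφ) z (fun F hF hF2 h => ?_) f hf
  refine g.eq_zero_of_cutoff_estimate U (fun j => (X j, 0)) (fun j => Or.inr rfl) hF.continuous hF2
    fun χ h1 h2 h3 => (g.cutoff_estimate_sublaplacian U X hF hz h h1 h2).trans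
      (sum_le_sum fun j _ => ?_)
  have hχ := g.isTest_leftInv (IsTest.ofReal h1 h2) (X j, 0)
  refine integral_mono_of_nonneg (.of_forall fun p => by positivity) ?_
    (.of_forall fun p => mul_le_mul_of_nonneg_right
      (le_add_of_nonneg_right (norm_nonneg _)) (by positivity))
  exact g.integrable_comp_test_mul U hχ (k := fun x => 4 * ‖x‖ ^ 2 + ‖x‖) (by fun_prop) (by simp)
    (hF.continuous.norm.pow 2)

lemma eq_zero_of_orthogonal_centralDeriv (u : W) {z : ℂ} (hz : z = I ∨ z = -I) (f : Lp ℂ 2 𝔪)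
    (hf : ∀ φ, IsTest φ → inner ℂ f (testLp 𝔪 (g.centralDeriv u φ)) = z * inner ℂ f (testLp 𝔪 φ)) :
    f = 0 := by
  refine g.eq_zero_of_mollified U (g.centralDeriv u) (fun φ hφ => g.isTest_centralDeriv u hφ)
    (fun ψ φ hψ hφ => g.centralDeriv_conv U u hψ hφ) z (fun F hF hF2 h => ?_) f hf
  refine g.eq_zero_of_cutoff_estimate U (fun _ : Unit => (0, u)) (fun j => Or.inl rfl)
    hF.continuous hF2 fun χ h1 h2 h3 =>
      (g.cutoff_estimate_centralDeriv U u hF hz h h1 h2).trans ?_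
  rw [Finset.univ_unique, Finset.sum_singleton]
  have hχ := g.isTest_leftInv (IsTest.ofReal h1 h2) (0, u)
  refine integral_mono_of_nonneg (.of_forall fun p => by positivity) ?_
    (.of_forall fun p => mul_le_mul_of_nonneg_right ?_ (by positivity))
  · exact g.integrable_comp_test_mul U hχ (k := fun x => 4 * ‖x‖ ^ 2 + ‖x‖) (by fun_prop) (by simp)
      (hF.continuous.norm.pow 2)
  · have := mul_le_of_le_one_left (norm_nonneg (g.leftInv (0, u) (fun p => (χ p : ℂ)) p)) (h3 p)
    nlinarith [sq_nonneg ‖g.leftInv (0, u) (fun p => (χ p : ℂ)) p‖]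

end TwoStepAlgebra

/-! ### Isometries of `L²` given on test functions -/

section TestIsometry

variable {M M' : Type*} [NormedAddCommGroup M] [NormedSpace ℝ M] [FiniteDimensional ℝ M]
  [MeasurableSpace M] [BorelSpace M] {ν : Measure M} [IsFiniteMeasureOnCompacts ν]
  [NormedAddCommGroup M'] [NormedSpace ℝ M'] [FiniteDimensional ℝ M']
  [MeasurableSpace M'] [BorelSpace M'] {ν' : Measure M'} [IsFiniteMeasureOnCompacts ν']

/-- The space of test functions. -/
def testSubmodule (M : Type*) [NormedAddCommGroup M] [NormedSpace ℝ M] : Submodule ℂ (M → ℂ) where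
  carrier := {φ | IsTest φ}
  add_mem' h1 h2 := h1.add h2
  zero_mem' := ⟨contDiff_const, HasCompactSupport.zero⟩
  smul_mem' c _ h := h.const_mul c

lemma norm_testLp_of_memLp {φ : M → ℂ} (hφ : MemLp φ 2 ν) :
    ‖testLp ν φ‖ = (eLpNorm φ 2 ν).toReal := by
  rw [testLp, dif_pos hφ, Lp.norm_toLp]

lemma exists_linearIsometry_of_test (P : (M → ℂ) → M' → ℂ)
    (hadd : ∀ φ ψ, IsTest φ → IsTest ψ → P (fun p => φ p + ψ p) = fun q => P φ q + P ψ q)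
    (hsmul : ∀ (c : ℂ) φ, IsTest φ → P (fun p => c * φ p) = fun q => c * P φ q)
    (hm : ∀ φ, IsTest φ → AEStronglyMeasurable (P φ) ν')
    (hP : ∀ φ, IsTest φ → eLpNorm (P φ) 2 ν' = eLpNorm φ 2 ν) :
    ∃ Φ : Lp ℂ 2 ν →ₗᵢ[ℂ] Lp ℂ 2 ν', ∀ φ, IsTest φ → Φ (testLp ν φ) =ᵐ[ν'] P φ := by
  have hmem : ∀ φ, IsTest φ → MemLp (P φ) 2 ν' := fun φ hφ =>
    ⟨hm φ hφ, by rw [hP φ hφ]; exact (hφ.memLp 2).2⟩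
  let e : testSubmodule M →ₗ[ℂ] Lp ℂ 2 ν :=
    { toFun := fun φ => testLp ν φ
      map_add' := fun φ ψ => testLp_add φ.2 ψ.2
      map_smul' := fun c φ => testLp_smul φ.2 c }
  let f : testSubmodule M →ₗ[ℂ] Lp ℂ 2 ν' :=
    { toFun := fun φ => testLp ν' (P φ)
      map_add' := fun φ ψ => by
        refine Lp.ext ?_
        have h3 := hadd φ ψ φ.2 ψ.2
        have h4 : MemLp (P ((φ + ψ : testSubmodule M) : M → ℂ)) 2 ν' := hmem _ (φ + ψ).2
        filter_upwards [coeFn_testLp_of_memLp h4, coeFn_testLp_of_memLp (hmem φ φ.2),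
          coeFn_testLp_of_memLp (hmem ψ ψ.2), Lp.coeFn_add (testLp ν' (P φ)) (testLp ν' (P ψ))]
          with q h5 h6 h7 h8
        rw [h5, h8, Pi.add_apply, h6, h7]
        exact congrFun h3 q
      map_smul' := fun c φ => by
        refine Lp.ext ?_
        have h3 := hsmul c φ φ.2
        have h4 : MemLp (P ((c • φ : testSubmodule M) : M → ℂ)) 2 ν' := hmem _ (c • φ).2
        filter_upwards [coeFn_testLp_of_memLp h4, coeFn_testLp_of_memLp (hmem φ φ.2),
          Lp.coeFn_smul c (testLp ν' (P φ))] with q h5 h6 h8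
        rw [h5, RingHom.id_apply, h8, Pi.smul_apply, h6]
        exact congrFun h3 q }
  have hd : DenseRange e := by
    refine (dense_testLp (ν := ν)).mono ?_
    rintro _ ⟨φ, hφ, rfl⟩
    exact ⟨⟨φ, hφ⟩, rfl⟩
  have hn : ∀ φ, ‖f φ‖ = ‖e φ‖ := fun φ => by
    change ‖testLp ν' (P φ)‖ = ‖testLp ν φ‖
    rw [norm_testLp_of_memLp (hmem φ φ.2), norm_testLp_of_memLp (IsTest.memLp φ.2 2), hP φ φ.2]
  have he := LinearMap.extendOfNorm_eq (f := f) (e := e) hd ⟨1, fun φ => by rw [hn, one_mul]⟩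
  refine ⟨⟨(f.extendOfNorm e).toLinearMap, fun x => ?_⟩, fun φ hφ => ?_⟩
  · refine hd.induction_on x (isClosed_eq (by fun_prop) (by fun_prop)) fun φ => ?_
    change ‖f.extendOfNorm e (e φ)‖ = _
    rw [he, hn]
  · change f.extendOfNorm e (e ⟨φ, hφ⟩) =ᵐ[ν'] _
    rw [he]
    exact coeFn_testLp_of_memLp (hmem φ hφ)

/-- The hypothesis `hPQ` says that `Q` is the formal adjoint of `P`. Two isometries `Φ`, `Ψ` adjoint
to each other satisfy `Φ Ψ = 1`, so `Φ` is onto; no inversion formula is needed. -/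
lemma exists_linearIsometryEquiv_of_test (P : (M → ℂ) → M' → ℂ) (Q : (M' → ℂ) → M → ℂ)
    (hadd : ∀ φ ψ, IsTest φ → IsTest ψ → P (fun p => φ p + ψ p) = fun q => P φ q + P ψ q)
    (hsmul : ∀ (c : ℂ) φ, IsTest φ → P (fun p => c * φ p) = fun q => c * P φ q)
    (hm : ∀ φ, IsTest φ → AEStronglyMeasurable (P φ) ν')
    (hP : ∀ φ, IsTest φ → eLpNorm (P φ) 2 ν' = eLpNorm φ 2 ν)
    (hadd' : ∀ φ ψ, IsTest φ → IsTest ψ → Q (fun p => φ p + ψ p) = fun q => Q φ q + Q ψ q)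
    (hsmul' : ∀ (c : ℂ) φ, IsTest φ → Q (fun p => c * φ p) = fun q => c * Q φ q)
    (hm' : ∀ φ, IsTest φ → AEStronglyMeasurable (Q φ) ν)
    (hQ : ∀ φ, IsTest φ → eLpNorm (Q φ) 2 ν = eLpNorm φ 2 ν')
    (hPQ : ∀ φ χ, IsTest φ → IsTest χ → ∫ q, conj (χ q) * P φ q ∂ν' = ∫ p, conj (Q χ p) * φ p ∂ν) :
    ∃ Φ : Lp ℂ 2 ν ≃ₗᵢ[ℂ] Lp ℂ 2 ν', ∀ φ, IsTest φ → Φ (testLp ν φ) =ᵐ[ν'] P φ := by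
  obtain ⟨Φ, hΦ⟩ := exists_linearIsometry_of_test (ν := ν) (ν' := ν') P hadd hsmul hm hP
  obtain ⟨Ψ, hΨ⟩ := exists_linearIsometry_of_test (ν := ν') (ν' := ν) Q hadd' hsmul' hm' hQ
  have h1 : ∀ χ φ, IsTest χ → IsTest φ →
      inner ℂ (testLp ν' χ) (Φ (testLp ν φ)) = inner ℂ (Ψ (testLp ν' χ)) (testLp ν φ) := by
    intro χ φ hχ hφ
    rw [inner_testLp_left _ hχ, inner_testLp_right _ hφ]
    have e1 : ∫ q, conj (χ q) * Φ (testLp ν φ) q ∂ν'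
        = ∫ q, conj (χ q) * P φ q ∂ν' := by
      refine integral_congr_ae ?_
      filter_upwards [hΦ φ hφ] with q hq
      rw [hq]
    have e2 : ∫ p, conj (Ψ (testLp ν' χ) p) * φ p ∂ν
        = ∫ p, conj (Q χ p) * φ p ∂ν := by
      refine integral_congr_ae ?_
      filter_upwards [hΨ χ hχ] with q hq
      rw [hq]
    rw [e1, e2, hPQ φ χ hφ hχ]
  have h2 : ∀ χ, IsTest χ → ∀ f, inner ℂ (testLp ν' χ) (Φ f) = inner ℂ (Ψ (testLp ν' χ)) f := by
    intro χ hχ f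
    refine (dense_testLp (ν := ν)).induction (P := fun f =>
      inner ℂ (testLp ν' χ) (Φ f) = inner ℂ (Ψ (testLp ν' χ)) f) ?_ ?_ f
    · rintro _ ⟨φ, hφ, rfl⟩
      exact h1 χ φ hχ hφ
    · exact isClosed_eq (continuous_const.inner Φ.continuous) (continuous_const.inner continuous_id)
  have h3 : ∀ f, Φ (Ψ f) = f := fun f => by
    rw [← sub_eq_zero]
    refine eq_zero_of_inner_testLp fun χ hχ => ?_
    rw [inner_sub_right, h2 χ hχ, LinearIsometry.inner_map_map, sub_self]
  exact ⟨LinearIsometryEquiv.ofSurjective Φ fun f => ⟨Ψ f, h3 f⟩, fun φ hφ => hΦ φ hφ⟩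

end TestIsometry

/-! ### The partial Fourier transform in the central variables -/

section PartialFourier

lemma constr_eq_sum (u : W) : U.constr ℝ η u = ∑ k, U.equivFun u k * η k := by
  simp [Basis.constr_apply_fintype]

lemma continuous_constr : Continuous fun p : (κ → ℝ) × W => U.constr ℝ p.1 p.2 := by
  simp_rw [constr_eq_sum]
  refine continuous_finsetSum _ fun k _ => ?_
  exact ((continuous_apply k).comp (U.equivFunL.continuous.comp continuous_snd)).mul
    ((continuous_apply k).comp continuous_fst)

/-- The normalizing constant `(2π)^{-k/2}`. -/
def fourierConst (κ : Type*) [Fintype κ] : ℝ := (√((2 * π) ^ Fintype.card κ))⁻¹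

lemma fourierConst_pos : 0 < fourierConst κ := by
  have := pi_pos
  rw [fourierConst]; positivity

lemma fourierConst_sq : fourierConst κ ^ 2 * (2 * π) ^ Fintype.card κ = 1 := by
  have := pi_pos
  rw [fourierConst, inv_pow, sq_sqrt (by positivity)]
  exact inv_mul_cancel₀ (by positivity)

/-- The character `u ↦ exp(i η(u))`. -/
def character (u : W) : ℂ := Complex.exp ((U.constr ℝ η u : ℝ) * I)

lemma norm_character (u : W) : ‖character U η u‖ = 1 := Complex.norm_exp_ofReal_mul_I _

lemma continuous_character : Continuous fun p : (κ → ℝ) × W => character U p.1 p.2 :=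
  Complex.continuous_exp.comp ((continuous_ofReal.comp (continuous_constr U)).mul continuous_const)

lemma character_neg_right (u : W) : character U η (-u) = conj (character U η u) := by
  rw [character, character, ← exp_conj]
  simp

lemma character_add (u v : W) : character U η (u + v) = character U η u * character U η v := by
  rw [character, character, character, ← Complex.exp_add, map_add, Complex.ofReal_add, add_mul]

lemma character_zero : character U η 0 = 1 := by simp [character]

/-- Coordinates identify the Lebesgue measure of `W` with that of `ℝ^κ`. -/
lemma measurePreserving_equivFun : MeasurePreserving U.equivFunL U.addHaar volume := by
  refine ⟨U.equivFunL.continuous.measurable, ?_⟩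
  have h1 : U.map (U.equivFunL : W ≃ₗ[ℝ] (κ → ℝ)) = Pi.basisFun ℝ κ := by
    classical
    ext i x
    simp [Basis.equivFunL, Pi.single_apply, eq_comm]
  have h2 : (Pi.basisFun ℝ κ).addHaar = volume := by
    rw [Basis.addHaar_def, Basis.parallelepiped_basisFun, addHaarMeasure_eq_volume_pi]
  rw [Basis.map_addHaar, h1, h2]

/-- Euclidean coordinates. -/
def euclideanCoord : EuclideanSpace ℝ κ ≃L[ℝ] W :=
  (PiLp.continuousLinearEquiv 2 ℝ fun _ : κ => ℝ).trans U.equivFunL.symm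

lemma measurePreserving_euclideanCoord : MeasurePreserving (euclideanCoord U) volume U.addHaar := by
  have h1 := PiLp.volume_preserving_ofLp κ
  have h2 := (measurePreserving_equivFun U).symm U.equivFunL.toHomeomorph.toMeasurableEquiv
  exact h2.comp h1

lemma measurableEmbedding_euclideanCoord : MeasurableEmbedding (euclideanCoord U) :=
  (euclideanCoord U).toHomeomorph.measurableEmbedding

lemma constr_euclideanCoord (v : EuclideanSpace ℝ κ) :
    U.constr ℝ η (euclideanCoord U v) = inner ℝ v (WithLp.toLp 2 η) := by
  rw [constr_eq_sum, PiLp.inner_apply]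
  refine sum_congr rfl fun k _ => ?_
  have : U.equivFun (euclideanCoord U v) = v.ofLp := by
    exact U.equivFunL.apply_symm_apply v.ofLp
  rw [this]
  simp [mul_comm]

lemma lintegral_comp_smul_volume {E : Type*} [NormedAddCommGroup E] [InnerProductSpace ℝ E]
    [FiniteDimensional ℝ E] [MeasurableSpace E] [BorelSpace E] {F : E → ENNReal} {R : ℝ}
    (hR : 0 < R) : ∫⁻ ζ, F (R⁻¹ • ζ) = ofReal (R ^ Module.finrank ℝ E) * ∫⁻ ζ, F ζ := by
  have h0 : R⁻¹ ≠ 0 := (inv_pos.2 hR).ne'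
  have h1 := Measure.map_addHaar_smul (volume : Measure E) h0
  have h2 := (MeasurableEquiv.smul₀ R⁻¹ h0 : E ≃ᵐ E).measurableEmbedding.lintegral_map
    (μ := volume) F
  rw [MeasurableEquiv.coe_smul₀, h1, lintegral_smul_measure] at h2
  rw [← h2, smul_eq_mul]
  congr 2
  rw [inv_pow, inv_inv, abs_of_pos (by positivity)]

/-- Plancherel for the kernel `e^{-2πi⟨v,ζ⟩}` in Euclidean coordinates, followed by the substitution
`ζ = η/(2π)`, which produces the power of `2π`. -/
lemma lintegral_fourier_sq {f : W → ℂ} (hf : IsTest f) :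
    ∫⁻ η : κ → ℝ, ‖∫ u, conj (character U η u) * f u ∂U.addHaar‖ₑ ^ 2
      = ofReal ((2 * π) ^ Fintype.card κ) * ∫⁻ u, ‖f u‖ₑ ^ 2 ∂U.addHaar := by
  have hpi := pi_pos
  have hF1 : HasCompactSupport (f ∘ euclideanCoord U) :=
    hf.2.comp_homeomorph (euclideanCoord U).toHomeomorph
  have hF2 : ContDiff ℝ ∞ (f ∘ euclideanCoord U) := hf.1.comp (euclideanCoord U).contDiff
  set F : 𝓢(EuclideanSpace ℝ κ, ℂ) := hF1.toSchwartzMap hF2 with hFdef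
  have hFapp : ∀ v, F v = f (euclideanCoord U v) := fun v => rfl
  have h1 : ∀ η : κ → ℝ, ∫ u, conj (character U η u) * f u ∂U.addHaar
      = FourierTransform.fourier F ((2 * π)⁻¹ • (WithLp.toLp 2 η : EuclideanSpace ℝ κ)) := by
    intro η
    rw [← (measurePreserving_euclideanCoord U).integral_comp (measurableEmbedding_euclideanCoord U),
      SchwartzMap.fourier_coe, Real.fourier_eq']
    congr 1; ext v
    rw [hFapp, smul_eq_mul, character, ← exp_conj, constr_euclideanCoord, inner_smul_right]
    congr 2
    simp only [map_mul, conj_ofReal, conj_I]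
    push_cast
    field_simp
  have h2 := SchwartzMap.integral_norm_sq_fourier F
  have h3 : ∀ G : 𝓢(EuclideanSpace ℝ κ, ℂ), ∫⁻ ζ, ‖G ζ‖ₑ ^ 2 = ofReal (∫ ζ, ‖G ζ‖ ^ 2) := by
    intro G
    have hG : MemLp G 2 volume := G.memLp 2 volume
    rw [ofReal_integral_eq_lintegral_ofReal (hG.integrable_norm_pow (by simp))
      (.of_forall fun _ => by positivity)]
    refine lintegral_congr fun ζ => ?_
    rw [ofReal_pow (norm_nonneg _), ofReal_norm]
  simp_rw [h1]
  have h4 := (PiLp.volume_preserving_ofLp κ).lintegral_comp_emb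
    (MeasurableEquiv.toLp 2 (κ → ℝ)).symm.measurableEmbedding
    (fun η => ‖FourierTransform.fourier F
      ((2 * π)⁻¹ • (WithLp.toLp 2 η : EuclideanSpace ℝ κ))‖ₑ ^ 2)
  rw [← h4]
  have h5 := lintegral_comp_smul_volume (E := EuclideanSpace ℝ κ)
    (F := fun ζ => ‖FourierTransform.fourier F ζ‖ₑ ^ 2) (R := 2 * π) (by positivity)
  rw [finrank_euclideanSpace, h3, h2, ← h3] at h5
  refine h5.trans ?_
  congr 1
  exact (measurePreserving_euclideanCoord U).lintegral_comp_emb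
    (measurableEmbedding_euclideanCoord U) fun u => ‖f u‖ₑ ^ 2

/-- The partial Fourier transform in the central variables. -/
def partialFourier (φ : V × W → ℂ) (q : V × (κ → ℝ)) : ℂ :=
  fourierConst κ * ∫ u, conj (character U q.2 u) * φ (q.1, u) ∂U.addHaar

/-- The inverse partial Fourier transform in the central variables. -/
def partialFourierInv (χ : V × (κ → ℝ) → ℂ) (p : V × W) : ℂ :=
  fourierConst κ * ∫ η, character U η p.2 * χ (p.1, η)

lemma isTest_slice {N : Type*} [NormedAddCommGroup N] [NormedSpace ℝ N] {φ : V × N → ℂ}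
    (hφ : IsTest φ) (x : V) : IsTest fun u => φ (x, u) := by
  refine ⟨hφ.1.comp (contDiff_const.prodMk contDiff_id), ?_⟩
  refine HasCompactSupport.intro (hφ.2.isCompact.image continuous_snd) fun u hu => ?_
  by_contra h
  exact hu ⟨(x, u), subset_tsupport _ h, rfl⟩

lemma integrable_character_mul {f : W → ℂ} (hf : Integrable f U.addHaar) (η : κ → ℝ) :
    Integrable (fun u => conj (character U η u) * f u) U.addHaar := by
  refine hf.bdd_mul (c := 1) ?_ (.of_forall fun u => ?_)
  · exact (continuous_conj.comp ((continuous_character U).comp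
      (continuous_const.prodMk continuous_id))).aestronglyMeasurable
  · rw [RCLike.norm_conj, norm_character]

lemma partialFourier_add (hφ : IsTest φ) (hψ : IsTest ψ) :
    partialFourier U (fun p => φ p + ψ p) = fun q => partialFourier U φ q + partialFourier U ψ q := by
  ext q
  simp only [partialFourier, mul_add]
  rw [integral_add (integrable_character_mul U (isTest_slice hφ _).integrable _)
    (integrable_character_mul U (isTest_slice hψ _).integrable _), mul_add]

lemma partialFourier_const_mul (c : ℂ) (φ : V × W → ℂ) :
    partialFourier U (fun p => c * φ p) = fun q => c * partialFourier U φ q := by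
  ext q
  simp only [partialFourier]
  rw [mul_left_comm c, ← integral_const_mul (μ := U.addHaar) c]
  congr 1
  refine integral_congr_ae (.of_forall fun u => ?_)
  ring

lemma stronglyMeasurable_partialFourier (hφ : Continuous φ) :
    StronglyMeasurable (partialFourier U φ) := by
  have h1 : Continuous fun r : (V × (κ → ℝ)) × W =>
      conj (character U r.1.2 r.2) * φ (r.1.1, r.2) :=
    (continuous_conj.comp ((continuous_character U).comp
      ((continuous_snd.comp continuous_fst).prodMk continuous_snd))).mul
      (hφ.comp ((continuous_fst.comp continuous_fst).prodMk continuous_snd))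
  exact (h1.stronglyMeasurable.integral_prod_right (ν := U.addHaar)).const_mul _

lemma lintegral_partialFourier_sq (hφ : IsTest φ) :
    ∫⁻ q, ‖partialFourier U φ q‖ₑ ^ 2 ∂((volume : Measure V).prod volume)
      = ∫⁻ p, ‖φ p‖ₑ ^ 2 ∂((volume : Measure V).prod U.addHaar) := by
  rw [lintegral_prod _ ((stronglyMeasurable_partialFourier U hφ.continuous).enorm.pow_const 2).aemeasurable,
    lintegral_prod _ (hφ.continuous.enorm.measurable.pow_const 2).aemeasurable]
  refine lintegral_congr fun x => ?_
  have h1 := lintegral_fourier_sq U (isTest_slice hφ x)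
  have h2 : ∀ η : κ → ℝ, ‖partialFourier U φ (x, η)‖ₑ ^ 2 = ofReal (fourierConst κ ^ 2)
      * ‖∫ u, conj (character U η u) * φ (x, u) ∂U.addHaar‖ₑ ^ 2 := fun η => by
    rw [partialFourier, enorm_mul, mul_pow, ofReal_pow fourierConst_pos.le]
    congr 2
    rw [← ofReal_norm, norm_real, norm_of_nonneg fourierConst_pos.le]
  simp_rw [h2]
  rw [lintegral_const_mul' _ _ ofReal_ne_top, h1, ← mul_assoc,
    ← ofReal_mul (by positivity), fourierConst_sq, ofReal_one, one_mul]

lemma eLpNorm_eq_of_lintegral_sq {M M' : Type*} [MeasurableSpace M] [MeasurableSpace M']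
    {ν : Measure M} {ν' : Measure M'} {f : M → ℂ} {h : M' → ℂ}
    (hfh : ∫⁻ p, ‖f p‖ₑ ^ 2 ∂ν = ∫⁻ q, ‖h q‖ₑ ^ 2 ∂ν') : eLpNorm f 2 ν = eLpNorm h 2 ν' := by
  rw [eLpNorm_eq_lintegral_rpow_enorm_toReal (by simp) (by simp),
    eLpNorm_eq_lintegral_rpow_enorm_toReal (by simp) (by simp)]
  simp only [toReal_ofNat, ENNReal.rpow_ofNat]
  rw [hfh]

/-- The inverse transform is a conjugated forward transform with `W` replaced by its coordinate
space, so its isometry and linearity need no separate proof. -/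
lemma partialFourierInv_eq (χ : V × (κ → ℝ) → ℂ) (p : V × W) :
    partialFourierInv U χ p = conj (partialFourier (Pi.basisFun ℝ κ)
      (fun q => conj (χ q)) (p.1, U.equivFunL p.2)) := by
  have h2 : (Pi.basisFun ℝ κ).addHaar = volume := by
    rw [Basis.addHaar_def, Basis.parallelepiped_basisFun, addHaarMeasure_eq_volume_pi]
  rw [partialFourierInv, partialFourier, map_mul, conj_ofReal, ← integral_conj, h2]
  congr 2; ext η
  rw [map_mul, conj_conj, conj_conj]
  congr 1
  rw [character, character, constr_eq_sum, constr_eq_sum]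
  congr 3
  refine sum_congr rfl fun k _ => ?_
  rw [mul_comm]; rfl

lemma lintegral_partialFourierInv_sq {χ : V × (κ → ℝ) → ℂ} (hχ : IsTest χ) :
    ∫⁻ p, ‖partialFourierInv U χ p‖ₑ ^ 2 ∂((volume : Measure V).prod U.addHaar)
      = ∫⁻ q, ‖χ q‖ₑ ^ 2 ∂((volume : Measure V).prod volume) := by
  have h2 : (Pi.basisFun ℝ κ).addHaar = volume := by
    rw [Basis.addHaar_def, Basis.parallelepiped_basisFun, addHaarMeasure_eq_volume_pi]
  have h1 := lintegral_partialFourier_sq (Pi.basisFun ℝ κ) hχ.star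
  have h3 := ((MeasurePreserving.id (volume : Measure V)).prod
    (measurePreserving_equivFun U)).lintegral_comp
    ((stronglyMeasurable_partialFourier (Pi.basisFun ℝ κ) hχ.star.continuous).enorm.pow_const 2)
  simp_rw [partialFourierInv_eq, RCLike.enorm_conj]
  refine Eq.trans ?_ (h3.trans (h1.trans ?_))
  · rfl
  · rw [h2]
    simp_rw [RCLike.enorm_conj]

lemma stronglyMeasurable_partialFourierInv {χ : V × (κ → ℝ) → ℂ} (hχ : Continuous χ) :
    StronglyMeasurable (partialFourierInv U χ) := by
  have h1 : Continuous fun r : (V × W) × (κ → ℝ) => character U r.2 r.1.2 * χ (r.1.1, r.2) :=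
    ((continuous_character U).comp (continuous_snd.prodMk (continuous_snd.comp continuous_fst))).mul
      (hχ.comp ((continuous_fst.comp continuous_fst).prodMk continuous_snd))
  exact (h1.stronglyMeasurable.integral_prod_right (ν := volume)).const_mul _

lemma memLp_partialFourier (hφ : IsTest φ) :
    MemLp (partialFourier U φ) 2 ((volume : Measure V).prod volume) :=
  ⟨(stronglyMeasurable_partialFourier U hφ.continuous).aestronglyMeasurable, by
    rw [eLpNorm_eq_of_lintegral_sq (lintegral_partialFourier_sq U hφ)]
    exact (hφ.memLp 2).2⟩

lemma memLp_partialFourierInv {χ : V × (κ → ℝ) → ℂ} (hχ : IsTest χ) :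
    MemLp (partialFourierInv U χ) 2 ((volume : Measure V).prod U.addHaar) :=
  ⟨(stronglyMeasurable_partialFourierInv U hχ.continuous).aestronglyMeasurable, by
    rw [eLpNorm_eq_of_lintegral_sq (lintegral_partialFourierInv_sq U hχ)]
    exact (hχ.memLp 2).2⟩

lemma integral_partialFourier_swap {χ : V × (κ → ℝ) → ℂ} (hφ : IsTest φ) (hχ : IsTest χ) :
    ∫ q, conj (χ q) * partialFourier U φ q ∂((volume : Measure V).prod volume)
      = ∫ p, conj (partialFourierInv U χ p) * φ p
        ∂((volume : Measure V).prod U.addHaar) := by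
  have i1 : Integrable (fun q => conj (χ q) * partialFourier U φ q)
      ((volume : Measure V).prod volume) :=
    (hχ.star.memLp 2).integrable_mul (memLp_partialFourier U hφ)
  have i2 : Integrable (fun p => conj (partialFourierInv U χ p) * φ p)
      ((volume : Measure V).prod U.addHaar) :=
    (memLp_partialFourierInv U hχ).star.integrable_mul (hφ.memLp 2)
  rw [integral_prod _ i1, integral_prod _ i2]
  congr 1; ext x
  have hc : Integrable (uncurry fun (η : κ → ℝ) (u : W) =>
      (fourierConst κ : ℂ) * conj (χ (x, η)) * conj (character U η u) * φ (x, u))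
      ((volume : Measure (κ → ℝ)).prod U.addHaar) := by
    have h1 : Integrable (fun p : (κ → ℝ) × W => conj (χ (x, p.1)) * φ (x, p.2))
        ((volume : Measure (κ → ℝ)).prod U.addHaar) :=
      (isTest_slice hχ x).star.integrable.mul_prod (isTest_slice hφ x).integrable
    have h2 := h1.bdd_mul (c := |fourierConst κ|)
      (f := fun p : (κ → ℝ) × W => (fourierConst κ : ℂ) * conj (character U p.1 p.2))
      (continuous_const.mul (continuous_conj.comp (continuous_character U))).aestronglyMeasurable
      (.of_forall fun p => by
        rw [norm_mul, RCLike.norm_conj, norm_character, mul_one, norm_real,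
          norm_eq_abs])
    refine h2.congr (.of_forall fun p => ?_)
    simp only [uncurry]
    ring
  have h3 := integral_integral_swap hc
  refine Eq.trans ?_ (h3.trans ?_)
  · congr 1; ext η
    rw [partialFourier, ← integral_const_mul, ← integral_const_mul]
    congr 1; ext u; ring
  · congr 1; ext u
    rw [partialFourierInv, map_mul, ← integral_conj, conj_ofReal, mul_comm, ← mul_assoc,
      ← integral_const_mul]
    congr 1; ext η
    rw [map_mul]; ring

lemma exists_partialFourierEquiv :
    ∃ Φ : Lp ℂ 2 ((volume : Measure V).prod U.addHaar) ≃ₗᵢ[ℂ]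
        Lp ℂ 2 ((volume : Measure V).prod (volume : Measure (κ → ℝ))),
      ∀ φ, IsTest φ → Φ (testLp _ φ) =ᵐ[(volume : Measure V).prod volume] partialFourier U φ := by
  have hinv : ∀ χ : V × (κ → ℝ) → ℂ, partialFourierInv U χ = fun p => starRingEnd ℂ
      (partialFourier (Pi.basisFun ℝ κ) (fun q => conj (χ q)) (p.1, U.equivFunL p.2)) :=
    fun χ => funext fun p => partialFourierInv_eq U χ p
  refine exists_linearIsometryEquiv_of_test (partialFourier U) (partialFourierInv U)
    (fun φ ψ hφ hψ => partialFourier_add U hφ hψ) (fun c φ _ => partialFourier_const_mul U c φ)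
    (fun φ hφ => (memLp_partialFourier U hφ).1)
    (fun φ hφ => eLpNorm_eq_of_lintegral_sq (lintegral_partialFourier_sq U hφ))
    (fun φ ψ hφ hψ => ?_) (fun c φ hφ => ?_)
    (fun φ hφ => (memLp_partialFourierInv U hφ).1)
    (fun φ hφ => eLpNorm_eq_of_lintegral_sq (lintegral_partialFourierInv_sq U hφ))
    (fun φ χ hφ hχ => integral_partialFourier_swap U hφ hχ)
  · simp only [hinv, map_add]
    rw [partialFourier_add _ hφ.star hψ.star]
    simp
  · simp only [hinv, map_mul]
    rw [partialFourier_const_mul]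
    simp

/-- The unitary partial Fourier transform. -/
def partialFourierL : Lp ℂ 2 ((volume : Measure V).prod U.addHaar) ≃ₗᵢ[ℂ]
    Lp ℂ 2 ((volume : Measure V).prod (volume : Measure (κ → ℝ))) :=
  (exists_partialFourierEquiv U).choose

lemma coeFn_partialFourierL (hφ : IsTest φ) :
    partialFourierL U (testLp _ φ) =ᵐ[(volume : Measure V).prod volume] partialFourier U φ :=
  (exists_partialFourierEquiv U).choose_spec φ hφ

end PartialFourier

/-! ### Resolvents of closed symmetric graphs with trivial deficiency spaces -/

section Graph

variable {F : Type*} [NormedAddCommGroup F] [InnerProductSpace ℂ F] [CompleteSpace F]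

lemma norm_sub_smul_sq_of_real {a b : F} (h : inner ℂ a b = inner ℂ b a) {z : ℂ}
    (hz : z = I ∨ z = -I) : ‖b - z • a‖ ^ 2 = ‖b‖ ^ 2 + ‖a‖ ^ 2 := by
  have h1 : (inner ℂ b a).im = 0 := by
    have := congrArg Complex.im h
    rw [← inner_conj_symm, conj_im] at this
    linarith
  have hz1 : ‖z‖ = 1 := by rcases hz with rfl | rfl <;> simp
  rw [norm_sub_sq (𝕜 := ℂ), inner_smul_right, norm_smul, hz1, one_mul]
  have : RCLike.re (z * inner ℂ b a) = 0 := by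
    rcases hz with rfl | rfl <;> simp [h1]
  rw [this]; ring

/-- Von Neumann's criterion. Symmetry gives `‖b ∓ ia‖² = ‖a‖² + ‖b‖²` on the graph, so the ranges of
`T ∓ i` are closed. Trivial deficiency makes them everything, and `R = (T - i)⁻¹`. The identities
recorded for `R` are those needed to diagonalize commuting resolvents. -/
lemma exists_resolvent_of_graph (G : Submodule ℂ (F × F)) (hG : IsClosed (G : Set (F × F)))
    (hsymm : ∀ p ∈ G, ∀ q ∈ G, inner ℂ p.1 q.2 = inner ℂ p.2 q.1)
    (hdense : ∀ y, (∀ p ∈ G, inner ℂ p.1 y = 0) → y = 0)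
    (hesa : ∀ z, (z = I ∨ z = -I) → ∀ f, (∀ p ∈ G, inner ℂ f p.2 = z * inner ℂ f p.1) → f = 0) :
    ∃ R : F →L[ℂ] F, (∀ f g, (f, g) ∈ G ↔ R (g - I • f) = f) ∧
      R - star R = (2 * I) • (star R * R) ∧ R * star R = star R * R ∧
      ∀ f, R f = 0 → f = 0 := by
  have hnorm : ∀ z, (z = I ∨ z = -I) → ∀ p ∈ G,
      ‖p.2 - z • p.1‖ ^ 2 = ‖p.2‖ ^ 2 + ‖p.1‖ ^ 2 := fun z hz p hp =>
    norm_sub_smul_sq_of_real (hsymm p hp p hp) hz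
  have hbd : ∀ z, (z = I ∨ z = -I) → ∀ p ∈ G, ‖p‖ ≤ ‖p.2 - z • p.1‖ := by
    intro z hz p hp
    have h := hnorm z hz p hp
    rw [Prod.norm_def]
    refine max_le ?_ ?_ <;>
      exact abs_le_of_sq_le_sq' (by nlinarith [sq_nonneg ‖p.1‖, sq_nonneg ‖p.2‖]) (norm_nonneg _) |>.2
  have hsurj : ∀ z, (z = I ∨ z = -I) → ∀ y, ∃ p ∈ G, p.2 - z • p.1 = y := by
    intro z hz y
    let D : G →L[ℂ] F := (ContinuousLinearMap.snd ℂ F F - z • ContinuousLinearMap.fst ℂ F F) ∘L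
      G.subtypeL
    have hD : ∀ p : G, D p = p.1.2 - z • p.1.1 := fun p => rfl
    haveI : CompleteSpace G := hG.completeSpace_coe
    have hanti : AntilipschitzWith 1 D := D.antilipschitz_of_bound fun p => by
      rw [NNReal.coe_one, one_mul]; exact hbd z hz p p.2
    have hcl : IsClosed ((LinearMap.range D.toLinearMap : Submodule ℂ F) : Set F) :=
      hanti.isClosed_range D.uniformContinuous
    haveI : CompleteSpace (LinearMap.range D.toLinearMap) := hcl.completeSpace_coe
    have htop : LinearMap.range D.toLinearMap = ⊤ := by
      rw [← Submodule.orthogonal_eq_bot_iff, Submodule.eq_bot_iff]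
      intro f hf
      refine hesa z hz f fun p hp => ?_
      have h1 := (Submodule.mem_orthogonal' _ f).1 hf (D ⟨p, hp⟩) ⟨⟨p, hp⟩, rfl⟩
      rw [hD, inner_sub_right, inner_smul_right] at h1
      exact sub_eq_zero.1 h1
    have : y ∈ LinearMap.range D.toLinearMap := htop ▸ Submodule.mem_top
    obtain ⟨p, hp⟩ := this
    exact ⟨p, p.2, hp⟩
  let D : G →ₗ[ℂ] F := (LinearMap.snd ℂ F F - I • LinearMap.fst ℂ F F) ∘ₗ G.subtype
  have hD : ∀ p : G, D p = p.1.2 - I • p.1.1 := fun p => rfl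
  have hbij : Function.Bijective D := by
    constructor
    · rw [← LinearMap.ker_eq_bot, LinearMap.ker_eq_bot']
      intro p hp
      have := hbd _ (Or.inl rfl) p p.2
      rw [← hD, hp, norm_zero] at this
      exact Subtype.ext (norm_le_zero_iff.1 this)
    · intro y
      obtain ⟨p, hp, h⟩ := hsurj _ (Or.inl rfl) y
      exact ⟨⟨p, hp⟩, h⟩
  let e := LinearEquiv.ofBijective D hbij
  let R : F →L[ℂ] F := mkContinuous
    (LinearMap.fst ℂ F F ∘ₗ G.subtype ∘ₗ e.symm.toLinearMap) 1 fun y => by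
      have h1 := hbd _ (Or.inl rfl) (e.symm y) (e.symm y).2
      rw [← hD] at h1
      have h2 : D (e.symm y) = y := e.apply_symm_apply y
      rw [h2] at h1
      rw [one_mul]
      exact (norm_fst_le _).trans h1
  have hR : ∀ p ∈ G, R (p.2 - I • p.1) = p.1 := by
    intro p hp
    have : e.symm (p.2 - I • p.1) = ⟨p, hp⟩ := e.symm_apply_apply ⟨p, hp⟩
    change (e.symm (p.2 - I • p.1)).1.1 = p.1
    rw [this]
  -- The adjoint of `R` is `(T + i)⁻¹`.
  have hRs : ∀ p ∈ G, star R (p.2 + I • p.1) = p.1 := by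
    intro p hp
    refine ext_inner_left ℂ fun y => ?_
    obtain ⟨q, hq, rfl⟩ := hsurj _ (Or.inl rfl) y
    rw [star_eq_adjoint, adjoint_inner_right, hR q hq,
      inner_add_right, inner_smul_right, hsymm q hq p hp, inner_sub_left, inner_smul_left,
      conj_I]
    ring
  -- The same difference, computed on vectors `(T + i)a` and on vectors `(T - i)a`, gives `R R*` and
  -- `R* R` respectively; comparison gives normality.
  have hRRs : R - star R = (2 * I) • (R * star R) := by
    ext y
    obtain ⟨p, hp, rfl⟩ := hsurj _ (Or.inr rfl) y
    have e1 : p.2 - (-I) • p.1 = p.2 + I • p.1 := by module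
    have e2 : p.2 + I • p.1 = (p.2 - I • p.1) + (2 * I) • p.1 := by module
    rw [e1]
    change R _ - star R _ = (2 * I) • R (star R _)
    rw [hRs p hp, e2, map_add, hR p hp, map_smul, add_sub_cancel_left]
  have hRsR : R - star R = (2 * I) • (star R * R) := by
    ext y
    obtain ⟨p, hp, rfl⟩ := hsurj _ (Or.inl rfl) y
    have e2 : p.2 - I • p.1 = (p.2 + I • p.1) - (2 * I) • p.1 := by module
    change R _ - star R _ = (2 * I) • star R (R _)
    rw [hR p hp, e2, map_sub, hRs p hp, map_smul, sub_sub_cancel]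
  refine ⟨R, fun f g => ⟨fun h => hR (f, g) h, fun h => ?_⟩, hRsR, ?_, fun y hy => ?_⟩
  · obtain ⟨p, hp, h1⟩ := hsurj _ (Or.inl rfl) (g - I • f)
    have h2 := hR p hp
    rw [h1, h] at h2
    have h3 : p.2 = g := by
      rw [← h2] at h1
      exact sub_left_injective h1
    have : p = (f, g) := Prod.ext h2.symm h3
    rwa [← this]
  · have := hRRs.symm.trans hRsR
    exact smul_right_injective _ (by simp : (2 * I) ≠ 0) this
  · obtain ⟨p, hp, rfl⟩ := hsurj _ (Or.inl rfl) y
    rw [hR p hp] at hy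
    have h1 : p.2 = 0 := hdense _ fun q hq => by
      rw [hsymm q hq p hp, hy, inner_zero_right]
    rw [h1, hy]; simp

end Graph

/-! ### Multiplication operators -/

section MulOp

variable {M : Type*} [MeasurableSpace M] (ν : Measure M) {h k : M → ℂ}

lemma BddMeas.memLp_mul (hh : BddMeas h) {f : M → ℂ} (hf : MemLp f 2 ν) :
    MemLp (fun p => h p * f p) 2 ν := by
  obtain ⟨C, hC⟩ := hh.bdd
  exact hf.of_le_mul (c := C) (hh.measurable.aestronglyMeasurable.mul hf.1) (.of_forall fun p => by
      rw [norm_mul]; exact mul_le_mul_of_nonneg_right (hC p) (norm_nonneg _))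

/-- Multiplication by a bounded measurable function on `L²`. -/
def mulOp (hh : BddMeas h) : Lp ℂ 2 ν →L[ℂ] Lp ℂ 2 ν := mkContinuous
    { toFun := fun f => (hh.memLp_mul ν (Lp.memLp f)).toLp _
      map_add' := fun f g => by
        refine Lp.ext ?_
        filter_upwards [(hh.memLp_mul ν (Lp.memLp f)).coeFn_toLp,
          (hh.memLp_mul ν (Lp.memLp g)).coeFn_toLp, (hh.memLp_mul ν (Lp.memLp (f + g))).coeFn_toLp,
          Lp.coeFn_add f g, Lp.coeFn_add ((hh.memLp_mul ν (Lp.memLp f)).toLp _)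
            ((hh.memLp_mul ν (Lp.memLp g)).toLp _)] with p h1 h2 h3 h4 h5
        rw [h3, h5, Pi.add_apply, h1, h2, h4, Pi.add_apply, mul_add]
      map_smul' := fun c f => by
        refine Lp.ext ?_
        filter_upwards [(hh.memLp_mul ν (Lp.memLp f)).coeFn_toLp,
          (hh.memLp_mul ν (Lp.memLp (c • f))).coeFn_toLp, Lp.coeFn_smul c f,
          Lp.coeFn_smul c ((hh.memLp_mul ν (Lp.memLp f)).toLp _)] with p h1 h2 h3 h4
        rw [h2, RingHom.id_apply, h4, Pi.smul_apply, h1, h3, Pi.smul_apply, smul_eq_mul,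
          smul_eq_mul]
        ring } (max hh.bdd.choose 0) fun f => by
      refine Lp.norm_le_mul_norm_of_ae_le_mul (c := max hh.bdd.choose 0) ?_
      filter_upwards [(hh.memLp_mul ν (Lp.memLp f)).coeFn_toLp] with p h1
      change ‖((hh.memLp_mul ν (Lp.memLp f)).toLp _) p‖ ≤ _
      rw [h1, norm_mul]
      exact mul_le_mul_of_nonneg_right ((hh.bdd.choose_spec p).trans (le_max_left _ _))
        (norm_nonneg _)

lemma coeFn_mulOp (hh : BddMeas h) (f : Lp ℂ 2 ν) :
    mulOp ν hh f =ᵐ[ν] fun p => h p * f p := (hh.memLp_mul ν (Lp.memLp f)).coeFn_toLp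

lemma inner_mulOp (hh : BddMeas h) (f g : Lp ℂ 2 ν) :
    inner ℂ f (mulOp ν hh g) = ∫ p, h p * (conj (f p) * g p) ∂ν := by
  rw [inner_Lp_eq]
  refine integral_congr_ae ?_
  filter_upwards [coeFn_mulOp ν hh g] with p hp
  rw [hp]; ring

lemma mulOp_mul_apply (hh : BddMeas h) (hk : BddMeas k) (f : Lp ℂ 2 ν) :
    mulOp ν (hh.mul hk) f = mulOp ν hh (mulOp ν hk f) := by
  refine Lp.ext ?_
  filter_upwards [coeFn_mulOp ν (hh.mul hk) f, coeFn_mulOp ν hh (mulOp ν hk f),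
    coeFn_mulOp ν hk f] with p h1 h2 h3
  rw [h1, h2, h3, mul_assoc]

lemma mulOp_add_apply (hh : BddMeas h) (hk : BddMeas k) (f : Lp ℂ 2 ν) :
    mulOp ν (hh.add hk) f = mulOp ν hh f + mulOp ν hk f := by
  refine Lp.ext ?_
  filter_upwards [coeFn_mulOp ν (hh.add hk) f, coeFn_mulOp ν hh f, coeFn_mulOp ν hk f,
    Lp.coeFn_add (mulOp ν hh f) (mulOp ν hk f)] with p h1 h2 h3 h4
  rw [h1, h4, Pi.add_apply, h2, h3, add_mul]

lemma mulOp_const_apply (c : ℂ) (f : Lp ℂ 2 ν) : mulOp ν (BddMeas.const c) f = c • f := by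
  refine Lp.ext ?_
  filter_upwards [coeFn_mulOp ν (BddMeas.const c) f, Lp.coeFn_smul c f] with p h1 h2
  rw [h1, h2, Pi.smul_apply, smul_eq_mul]

lemma inner_mulOp_conj (hh : BddMeas h) (f g : Lp ℂ 2 ν) :
    inner ℂ (mulOp ν hh f) g = inner ℂ f (mulOp ν hh.star g) := by
  rw [inner_mulOp, inner_Lp_eq]
  refine integral_congr_ae ?_
  filter_upwards [coeFn_mulOp ν hh f] with p hp
  rw [hp, map_mul]; ring

end MulOp

/-! ### Closures of symmetric operators on test functions -/

section TestGraph

variable {M : Type*} [NormedAddCommGroup M] [NormedSpace ℝ M] [FiniteDimensional ℝ M]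
  [MeasurableSpace M] [BorelSpace M] {ν : Measure M} [IsFiniteMeasureOnCompacts ν]
  {A : (M → ℂ) → M → ℂ}

lemma inner_symm_closure_testGraph (hA : ∀ φ, IsTest φ → IsTest (A φ))
    (hsymm : ∀ φ ψ, IsTest φ → IsTest ψ →
      inner ℂ (testLp ν φ) (testLp ν (A ψ)) = inner ℂ (testLp ν (A φ)) (testLp ν ψ))
    {p q : Lp ℂ 2 ν × Lp ℂ 2 ν} (hp : p ∈ closure (testGraph ν A))
    (hq : q ∈ closure (testGraph ν A)) : inner ℂ p.1 q.2 = inner ℂ p.2 q.1 := by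
  have hcl : IsClosed {r : (Lp ℂ 2 ν × Lp ℂ 2 ν) × (Lp ℂ 2 ν × Lp ℂ 2 ν) |
      inner ℂ r.1.1 r.2.2 = inner ℂ r.1.2 r.2.1} :=
    isClosed_eq ((continuous_fst.comp continuous_fst).inner (continuous_snd.comp continuous_snd))
      ((continuous_snd.comp continuous_fst).inner (continuous_fst.comp continuous_snd))
  have hsub : testGraph ν A ×ˢ testGraph ν A ⊆ {r : (Lp ℂ 2 ν × Lp ℂ 2 ν) × (Lp ℂ 2 ν × Lp ℂ 2 ν) |
      inner ℂ r.1.1 r.2.2 = inner ℂ r.1.2 r.2.1} := by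
    rintro ⟨r, s⟩ ⟨hr, hs⟩
    obtain ⟨φ, hφ, rfl⟩ := (mem_testGraph_iff hA r).1 hr
    obtain ⟨ψ, hψ, rfl⟩ := (mem_testGraph_iff hA s).1 hs
    exact hsymm φ ψ hφ hψ
  have h1 := hcl.closure_subset_iff.2 hsub
  rw [closure_prod_eq] at h1
  exact h1 (mk_mem_prod hp hq)

lemma exists_resolvent_of_testGraph (hA : ∀ φ, IsTest φ → IsTest (A φ))
    (hadd : ∀ φ ψ, IsTest φ → IsTest ψ → A (fun p => φ p + ψ p) = fun p => A φ p + A ψ p)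
    (hsmul : ∀ (c : ℂ) φ, IsTest φ → A (fun p => c * φ p) = fun p => c * A φ p)
    (hsymm : ∀ φ ψ, IsTest φ → IsTest ψ →
      inner ℂ (testLp ν φ) (testLp ν (A ψ)) = inner ℂ (testLp ν (A φ)) (testLp ν ψ))
    (hesa : ∀ z, (z = I ∨ z = -I) → ∀ f : Lp ℂ 2 ν,
      (∀ φ, IsTest φ → inner ℂ f (testLp ν (A φ)) = z * inner ℂ f (testLp ν φ)) → f = 0) :
    ∃ R : Lp ℂ 2 ν →L[ℂ] Lp ℂ 2 ν, (∀ f g, (f, g) ∈ closure (testGraph ν A) ↔ R (g - I • f) = f) ∧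
      R - star R = (2 * I) • (star R * R) ∧ R * star R = star R * R ∧
      ∀ f, R f = 0 → f = 0 := by
  let G₀ : Submodule ℂ (Lp ℂ 2 ν × Lp ℂ 2 ν) :=
    { carrier := testGraph ν A
      add_mem' := fun {p q} hp hq => by
        obtain ⟨φ, hφ, rfl⟩ := (mem_testGraph_iff hA p).1 hp
        obtain ⟨ψ, hψ, rfl⟩ := (mem_testGraph_iff hA q).1 hq
        refine (mem_testGraph_iff hA _).2 ⟨_, hφ.add hψ, ?_⟩
        rw [testLp_add hφ hψ, hadd φ ψ hφ hψ, testLp_add (hA φ hφ) (hA ψ hψ)]; rfl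
      zero_mem' := by
        have h0 : IsTest (fun _ : M => (0 : ℂ)) := ⟨contDiff_const, HasCompactSupport.zero⟩
        refine (mem_testGraph_iff hA _).2 ⟨_, h0.const_mul 0, ?_⟩
        rw [testLp_smul h0, hsmul 0 _ h0, testLp_smul (hA _ h0), zero_smul, zero_smul]; rfl
      smul_mem' := fun c p hp => by
        obtain ⟨φ, hφ, rfl⟩ := (mem_testGraph_iff hA p).1 hp
        refine (mem_testGraph_iff hA _).2 ⟨_, hφ.const_mul c, ?_⟩
        rw [testLp_smul hφ, hsmul c φ hφ, testLp_smul (hA φ hφ)]; rfl }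
  have hsub : ∀ φ, IsTest φ → (testLp ν φ, testLp ν (A φ)) ∈ G₀.topologicalClosure := fun φ hφ =>
    subset_closure ((mem_testGraph_iff hA _).2 ⟨φ, hφ, rfl⟩)
  exact exists_resolvent_of_graph G₀.topologicalClosure isClosed_closure
    (fun p hp q hq => inner_symm_closure_testGraph hA hsymm hp hq)
    (fun y hy => eq_zero_of_inner_testLp fun φ hφ => hy _ (hsub φ hφ))
    (fun z hz f hf => hesa z hz f fun φ hφ => hf _ (hsub φ hφ))

lemma map_mem_closure_testGraph (hA : ∀ φ, IsTest φ → IsTest (A φ)) (Φ : Lp ℂ 2 ν ≃ₗᵢ[ℂ] Lp ℂ 2 ν)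
    (hΦ : ∀ φ, IsTest φ → ∃ ψ, IsTest ψ ∧ Φ (testLp ν φ) = testLp ν ψ ∧
      Φ (testLp ν (A φ)) = testLp ν (A ψ)) {p : Lp ℂ 2 ν × Lp ℂ 2 ν}
    (hp : p ∈ closure (testGraph ν A)) : (Φ p.1, Φ p.2) ∈ closure (testGraph ν A) := by
  refine map_mem_closure (f := fun p : Lp ℂ 2 ν × Lp ℂ 2 ν => (Φ p.1, Φ p.2))
    ((Φ.continuous.comp continuous_fst).prodMk (Φ.continuous.comp continuous_snd)) hp
    fun q hq => ?_
  obtain ⟨φ, hφ, rfl⟩ := (mem_testGraph_iff hA q).1 hq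
  obtain ⟨ψ, hψ, h1, h2⟩ := hΦ φ hφ
  exact (mem_testGraph_iff hA _).2 ⟨ψ, hψ, Prod.ext h1 h2⟩

end TestGraph

/-! ### The joint spectral measure exists -/

namespace TwoStepAlgebra

lemma leftInv_add (Z : V × W) (hφ : Differentiable ℝ φ) (hψ : Differentiable ℝ ψ) :
    g.leftInv Z (fun p => φ p + ψ p) = fun p => g.leftInv Z φ p + g.leftInv Z ψ p := by
  ext p
  have h := (g.hasDerivAt_leftInv hφ Z p 0).add (g.hasDerivAt_leftInv hψ Z p 0)
  simp only [zero_smul, g.mul_zero] at h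
  exact h.deriv

lemma leftInv_const_mul (Z : V × W) (hφ : Differentiable ℝ φ) (c : ℂ) :
    g.leftInv Z (fun p => c * φ p) = fun p => c * g.leftInv Z φ p := by
  ext p
  have h := (g.hasDerivAt_leftInv hφ Z p 0).const_mul c
  simp only [zero_smul, g.mul_zero] at h
  exact h.deriv

lemma sublaplacian_add (X : ι → V) (hφ : IsTest φ) (hψ : IsTest ψ) :
    g.sublaplacian X (fun p => φ p + ψ p)
      = fun p => g.sublaplacian X φ p + g.sublaplacian X ψ p := by
  ext p
  simp only [sublaplacian]
  rw [← neg_add, ← sum_add_distrib]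
  congr 1
  refine sum_congr rfl fun j _ => ?_
  rw [g.leftInv_add _ hφ.differentiable hψ.differentiable,
    g.leftInv_add _ (g.isTest_leftInv hφ _).differentiable (g.isTest_leftInv hψ _).differentiable]

lemma sublaplacian_const_mul (X : ι → V) (hφ : IsTest φ) (c : ℂ) :
    g.sublaplacian X (fun p => c * φ p) = fun p => c * g.sublaplacian X φ p := by
  ext p
  simp only [sublaplacian]
  rw [mul_neg, mul_sum]
  congr 1
  refine sum_congr rfl fun j _ => ?_
  rw [g.leftInv_const_mul _ hφ.differentiable,
    g.leftInv_const_mul _ (g.isTest_leftInv hφ _).differentiable]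

lemma centralDeriv_add (u : W) (hφ : IsTest φ) (hψ : IsTest ψ) :
    g.centralDeriv u (fun p => φ p + ψ p)
      = fun p => g.centralDeriv u φ p + g.centralDeriv u ψ p := by
  ext p
  simp only [centralDeriv]
  rw [g.leftInv_add _ hφ.differentiable hψ.differentiable]
  ring

lemma centralDeriv_const_mul (u : W) (hφ : IsTest φ) (c : ℂ) :
    g.centralDeriv u (fun p => c * φ p) = fun p => c * g.centralDeriv u φ p := by
  ext p
  simp only [centralDeriv]
  rw [g.leftInv_const_mul _ hφ.differentiable]
  ring

lemma sublaplacian_conj (X : ι → V) (he : ContDiff ℝ ∞ e) (p : V × W) :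
    g.sublaplacian X (fun p => conj (e p)) p = conj (g.sublaplacian X e p) := by
  have h1 : ∀ j, g.leftInv (X j, 0) (fun p => conj (e p))
      = fun p => conj (g.leftInv (X j, 0) e p) := fun j => funext fun p =>
    g.leftInv_conj (he.differentiable (by simp)) _ p
  simp only [sublaplacian, h1, map_neg, map_sum]
  congr 1
  refine sum_congr rfl fun j _ => ?_
  exact g.leftInv_conj ((g.contDiff_leftInv he _).differentiable (by simp)) _ p

lemma integral_mul_sublaplacian (X : ι → V) (hφ : IsTest φ) (he : ContDiff ℝ ∞ e) :
    ∫ p, e p * g.sublaplacian X φ p ∂𝔪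
      = ∫ p, g.sublaplacian X e p * φ p ∂𝔪 := by
  have h1 : ∀ j, ∫ p, e p * g.leftInv (X j, 0) (g.leftInv (X j, 0) φ) p ∂𝔪
      = ∫ p, g.leftInv (X j, 0) (g.leftInv (X j, 0) e) p * φ p ∂𝔪 := fun j => by
    rw [g.integral_leftInv_mul U (g.isTest_leftInv hφ _) he,
      g.integral_leftInv_mul U hφ (g.contDiff_leftInv he _), neg_neg]
  simp only [sublaplacian, mul_neg, neg_mul, mul_sum, sum_mul]
  rw [integral_neg, integral_neg, integral_finsetSum, integral_finsetSum,
    sum_congr rfl fun j _ => h1 j]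
  · exact fun j _ => (IsTest.mul_left (g.contDiff_leftInv (g.contDiff_leftInv he _) _) hφ).integrable
  · exact fun j _ => (IsTest.mul_left he (g.isTest_leftInv (g.isTest_leftInv hφ _) _)).integrable

lemma inner_testLp_sublaplacian (X : ι → V) (hφ : IsTest φ) (hψ : IsTest ψ) :
    inner ℂ (testLp 𝔪 φ) (testLp 𝔪 (g.sublaplacian X ψ))
      = inner ℂ (testLp 𝔪 (g.sublaplacian X φ)) (testLp 𝔪 ψ) := by
  have h : ∀ φ ψ : V × W → ℂ, IsTest φ → IsTest ψ → inner ℂ (testLp 𝔪 φ)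
      (testLp 𝔪 ψ) = ∫ p, conj (φ p) * ψ p ∂𝔪 := fun φ ψ hφ hψ => by
    rw [inner_testLp_left _ hφ]
    refine integral_congr_ae ?_
    filter_upwards [coeFn_testLp (ν := 𝔪) hψ] with p hp
    rw [hp]
  rw [h _ _ hφ (g.isTest_sublaplacian X hψ), h _ _ (g.isTest_sublaplacian X hφ) hψ,
    g.integral_mul_sublaplacian U X hψ hφ.star.contDiff]
  simp_rw [g.sublaplacian_conj X hφ.contDiff]

lemma inner_testLp_centralDeriv (u : W) (hφ : IsTest φ) (hψ : IsTest ψ) :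
    inner ℂ (testLp 𝔪 φ) (testLp 𝔪 (g.centralDeriv u ψ))
      = inner ℂ (testLp 𝔪 (g.centralDeriv u φ)) (testLp 𝔪 ψ) := by
  have h : ∀ φ ψ : V × W → ℂ, IsTest φ → IsTest ψ → inner ℂ (testLp 𝔪 φ)
      (testLp 𝔪 ψ) = ∫ p, conj (φ p) * ψ p ∂𝔪 := fun φ ψ hφ hψ => by
    rw [inner_testLp_left _ hφ]
    refine integral_congr_ae ?_
    filter_upwards [coeFn_testLp (ν := 𝔪) hψ] with p hp
    rw [hp]
  rw [h _ _ hφ (g.isTest_centralDeriv u hψ), h _ _ (g.isTest_centralDeriv u hφ) hψ]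
  have h2 := g.integral_leftInv_mul U hψ hφ.star.contDiff (0, u)
  simp_rw [g.leftInv_conj hφ.differentiable] at h2
  have e1 : ∀ p, conj (φ p) * g.centralDeriv u ψ p
      = -I * (conj (φ p) * g.leftInv (0, u) ψ p) := fun p => by
    rw [centralDeriv]; ring
  have e2 : ∀ p, conj (g.centralDeriv u φ p) * ψ p
      = I * (conj (g.leftInv (0, u) φ p) * ψ p) := fun p => by
    rw [centralDeriv, map_mul, map_neg, conj_I]; ring
  simp_rw [e1, e2]
  rw [integral_const_mul, integral_const_mul, h2]
  ring

lemma exists_resolvent_sublaplacian (X : ι → V) :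
    ∃ R : Lp ℂ 2 𝔪 →L[ℂ] Lp ℂ 2 𝔪, (∀ f h, (f, h) ∈ closure (testGraph 𝔪 (g.sublaplacian X)) ↔
        R (h - I • f) = f) ∧
      R - star R = (2 * I) • (star R * R) ∧ R * star R = star R * R ∧
      ∀ f, R f = 0 → f = 0 :=
  exists_resolvent_of_testGraph (fun _ hφ => g.isTest_sublaplacian X hφ)
    (fun _ _ hφ hψ => g.sublaplacian_add X hφ hψ) (fun c _ hφ => g.sublaplacian_const_mul X hφ c)
    (fun _ _ hφ hψ => g.inner_testLp_sublaplacian U X hφ hψ)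
    fun _ hz f hf => g.eq_zero_of_orthogonal_sublaplacian U X hz f hf

lemma exists_resolvent_centralDeriv (u : W) :
    ∃ R : Lp ℂ 2 𝔪 →L[ℂ] Lp ℂ 2 𝔪, (∀ f h, (f, h) ∈ closure (testGraph 𝔪 (g.centralDeriv u)) ↔
        R (h - I • f) = f) ∧
      R - star R = (2 * I) • (star R * R) ∧ R * star R = star R * R ∧
      ∀ f, R f = 0 → f = 0 :=
  exists_resolvent_of_testGraph (fun _ hφ => g.isTest_centralDeriv u hφ)
    (fun _ _ hφ hψ => g.centralDeriv_add u hφ hψ) (fun c _ hφ => g.centralDeriv_const_mul u hφ c)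
    (fun _ _ hφ hψ => g.inner_testLp_centralDeriv U u hφ hψ)
    fun _ hz f hf => g.eq_zero_of_orthogonal_centralDeriv U u hz f hf

lemma sublaplacian_comp_leftMul (X : ι → V) (q : V × W) (φ : V × W → ℂ) :
    g.sublaplacian X (fun p => φ (g.mul q p)) = fun p => g.sublaplacian X φ (g.mul q p) := by
  ext p
  simp only [sublaplacian, g.leftInv_comp_leftMul]

lemma centralDeriv_comp_leftMul (u : W) (q : V × W) (φ : V × W → ℂ) :
    g.centralDeriv u (fun p => φ (g.mul q p)) = fun p => g.centralDeriv u φ (g.mul q p) := by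
  ext p
  simp only [centralDeriv, g.leftInv_comp_leftMul]

lemma leftTrans_mem_closure {A : (V × W → ℂ) → V × W → ℂ} (hA : ∀ φ, IsTest φ → IsTest (A φ))
    (hinv : ∀ q φ, A (fun p => φ (g.mul q p)) = fun p => A φ (g.mul q p)) (q : V × W)
    {p : Lp ℂ 2 𝔪 × Lp ℂ 2 𝔪} (hp : p ∈ closure (testGraph 𝔪 A)) :
    (g.leftTrans U q p.1, g.leftTrans U q p.2) ∈ closure (testGraph 𝔪 A) := by
  refine map_mem_closure_testGraph hA (g.leftTrans U q) (fun φ hφ => ?_) hp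
  refine ⟨_, g.isTest_comp_leftMul hφ (g.inv q), g.leftTrans_testLp U q hφ, ?_⟩
  rw [g.leftTrans_testLp U q (hA φ hφ), hinv]

/-- Resolvents of left-invariant operators commute with left translations. -/
lemma leftTrans_resolvent {A : (V × W → ℂ) → V × W → ℂ} (hA : ∀ φ, IsTest φ → IsTest (A φ))
    (hinv : ∀ q φ, A (fun p => φ (g.mul q p)) = fun p => A φ (g.mul q p))
    {R : Lp ℂ 2 𝔪 →L[ℂ] Lp ℂ 2 𝔪}
    (hR : ∀ f h, (f, h) ∈ closure (testGraph 𝔪 A) ↔ R (h - I • f) = f)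
    (q : V × W) (f : Lp ℂ 2 𝔪) :
    g.leftTrans U q (R f) = R (g.leftTrans U q f) := by
  have h1 : (R f, f + I • R f) ∈ closure (testGraph 𝔪 A) :=
    (hR _ _).2 (by rw [add_sub_cancel_right])
  have h2 := (hR _ _).1 (g.leftTrans_mem_closure U hA hinv q h1)
  simp only [map_add, map_smul, add_sub_cancel_right] at h2
  exact h2.symm

/-! #### The partial Fourier transform of the central derivatives -/

/-- Integration by parts in the central variable, on each slice with `x` fixed. -/
lemma partialFourier_centralDeriv (k : κ) (hφ : IsTest φ) (q : V × (κ → ℝ)) :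
    partialFourier U (g.centralDeriv (U k) φ) q = q.2 k * partialFourier U φ q := by
  obtain ⟨x, η⟩ := q
  have hs := isTest_slice hφ x
  have h1 : ∀ u, g.leftInv (0, U k) φ (x, u) = fderiv ℝ (fun u => φ (x, u)) u (U k) := fun u => by
    rw [g.leftInv_eq hφ.differentiable]
    have h2 : HasFDerivAt (fun u : W => (x, u)) (ContinuousLinearMap.inr ℝ V W) u :=
      hasFDerivAt_prodMk_right x u
    have h3 : HasFDerivAt (fun u => φ (x, u)) _ u :=
      (hφ.differentiable (x, u)).hasFDerivAt.comp u h2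
    rw [h3.fderiv]
    simp [field]
  have hc : ∀ u, HasFDerivAt (fun u => conj (character U η u)) (((-I) * conj (character U η u)) •
        (ofRealCLM ∘L (toContinuousLinearMap (U.constr ℝ η)))) u := fun u => by
    have h2 : HasFDerivAt (fun u => ((U.constr ℝ η u : ℝ) : ℂ))
        (ofRealCLM ∘L (toContinuousLinearMap (U.constr ℝ η))) u :=
      (ofRealCLM ∘L (toContinuousLinearMap (U.constr ℝ η))).hasFDerivAt
    have h3 := (h2.mul_const (-I)).cexp
    have h4 : ∀ u, conj (character U η u)
        = Complex.exp ((U.constr ℝ η u : ℝ) * -I) := fun u => by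
      rw [character, ← exp_conj, map_mul, conj_ofReal, conj_I]
    simp_rw [h4]
    refine h3.congr_fderiv ?_
    ext v
    simp only [ContinuousLinearMap.smul_apply, smul_eq_mul]
    ring
  have hcd : ∀ u, fderiv ℝ (fun u => conj (character U η u)) u (U k)
      = -I * η k * conj (character U η u) := fun u => by
    rw [(hc u).fderiv]
    change (_ * _) * (((U.constr ℝ η (U k) : ℝ) : ℂ)) = _
    rw [U.constr_basis]; ring
  have hT : IsTest fun u => fderiv ℝ (fun u => φ (x, u)) u (U k) := by
    have := isTest_slice (g.isTest_leftInv hφ (0, U k)) x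
    simpa only [h1] using this
  have ibp := integral_mul_fderiv_eq_neg_fderiv_mul_of_integrable (μ := U.addHaar)
    (f := fun u => conj (character U η u)) (g := fun u => φ (x, u)) (v := U k)
    (by
      simp_rw [hcd, _root_.mul_assoc]
      refine Integrable.const_mul ?_ _
      exact Integrable.const_mul (integrable_character_mul U hs.integrable η) _)
    (integrable_character_mul U hT.integrable η)
    (integrable_character_mul U hs.integrable η)
    (fun u _ => (hc u).differentiableAt) (fun u _ => hs.differentiable u)
  simp only [partialFourier, centralDeriv, h1]
  have e1 : ∀ u, conj (character U η u)
      * (-I * fderiv ℝ (fun u => φ (x, u)) u (U k))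
      = -I * (conj (character U η u) * fderiv ℝ (fun u => φ (x, u)) u (U k)) :=
    fun u => by ring
  simp_rw [e1]
  rw [integral_const_mul, ibp]
  simp_rw [hcd, _root_.mul_assoc]
  rw [integral_const_mul, integral_const_mul]
  linear_combination (-(fourierConst κ : ℂ) * (η k) * ∫ u, conj (character U η u)
    * φ (x, u) ∂U.addHaar) * I_sq

lemma partialFourier_centralTrans (v : W) (φ : V × W → ℂ) (q : V × (κ → ℝ)) :
    partialFourier U (fun p => φ (g.mul (g.inv (0, v)) p)) q
      = conj (character U q.2 v) * partialFourier U φ q := by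
  obtain ⟨x, η⟩ := q
  have h1 : ∀ u, g.mul (g.inv (0, v)) (x, u) = (x, u - v) := fun u => by
    simp [mul, inv, sub_eq_neg_add]
  simp only [partialFourier, h1]
  have h2 := integral_sub_right_eq_self (μ := U.addHaar)
    (fun u => conj (character U η (u + v)) * φ (x, u)) v
  simp only [sub_add_cancel] at h2
  rw [h2]
  simp_rw [character_add, map_mul]
  rw [mul_left_comm (starRingEnd ℂ _),
    ← integral_const_mul (μ := U.addHaar) (conj (character U η v))]
  congr 1
  refine integral_congr_ae (.of_forall fun u => ?_)
  ring

lemma bddMeas_character (v : W) : BddMeas fun q : V × (κ → ℝ) => conj (character U q.2 v) :=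
  ⟨(continuous_conj.comp ((continuous_character U).comp
    (Continuous.prodMk_left v : Continuous fun η : κ → ℝ => (η, v)))).measurable.comp
      measurable_snd, 1, fun q => by rw [RCLike.norm_conj, norm_character]⟩

lemma partialFourierL_leftTrans (v : W) (f : Lp ℂ 2 𝔪) : partialFourierL U (g.leftTrans U (0, v) f)
      = mulOp _ (bddMeas_character (V := V) U v) (partialFourierL U f) := by
  refine (dense_testLp (ν := 𝔪)).induction (P := fun f =>
    partialFourierL U (g.leftTrans U (0, v) f)
      = mulOp _ (bddMeas_character (V := V) U v) (partialFourierL U f)) ?_ ?_ f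
  · rintro _ ⟨φ, hφ, rfl⟩
    rw [g.leftTrans_testLp U _ hφ]
    refine Lp.ext ?_
    filter_upwards [coeFn_partialFourierL U (g.isTest_comp_leftMul hφ (g.inv (0, v))),
      coeFn_mulOp _ (bddMeas_character (V := V) U v) (partialFourierL U (testLp _ φ)),
      coeFn_partialFourierL U hφ] with q h1 h2 h3
    rw [h1, h2, h3, partialFourier_centralTrans]
  · exact isClosed_eq ((partialFourierL U).continuous.comp (g.leftTrans U (0, v)).continuous)
      ((ContinuousLinearMap.continuous _).comp (partialFourierL U).continuous)

lemma bddMeas_res_snd (k : κ) : BddMeas fun q : V × (κ → ℝ) => ((q.2 k : ℂ) - I)⁻¹ :=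
  BddMeas.resolvent ((measurable_pi_apply k).comp measurable_snd)

/-- The relation between the two components of the graph is clear for test functions and is closed,
so it holds on the closure. -/
lemma partialFourierL_resolvent (k : κ) {R : Lp ℂ 2 𝔪 →L[ℂ] Lp ℂ 2 𝔪}
    (hR : ∀ f h, (f, h) ∈ closure (testGraph 𝔪 (g.centralDeriv (U k))) ↔
      R (h - I • f) = f) (f : Lp ℂ 2 𝔪) :
    partialFourierL U (R f)
      = mulOp _ (bddMeas_res_snd (V := V) k) (partialFourierL U f) := by
  have key : ∀ p ∈ closure (testGraph 𝔪 (g.centralDeriv (U k))),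
      partialFourierL U p.1 = mulOp _ (bddMeas_res_snd (V := V) k)
        (partialFourierL U (p.2 - I • p.1)) := by
    have hcl : IsClosed {p : Lp ℂ 2 𝔪 × Lp ℂ 2 𝔪 |
        partialFourierL U p.1 = mulOp _ (bddMeas_res_snd (V := V) k)
          (partialFourierL U (p.2 - I • p.1))} :=
      isClosed_eq ((partialFourierL U).continuous.comp continuous_fst)
        ((ContinuousLinearMap.continuous _).comp ((partialFourierL U).continuous.comp
          (continuous_snd.sub ((continuous_const_smul I).comp continuous_fst))))
    refine hcl.closure_subset_iff.2 fun p hp => ?_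
    obtain ⟨φ, hφ, rfl⟩ := (mem_testGraph_iff (fun _ h => g.isTest_centralDeriv (U k) h) p).1 hp
    change partialFourierL U (testLp _ φ) = mulOp _ _ (partialFourierL U (testLp _ _ - _ • testLp _ φ))
    rw [map_sub, map_smul]
    refine Lp.ext ?_
    filter_upwards [coeFn_partialFourierL U hφ,
      coeFn_partialFourierL U (g.isTest_centralDeriv (U k) hφ),
      coeFn_mulOp _ (bddMeas_res_snd (V := V) k)
        (partialFourierL U (testLp _ (g.centralDeriv (U k) φ))
          - I • partialFourierL U (testLp _ φ)),
      Lp.coeFn_sub (partialFourierL U (testLp _ (g.centralDeriv (U k) φ)))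
        (I • partialFourierL U (testLp _ φ)),
      Lp.coeFn_smul I (partialFourierL U (testLp _ φ))] with q h1 h2 h3 h4 h5
    rw [h3, h4, Pi.sub_apply, h5, Pi.smul_apply, h1, h2, g.partialFourier_centralDeriv U k hφ, smul_eq_mul,
      ← sub_mul, ← _root_.mul_assoc,
      inv_mul_cancel₀ (ProjectionValuedMeasure.sub_I_ne_zero _), one_mul]
  have h1 : (R f, f + I • R f) ∈ closure (testGraph 𝔪 (g.centralDeriv (U k))) :=
    (hR _ _).2 (by rw [add_sub_cancel_right])
  have h2 := key _ h1
  simpa only [add_sub_cancel_right] using h2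

/-- The value is `1/(1 + iη_k)`, rewritten to show the resolvent at `i`. -/
lemma integral_exp_mul_character (k : κ) (η : κ → ℝ) :
    ∫ t in Ioi (0 : ℝ), Complex.exp (-t) * conj (character U η (t • U k))
      = -I * ((η k : ℂ) - I)⁻¹ := by
  have h1 : ∀ t : ℝ, Complex.exp (-t) * conj (character U η (t • U k))
      = Complex.exp ((-1 - η k * I) * t) := fun t => by
    rw [character, ← exp_conj, ← Complex.exp_add, map_smul, U.constr_basis]
    congr 1
    simp only [smul_eq_mul, map_mul, conj_ofReal, conj_I]
    push_cast; ring
  simp_rw [h1]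
  have h0 := ProjectionValuedMeasure.sub_I_ne_zero (η k)
  rw [integral_exp_mul_complex_Ioi (by simp)]
  have h2 : (-1 - η k * I : ℂ) ≠ 0 := fun h => by
    have := congrArg Complex.re h
    simp at this
  simp only [Complex.ofReal_zero, MulZeroClass.mul_zero, Complex.exp_zero]
  field_simp
  linear_combination (-(η k : ℂ)) * I_sq

/-- The resolvents of the central derivatives are averages of central translations. -/
lemma inner_resolvent_centralDeriv (k : κ) {R : Lp ℂ 2 𝔪 →L[ℂ] Lp ℂ 2 𝔪}
    (hR : ∀ f h, (f, h) ∈ closure (testGraph 𝔪 (g.centralDeriv (U k))) ↔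
      R (h - I • f) = f) (h f : Lp ℂ 2 𝔪) :
    inner ℂ h (R f) = I * ∫ t in Ioi (0 : ℝ),
      Complex.exp (-t) * inner ℂ h (g.leftTrans U (0, t • U k) f) := by
  set ν := (volume : Measure V).prod (volume : Measure (κ → ℝ)) with hν
  set a := partialFourierL U h
  set b := partialFourierL U f
  have h1 : ∀ t : ℝ, inner ℂ h (g.leftTrans U (0, t • U k) f)
      = ∫ q, conj (character U q.2 (t • U k)) * (conj (a q) * b q) ∂ν := fun t => by
    rw [← (partialFourierL U).inner_map_map, partialFourierL_leftTrans, inner_mulOp]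
  have hab : Integrable (fun q => conj (a q) * b q) ν :=
    (Lp.memLp a).star.integrable_mul (Lp.memLp b)
  have hexp : Integrable (fun t : ℝ => Complex.exp (-t)) (volume.restrict (Ioi 0)) := by
    have := integrableOn_exp_mul_complex_Ioi (a := -1) (by simp) 0
    simp only [neg_one_mul] at this
    exact this
  have hint : Integrable (uncurry fun (t : ℝ) (q : V × (κ → ℝ)) =>
      Complex.exp (-t) * (conj (character U q.2 (t • U k)) * (conj (a q) * b q)))
      ((volume.restrict (Ioi 0)).prod ν) := by
    have h2 := (hexp.mul_prod hab).bdd_mul (c := 1)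
      (f := fun r : ℝ × (V × (κ → ℝ)) => conj (character U r.2.2 (r.1 • U k)))
      (continuous_conj.comp ((continuous_character U).comp
        ((continuous_snd.comp continuous_snd).prodMk
          (continuous_fst.smul continuous_const)))).aestronglyMeasurable
      (.of_forall fun r => by rw [RCLike.norm_conj, norm_character])
    refine h2.congr (.of_forall fun r => ?_)
    simp only [uncurry]
    ring
  rw [← (partialFourierL U).inner_map_map, g.partialFourierL_resolvent U k hR, inner_mulOp]
  have h4 : ∫ t in Ioi (0 : ℝ), Complex.exp (-t) * inner ℂ h (g.leftTrans U (0, t • U k) f)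
      = ∫ q, (∫ t in Ioi (0 : ℝ), Complex.exp (-t) * (conj (character U q.2 (t • U k))
        * (conj (a q) * b q))) ∂ν := by
    rw [← integral_integral_swap hint]
    refine integral_congr_ae (.of_forall fun t => ?_)
    simp only
    rw [h1, integral_const_mul]
  rw [h4, ← integral_const_mul]
  refine integral_congr_ae (.of_forall fun q => ?_)
  have h3 := integral_exp_mul_character U k q.2
  simp only
  simp_rw [← _root_.mul_assoc (Complex.exp _)]
  rw [integral_mul_const, h3]
  linear_combination (((q.2 k : ℂ) - I)⁻¹ * (conj (a q) * b q)) * I_sq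

/-- Operators that commute with translations commute with the resolvents of the central
derivatives. -/
lemma commute_resolvent_centralDeriv (k : κ) {R T : Lp ℂ 2 𝔪 →L[ℂ] Lp ℂ 2 𝔪}
    (hR : ∀ f h, (f, h) ∈ closure (testGraph 𝔪 (g.centralDeriv (U k))) ↔ R (h - I • f) = f)
    (hT : ∀ q f, g.leftTrans U q (T f) = T (g.leftTrans U q f)) : T * R = R * T := by
  ext1 f
  refine ext_inner_left ℂ fun h => ?_
  change inner ℂ h (T (R f)) = inner ℂ h (R (T f))
  rw [← adjoint_inner_left, g.inner_resolvent_centralDeriv U k hR,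
    g.inner_resolvent_centralDeriv U k hR]
  simp_rw [adjoint_inner_left, hT]

lemma leftTrans_star {T : Lp ℂ 2 𝔪 →L[ℂ] Lp ℂ 2 𝔪}
    (hT : ∀ q f, g.leftTrans U q (T f) = T (g.leftTrans U q f)) (q : V × W)
    (f : Lp ℂ 2 𝔪) : g.leftTrans U q (star T f) = star T (g.leftTrans U q f) := by
  refine ext_inner_right ℂ fun h => ?_
  rw [g.inner_leftTrans, star_eq_adjoint, adjoint_inner_left, adjoint_inner_left,
    g.inner_leftTrans, hT]

/-- All resolvents and their adjoints commute with left translations, and central derivatives have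
resolvents that are averages of such translations. So every pair in which one member is central
commutes, and the only remaining pair is the resolvent of `L` with its own adjoint, which is
normality. -/
lemma exists_isJointSpectralMeasure (X : OrthonormalBasis ι ℝ V) :
    ∃ E : ProjectionValuedMeasure (ℝ × (κ → ℝ)) (Lp ℂ 2 𝔪), g.IsJointSpectralMeasure X U E := by
  obtain ⟨R₀, hR₀, hres₀, hnormal₀, hker₀⟩ := g.exists_resolvent_sublaplacian U X
  choose R hR hres hnormal hker using fun k => g.exists_resolvent_centralDeriv U (U k)
  have hT₀ := g.leftTrans_resolvent U (fun _ h => g.isTest_sublaplacian X h)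
    (g.sublaplacian_comp_leftMul X) hR₀
  have hT := fun k => g.leftTrans_resolvent U (fun _ h => g.isTest_centralDeriv (U k) h)
    (g.centralDeriv_comp_leftMul (U k)) (hR k)
  have c1 : ∀ k, R₀ * R k = R k * R₀ := fun k => g.commute_resolvent_centralDeriv U k (hR k) hT₀
  have c2 : ∀ j k, R j * R k = R k * R j := fun j k =>
    g.commute_resolvent_centralDeriv U k (hR k) (hT j)
  have c3 : ∀ k, star R₀ * R k = R k * star R₀ := fun k =>
    g.commute_resolvent_centralDeriv U k (hR k) (g.leftTrans_star U hT₀)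
  have c4 : ∀ j k, star (R j) * R k = R k * star (R j) := fun j k =>
    g.commute_resolvent_centralDeriv U k (hR k) (g.leftTrans_star U (hT j))
  obtain ⟨E, hE⟩ := exists_projectionValuedMeasure (fun o : Option κ => o.elim R₀ R)
    (by rintro (_ | i) (_ | j); exacts [rfl, c1 j, (c1 i).symm, c2 i j])
    (by
      rintro (_ | i) (_ | j)
      · exact hnormal₀
      · have := congrArg star (c3 j)
        simp only [star_mul, star_star] at this
        exact this.symm
      · exact (c3 i).symm
      · exact (c4 j i).symm)
    (by rintro (_ | i); exacts [hres₀, hres i])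
    (by rintro (_ | i); exacts [hker₀, hker i])
  have hm : Measurable fun x : Option κ → ℝ => (x none, fun k => x (some k)) := by fun_prop
  refine ⟨E.map _ hm, ?_, fun k => ?_⟩
  · ext ⟨f, h⟩
    rw [hR₀, ProjectionValuedMeasure.mem_spectralGraph_iff _ measurable_fst,
      ProjectionValuedMeasure.res_map _ _ _ measurable_fst]
    exact iff_of_eq (congrArg (fun T : Lp ℂ 2 𝔪 →L[ℂ] Lp ℂ 2 𝔪 =>
      T (h - I • f) = f) (hE none).symm)
  · have hmk : Measurable fun a : ℝ × (κ → ℝ) => a.2 k := (measurable_pi_apply k).comp measurable_snd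
    ext ⟨f, h⟩
    rw [hR k, ProjectionValuedMeasure.mem_spectralGraph_iff _ hmk,
      ProjectionValuedMeasure.res_map _ _ _ hmk]
    exact iff_of_eq (congrArg (fun T : Lp ℂ 2 𝔪 →L[ℂ] Lp ℂ 2 𝔪 =>
      T (h - I • f) = f) (hE (some k)).symm)

end TwoStepAlgebra

/-! ### Hyperbolic functions of a square root -/

/-- The entire function `sinh (s √a) / √a` of `a`. -/
def shc (s a : ℝ) : ℝ := s * dslope sinh 0 (s * √a)

/-- The entire function `cosh (s √a)` of `a`. -/
def chc (s a : ℝ) : ℝ := cosh (s * √a)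

/-- The quotient `chc / shc`. -/
def cth (s a : ℝ) : ℝ := chc s a / shc s a

lemma sqrt_mul_shc (s a : ℝ) : √a * shc s a = sinh (s * √a) := by
  have := sub_smul_dslope sinh 0 (s * √a)
  simp only [sub_zero, smul_eq_mul, Real.sinh_zero] at this
  rw [← this, shc]; ring

lemma shc_of_sqrt_eq_zero (ha : √a = 0) (s : ℝ) : shc s a = s := by
  rw [shc, ha, mul_zero, dslope_same]; simp

lemma shc_of_sqrt_ne_zero (ha : √a ≠ 0) (s : ℝ) : shc s a = sinh (s * √a) / √a := by
  rw [← sqrt_mul_shc]; field_simp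

lemma continuous_shc : Continuous fun p : ℝ × ℝ => shc p.1 p.2 := by
  have h : Continuous (dslope sinh 0) := by
    rw [← continuousOn_univ, continuousOn_dslope Filter.univ_mem]
    exact ⟨Real.continuous_sinh.continuousOn, Real.differentiable_sinh 0⟩
  exact continuous_fst.mul (h.comp (continuous_fst.mul (Real.continuous_sqrt.comp continuous_snd)))

lemma continuous_chc : Continuous fun p : ℝ × ℝ => chc p.1 p.2 :=
  Real.continuous_cosh.comp (continuous_fst.mul (Real.continuous_sqrt.comp continuous_snd))

lemma le_shc (hs : 0 ≤ s) (a : ℝ) : s ≤ shc s a := by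
  by_cases ha : √a = 0
  · rw [shc_of_sqrt_eq_zero ha]
  · have h0 : 0 < √a := lt_of_le_of_ne (Real.sqrt_nonneg a) (Ne.symm ha)
    rw [shc_of_sqrt_ne_zero ha, le_div_iff₀ h0]
    exact Real.self_le_sinh_iff.2 (by positivity)

lemma shc_pos (hs : 0 < s) (a : ℝ) : 0 < shc s a := hs.trans_le (le_shc hs.le a)

lemma chc_pos (s a : ℝ) : 0 < chc s a := Real.cosh_pos _

lemma cth_pos (hs : 0 < s) (a : ℝ) : 0 < cth s a := div_pos (chc_pos s a) (shc_pos hs a)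

lemma hasDerivAt_shc (s a : ℝ) : HasDerivAt (fun s => shc s a) (chc s a) s := by
  by_cases ha : √a = 0
  · have : (fun s => shc s a) = fun s => s := funext fun s => shc_of_sqrt_eq_zero ha s
    rw [this, chc, ha, mul_zero, cosh_zero]
    exact hasDerivAt_id s
  · have : (fun s => shc s a) = fun s => sinh (s * √a) / √a :=
      funext fun s => shc_of_sqrt_ne_zero ha s
    rw [this]
    have h := (((hasDerivAt_id s).mul_const √a).sinh).div_const √a
    refine h.congr_deriv ?_
    rw [chc]; simp only [id]; field_simp

lemma hasDerivAt_chc (s : ℝ) (ha : 0 ≤ a) : HasDerivAt (fun s => chc s a) (a * shc s a) s := by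
  have h := ((hasDerivAt_id s).mul_const √a).cosh
  refine h.congr_deriv ?_
  simp only [id]
  rw [← sqrt_mul_shc, one_mul]
  linear_combination (shc s a) * Real.mul_self_sqrt ha

lemma shc_add (s t a : ℝ) : shc (s + t) a = shc s a * chc t a + chc s a * shc t a := by
  by_cases ha : √a = 0
  · simp only [shc_of_sqrt_eq_zero ha, chc, ha, mul_zero, cosh_zero]; ring
  · simp only [shc_of_sqrt_ne_zero ha, chc, add_mul, Real.sinh_add]; ring

/-- A Riccati equation. It is the reason why the Gaussian with coefficient `cth` solves the fibre
heat equation. -/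
lemma hasDerivAt_cth (hs : 0 < s) (ha : 0 ≤ a) :
    HasDerivAt (fun s => cth s a) (a - cth s a ^ 2) s := by
  have h0 := (shc_pos hs a).ne'
  refine ((hasDerivAt_chc s ha).div (hasDerivAt_shc s a) h0).congr_deriv ?_
  rw [cth]; field_simp

lemma hasDerivAt_log_shc (hs : 0 < s) (a : ℝ) :
    HasDerivAt (fun s => log (4 * π * shc s a)) (cth s a) s := by
  have h0 := (shc_pos hs a).ne'
  have := pi_pos.ne'
  refine (((hasDerivAt_shc s a).const_mul (4 * π)).log (by positivity)).congr_deriv ?_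
  rw [cth]; field_simp

lemma sinh_le_mul_cosh {y : ℝ} (hy : 0 ≤ y) : sinh y ≤ y * cosh y := by
  have hd : ∀ y : ℝ, HasDerivAt (fun y => y * cosh y - sinh y) (y * sinh y) y :=
    fun y => (((hasDerivAt_id y).mul (Real.hasDerivAt_cosh y)).sub
      (Real.hasDerivAt_sinh y)).congr_deriv (by simp only [id]; ring)
  have hm : MonotoneOn (fun y => y * cosh y - sinh y) (Ici 0) := by
    refine monotoneOn_of_deriv_nonneg (convex_Ici 0)
      (fun y _ => (hd y).continuousAt.continuousWithinAt)
      (fun y _ => (hd y).differentiableAt.differentiableWithinAt) fun y hy => ?_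
    rw [interior_Ici] at hy
    rw [(hd y).deriv]
    exact mul_nonneg (le_of_lt hy) (Real.sinh_nonneg_iff.2 (le_of_lt hy))
  have := hm (mem_Ici.2 le_rfl) hy hy
  simp only [zero_mul, Real.sinh_zero, sub_zero] at this
  linarith

/-- The twisted Gaussian decays at least as fast as the Euclidean one, uniformly in `η`. -/
lemma inv_le_cth (hs : 0 < s) (a : ℝ) : s⁻¹ ≤ cth s a := by
  rw [cth, le_div_iff₀ (shc_pos hs a), inv_mul_le_iff₀ hs]
  by_cases ha : √a = 0
  · rw [shc_of_sqrt_eq_zero ha, chc, ha, mul_zero, cosh_zero, mul_one]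
  · have h0 : 0 < √a := lt_of_le_of_ne (Real.sqrt_nonneg a) (Ne.symm ha)
    rw [shc_of_sqrt_ne_zero ha, chc, div_le_iff₀ h0]
    refine (sinh_le_mul_cosh (by positivity)).trans (le_of_eq ?_)
    ring

lemma continuous_log_shc (hs : 0 < s) : Continuous fun a => log (4 * π * shc s a) :=
  Continuous.log (continuous_const.mul (continuous_shc.comp (continuous_const.prodMk continuous_id)))
    fun a => by have := shc_pos hs a; have := pi_pos; positivity

lemma continuous_cth (hs : 0 < s) : Continuous (cth s) :=
  (continuous_chc.comp (continuous_const.prodMk continuous_id)).div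
    (continuous_shc.comp (continuous_const.prodMk continuous_id)) fun a => (shc_pos hs a).ne'

/-! ### Functions of `-J_η²` -/

namespace TwoStepAlgebra

lemma inner_J_left (x y : V) : inner ℝ (g.J U η x) y = - inner ℝ x (g.J U η y) := by
  rw [inner_J, g.bracket_swap, map_neg, ← inner_J, real_inner_comm]

/-- The positive semidefinite endomorphism `-J_η²`. -/
def negJSq : V →ₗ[ℝ] V := -(g.J U η ∘ₗ g.J U η)

lemma negJSq_apply (x : V) : g.negJSq U η x = - g.J U η (g.J U η x) := rfl

lemma isSymmetric_negJSq : (g.negJSq U η).IsSymmetric := fun x y => by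
  simp only [negJSq_apply, inner_neg_left, inner_neg_right, g.inner_J_left, neg_neg]

/-- An orthonormal basis of eigenvectors of `-J_η²`. -/
def evec : OrthonormalBasis (Fin (Module.finrank ℝ V)) ℝ V :=
  (g.isSymmetric_negJSq U η).eigenvectorBasis rfl

/-- The eigenvalues of `-J_η²`. -/
def ev (i : Fin (Module.finrank ℝ V)) : ℝ := (g.isSymmetric_negJSq U η).eigenvalues rfl i

lemma negJSq_evec (i : Fin (Module.finrank ℝ V)) :
    g.negJSq U η (g.evec U η i) = g.ev U η i • g.evec U η i :=
  (g.isSymmetric_negJSq U η).apply_eigenvectorBasis rfl i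

lemma ev_nonneg (i : Fin (Module.finrank ℝ V)) : 0 ≤ g.ev U η i := by
  have h : g.ev U η i = inner ℝ (g.negJSq U η (g.evec U η i)) (g.evec U η i) := by
    rw [negJSq_evec, real_inner_smul_left, real_inner_self_eq_norm_sq,
      (g.evec U η).norm_eq_one]; simp
  rw [h, negJSq_apply, inner_neg_left, g.inner_J_left, neg_neg]
  exact real_inner_self_nonneg

/-- The bilinear form `⟨f(-J_η²) x, y⟩`. -/
def bil (f : ℝ → ℝ) (η : κ → ℝ) (x y : V) : ℝ :=
  ∑ i, f (g.ev U η i) * (inner ℝ (g.evec U η i) x * inner ℝ (g.evec U η i) y)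

lemma bil_comm (f : ℝ → ℝ) (η : κ → ℝ) (x y : V) : g.bil U f η x y = g.bil U f η y x := by
  simp only [bil, mul_comm (inner ℝ _ x)]

lemma bil_add_left (f : ℝ → ℝ) (η : κ → ℝ) (x x' y : V) :
    g.bil U f η (x + x') y = g.bil U f η x y + g.bil U f η x' y := by
  simp only [bil, inner_add_right, add_mul, mul_add, sum_add_distrib]

lemma bil_smul_left (f : ℝ → ℝ) (η : κ → ℝ) (c : ℝ) (x y : V) :
    g.bil U f η (c • x) y = c * g.bil U f η x y := by
  simp only [bil, real_inner_smul_right, mul_sum]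
  exact sum_congr rfl fun i _ => by ring

lemma bil_add_right (f : ℝ → ℝ) (η : κ → ℝ) (x y y' : V) :
    g.bil U f η x (y + y') = g.bil U f η x y + g.bil U f η x y' := by
  rw [bil_comm, bil_add_left, g.bil_comm U f η y, g.bil_comm U f η y']

lemma bil_smul_right (f : ℝ → ℝ) (η : κ → ℝ) (c : ℝ) (x y : V) :
    g.bil U f η x (c • y) = c * g.bil U f η x y := by
  rw [bil_comm, bil_smul_left, bil_comm]

lemma bil_add_smul_self (f : ℝ → ℝ) (η : κ → ℝ) (x z : V) (t : ℝ) :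
    g.bil U f η (x + t • z) (x + t • z)
      = g.bil U f η x x + 2 * t * g.bil U f η x z + t ^ 2 * g.bil U f η z z := by
  simp only [bil_add_left, bil_add_right, bil_smul_left, bil_smul_right]
  rw [g.bil_comm U f η z x]
  ring

lemma sum_inner_sq {n : Type*} [Fintype n] (b : OrthonormalBasis n ℝ V) (x : V) :
    ∑ j, inner ℝ x (b j) ^ 2 = ‖x‖ ^ 2 := by
  have := b.sum_sq_norm_inner_left x
  simpa using this

/-- The trace of `f(-J_η²)`. -/
lemma sum_bil_self {n : Type*} [Fintype n] (b : OrthonormalBasis n ℝ V) (f : ℝ → ℝ) (η : κ → ℝ) :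
    ∑ j, g.bil U f η (b j) (b j) = ∑ i, f (g.ev U η i) := by
  simp only [bil]
  rw [sum_comm]
  refine sum_congr rfl fun i _ => ?_
  rw [← mul_sum]
  have := sum_inner_sq b (g.evec U η i)
  simp only [sq, (g.evec U η).norm_eq_one] at this
  rw [this]; ring

lemma sum_bil_sq {n : Type*} [Fintype n] (b : OrthonormalBasis n ℝ V) (f : ℝ → ℝ) (η : κ → ℝ)
    (x : V) : ∑ j, g.bil U f η x (b j) ^ 2 = g.bil U (fun a => f a ^ 2) η x x := by
  have h1 : ∀ y, g.bil U f η x y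
      = inner ℝ (∑ i, (f (g.ev U η i) * inner ℝ (g.evec U η i) x) • g.evec U η i) y := fun y => by
    simp only [bil, sum_inner, real_inner_smul_left]
    exact sum_congr rfl fun i _ => by ring
  simp_rw [h1]
  rw [sum_inner_sq, ← (g.evec U η).sum_sq_norm_inner_right]
  simp only [bil]
  refine sum_congr rfl fun i _ => ?_
  rw [(g.evec U η).orthonormal.inner_right_fintype, norm_eq_abs, sq_abs]
  ring

/-- The operator `f(-J²)` is symmetric and commutes with the skew operator `J`, so their product is
skew. This kills the first-order cross term when `L` is applied to the heat kernel. -/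
lemma bil_J (f : ℝ → ℝ) (η : κ → ℝ) (x : V) : g.bil U f η x (g.J U η x) = 0 := by
  set e := g.evec U η
  have hexp : ∀ i, inner ℝ (e i) (g.J U η x)
      = ∑ k, inner ℝ (e k) x * inner ℝ (e i) (g.J U η (e k)) := fun i => by
    conv_lhs => rw [← e.sum_repr' x]
    rw [map_sum, inner_sum]
    exact sum_congr rfl fun k _ => by rw [map_smul, real_inner_smul_right]
  have hanti : ∀ i k, inner ℝ (e i) (g.J U η (e k)) = - inner ℝ (e k) (g.J U η (e i)) := fun i k => by
    rw [real_inner_comm, g.inner_J_left]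
  -- Since `J` preserves eigenspaces, its matrix entries between different eigenvalues vanish.
  have hcomm : ∀ i k, f (g.ev U η i) * inner ℝ (e i) (g.J U η (e k))
      = f (g.ev U η k) * inner ℝ (e i) (g.J U η (e k)) := fun i k => by
    have h1 : g.ev U η i * inner ℝ (e i) (g.J U η (e k))
        = g.ev U η k * inner ℝ (e i) (g.J U η (e k)) := by
      have h3 : g.negJSq U η (g.J U η (e k)) = g.J U η (g.negJSq U η (e k)) := by
        simp only [negJSq_apply, map_neg]
      rw [← real_inner_smul_left, ← negJSq_evec, g.isSymmetric_negJSq U η, h3, negJSq_evec,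
        map_smul, real_inner_smul_right]
    by_cases h : inner ℝ (e i) (g.J U η (e k)) = 0
    · rw [h]; simp
    · rw [mul_right_cancel₀ h h1]
  have hswap : g.bil U f η x (g.J U η x) = - g.bil U f η x (g.J U η x) := by
    have h2 : g.bil U f η x (g.J U η x) = ∑ i, ∑ k, f (g.ev U η i) * inner ℝ (e i) x
        * (inner ℝ (e k) x * inner ℝ (e i) (g.J U η (e k))) := by
      simp only [bil]
      refine sum_congr rfl fun i _ => ?_
      change f _ * (inner ℝ (e i) x * inner ℝ (e i) (g.J U η x)) = _
      rw [hexp, ← _root_.mul_assoc, mul_sum]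
    conv_lhs => rw [h2, sum_comm]
    rw [h2, ← sum_neg_distrib]
    refine sum_congr rfl fun i _ => ?_
    rw [← sum_neg_distrib]
    refine sum_congr rfl fun k _ => ?_
    rw [hanti k i]
    linear_combination (-inner ℝ (e k) x * inner ℝ (e i) x) * (-(hcomm i k))
  linarith

lemma bil_id (x : V) : g.bil U (fun a => a) η x x = ‖g.J U η x‖ ^ 2 := by
  have h1 : ‖g.J U η x‖ ^ 2 = inner ℝ (g.negJSq U η x) x := by
    rw [negJSq_apply, inner_neg_left, g.inner_J_left, neg_neg, real_inner_self_eq_norm_sq]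
  rw [h1, ← (g.evec U η).sum_inner_mul_inner]
  simp only [bil]
  refine sum_congr rfl fun i _ => ?_
  rw [g.isSymmetric_negJSq U η, negJSq_evec, real_inner_smul_right, real_inner_comm]
  ring

lemma J_eq_sum {n : Type*} [Fintype n] (b : OrthonormalBasis n ℝ V) (η : κ → ℝ) (x : V) :
    g.J U η x = ∑ i, (U.constr ℝ η (g.bracket x (b i)) : ℝ) • b i := by
  conv_lhs => rw [← b.sum_repr' (g.J U η x)]
  refine sum_congr rfl fun i _ => ?_
  rw [real_inner_comm, inner_J]

lemma continuous_J : Continuous fun q : V × (κ → ℝ) => g.J U q.2 q.1 := by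
  obtain ⟨n, ⟨b⟩⟩ : ∃ n : ℕ, Nonempty (OrthonormalBasis (Fin n) ℝ V) :=
    ⟨_, ⟨stdOrthonormalBasis ℝ V⟩⟩
  have h : Continuous fun q : V × (κ → ℝ) => ∑ i, (U.constr ℝ q.2 (g.bracket q.1 (b i)) : ℝ) • b i := by
    refine continuous_finsetSum _ fun i _ => Continuous.smul ?_ continuous_const
    have h1 : Continuous fun q : V × (κ → ℝ) => g.bracket q.1 (b i) :=
      g.continuous_bracket continuous_fst continuous_const
    have h2 : Continuous fun q : V × (κ → ℝ) => ((q.2, g.bracket q.1 (b i)) : (κ → ℝ) × W) :=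
      continuous_snd.prodMk h1
    have h3 := (continuous_constr U).comp h2
    exact h3
  exact h.congr fun q => (g.J_eq_sum U b q.2 q.1).symm

lemma continuous_negJSq_pow (n : ℕ) :
    Continuous fun q : V × (κ → ℝ) => ((g.negJSq U q.2) ^ n) q.1 := by
  induction n with
  | zero => simpa using continuous_fst
  | succ n ih =>
    have h := g.continuous_J U
    have h1 := h.comp ((h.comp (ih.prodMk continuous_snd)).prodMk continuous_snd)
    refine h1.neg.congr fun q => ?_
    rw [pow_succ']; rfl

lemma inner_negJSq_pow (n : ℕ) (x : V) (i : Fin (Module.finrank ℝ V)) :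
    inner ℝ (((g.negJSq U η) ^ n) x) (g.evec U η i)
      = g.ev U η i ^ n * inner ℝ (g.evec U η i) x := by
  induction n with
  | zero => simp [real_inner_comm]
  | succ n ih =>
    rw [pow_succ']
    change inner ℝ (g.negJSq U η (((g.negJSq U η) ^ n) x)) _ = _
    rw [g.isSymmetric_negJSq U η, negJSq_evec, real_inner_smul_right, ih]
    ring

lemma continuous_bil_polynomial (p : Polynomial ℝ) :
    Continuous fun q : V × (κ → ℝ) => g.bil U (fun a => p.eval a) q.2 q.1 q.1 := by
  induction p using Polynomial.induction_on' with
  | add p r hp hr =>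
    refine (hp.add hr).congr fun q => ?_
    simp only [Pi.add_apply, bil, Polynomial.eval_add, add_mul, sum_add_distrib]
  | monomial n c =>
    have h := ((g.continuous_negJSq_pow U n).inner (𝕜 := ℝ) continuous_fst).const_smul c
    refine h.congr fun q => ?_
    simp only [bil, Polynomial.eval_monomial]
    rw [Pi.smul_apply, ← (g.evec U q.2).sum_inner_mul_inner, smul_eq_mul, mul_sum]
    refine sum_congr rfl fun i _ => ?_
    rw [inner_negJSq_pow]; ring

/-- The eigenvectors need not depend measurably on `η`. For polynomial `f` the form is continuous
because it involves only powers of `-J_η²`, and a continuous `f` is approximated by polynomials on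
the intervals `[0, n]`, which exhaust the possible eigenvalues. -/
lemma measurable_bil {f : ℝ → ℝ} (hf : Continuous f) :
    Measurable fun q : V × (κ → ℝ) => g.bil U f q.2 q.1 q.1 := by
  choose p hp using fun n : ℕ => exists_polynomial_near_of_continuousOn 0 n f hf.continuousOn
    (1 / ((n : ℝ) + 1)) (by positivity)
  refine measurable_of_tendsto_metrizable
    (f := fun (n : ℕ) (q : V × (κ → ℝ)) => g.bil U (fun a => (p n).eval a) q.2 q.1 q.1)
    (fun n => (g.continuous_bil_polynomial U (p n)).measurable) (tendsto_pi_nhds.2 fun q => ?_)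
  refine tendsto_finsetSum _ fun i _ => Tendsto.mul_const _ ?_
  rw [tendsto_iff_norm_sub_tendsto_zero]
  refine squeeze_zero' (.of_forall fun n => norm_nonneg _) ?_
    (tendsto_one_div_add_atTop_nhds_zero_nat (𝕜 := ℝ))
  filter_upwards [eventually_ge_atTop ⌈g.ev U q.2 i⌉₊] with n hn
  exact (hp n _ ⟨g.ev_nonneg U q.2 i, (Nat.le_ceil _).trans (Nat.cast_le.2 hn)⟩).le

lemma measurable_sum_ev {f : ℝ → ℝ} (hf : Continuous f) :
    Measurable fun η : κ → ℝ => ∑ i, f (g.ev U η i) := by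
  obtain ⟨n, ⟨b⟩⟩ : ∃ n : ℕ, Nonempty (OrthonormalBasis (Fin n) ℝ V) :=
    ⟨_, ⟨stdOrthonormalBasis ℝ V⟩⟩
  have h1 : ∀ v : V, Measurable fun η : κ → ℝ => g.bil U f η v v := fun v => by
    have h : Measurable fun η : κ → ℝ => ((v, η) : V × (κ → ℝ)) :=
      measurable_const.prodMk measurable_id
    have h' := (g.measurable_bil U hf).comp h
    exact h'
  have h2 : Measurable fun η : κ → ℝ => ∑ j, g.bil U f η (b j)
      (b j) := Finset.measurable_fun_sum _ fun j _ => h1 _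
  have h3 : (fun η : κ → ℝ => ∑ i, f (g.ev U η i)) = fun η : κ → ℝ =>
      ∑ j, g.bil U f η (b j) (b j) :=
    funext fun η => (g.sum_bil_self U b f η).symm
  rw [h3]
  exact h2

end TwoStepAlgebra

/-! ### The fibre heat kernels -/

/-- No sign condition on `b` is needed: for a nonpositive coefficient the one-dimensional integral
and the square root both take the default value `0`. -/
lemma integral_exp_neg_sum_sq {V : Type*} [NormedAddCommGroup V] [InnerProductSpace ℝ V]
    [FiniteDimensional ℝ V] [MeasurableSpace V] [BorelSpace V] {n : Type*} [Fintype n]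
    (e : OrthonormalBasis n ℝ V) (b : n → ℝ) :
    ∫ x : V, exp (- ∑ i, b i * inner ℝ (e i) x ^ 2) = ∏ i, √(π / b i) := by
  have h1 : MeasurePreserving (fun x : V => (e.repr x).ofLp) volume (volume : Measure (n → ℝ)) :=
    (PiLp.volume_preserving_ofLp n).comp e.measurePreserving_repr
  have he : MeasurableEmbedding (fun x : V => (e.repr x).ofLp) :=
    (MeasurableEquiv.toLp 2 (n → ℝ)).symm.measurableEmbedding.comp
      e.repr.toHomeomorph.measurableEmbedding
  have h2 := h1.integral_comp he (fun y : n → ℝ => exp (- ∑ i, b i * y i ^ 2))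
  have h3 : ∀ x : V, (fun y : n → ℝ => exp (- ∑ i, b i * y i ^ 2)) ((e.repr x).ofLp)
      = exp (- ∑ i, b i * inner ℝ (e i) x ^ 2) := fun x => by
    simp only [← e.repr_apply_apply]
  simp only [h3] at h2
  rw [h2]
  have h4 : ∀ y : n → ℝ, exp (- ∑ i, b i * y i ^ 2) = ∏ i, exp (- b i * y i ^ 2) :=
    fun y => by rw [← sum_neg_distrib, exp_sum]; simp only [neg_mul]
  simp_rw [h4]
  rw [integral_fintype_prod_volume_eq_prod (fun i (t : ℝ) => exp (- b i * t ^ 2))]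
  simp only [integral_gaussian]

lemma chc_sq (s : ℝ) (ha : 0 ≤ a) : chc s a ^ 2 = 1 + a * shc s a ^ 2 := by
  have h := Real.cosh_sq (s * √a)
  rw [← sqrt_mul_shc, mul_pow, sq_sqrt ha] at h
  rw [chc, h]; ring

lemma cth_sq_sub (hs : 0 < s) (ha : 0 ≤ a) : cth s a ^ 2 - a = (shc s a ^ 2)⁻¹ := by
  have h0 := (shc_pos hs a).ne'
  rw [cth, div_pow, chc_sq s ha]; field_simp; ring

lemma inv_shc_sq_le (hs : 0 < s) (a : ℝ) : (shc s a ^ 2)⁻¹ ≤ (s ^ 2)⁻¹ := by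
  have := le_shc hs.le a
  gcongr

lemma cth_le (hs : 0 < s) (ha : 0 ≤ a) : cth s a ≤ 1 + a + (s ^ 2)⁻¹ := by
  have h1 := cth_sq_sub hs ha
  have h2 := inv_shc_sq_le hs a
  nlinarith [sq_nonneg (cth s a - 1), cth_pos hs a]

namespace TwoStepAlgebra

/-- The value at the origin of the heat kernel of the fibre over `η`. -/
def heatDiag (s : ℝ) (η : κ → ℝ) : ℝ := exp (-(1 / 2) * ∑ i, log (4 * π * shc s (g.ev U η i)))

/-- The heat kernel of the fibre over `η`. -/
def heat (s : ℝ) (η : κ → ℝ) (x : V) : ℝ :=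
  g.heatDiag U s η * exp (-(1 / 4) * g.bil U (cth s) η x x)

lemma heatDiag_pos (s : ℝ) (η : κ → ℝ) : 0 < g.heatDiag U s η := exp_pos _

lemma heat_pos (s : ℝ) (η : κ → ℝ) (x : V) : 0 < g.heat U s η x :=
  mul_pos (g.heatDiag_pos U s η) (exp_pos _)

lemma measurable_heatDiag (hs : 0 < s) : Measurable (g.heatDiag U s) :=
  measurable_exp.comp ((g.measurable_sum_ev U (continuous_log_shc hs)).const_mul _)

lemma measurable_heat (hs : 0 < s) : Measurable fun q : V × (κ → ℝ) => g.heat U s q.2 q.1 := by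
  have h1 : Measurable fun q : V × (κ → ℝ) => g.heatDiag U s q.2 :=
    (g.measurable_heatDiag U hs).comp measurable_snd
  have h2 : Measurable fun q : V × (κ → ℝ) =>
      exp (-(1 / 4) * g.bil U (cth s) q.2 q.1 q.1) :=
    measurable_exp.comp ((g.measurable_bil U (continuous_cth hs)).const_mul _)
  exact h1.mul h2

/-- The definition through a trace of logarithms suits measurability and differentiation; this
product form suits estimates and Gaussian integrals. -/
lemma heatDiag_eq_prod (s : ℝ) (hs : 0 < s) (η : κ → ℝ) :
    g.heatDiag U s η = ∏ i, (√(4 * π * shc s (g.ev U η i)))⁻¹ := by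
  rw [heatDiag, mul_sum, exp_sum]
  refine prod_congr rfl fun i _ => ?_
  have h : 0 < 4 * π * shc s (g.ev U η i) := by
    have := shc_pos hs (g.ev U η i); have := pi_pos; positivity
  rw [sqrt_eq_rpow, ← Real.rpow_neg h.le, Real.rpow_def_of_pos h]
  ring_nf

lemma heatDiag_antitone (hs : 0 < s) (hst : s ≤ t) : g.heatDiag U t η ≤ g.heatDiag U s η := by
  have hm : ∀ a, shc s a ≤ shc t a := fun a => by
    have : Monotone fun s => shc s a := monotone_of_deriv_nonneg
      (fun s => (hasDerivAt_shc s a).differentiableAt)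
      (fun s => by rw [(hasDerivAt_shc s a).deriv]; exact (chc_pos s a).le)
    exact this hst
  rw [g.heatDiag_eq_prod U s hs, g.heatDiag_eq_prod U t (hs.trans_le hst)]
  refine Finset.prod_le_prod (fun i _ => by positivity) fun i _ => ?_
  have := shc_pos hs (g.ev U η i); have := pi_pos
  have := hm (g.ev U η i)
  gcongr

lemma heatDiag_le (hs : 0 < s) (η : κ → ℝ) :
    g.heatDiag U s η ≤ (√(4 * π * s))⁻¹ ^ Module.finrank ℝ V := by
  rw [g.heatDiag_eq_prod U s hs]
  refine (Finset.prod_le_prod (g := fun _ => (√(4 * π * s))⁻¹)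
    (fun i _ => by positivity) fun i _ => ?_).trans (by simp)
  have := le_shc hs.le (g.ev U η i); have := pi_pos
  gcongr

lemma norm_sq_le_bil_cth (hs : 0 < s) (η : κ → ℝ) (x : V) :
    s⁻¹ * ‖x‖ ^ 2 ≤ g.bil U (cth s) η x x := by
  rw [← sum_inner_sq (g.evec U η) x, mul_sum]
  refine sum_le_sum fun i _ => ?_
  rw [real_inner_comm, sq]
  exact mul_le_mul_of_nonneg_right (inv_le_cth hs _) (mul_self_nonneg _)

lemma heat_le (hs : 0 < s) (η : κ → ℝ) (x : V) :
    g.heat U s η x ≤ (√(4 * π * s))⁻¹ ^ Module.finrank ℝ V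
      * exp (-(1 / 4) * (s⁻¹ * ‖x‖ ^ 2)) := by
  refine mul_le_mul (g.heatDiag_le U hs η) (exp_le_exp.2 ?_) (exp_pos _).le (by positivity)
  linarith [g.norm_sq_le_bil_cth U hs η x]

lemma heat_mul_heat (s t : ℝ) (η : κ → ℝ) (x : V) : g.heat U s η x * g.heat U t η x
    = g.heatDiag U s η * g.heatDiag U t η * exp (- ∑ i, ((1 / 4) *
      (cth s (g.ev U η i) + cth t (g.ev U η i))) * inner ℝ (g.evec U η i) x ^ 2) := by
  rw [heat, heat, mul_mul_mul_comm, ← exp_add]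
  congr 2
  simp only [bil, mul_sum, ← sum_add_distrib, ← sum_neg_distrib]
  exact sum_congr rfl fun i _ => by ring

/-- The semigroup law at the origin, where the twisting phase is trivial. The Gaussian integral
contributes `cth s + cth t` in each eigendirection, and the addition formula gives `shc (s + t) =
shc s · shc t · (cth s + cth t)`. -/
lemma integral_heat_mul_heat (hs : 0 < s) (ht : 0 < t) (η : κ → ℝ) :
    ∫ x : V, g.heat U s η x * g.heat U t η x = g.heatDiag U (s + t) η := by
  simp_rw [heat_mul_heat]
  rw [integral_const_mul, integral_exp_neg_sum_sq (g.evec U η), g.heatDiag_eq_prod U s hs,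
    g.heatDiag_eq_prod U t ht, g.heatDiag_eq_prod U (s + t) (by linarith),
    ← prod_mul_distrib, ← prod_mul_distrib]
  refine prod_congr rfl fun i _ => ?_
  set a := g.ev U η i
  have h1 := shc_pos hs a
  have h2 := shc_pos ht a
  have h3 := pi_pos
  have h4 := chc_pos s a
  have h5 := chc_pos t a
  rw [← sqrt_inv, ← sqrt_inv, ← sqrt_inv, ← sqrt_mul (by positivity),
    ← sqrt_mul (by positivity), shc_add, cth, cth]
  congr 1
  have h6 : 0 < shc s a * chc t a + chc s a * shc t a := by positivity
  field_simp
  ring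

lemma integrable_heat_mul_heat (hs : 0 < s) (ht : 0 < t) (η : κ → ℝ) :
    Integrable fun x : V => g.heat U s η x * g.heat U t η x := by
  -- A nonintegrable function would have integral `0` by convention, whereas the value found is
  -- positive.
  by_contra h
  have h1 := g.integral_heat_mul_heat U hs ht η
  rw [integral_undef h] at h1
  exact (g.heatDiag_pos U (s + t) η).ne h1

lemma hasDerivAt_heat (hs : 0 < s) (η : κ → ℝ) (x : V) :
    HasDerivAt (fun s => g.heat U s η x) (g.heat U s η x * (-(1 / 2) * ∑ i, cth s (g.ev U η i)
        - 1 / 4 * g.bil U (fun a => a - cth s a ^ 2) η x x)) s := by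
  have h1 : HasDerivAt (fun s => g.heatDiag U s η)
      (g.heatDiag U s η * (-(1 / 2) * ∑ i, cth s (g.ev U η i))) s :=
    ((HasDerivAt.fun_sum fun i _ => hasDerivAt_log_shc hs (g.ev U η i)).const_mul _).exp
  have h2 : HasDerivAt (fun s => g.bil U (cth s) η x x)
      (g.bil U (fun a => a - cth s a ^ 2) η x x) s :=
    HasDerivAt.fun_sum fun i _ => (hasDerivAt_cth hs (g.ev_nonneg U η i)).mul_const _
  refine (h1.mul (h2.const_mul (-(1 / 4))).exp).congr_deriv ?_
  rw [heat]; ring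

/-- The dependence on `η` is through `1 + tr(-J_η²)` only, which is exactly the factor that `weight`
divides out. -/
lemma abs_deriv_heat_le (hs : 0 < s) (η : κ → ℝ) (x : V) :
    |g.heat U s η x * (-(1 / 2) * ∑ i, cth s (g.ev U η i)
        - 1 / 4 * g.bil U (fun a => a - cth s a ^ 2) η x x)|
      ≤ (√(4 * π * s))⁻¹ ^ Module.finrank ℝ V *
        ((Module.finrank ℝ V * (1 + (s ^ 2)⁻¹) + (s ^ 2)⁻¹ * ‖x‖ ^ 2 + 1) *
          (1 + ∑ i, g.ev U η i)) := by
  have hev : 0 ≤ ∑ i, g.ev U η i := sum_nonneg fun i _ => g.ev_nonneg U η i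
  have h0 : g.heat U s η x ≤ (√(4 * π * s))⁻¹ ^ Module.finrank ℝ V := by
    refine (g.heat_le U hs η x).trans (mul_le_of_le_one_right (by positivity) ?_)
    rw [exp_le_one_iff]
    have : 0 ≤ s⁻¹ * ‖x‖ ^ 2 := by positivity
    linarith
  have h1 : ∑ i, cth s (g.ev U η i)
      ≤ Module.finrank ℝ V * (1 + (s ^ 2)⁻¹) + ∑ i, g.ev U η i := by
    refine (sum_le_sum fun i _ => cth_le hs (g.ev_nonneg U η i)).trans (le_of_eq ?_)
    simp only [sum_add_distrib, Finset.sum_const, Finset.card_univ, Fintype.card_fin,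
      nsmul_eq_mul]
    ring
  have h1' : 0 ≤ ∑ i, cth s (g.ev U η i) := sum_nonneg fun i _ => (cth_pos hs _).le
  have h2 : - g.bil U (fun a => a - cth s a ^ 2) η x x ≤ (s ^ 2)⁻¹ * ‖x‖ ^ 2 := by
    rw [← sum_inner_sq (g.evec U η) x, mul_sum, bil, ← sum_neg_distrib]
    refine sum_le_sum fun i _ => ?_
    rw [real_inner_comm, sq (inner ℝ _ _), ← neg_mul, neg_sub, cth_sq_sub hs (g.ev_nonneg U η i)]
    exact mul_le_mul_of_nonneg_right (inv_shc_sq_le hs _) (mul_self_nonneg _)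
  have h2' : 0 ≤ - g.bil U (fun a => a - cth s a ^ 2) η x x := by
    rw [bil, ← sum_neg_distrib]
    refine sum_nonneg fun i _ => ?_
    rw [← neg_mul, neg_sub, cth_sq_sub hs (g.ev_nonneg U η i)]
    exact mul_nonneg (by positivity) (mul_self_nonneg _)
  rw [abs_mul, abs_of_pos (g.heat_pos U s η x)]
  refine mul_le_mul h0 ?_ (abs_nonneg _) (by positivity)
  have h3 : 0 ≤ (Module.finrank ℝ V * (1 + (s ^ 2)⁻¹) + (s ^ 2)⁻¹ * ‖x‖ ^ 2) *
      ∑ i, g.ev U η i := mul_nonneg (by positivity) hev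
  have h4 : (0 : ℝ) ≤ Module.finrank ℝ V * (1 + (s ^ 2)⁻¹) := by positivity
  have h5 : (0 : ℝ) ≤ (s ^ 2)⁻¹ * ‖x‖ ^ 2 := by positivity
  rw [abs_le]
  constructor <;> linarith

/-! ### The heat equation -/

lemma contDiff_bil (f : ℝ → ℝ) (η : κ → ℝ) {n : WithTop ℕ∞} :
    ContDiff ℝ n fun x : V => g.bil U f η x x := by
  unfold bil
  refine ContDiff.sum fun i _ => contDiff_const.mul ?_
  exact (contDiff_const.inner ℝ contDiff_id).mul (contDiff_const.inner ℝ contDiff_id)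

lemma contDiff_bil_right (f : ℝ → ℝ) (η : κ → ℝ) (z : V) {n : WithTop ℕ∞} :
    ContDiff ℝ n fun x : V => g.bil U f η x z := by
  unfold bil
  refine ContDiff.sum fun i _ => contDiff_const.mul ?_
  exact (contDiff_const.inner ℝ contDiff_id).mul contDiff_const

lemma sum_bil_mul_inner {n : Type*} [Fintype n] (b : OrthonormalBasis n ℝ V) (f : ℝ → ℝ)
    (η : κ → ℝ) (x y : V) : ∑ j, g.bil U f η x (b j) * inner ℝ y (b j) = g.bil U f η x y := by
  simp only [bil, sum_mul]
  rw [sum_comm]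
  refine sum_congr rfl fun i _ => ?_
  rw [← b.sum_inner_mul_inner (g.evec U η i) y, mul_sum, mul_sum]
  refine sum_congr rfl fun j _ => ?_
  rw [real_inner_comm (b j) y]; ring

lemma contDiff_heat (s : ℝ) (η : κ → ℝ) {n : WithTop ℕ∞} : ContDiff ℝ n (g.heat U s η) :=
  contDiff_const.mul (Real.contDiff_exp.comp (contDiff_const.mul (g.contDiff_bil U _ η)))

lemma contDiff_character {n : WithTop ℕ∞} : ContDiff ℝ n (character U η) := by
  have h : ContDiff ℝ n fun u : W => (U.constr ℝ η u : ℝ) :=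
    (U.constr ℝ η : W →ₗ[ℝ] ℝ).toContinuousLinearMap.contDiff
  unfold character
  exact Complex.contDiff_exp.comp ((ofRealCLM.contDiff.comp h).mul contDiff_const)

/-- The lift of the fibre heat kernel to the group. -/
def heatLift (s : ℝ) (η : κ → ℝ) (p : V × W) : ℂ := (g.heat U s η p.1 : ℂ) * character U η p.2

lemma contDiff_heatLift (s : ℝ) (η : κ → ℝ) {n : WithTop ℕ∞} : ContDiff ℝ n (g.heatLift U s η) :=
  (ofRealCLM.contDiff.comp ((g.contDiff_heat U s η).comp contDiff_fst)).mul
    ((contDiff_character U η).comp contDiff_snd)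

/-- The logarithmic derivative of `heatLift` in the direction `Z`. -/
def heatSlope (s : ℝ) (η : κ → ℝ) (Z x : V) : ℂ :=
  (-(1 / 2) * g.bil U (cth s) η x Z : ℝ) + (1 / 2 * inner ℝ (g.J U η x) Z : ℝ) * I

lemma hasDerivAt_bil_line (f : ℝ → ℝ) (η : κ → ℝ) (x z : V) :
    HasDerivAt (fun t : ℝ => g.bil U f η (x + t • z) (x + t • z)) (2 * g.bil U f η x z) 0 := by
  simp_rw [bil_add_smul_self]
  have h1 : HasDerivAt (fun t : ℝ => 2 * t * g.bil U f η x z) (2 * 1 * g.bil U f η x z) 0 :=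
    ((hasDerivAt_id (0 : ℝ)).const_mul 2).mul_const _
  have h2 : HasDerivAt (fun t : ℝ => t ^ 2 * g.bil U f η z z)
      (((2 : ℕ) : ℝ) * 0 ^ (2 - 1) * g.bil U f η z z) 0 := (hasDerivAt_pow 2 (0 : ℝ)).mul_const _
  refine ((h1.const_add _).add h2).congr_deriv ?_
  simp

lemma leftInv_heatLift (s : ℝ) (η : κ → ℝ) (Z : V) (p : V × W) :
    g.leftInv (Z, 0) (g.heatLift U s η) p = g.heatSlope U s η Z p.1 * g.heatLift U s η p := by
  have h1 : HasDerivAt (fun t : ℝ => g.heat U s η (p.1 + t • Z))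
      (g.heat U s η p.1 * (-(1 / 2) * g.bil U (cth s) η p.1 Z)) 0 := by
    refine (((g.hasDerivAt_bil_line U (cth s) η p.1 Z).const_mul (-(1 / 4))).exp.const_mul
      (g.heatDiag U s η)).congr_deriv ?_
    simp only [zero_smul, add_zero, heat]
    ring
  have h2 : HasDerivAt (fun t : ℝ => character U η (p.2 + (t / 2) • g.bracket p.1 Z))
      (character U η p.2 * ((1 / 2 * inner ℝ (g.J U η p.1) Z : ℝ) * I)) 0 := by
    have h3 : HasDerivAt (fun t : ℝ => U.constr ℝ η (p.2 + (t / 2) • g.bracket p.1 Z))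
        (1 / 2 * inner ℝ (g.J U η p.1) Z) 0 := by
      simp only [map_add, map_smul, smul_eq_mul, g.inner_J]
      exact (((hasDerivAt_id (0 : ℝ)).div_const 2).mul_const _).const_add _
    refine ((h3.ofReal_comp).mul_const I).cexp.congr_deriv ?_
    simp [character]
  have h4 := (h1.ofReal_comp).mul h2
  refine (h4.congr_deriv ?_).congr_of_eventuallyEq ?_ |>.deriv
  · simp only [zero_smul, add_zero, zero_div, heatSlope, heatLift]
    push_cast
    ring
  · refine .of_forall fun t => ?_
    simp only [heatLift, mul, Pi.mul_apply, Prod.smul_mk, smul_zero, add_zero, map_smul,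
      smul_smul]
    rw [show (1 / 2 : ℝ) * t = t / 2 by ring]

lemma contDiff_heatSlope (s : ℝ) (η : κ → ℝ) (Z : V) {n : WithTop ℕ∞} :
    ContDiff ℝ n fun p : V × W => g.heatSlope U s η Z p.1 := by
  have h1 : ContDiff ℝ n fun p : V × W => -(1 / 2) * g.bil U (cth s) η p.1 Z :=
    contDiff_const.mul ((g.contDiff_bil_right U _ η Z).comp contDiff_fst)
  have h2 : ContDiff ℝ n fun p : V × W => 1 / 2 * inner ℝ (g.J U η p.1) Z :=
    contDiff_const.mul ((((g.J U η).toContinuousLinearMap.contDiff).comp contDiff_fst).inner ℝ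
      contDiff_const)
  exact (ofRealCLM.contDiff.comp h1).add ((ofRealCLM.contDiff.comp h2).mul contDiff_const)

lemma leftInv_heatSlope (s : ℝ) (η : κ → ℝ) (Z : V) (p : V × W) :
    g.leftInv (Z, 0) (fun p => g.heatSlope U s η Z p.1) p = g.heatSlope U s η Z Z := by
  have h : ∀ t : ℝ, g.heatSlope U s η Z ((g.mul p (t • (Z, 0))).1)
      = g.heatSlope U s η Z p.1 + t * g.heatSlope U s η Z Z := fun t => by
    simp only [heatSlope, mul, Prod.smul_mk, bil_add_left, bil_smul_left, map_add, map_smul,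
      inner_add_left, real_inner_smul_left]
    push_cast
    ring
  have h1 : HasDerivAt (fun t : ℝ => g.heatSlope U s η Z p.1 + t * g.heatSlope U s η Z Z)
      (g.heatSlope U s η Z Z) 0 := by
    refine (((hasDerivAt_id (0 : ℝ)).ofReal_comp.mul_const _).const_add _).congr_deriv ?_
    simp
  unfold leftInv
  simp_rw [h]
  exact h1.deriv

/-- The heat equation on a fibre. From `X_j h = slope_j · h` one gets `X_j² h = (X_j slope_j +
slope_j²) h`. Summed over `j` this gives the trace of `cth`, the forms of `cth²` and of `-J²`, and a
cross term that vanishes by `bil_J`. By the Riccati equation the real factor is the time derivative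
of the kernel. -/
lemma sublaplacian_heatLift (X : OrthonormalBasis ι ℝ V) (s : ℝ) (η : κ → ℝ) (p : V × W) :
    g.sublaplacian X (g.heatLift U s η) p = - ((g.heat U s η p.1 *
      (-(1 / 2) * ∑ i, cth s (g.ev U η i)
        - 1 / 4 * g.bil U (fun a => a - cth s a ^ 2) η p.1 p.1) : ℝ) : ℂ)
        * character U η p.2 := by
  have h1 : ∀ j, g.leftInv (X j, 0) (g.leftInv (X j, 0) (g.heatLift U s η)) p
      = ((-(1 / 2) * g.bil U (cth s) η (X j) (X j)
        + (1 / 4 * g.bil U (cth s) η p.1 (X j) ^ 2 - 1 / 4 * inner ℝ (g.J U η p.1) (X j) ^ 2) : ℝ)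
        - (1 / 2 * (g.bil U (cth s) η p.1 (X j) * inner ℝ (g.J U η p.1) (X j)) : ℝ) * I)
        * g.heatLift U s η p := fun j => by
    have h2 : g.leftInv (X j, 0) (g.heatLift U s η)
        = fun p => g.heatSlope U s η (X j) p.1 * g.heatLift U s η p :=
      funext fun p => g.leftInv_heatLift U s η (X j) p
    have h3 : inner ℝ (g.J U η (X j)) (X j) = 0 := by rw [inner_J, g.bracket_self, map_zero]
    rw [h2, g.leftInv_mul ((g.contDiff_heatSlope U s η (X j) (n := 1)).differentiable one_ne_zero)
      ((g.contDiff_heatLift U s η (n := 1)).differentiable one_ne_zero), leftInv_heatSlope,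
      leftInv_heatLift, heatSlope, heatSlope, h3]
    push_cast
    linear_combination (1 / 4 * (inner ℝ (g.J U η p.1) (X j) : ℂ) ^ 2 * g.heatLift U s η p)
      * I_sq
  unfold sublaplacian
  simp_rw [h1]
  rw [← sum_mul, sum_sub_distrib, ← sum_mul, ← ofReal_sum,
    ← ofReal_sum, ← mul_sum, sum_bil_mul_inner, bil_J, sum_add_distrib,
    sum_sub_distrib, ← mul_sum, ← mul_sum, ← mul_sum, sum_bil_self,
    sum_bil_sq, sum_inner_sq, ← bil_id, heatLift]
  have h4 : g.bil U (fun a => a - cth s a ^ 2) η p.1 p.1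
      = g.bil U (fun a => a) η p.1 p.1 - g.bil U (fun a => cth s a ^ 2) η p.1 p.1 := by
    simp only [bil, sub_mul, sum_sub_distrib]
  rw [h4]
  push_cast
  ring

end TwoStepAlgebra

/-! ### The joint spectral measure and the partial Fourier transform -/

lemma eLpNorm_two_sq {M : Type*} [MeasurableSpace M] (ν : Measure M) (f : M → ℂ) :
    eLpNorm f 2 ν ^ 2 = ∫⁻ p, ‖f p‖ₑ ^ 2 ∂ν := by
  rw [eLpNorm_eq_lintegral_rpow_enorm_toReal (by simp) (by simp), ← rpow_natCast,
    ← ENNReal.rpow_mul]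
  simp

namespace TwoStepAlgebra

lemma partialFourierL_res (hE : g.IsJointSpectralMeasure X U E) (k : κ) (f : Lp ℂ 2 𝔪) :
    partialFourierL U (E.res (fun a => a.2 k) f)
      = mulOp _ (bddMeas_res_snd (V := V) k) (partialFourierL U f) := by
  have hm : Measurable fun a : ℝ × (κ → ℝ) => a.2 k := (measurable_pi_apply k).comp measurable_snd
  refine g.partialFourierL_resolvent U k (fun f h => ?_) f
  rw [hE.2 k, E.mem_spectralGraph_iff hm]

/-- The density `|f̂|²` of an `L²` function on the Fourier side. -/
def fourierDensity (f : Lp ℂ 2 𝔪) : Measure (V × (κ → ℝ)) :=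
  ((volume : Measure V).prod volume).withDensity fun q => ‖partialFourierL U f q‖ₑ ^ 2

lemma measurable_partialFourierL (f : Lp ℂ 2 𝔪) :
    Measurable fun q => partialFourierL U f q := (Lp.stronglyMeasurable _).measurable

lemma fourierDensity_univ (f : Lp ℂ 2 𝔪) : g.fourierDensity U f univ = ofReal (‖f‖ ^ 2) := by
  rw [fourierDensity, withDensity_apply _ MeasurableSet.univ, setLIntegral_univ,
    ← (partialFourierL U).norm_map f, Lp.norm_def, ← toReal_pow, ofReal_toReal
      (pow_ne_top (Lp.eLpNorm_ne_top _)), eLpNorm_two_sq]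

instance (f : Lp ℂ 2 𝔪) : IsFiniteMeasure (g.fourierDensity U f) :=
  ⟨by rw [fourierDensity_univ]; exact ofReal_lt_top⟩

lemma inner_mulOp_partialFourierL {h : V × (κ → ℝ) → ℂ} (hh : BddMeas h) (f : Lp ℂ 2 𝔪) :
    inner ℂ (partialFourierL U f) (mulOp _ hh (partialFourierL U f))
      = ∫ q, h q ∂(g.fourierDensity U f) := by
  rw [inner_mulOp, fourierDensity, integral_withDensity_eq_integral_toReal_smul₀
    ((g.measurable_partialFourierL U f).enorm.pow_const 2).aemeasurable
    (.of_forall fun q => by simp)]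
  refine integral_congr_ae (.of_forall fun q => ?_)
  simp only [toReal_pow, toReal_enorm, real_smul]
  rw [← Complex.normSq_eq_conj_mul_self, normSq_eq_norm_sq]
  ring

/-- The marginal in `η` of a scalar spectral measure is that of `|f̂|²`. Functions of `η` whose
operators become multiplication operators form a star algebra, which contains the resolvents of the
coordinates. -/
lemma map_snd_scalarMeasure (hE : g.IsJointSpectralMeasure X U E) (f : Lp ℂ 2 𝔪) :
    (E.scalarMeasure f).map Prod.snd = (g.fourierDensity U f).map Prod.snd := by
  have hb : ∀ a : BoundedContinuousFunction (κ → ℝ) ℂ, BddMeas a := fun a =>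
    ⟨a.continuous.measurable, ‖a‖, a.norm_coe_le_norm⟩
  have hb1 : ∀ a : BoundedContinuousFunction (κ → ℝ) ℂ,
    BddMeas fun q : ℝ × (κ → ℝ) => a q.2 := fun a => (hb a).comp measurable_snd
  have hb2 : ∀ a : BoundedContinuousFunction (κ → ℝ) ℂ,
    BddMeas fun q : V × (κ → ℝ) => a q.2 := fun a => (hb a).comp measurable_snd
  let A : StarSubalgebra ℂ (BoundedContinuousFunction (κ → ℝ) ℂ) :=
    { carrier := {a | ∀ f, partialFourierL U (E.op (fun q => a q.2) f)
        = mulOp _ (hb2 a) (partialFourierL U f)}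
      mul_mem' := fun {a b} ha hb f => by
        have e1 := E.op_mul_apply (hb1 a) (hb1 b) f
        have e2 := mulOp_mul_apply _ (hb2 a) (hb2 b) (partialFourierL U f)
        exact (congrArg (partialFourierL U) e1).trans
          (((ha _).trans (congrArg _ (hb f))).trans e2.symm)
      add_mem' := fun {a b} ha hb f => by
        have e1 := E.op_add (hb1 a) (hb1 b)
        have e2 := mulOp_add_apply _ (hb2 a) (hb2 b) (partialFourierL U f)
        change partialFourierL U (E.op (fun x => a x.2 + b x.2) f) = _
        rw [e1, ContinuousLinearMap.add_apply, map_add, ha, hb]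
        exact e2.symm
      algebraMap_mem' := fun c f => by
        have e1 := E.op_const c
        have e2 := mulOp_const_apply _ c (partialFourierL U f)
        change partialFourierL U (E.op (fun x => c) f) = _
        rw [e1, ContinuousLinearMap.smul_apply, ContinuousLinearMap.one_apply, map_smul]
        exact e2.symm
      star_mem' := fun {a} ha f => by
        have e1 := E.op_conj (hb1 a)
        change partialFourierL U (E.op (fun x => conj (a x.2)) f) = _
        rw [e1]
        refine ext_inner_left ℂ fun m => ?_
        obtain ⟨m, rfl⟩ := (partialFourierL U).surjective m
        rw [LinearIsometryEquiv.inner_map_map, adjoint_inner_right,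
          ← (partialFourierL U).inner_map_map, ha m, inner_mulOp_conj]
        rfl }
  refine ext_of_forall_mem_subalgebra_integral_eq_of_pseudoEMetric_complete_countable
    (𝕜 := ℂ) (A := A) ?_ ?_
  · intro a b hab
    by_contra hcon
    apply hab
    ext k
    by_contra hne
    apply hcon
    have hm : Measurable fun a : κ → ℝ => a k := measurable_pi_apply k
    have hbnd := BddMeas.resolvent hm
    have hcont : Continuous fun a : κ → ℝ => ((a k : ℂ) - I)⁻¹ :=
      ((continuous_ofReal.comp (continuous_apply k)).sub continuous_const).inv₀
        fun a => ProjectionValuedMeasure.sub_I_ne_zero _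
    let r : BoundedContinuousFunction (κ → ℝ) ℂ := BoundedContinuousFunction.ofNormedAddCommGroup
      (fun a => ((a k : ℂ) - I)⁻¹) hcont hbnd.bdd.choose hbnd.bdd.choose_spec
    refine ⟨r, ⟨r.toContinuousMap, ⟨r, fun f => g.partialFourierL_res U hE k f, rfl⟩, rfl⟩,
      fun hr => hne ?_⟩
    have hr' : ((a k : ℂ) - I)⁻¹ = ((b k : ℂ) - I)⁻¹ := hr
    have := inv_injective hr'
    exact_mod_cast sub_left_injective this
  · intro a ha
    rw [integral_map measurable_snd.aemeasurable a.continuous.aestronglyMeasurable,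
      integral_map measurable_snd.aemeasurable a.continuous.aestronglyMeasurable,
      ← E.isIntegral_op (hb1 a), ← g.inner_mulOp_partialFourierL U (hb2 a) f, ← ha f,
      LinearIsometryEquiv.inner_map_map]

lemma partialFourierL_op_snd (hE : g.IsJointSpectralMeasure X U E) {h : (κ → ℝ) → ℂ}
    (hh : BddMeas h) (f : Lp ℂ 2 𝔪) :
    partialFourierL U (E.op (fun a => h a.2) f)
      = mulOp _ (hh.comp (measurable_snd (α := V))) (partialFourierL U f) := by
  have h1 : E.op (fun a => h a.2)
      = ((partialFourierL U).symm.toContinuousLinearEquiv.toContinuousLinearMap ∘L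
        mulOp _ (hh.comp (measurable_snd (α := V)))) ∘L
      (partialFourierL U).toContinuousLinearEquiv.toContinuousLinearMap := by
    refine E.op_eq (hh.comp measurable_snd) fun f => ?_
    change inner ℂ f ((partialFourierL U).symm (mulOp _ (hh.comp (measurable_snd (α := V)))
      (partialFourierL U f))) = _
    rw [← (partialFourierL U).inner_map_map, (partialFourierL U).apply_symm_apply,
      inner_mulOp_partialFourierL,
      ← integral_map (f := h) measurable_snd.aemeasurable hh.measurable.aestronglyMeasurable,
      ← integral_map (f := h) measurable_snd.aemeasurable hh.measurable.aestronglyMeasurable,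
      g.map_snd_scalarMeasure U hE]
  rw [h1]
  exact (partialFourierL U).apply_symm_apply _

/-! ### The weighted heat kernels on the group -/

/-- An integrable weight on the dual of the second layer. -/
def weight : ℝ := (1 + ‖η‖) ^ (-((Fintype.card κ : ℝ) + 1)) / (1 + ∑ i, g.ev U η i)

lemma sum_ev_nonneg : 0 ≤ ∑ i, g.ev U η i := sum_nonneg fun i _ => g.ev_nonneg U η i

lemma weight_pos : 0 < g.weight U η := by
  have := g.sum_ev_nonneg U η
  unfold weight
  positivity

lemma weight_le_one : g.weight U η ≤ 1 := by
  have := g.sum_ev_nonneg U η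
  rw [weight, div_le_one (by positivity)]
  refine (Real.rpow_le_one_of_one_le_of_nonpos (by linarith [norm_nonneg η]) ?_).trans (by linarith)
  have : (0 : ℝ) ≤ Fintype.card κ := Nat.cast_nonneg _
  linarith

lemma measurable_weight : Measurable (g.weight U) := by
  have h1 : Measurable fun η : κ → ℝ => ∑ i, g.ev U η i := g.measurable_sum_ev U continuous_id
  exact ((measurable_const.add measurable_norm).pow_const _).div (measurable_const.add h1)

/-- The power of `1 + ‖η‖` in the weight is just beyond the dimension, and the denominator cancels
the extra factor, so a dominating function survives for the time derivative of the heat kernel. -/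
lemma integrable_weight_mul : Integrable fun η : κ → ℝ => g.weight U η * (1 + ∑ i, g.ev U η i) := by
  have h : Integrable fun η : κ → ℝ => (1 + ‖η‖) ^ (-((Fintype.card κ : ℝ) + 1)) :=
    integrable_one_add_norm (by rw [Module.finrank_fintype_fun_eq_card]; linarith)
  refine h.congr (.of_forall fun η => ?_)
  have := g.sum_ev_nonneg U η
  simp only [weight]
  field_simp

lemma integrable_weight : Integrable (g.weight U) := by
  refine (g.integrable_weight_mul U).mono (g.measurable_weight U).aestronglyMeasurable
    (.of_forall fun η => ?_)
  have h1 := g.sum_ev_nonneg U η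
  have h2 := g.weight_pos U η
  rw [norm_mul, norm_of_nonneg h2.le, norm_of_nonneg (by linarith)]
  exact le_mul_of_one_le_right h2.le (by linarith)

lemma integrable_weight_sq : Integrable fun η => g.weight U η ^ 2 := by
  refine (g.integrable_weight U).mono ((g.measurable_weight U).pow_const 2).aestronglyMeasurable
    (.of_forall fun η => ?_)
  have h2 := g.weight_pos U η
  rw [norm_pow, norm_of_nonneg h2.le, sq]
  exact mul_le_of_le_one_left h2.le (g.weight_le_one U η)

lemma integrable_weight_sq_heatDiag (hs : 0 < s) :
    Integrable fun η => g.weight U η ^ 2 * g.heatDiag U s η := by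
  refine (g.integrable_weight_sq U).mul_bdd (c := (√(4 * π * s))⁻¹ ^ Module.finrank ℝ V)
    (g.measurable_heatDiag U hs).aestronglyMeasurable (.of_forall fun η => ?_)
  rw [norm_of_nonneg (g.heatDiag_pos U s η).le]
  exact g.heatDiag_le U hs η

/-- The partial Fourier transform of the weighted heat kernel. -/
def weightHeat (s : ℝ) (q : V × (κ → ℝ)) : ℂ := ((g.weight U q.2 * g.heat U s q.2 q.1 : ℝ) : ℂ)

lemma measurable_weightHeat (hs : 0 < s) : Measurable (g.weightHeat U s) :=
  measurable_ofReal.comp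
    (((g.measurable_weight U).comp measurable_snd).mul (g.measurable_heat U hs))

lemma integrable_weightHeat_mul (hs : 0 < s) (ht : 0 < t) :
    Integrable (fun q : V × (κ → ℝ) => g.weight U q.2 ^ 2 * (g.heat U s q.2 q.1 * g.heat U t q.2 q.1))
      ((volume : Measure V).prod volume) := by
  have hm : Measurable fun q : V × (κ → ℝ) =>
      g.weight U q.2 ^ 2 * (g.heat U s q.2 q.1 * g.heat U t q.2 q.1) :=
    (((g.measurable_weight U).comp measurable_snd).pow_const 2).mul
      ((g.measurable_heat U hs).mul (g.measurable_heat U ht))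
  rw [integrable_prod_iff' hm.aestronglyMeasurable]
  refine ⟨.of_forall fun η => (g.integrable_heat_mul_heat U hs ht η).const_mul (g.weight U η ^ 2), ?_⟩
  refine (g.integrable_weight_sq_heatDiag U (add_pos hs ht)).congr (.of_forall fun η => ?_)
  simp only
  rw [← g.integral_heat_mul_heat U hs ht, ← integral_const_mul]
  refine integral_congr_ae (.of_forall fun x => ?_)
  have h1 := g.heat_pos U s η x
  have h2 := g.heat_pos U t η x
  exact (norm_of_nonneg (by positivity)).symm

lemma memLp_weightHeat (hs : 0 < s) :
    MemLp (g.weightHeat U s) 2 ((volume : Measure V).prod volume) := by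
  refine (memLp_two_iff_integrable_sq_norm (g.measurable_weightHeat U hs).aestronglyMeasurable).2 ?_
  refine (g.integrable_weightHeat_mul U hs hs).congr (.of_forall fun q => ?_)
  simp only [weightHeat, norm_real, norm_mul, norm_eq_abs, mul_pow, sq_abs]
  ring

/-- The weighted heat kernel. -/
def heatVec (s : ℝ) : Lp ℂ 2 𝔪 := (partialFourierL U).symm (testLp _ (g.weightHeat U s))

lemma coeFn_partialFourierL_heatVec (hs : 0 < s) :
    partialFourierL U (g.heatVec U s) =ᵐ[(volume : Measure V).prod volume] g.weightHeat U s := by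
  rw [heatVec, LinearIsometryEquiv.apply_symm_apply]
  exact coeFn_testLp_of_memLp (g.memLp_weightHeat U hs)

/-- The inner products of the weighted heat kernels. -/
def heatPair (s : ℝ) : ℝ := ∫ η, g.weight U η ^ 2 * g.heatDiag U s η

lemma inner_heatVec (hs : 0 < s) (ht : 0 < t) :
    inner ℂ (g.heatVec U s) (g.heatVec U t) = g.heatPair U (s + t) := by
  have h1 : ∫ q : V × (κ → ℝ), g.weight U q.2 ^ 2 * (g.heat U s q.2 q.1 * g.heat U t q.2 q.1)
      ∂((volume : Measure V).prod volume) = g.heatPair U (s + t) := by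
    rw [integral_prod_symm _ (g.integrable_weightHeat_mul U hs ht), heatPair]
    refine integral_congr_ae (.of_forall fun η => ?_)
    simp only
    rw [integral_const_mul, g.integral_heat_mul_heat U hs ht]
  rw [← (partialFourierL U).inner_map_map, inner_Lp_eq, ← h1, ← integral_complex_ofReal]
  refine integral_congr_ae ?_
  filter_upwards [g.coeFn_partialFourierL_heatVec U hs, g.coeFn_partialFourierL_heatVec U ht]
    with q h2 h3
  rw [h2, h3, weightHeat, weightHeat, conj_ofReal, ← Complex.ofReal_mul]
  congr 1
  ring

lemma hasDerivAt_heatDiag (hs : 0 < s) (η : κ → ℝ) : HasDerivAt (fun s => g.heatDiag U s η)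
      (g.heatDiag U s η * (-(1 / 2) * ∑ i, cth s (g.ev U η i))) s :=
  ((HasDerivAt.fun_sum fun i _ => hasDerivAt_log_shc hs (g.ev U η i)).const_mul _).exp

/-- Near `s` the integrand is dominated by its value at `s / 2`, since `heatDiag` decreases in time.
-/
lemma continuousAt_heatPair (hs : 0 < s) : ContinuousAt (g.heatPair U) s := by
  refine continuousAt_of_dominated (bound := fun η => g.weight U η ^ 2 * g.heatDiag U (s / 2) η)
    ?_ ?_ (g.integrable_weight_sq_heatDiag U (half_pos hs)) (.of_forall fun η => ?_)
  · filter_upwards [Ioi_mem_nhds hs] with t ht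
    exact (g.integrable_weight_sq_heatDiag U ht).aestronglyMeasurable
  · filter_upwards [Ioi_mem_nhds (half_lt_self hs)] with t ht
    refine .of_forall fun η => ?_
    rw [norm_mul, norm_of_nonneg (sq_nonneg _), norm_of_nonneg (g.heatDiag_pos U t η).le]
    exact mul_le_mul_of_nonneg_left (g.heatDiag_antitone U η (half_pos hs) (le_of_lt ht))
      (sq_nonneg _)
  · exact ((g.hasDerivAt_heatDiag U hs η).continuousAt).const_mul _

/-- The inner product of two of these vectors depends only on the sum of the times, so squared
distances are combinations of values of `heatPair`. -/
lemma continuousOn_heatVec : ContinuousOn (g.heatVec U) (Ioi 0) := by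
  intro s hs
  refine ContinuousAt.continuousWithinAt ?_
  have hs' : (0 : ℝ) < s := hs
  have h1 : ∀ᶠ t in 𝓝 s, ‖g.heatVec U t - g.heatVec U s‖ ^ 2
      = g.heatPair U (t + t) - 2 * g.heatPair U (t + s) + g.heatPair U (s + s) := by
    filter_upwards [Ioi_mem_nhds hs'] with t ht
    have e : ∀ r, 0 < r → ‖g.heatVec U r‖ ^ 2 = g.heatPair U (r + r) := fun r hr => by
      have := g.inner_heatVec U hr hr
      rw [inner_self_eq_norm_sq_to_K] at this
      have h : ((‖g.heatVec U r‖ ^ 2 : ℝ) : ℂ) = (g.heatPair U (r + r) : ℂ) := by simpa using this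
      exact ofReal_injective h
    rw [@norm_sub_sq ℂ, e t ht, e s hs', g.inner_heatVec U ht hs']
    simp
  have hc := g.continuousAt_heatPair U (add_pos hs' hs')
  have h2 : Tendsto (fun t => g.heatPair U (t + t) - 2 * g.heatPair U (t + s)
      + g.heatPair U (s + s)) (𝓝 s) (𝓝 (g.heatPair U (s + s) - 2 * g.heatPair U (s + s)
      + g.heatPair U (s + s))) := by
    have a1 : Tendsto (fun t : ℝ => t + t) (𝓝 s) (𝓝 (s + s)) := tendsto_id.add tendsto_id
    have a2 : Tendsto (fun t : ℝ => t + s) (𝓝 s) (𝓝 (s + s)) := tendsto_id.add_const s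
    exact ((hc.tendsto.comp a1).sub ((hc.tendsto.comp a2).const_mul 2)).add_const _
  rw [show g.heatPair U (s + s) - 2 * g.heatPair U (s + s) + g.heatPair U (s + s) = 0 by ring] at h2
  have h3 := h2.congr' (h1.mono fun t ht => ht.symm)
  rw [ContinuousAt, tendsto_iff_norm_sub_tendsto_zero]
  have h4 := h3.sqrt
  simpa [sqrt_sq] using h4

/-! ### The heat equation on the group -/

lemma inner_testLp_heatVec (hφ : IsTest φ) (hs : 0 < s) : inner ℂ (testLp 𝔪 φ) (g.heatVec U s)
      = ∫ q, conj (partialFourier U φ q) * g.weightHeat U s q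
        ∂((volume : Measure V).prod volume) := by
  rw [← (partialFourierL U).inner_map_map, inner_Lp_eq]
  refine integral_congr_ae ?_
  filter_upwards [coeFn_partialFourierL U hφ, g.coeFn_partialFourierL_heatVec U hs] with q h1 h2
  rw [h1, h2]

/-- The time derivative of `heat`. -/
def heatDot (s : ℝ) (η : κ → ℝ) (x : V) : ℝ := g.heat U s η x * (-(1 / 2) * ∑ i, cth s (g.ev U η i)
        - 1 / 4 * g.bil U (fun a => a - cth s a ^ 2) η x x)

lemma measurable_heatDot (hs : 0 < s) :
    Measurable fun q : V × (κ → ℝ) => g.heatDot U s q.2 q.1 := by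
  have h1 : Measurable fun q : V × (κ → ℝ) => ∑ i, cth s (g.ev U q.2 i) :=
    (g.measurable_sum_ev U (continuous_cth hs)).comp measurable_snd
  have h2 := g.measurable_bil U (continuous_id.sub ((continuous_cth hs).pow 2))
  exact (g.measurable_heat U hs).mul ((h1.const_mul _).sub (h2.const_mul _))

lemma conj_partialFourier_mul (φ : V × W → ℂ) (f : V → (κ → ℝ) → ℝ) (q : V × (κ → ℝ)) :
    conj (partialFourier U φ q) * (f q.1 q.2 : ℂ)
      = fourierConst κ * ∫ u, ((f q.1 q.2 : ℂ) * character U q.2 u) *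
        conj (φ (q.1, u)) ∂U.addHaar := by
  rw [partialFourier, map_mul, conj_ofReal, ← integral_conj, _root_.mul_assoc, mul_comm
    (∫ _, _ ∂_), ← integral_const_mul]
  congr 1
  refine integral_congr_ae (.of_forall fun u => ?_)
  simp only [map_mul, conj_conj]
  ring

lemma norm_partialFourier_le (φ : V × W → ℂ) (q : V × (κ → ℝ)) :
    ‖partialFourier U φ q‖ ≤ fourierConst κ * ∫ u, ‖φ (q.1, u)‖ ∂U.addHaar := by
  rw [partialFourier, norm_mul, norm_real, norm_of_nonneg fourierConst_pos.le]
  refine mul_le_mul_of_nonneg_left ((norm_integral_le_integral_norm _).trans (le_of_eq ?_))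
    fourierConst_pos.le
  refine integral_congr_ae (.of_forall fun u => ?_)
  simp [norm_character]

/-- Both sides are pairings on the group with lifted functions such as `heatLift`. The lift is
smooth, though not in `L²`, and `φ` has compact support, so `L` may be moved from one to the other
and the fibre heat equation applied. -/
lemma integral_fibre_heat {X : OrthonormalBasis ι ℝ V} (hφ : IsTest φ) (s : ℝ) (η : κ → ℝ) :
    ∫ x, conj (partialFourier U φ (x, η)) * (g.heatDot U s η x : ℂ)
      = - ∫ x, conj (partialFourier U (g.sublaplacian X φ) (x, η))
        * (g.heat U s η x : ℂ) := by
  have hφ' := g.isTest_sublaplacian X hφ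
  have e1 : ∀ (ψ : V × W → ℂ) (f : V → (κ → ℝ) → ℝ), IsTest ψ → ContDiff ℝ ∞ (fun x => f x η) →
      ∫ x, conj (partialFourier U ψ (x, η)) * (f x η : ℂ) = fourierConst κ *
        ∫ p : V × W, ((f p.1 η : ℂ) * character U η p.2) * conj (ψ p) ∂𝔪 :=
    fun ψ f hψ hf => by
    have hs : ContDiff ℝ ∞ fun p : V × W => (f p.1 η : ℂ) * character U η p.2 :=
      (ofRealCLM.contDiff.comp (hf.comp contDiff_fst)).mul
        ((contDiff_character U η).comp contDiff_snd)
    have hi : Integrable (fun p : V × W => ((f p.1 η : ℂ) * character U η p.2) *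
        conj (ψ p)) 𝔪 := (IsTest.mul_left hs hψ.star).integrable
    rw [integral_prod _ hi, ← integral_const_mul]
    exact integral_congr_ae (.of_forall fun x => conj_partialFourier_mul U ψ f (x, η))
  have hdot : ContDiff ℝ ∞ fun x => g.heatDot U s η x :=
    (g.contDiff_heat U s η).mul (contDiff_const.sub (contDiff_const.mul (g.contDiff_bil U _ η)))
  have e2 := e1 φ (fun x η => g.heatDot U s η x) hφ hdot
  have e3 := e1 _ (fun x η => g.heat U s η x) hφ' (g.contDiff_heat U s η)
  have e4 := g.integral_mul_sublaplacian U X hφ.star (g.contDiff_heatLift U s η)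
  rw [e2, e3, ← mul_neg]
  congr 1
  simp_rw [g.sublaplacian_conj X hφ.contDiff, g.sublaplacian_heatLift U X] at e4
  change _ = - ∫ p, g.heatLift U s η p * _ ∂_
  rw [e4, ← integral_neg]
  refine integral_congr_ae (.of_forall fun p => ?_)
  simp only [heatDot]
  ring

lemma abs_heatDot_le (hs : 0 < s) (hst : s ≤ t) (η : κ → ℝ) (x : V) :
    |g.heatDot U t η x| ≤ (√(4 * π * s))⁻¹ ^ Module.finrank ℝ V *
        ((Module.finrank ℝ V * (1 + (s ^ 2)⁻¹) + (s ^ 2)⁻¹ * ‖x‖ ^ 2 + 1) *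
          (1 + ∑ i, g.ev U η i)) := by
  refine (g.abs_deriv_heat_le U (hs.trans_le hst) η x).trans ?_
  have := g.sum_ev_nonneg U η
  have := pi_pos
  gcongr

/-- The heat equation for `heatVec` in weak form: differentiation under the integral on the Fourier
side, then `integral_fibre_heat` for each `η`. -/
lemma hasDerivAt_inner_heatVec (X : OrthonormalBasis ι ℝ V) (hφ : IsTest φ) (hs : 0 < s) :
    HasDerivAt (fun s => inner ℂ (testLp 𝔪 φ) (g.heatVec U s))
      (- inner ℂ (testLp 𝔪 (g.sublaplacian X φ)) (g.heatVec U s)) s := by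
  have hφ' := g.isTest_sublaplacian X hφ
  -- Times beyond `s / 2` form a neighbourhood of `s` on which the derivative bound is uniform.
  set r := s / 2 with hr
  have hr0 : 0 < r := half_pos hs
  have hm : ∀ {ψ : V × W → ℂ}, IsTest ψ →
      AEStronglyMeasurable (fun q => conj (partialFourier U ψ q))
        ((volume : Measure V).prod volume) := fun hψ =>
    (continuous_conj.comp_stronglyMeasurable
      (stronglyMeasurable_partialFourier U hψ.continuous)).aestronglyMeasurable
  have hi : ∀ {ψ : V × W → ℂ}, IsTest ψ → ∀ {t : ℝ}, 0 < t →
      Integrable (fun q => conj (partialFourier U ψ q) * g.weightHeat U t q)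
        ((volume : Measure V).prod volume) := fun hψ t ht => by
    have h1 : MemLp (fun q => conj (partialFourier U _ q)) 2
      ((volume : Measure V).prod volume) := (memLp_partialFourier U hψ).star
    exact h1.integrable_mul (g.memLp_weightHeat U ht)
  set F' : ℝ → V × (κ → ℝ) → ℂ := fun t q => conj (partialFourier U φ q) *
    ((g.weight U q.2 * g.heatDot U t q.2 q.1 : ℝ) : ℂ) with hF'
  set bound : V × (κ → ℝ) → ℝ := fun q => ((fourierConst κ * ∫ u, ‖φ (q.1, u)‖ ∂U.addHaar) *
    ((√(4 * π * r))⁻¹ ^ Module.finrank ℝ V *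
      (Module.finrank ℝ V * (1 + (r ^ 2)⁻¹) + (r ^ 2)⁻¹ * ‖q.1‖ ^ 2 + 1))) *
      (g.weight U q.2 * (1 + ∑ i, g.ev U q.2 i)) with hbound
  have hbi : Integrable bound ((volume : Measure V).prod volume) := by
    refine Integrable.mul_prod (f := fun x => (fourierConst κ * ∫ u, ‖φ (x, u)‖ ∂U.addHaar) *
      ((√(4 * π * r))⁻¹ ^ Module.finrank ℝ V *
      (Module.finrank ℝ V * (1 + (r ^ 2)⁻¹) + (r ^ 2)⁻¹ * ‖x‖ ^ 2 + 1))) ?_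
      (g.integrable_weight_mul U)
    have hc : Continuous fun p : V × W => ‖φ p‖ * ((√(4 * π * r))⁻¹ ^ Module.finrank ℝ V *
        (Module.finrank ℝ V * (1 + (r ^ 2)⁻¹) + (r ^ 2)⁻¹ * ‖p.1‖ ^ 2 + 1)) := by
      have := hφ.continuous
      fun_prop
    have hint : Integrable (fun p : V × W => ‖φ p‖ * ((√(4 * π * r))⁻¹ ^ Module.finrank ℝ V *
        (Module.finrank ℝ V * (1 + (r ^ 2)⁻¹) + (r ^ 2)⁻¹ * ‖p.1‖ ^ 2 + 1))) 𝔪 :=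
      hc.integrable_of_hasCompactSupport (hφ.2.norm.mul_right)
    refine (hint.integral_prod_left.const_mul (fourierConst κ)).congr (.of_forall fun x => ?_)
    simp only [integral_mul_const]
    ring
  have key := hasDerivAt_integral_of_dominated_loc_of_deriv_le
    (F := fun t q => conj (partialFourier U φ q) * g.weightHeat U t q) (F' := F')
    (μ := (volume : Measure V).prod (volume : Measure (κ → ℝ))) (bound := bound)
    (s := Ioi r) (x₀ := s) (Ioi_mem_nhds (half_lt_self hs)) ?_ (hi hφ hs) ?_ ?_ hbi ?_
  · have hF'i := key.1
    have h2 := key.2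
    have h3 : ∫ q, F' s q ∂((volume : Measure V).prod volume)
        = - inner ℂ (testLp 𝔪 (g.sublaplacian X φ)) (g.heatVec U s) := by
      rw [g.inner_testLp_heatVec U hφ' hs, integral_prod_symm _ hF'i,
        integral_prod_symm _ (hi hφ' hs), ← integral_neg]
      refine integral_congr_ae (.of_forall fun η => ?_)
      have e1 : ∀ x, F' s (x, η) = g.weight U η * (conj (partialFourier U φ (x, η)) *
        (g.heatDot U s η x : ℂ)) := fun x => by simp only [hF']; push_cast; ring
      have e2 : ∀ x, conj (partialFourier U (g.sublaplacian X φ) (x, η)) *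
          g.weightHeat U s (x, η) = g.weight U η * (conj (partialFourier U
          (g.sublaplacian X φ) (x, η)) * (g.heat U s η x : ℂ)) := fun x => by
        simp only [weightHeat]; push_cast; ring
      simp only [e1, e2, integral_const_mul]
      rw [g.integral_fibre_heat U (X := X) hφ, mul_neg]
    rw [← h3]
    refine h2.congr_of_eventuallyEq ?_
    filter_upwards [Ioi_mem_nhds hs] with t ht
    exact g.inner_testLp_heatVec U hφ ht
  · filter_upwards [Ioi_mem_nhds hs] with t ht
    exact (hi hφ ht).aestronglyMeasurable
  · exact (hm hφ).mul (measurable_ofReal.comp (((g.measurable_weight U).comp measurable_snd).mul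
        (g.measurable_heatDot U hs))).aestronglyMeasurable
  · refine .of_forall fun q t ht => ?_
    have h1 := norm_partialFourier_le U φ q
    have h2 := g.abs_heatDot_le U hr0 (le_of_lt ht) q.2 q.1
    have h3 := g.weight_pos U q.2
    rw [hF', hbound]
    simp only
    rw [norm_mul, RCLike.norm_conj, norm_real, norm_mul, norm_of_nonneg h3.le,
      norm_eq_abs]
    refine (mul_le_mul h1 (mul_le_mul_of_nonneg_left h2 h3.le) (by positivity)
      ((norm_nonneg _).trans h1)).trans (le_of_eq ?_)
    ring
  · refine .of_forall fun q t ht => ?_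
    have h1 := ((g.hasDerivAt_heat U (hr0.trans ht) q.2 q.1).const_mul (g.weight U q.2)).ofReal_comp
    exact h1.const_mul _

end TwoStepAlgebra

/-! ### Spectral description of one-parameter semigroup orbits -/

namespace ProjectionValuedMeasure

variable {α F : Type*} [MeasurableSpace α] [NormedAddCommGroup F] [InnerProductSpace ℂ F]
  [CompleteSpace F] (E : ProjectionValuedMeasure α F)

/-- The truncated exponential `1_{|h| ≤ N} e^{-t h}`. -/
def expTrunc (h : α → ℝ) (N : ℕ) (t : ℝ) (a : α) : ℂ :=
  {a | |h a| ≤ N}.indicator (fun a => (exp (-t * h a) : ℂ)) a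

lemma exp_le_of_abs_le {t x : ℝ} {N : ℕ} (hx : |x| ≤ N) : exp (-t * x) ≤ exp (|t| * N) := by
  refine exp_le_exp.2 ((le_abs_self _).trans ?_)
  rw [abs_mul, abs_neg]
  exact mul_le_mul_of_nonneg_left hx (abs_nonneg _)

lemma norm_expTrunc_le (h : α → ℝ) (N : ℕ) (t : ℝ) (a : α) :
    ‖expTrunc h N t a‖ ≤ exp (|t| * N) := by
  rw [expTrunc]
  by_cases ha : a ∈ {a | |h a| ≤ N}
  · rw [indicator_of_mem ha, norm_real, norm_of_nonneg (exp_pos _).le]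
    exact exp_le_of_abs_le ha
  · rw [indicator_of_notMem ha, norm_zero]; positivity

lemma bddMeas_expTrunc {h : α → ℝ} (hh : Measurable h) (N : ℕ) (t : ℝ) :
    BddMeas (expTrunc h N t) := by
  have hm : MeasurableSet {a | |h a| ≤ N} := measurableSet_le hh.abs measurable_const
  exact ⟨(measurable_ofReal.comp (measurable_exp.comp (hh.const_mul _))).indicator hm,
    _, norm_expTrunc_le h N t⟩

/-- On the band `|h| ≤ N` the generator is bounded. The remainder is estimated in operator norm by
`|e^x - 1 - x| ≤ x²` for `|x| ≤ 1`. -/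
lemma hasDerivAt_op_expTrunc {h : α → ℝ} (hh : Measurable h) (N : ℕ) (f : F) (t : ℝ) :
    HasDerivAt (fun t => E.op (expTrunc h N t) f)
      (- E.op (trunc h N) (E.op (expTrunc h N t) f)) t := by
  have hb := bddMeas_expTrunc hh N
  have ht := bddMeas_trunc hh N
  rw [← E.op_mul_apply ht (hb t), hasDerivAt_iff_isLittleO_nhds_zero]
  have h1 : ∀ k : ℝ, E.op (expTrunc h N (t + k)) f - E.op (expTrunc h N t) f
      - k • (- E.op (fun a => trunc h N a * expTrunc h N t a) f)
      = E.op (fun a => expTrunc h N (t + k) a - expTrunc h N t a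
        - (-(k : ℂ)) * (trunc h N a * expTrunc h N t a)) f := fun k => by
    rw [E.op_sub ((hb _).sub (hb t)) ((BddMeas.const _).mul (ht.mul (hb t))),
      E.op_sub (hb _) (hb t), E.op_smul (ht.mul (hb t))]
    simp
  simp_rw [h1]
  refine Asymptotics.IsBigO.trans_isLittleO (g := fun k : ℝ => k ^ 2) ?_
    (by simpa using Asymptotics.isLittleO_pow_pow (𝕜 := ℝ) (m := 1) (n := 2) one_lt_two)
  refine Asymptotics.IsBigO.of_bound (exp (|t| * N) * N ^ 2 * ‖f‖) ?_
  have h2 : ∀ᶠ k : ℝ in 𝓝 0, |k| * N ≤ 1 := by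
    have : Tendsto (fun k : ℝ => |k| * N) (𝓝 0) (𝓝 (|0| * N)) :=
      (continuous_abs.tendsto 0).mul_const _
    rw [abs_zero, zero_mul] at this
    exact (this.eventually_lt_const one_pos).mono fun k hk => hk.le
  filter_upwards [h2] with k hk
  have h3 : ∀ a, ‖expTrunc h N (t + k) a - expTrunc h N t a
      - (-(k : ℂ)) * (trunc h N a * expTrunc h N t a)‖ ≤ exp (|t| * N) * N ^ 2 * k ^ 2 :=
    fun a => by
    by_cases ha : |h a| ≤ N
    · have e : ∀ t, expTrunc h N t a = (exp (-t * h a) : ℂ) := fun t =>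
        indicator_of_mem (s := {a | |h a| ≤ N}) ha _
      have e2 : expTrunc h N (t + k) a - expTrunc h N t a
          - (-(k : ℂ)) * (trunc h N a * expTrunc h N t a)
          = ((exp (-t * h a) * (exp (-k * h a) - 1 - (-k * h a)) : ℝ) : ℂ) := by
        rw [e, e, trunc_eq ha, show -(t + k) * h a = -t * h a + -k * h a by ring, exp_add]
        push_cast
        ring
      have hk1 : |-k * h a| ≤ 1 := by
        rw [abs_mul, abs_neg]
        exact (mul_le_mul_of_nonneg_left ha (abs_nonneg _)).trans hk
      rw [e2, norm_real, norm_mul, norm_of_nonneg (exp_pos _).le, _root_.mul_assoc]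
      refine mul_le_mul (exp_le_of_abs_le ha) ((Real.abs_exp_sub_one_sub_id_le hk1).trans ?_)
        (norm_nonneg _) (exp_pos _).le
      rw [mul_pow, neg_sq, mul_comm, ← sq_abs (h a)]
      exact mul_le_mul_of_nonneg_right (pow_le_pow_left₀ (abs_nonneg _) ha 2) (sq_nonneg _)
    · have e : ∀ t, expTrunc h N t a = 0 := fun t =>
        indicator_of_notMem (s := {a | |h a| ≤ N}) ha _
      rw [e, e]; simp; positivity
  refine (E.norm_op_le (((hb _).sub (hb t)).sub ((BddMeas.const _).mul (ht.mul (hb t))))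
    (by positivity) h3 f).trans (le_of_eq ?_)
  rw [norm_of_nonneg (sq_nonneg k)]
  ring

lemma inner_op_left_of_real {h : α → ℂ} (hh : BddMeas h) (hr : ∀ a, conj (h a) = h a) (f v : F) :
    inner ℂ (E.op h f) v = inner ℂ f (E.op h v) := by
  have h1 := E.op_conj hh
  simp_rw [hr] at h1
  rw [← adjoint_inner_right, ← h1]

lemma trunc_mul_expTrunc_zero (h : α → ℝ) (N : ℕ) :
    (fun a => trunc h N a * expTrunc h N 0 a) = trunc h N := by
  ext a
  by_cases ha : |h a| ≤ N
  · rw [expTrunc, indicator_of_mem (s := {a | |h a| ≤ N}) ha]; simp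
  · rw [trunc, indicator_of_notMem (s := {a | |h a| ≤ N}) ha, zero_mul]

lemma mul_expTrunc_zero (h : α → ℝ) (N : ℕ) :
    (fun a => (h a : ℂ) * expTrunc h N 0 a) = trunc h N := by
  ext a
  by_cases ha : |h a| ≤ N
  · rw [expTrunc, indicator_of_mem (s := {a | |h a| ≤ N}) ha, trunc_eq ha]; simp
  · rw [trunc, indicator_of_notMem (s := {a | |h a| ≤ N}) ha, expTrunc,
      indicator_of_notMem (s := {a | |h a| ≤ N}) ha, mul_zero]

lemma conj_trunc (h : α → ℝ) (N : ℕ) (a : α) : conj (trunc h N a) = trunc h N a := by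
  by_cases ha : |h a| ≤ N
  · rw [trunc_eq ha, conj_ofReal]
  · rw [trunc, indicator_of_notMem (s := {a | |h a| ≤ N}) ha, map_zero]

lemma conj_expTrunc (h : α → ℝ) (N : ℕ) (t : ℝ) (a : α) :
    conj (expTrunc h N t a) = expTrunc h N t a := by
  by_cases ha : |h a| ≤ N
  · rw [expTrunc, indicator_of_mem (s := {a | |h a| ≤ N}) ha, conj_ofReal]
  · rw [expTrunc, indicator_of_notMem (s := {a | |h a| ≤ N}) ha, map_zero]

/-- A form core on which `h` is nonnegative forces the spectral measure to live on `0 ≤ h`. -/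
lemma ae_nonneg_of_core {h : α → ℝ} (hh : Measurable h) {D : Set (F × F)}
    (hD : E.spectralGraph h ⊆ closure D) (hpos : ∀ p ∈ D, 0 ≤ (inner ℂ p.1 p.2).re) (f : F) :
    ∀ᵐ a ∂(E.scalarMeasure f), 0 ≤ h a := by
  have hpos' : ∀ p ∈ closure D, 0 ≤ (inner ℂ p.1 p.2).re := by
    have hc : Continuous fun p : F × F => (inner ℂ p.1 p.2).re :=
      Complex.continuous_re.comp (continuous_fst.inner continuous_snd)
    exact fun p hp => closure_minimal (t := {p : F × F | 0 ≤ (inner ℂ p.1 p.2).re}) hpos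
      (isClosed_le continuous_const hc) hp
  have h1 : ∀ N : ℕ, ∀ᵐ a ∂(E.scalarMeasure f), ¬ (h a < 0 ∧ -(N : ℝ) ≤ h a) := fun N => by
    set B : Set α := {a | h a < 0 ∧ -(N : ℝ) ≤ h a} with hB
    have hBm : MeasurableSet B :=
      (measurableSet_lt hh measurable_const).inter (measurableSet_le measurable_const hh)
    have hc : BddMeas (B.indicator fun _ => (1 : ℂ)) := (BddMeas.const 1).indicator hBm
    have hhc : BddMeas fun a => (h a : ℂ) * B.indicator (fun _ => (1 : ℂ)) a := by
      refine ⟨(measurable_ofReal.comp hh).mul hc.measurable, N, fun a => ?_⟩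
      by_cases ha : a ∈ B
      · rw [indicator_of_mem ha, mul_one, norm_real, norm_eq_abs, abs_of_neg ha.1]
        linarith [ha.2]
      · rw [indicator_of_notMem ha]; simp
    -- Positivity, tested on the vector `E(B) f`, gives `∫_B h ≥ 0`, although `h < 0` on `B`; so `B`
    -- is null.
    have h2 := hpos' _ (hD (E.op_mem_spectralGraph hh hc hhc f))
    simp only at h2
    rw [E.inner_op_op hc hhc] at h2
    have h3 : ∫ a, conj (B.indicator (fun _ => (1 : ℂ)) a) *
        ((h a : ℂ) * B.indicator (fun _ => (1 : ℂ)) a) ∂(E.scalarMeasure f)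
        = ((∫ a, B.indicator h a ∂(E.scalarMeasure f) : ℝ) : ℂ) := by
      rw [← integral_complex_ofReal]
      refine integral_congr_ae (.of_forall fun a => ?_)
      by_cases ha : a ∈ B
      · simp [ha]
      · simp [ha]
    rw [h3, ofReal_re] at h2
    have hint : Integrable (B.indicator h) (E.scalarMeasure f) := by
      refine (hhc.integrable (E.scalarMeasure f)).re.congr (.of_forall fun a => ?_)
      by_cases ha : a ∈ B
      · simp [ha]
      · simp [ha]
    have h4 : ∫ a, -B.indicator h a ∂(E.scalarMeasure f) = 0 := by
      refine le_antisymm ?_ (integral_nonneg fun a => ?_)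
      · rw [integral_neg]; linarith
      · by_cases ha : a ∈ B
        · simp [ha, ha.1.le]
        · simp [ha]
    rw [integral_eq_zero_iff_of_nonneg (f := fun a => -B.indicator h a) (fun a => ?_) hint.neg] at h4
    · filter_upwards [h4] with a ha hmem
      have : -B.indicator h a = 0 := ha
      rw [indicator_of_mem (show a ∈ B from hmem)] at this
      linarith [hmem.1]
    · by_cases ha : a ∈ B
      · simp [ha, ha.1.le]
      · simp [ha]
  filter_upwards [ae_all_iff.2 h1] with a ha
  by_contra hneg
  push Not at hneg
  obtain ⟨N, hN⟩ := exists_nat_ge (-h a)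
  exact ha N ⟨hneg, by linarith⟩

/-- The half-line exponential `1_{h ≥ 0} e^{-t h}`. -/
def expPos (h : α → ℝ) (t : ℝ) (a : α) : ℂ :=
  {a | 0 ≤ h a}.indicator (fun a => (exp (-t * h a) : ℂ)) a

lemma norm_expPos_le (h : α → ℝ) (ht : 0 ≤ t) (a : α) : ‖expPos h t a‖ ≤ 1 := by
  rw [expPos]
  by_cases ha : a ∈ {a | 0 ≤ h a}
  · rw [indicator_of_mem ha, norm_real, norm_of_nonneg (exp_pos _).le, exp_le_one_iff]
    have : 0 ≤ h a := ha
    nlinarith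
  · rw [indicator_of_notMem ha, norm_zero]; exact zero_le_one

lemma bddMeas_expPos {h : α → ℝ} (hh : Measurable h) (ht : 0 ≤ t) : BddMeas (expPos h t) := by
  have hm : MeasurableSet {a | 0 ≤ h a} := measurableSet_le measurable_const hh
  exact ⟨(measurable_ofReal.comp (measurable_exp.comp (hh.const_mul _))).indicator hm,
    1, norm_expPos_le h ht⟩

/-- Projected to the band `|h| ≤ N`, the orbit solves a linear ODE with bounded generator, and so
does the truncated exponential; both agree at time `s`. Only a weak equation tested on a core is
assumed. -/
lemma op_expTrunc_of_orbit {h : α → ℝ} (hh : Measurable h) {D : Set (F × F)}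
    (hD : E.spectralGraph h ⊆ closure D) {x : ℝ → F} (hx : ContinuousOn x (Ioi 0))
    (hderiv : ∀ p ∈ D, ∀ s, 0 < s → HasDerivAt (fun s => inner ℂ p.1 (x s)) (- inner ℂ p.2 (x s)) s)
    (N : ℕ) (hs : 0 < s) (hst : s ≤ t) :
    E.op (expTrunc h N 0) (x t) = E.op (expTrunc h N (t - s)) (x s) := by
  have hb := bddMeas_expTrunc hh N
  have ht := bddMeas_trunc hh N
  have hsub : ∀ {s t : ℝ}, 0 < s → 0 < t → uIcc s t ⊆ Ioi 0 := fun hs ht r hr =>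
    lt_of_lt_of_le (lt_min hs ht) hr.1
  have hxi : ∀ {s t : ℝ}, 0 < s → 0 < t → IntervalIntegrable x volume s t := fun hs ht =>
    (hx.mono (hsub hs ht)).intervalIntegrable
  -- The equation is used in integrated form because, unlike the differential form, it is a closed
  -- condition on `p` and extends from the core to the whole graph.
  have h1 : ∀ p ∈ closure D, ∀ s t, 0 < s → 0 < t →
      inner ℂ p.1 (x t - x s) = - inner ℂ p.2 (∫ r in s..t, x r) := by
    intro p hp s t hs ht
    refine closure_minimal (s := D) (t := {p : F × F | inner ℂ p.1 (x t - x s)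
      = - inner ℂ p.2 (∫ r in s..t, x r)}) (fun p hp => ?_) ?_ hp
    · have e1 := intervalIntegral.integral_eq_sub_of_hasDerivAt
        (f := fun s => inner ℂ p.1 (x s)) (f' := fun s => - inner ℂ p.2 (x s)) (a := s) (b := t)
        (fun r hr => hderiv p hp r (hsub hs ht hr))
        ((continuousOn_const.inner (hx.mono (hsub hs ht))).neg.intervalIntegrable)
      rw [intervalIntegral.integral_neg] at e1
      have e2 := (innerSL ℂ p.2).intervalIntegral_comp_comm (hxi hs ht)
      simp only [innerSL_apply_apply] at e2
      rw [mem_setOf_eq, inner_sub_right, ← e1, e2]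
    · exact isClosed_eq (continuous_fst.inner continuous_const)
        (continuous_snd.inner continuous_const).neg
  have h2 : ∀ s t, 0 < s → 0 < t → E.op (expTrunc h N 0) (x t)
      = E.op (expTrunc h N 0) (x s) - E.op (trunc h N) (∫ r in s..t, x r) := by
    intro s t hs ht'
    rw [eq_sub_iff_add_eq', ← eq_sub_iff_add_eq, ← map_sub, ← neg_sub (x t), map_neg]
    refine ext_inner_left ℂ fun f => ?_
    have hmem := E.op_mem_spectralGraph hh (hb 0) (by rw [mul_expTrunc_zero]; exact ht) f
    have e := h1 _ (hD hmem) s t hs ht'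
    simp only [mul_expTrunc_zero] at e
    rw [E.inner_op_left_of_real (hb 0) (conj_expTrunc h N 0),
      E.inner_op_left_of_real ht (conj_trunc h N)] at e
    rw [inner_neg_right, e, neg_neg]
  have h3 : ∀ s, 0 < s → HasDerivAt (fun t => E.op (expTrunc h N 0) (x t))
      (- E.op (trunc h N) (E.op (expTrunc h N 0) (x s))) s := by
    intro s hs
    rw [← E.op_mul_apply ht (hb 0), trunc_mul_expTrunc_zero]
    have hcs : ContinuousAt x s := hx.continuousAt (Ioi_mem_nhds hs)
    have e1 : HasDerivAt (fun t => ∫ r in s..t, x r) (x s) s :=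
      intervalIntegral.integral_hasDerivAt_right (hxi hs hs)
        (hx.stronglyMeasurableAtFilter isOpen_Ioi s hs) hcs
    have e2 : HasDerivAt (fun t => E.op (trunc h N) (∫ r in s..t, x r)) (E.op (trunc h N) (x s)) s :=
      ((E.op (trunc h N)).restrictScalars ℝ).hasFDerivAt.comp_hasDerivAt s e1
    refine (e2.const_sub (E.op (expTrunc h N 0) (x s))).congr_of_eventuallyEq ?_
    filter_upwards [Ioi_mem_nhds hs] with t ht'
    exact h2 s t hs ht'
  have h4 : ∀ r, HasDerivAt (fun t => E.op (expTrunc h N (t - s)) (x s))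
      (- E.op (trunc h N) (E.op (expTrunc h N (r - s)) (x s))) r := fun r =>
    (E.hasDerivAt_op_expTrunc hh N (x s) (r - s)).comp_sub_const r s
  have hL : LipschitzWith ‖E.op (trunc h N)‖₊ fun v : F => - E.op (trunc h N) v :=
    (E.op (trunc h N)).lipschitz.neg
  exact ODE_solution_unique_of_mem_Ioo (a := 0) (b := t + 1) (t₀ := s) (s := fun _ => univ)
    (v := fun _ v => - E.op (trunc h N) v)
    (f := fun t => E.op (expTrunc h N 0) (x t)) (g := fun t => E.op (expTrunc h N (t - s)) (x s))
    (fun _ _ => hL.lipschitzOnWith) ⟨hs, by linarith⟩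
    (fun r hr => ⟨h3 r hr.1, mem_univ _⟩) (fun r _ => ⟨h4 r, mem_univ _⟩) (by simp)
    ⟨hs.trans_le hst, by linarith⟩

/-- The limit `N → ∞` of the preceding identity. Nonnegativity of `h` on the spectrum keeps the
truncated exponentials uniformly bounded. -/
lemma orbit_eq_op_expPos {h : α → ℝ} (hh : Measurable h) {D : Set (F × F)}
    (hD : E.spectralGraph h ⊆ closure D) (hpos : ∀ p ∈ D, 0 ≤ (inner ℂ p.1 p.2).re)
    {x : ℝ → F} (hx : ContinuousOn x (Ioi 0))
    (hderiv : ∀ p ∈ D, ∀ s, 0 < s → HasDerivAt (fun s => inner ℂ p.1 (x s)) (- inner ℂ p.2 (x s)) s)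
    (hs : 0 < s) (ht : 0 ≤ t) : x (s + t) = E.op (expPos h t) (x s) := by
  have hb := bddMeas_expTrunc hh
  have hm0 : MeasurableSet {a | 0 ≤ h a} := measurableSet_le measurable_const hh
  have h1 : Tendsto (fun N : ℕ => E.op (expTrunc h N 0) (x (s + t))) atTop (𝓝 (x (s + t))) := by
    have := E.tendsto_op (h := fun N => expTrunc h N 0) (k := fun _ => 1) (C := 1)
      (fun N => hb N 0) (BddMeas.const 1)
      (fun N a => by simpa using norm_expTrunc_le h N 0 a) (x (s + t))
      (.of_forall fun a => by
        refine tendsto_const_nhds.congr' ?_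
        obtain ⟨M, hM⟩ := exists_nat_ge |h a|
        filter_upwards [eventually_ge_atTop M] with N hN
        rw [expTrunc, indicator_of_mem (s := {a | |h a| ≤ N}) (hM.trans (Nat.cast_le.2 hN))]
        simp)
    rwa [E.op_one] at this
  have hb' : ∀ N, BddMeas ({a | 0 ≤ h a}.indicator (expTrunc h N t)) :=
    fun N => (hb N t).indicator hm0
  have h2 : Tendsto (fun N : ℕ => E.op ({a | 0 ≤ h a}.indicator (expTrunc h N t)) (x s)) atTop
      (𝓝 (E.op (expPos h t) (x s))) := by
    refine E.tendsto_op (C := 1) hb' (bddMeas_expPos hh ht) (fun N a => ?_) (x s)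
      (.of_forall fun a => ?_)
    · by_cases ha : a ∈ {a | 0 ≤ h a}
      · refine le_trans (le_of_eq_of_le ?_ (norm_indicator_le_norm_self
          (s := {a | |h a| ≤ N}) (expPos h t) a)) (norm_expPos_le h ht a)
        rw [indicator_of_mem ha, expTrunc]
        congr 1
        by_cases hN : a ∈ {a | |h a| ≤ N}
        · rw [indicator_of_mem hN, indicator_of_mem hN, expPos, indicator_of_mem ha]
        · rw [indicator_of_notMem hN, indicator_of_notMem hN]
      · rw [indicator_of_notMem ha, norm_zero]; exact zero_le_one
    · refine tendsto_const_nhds.congr' ?_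
      obtain ⟨M, hM⟩ := exists_nat_ge |h a|
      filter_upwards [eventually_ge_atTop M] with N hN
      by_cases ha : a ∈ {a | 0 ≤ h a}
      · rw [indicator_of_mem ha, expTrunc, indicator_of_mem (s := {a | |h a| ≤ N})
          (hM.trans (Nat.cast_le.2 hN)), expPos, indicator_of_mem ha]
      · rw [indicator_of_notMem ha, expPos, indicator_of_notMem ha]
  refine tendsto_nhds_unique h1 (h2.congr fun N => ?_)
  rw [E.op_expTrunc_of_orbit hh hD hx hderiv N hs (t := s + t) (by linarith), add_sub_cancel_left]
  refine E.op_congr_ae (hb' N) (hb N t) (x s) ?_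
  filter_upwards [E.ae_nonneg_of_core hh hD hpos (x s)] with a ha
  exact indicator_of_mem (s := {a | 0 ≤ h a}) ha _

end ProjectionValuedMeasure

/-! ### The weighted heat kernels as an orbit of the heat semigroup. -/

namespace TwoStepAlgebra

lemma re_inner_testLp_sublaplacian_nonneg (X : ι → V) (hφ : IsTest φ) :
    0 ≤ (inner ℂ (testLp 𝔪 φ) (testLp 𝔪 (g.sublaplacian X φ))).re := by
  have h1 : inner ℂ (testLp 𝔪 φ) (testLp 𝔪 (g.sublaplacian X φ))
      = ∫ p, conj (φ p) * g.sublaplacian X φ p ∂𝔪 := by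
    rw [inner_testLp_left _ hφ]
    refine integral_congr_ae ?_
    filter_upwards [coeFn_testLp (ν := 𝔪) (g.isTest_sublaplacian X hφ)] with p hp
    rw [hp]
  have h2 : ∀ j, ∫ p, conj (φ p) * g.leftInv (X j, 0) (g.leftInv (X j, 0) φ) p ∂𝔪
      = - ((∫ p, ‖g.leftInv (X j, 0) φ p‖ ^ 2 ∂𝔪 : ℝ) : ℂ) := fun j => by
    rw [g.integral_leftInv_mul U (g.isTest_leftInv hφ _) hφ.star.contDiff, ← integral_complex_ofReal]
    congr 1
    refine integral_congr_ae (.of_forall fun p => ?_)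
    simp only
    rw [g.leftInv_conj hφ.differentiable, ← Complex.normSq_eq_conj_mul_self,
      normSq_eq_norm_sq]
  have h3 : inner ℂ (testLp 𝔪 φ) (testLp 𝔪 (g.sublaplacian X φ))
      = ((∑ j, ∫ p, ‖g.leftInv (X j, 0) φ p‖ ^ 2 ∂𝔪 : ℝ) : ℂ) := by
    rw [h1]
    simp only [sublaplacian, mul_neg, mul_sum]
    rw [integral_neg, integral_finsetSum _ fun j _ => ?_]
    · simp only [h2]; simp
    · exact (hφ.star.mul_right
        (g.isTest_leftInv (g.isTest_leftInv hφ (X j, 0)) (X j, 0)).contDiff).integrable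
  rw [h3, ofReal_re]
  exact sum_nonneg fun j _ => integral_nonneg fun p => sq_nonneg _

lemma heatVec_add (hE : g.IsJointSpectralMeasure X U E) (hs : 0 < s) (ht : 0 ≤ t) :
    g.heatVec U (s + t) = E.op (ProjectionValuedMeasure.expPos Prod.fst t) (g.heatVec U s) := by
  have hA := fun φ hφ => g.isTest_sublaplacian (φ := φ) X hφ
  refine E.orbit_eq_op_expPos measurable_fst
    (D := testGraph 𝔪 (g.sublaplacian X)) hE.1.ge (fun p hp => ?_)
    (g.continuousOn_heatVec U) (fun p hp r hr => ?_) hs ht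
  · obtain ⟨φ, hφ, rfl⟩ := (mem_testGraph_iff hA p).1 hp
    exact g.re_inner_testLp_sublaplacian_nonneg U X hφ
  · obtain ⟨φ, hφ, rfl⟩ := (mem_testGraph_iff hA p).1 hp
    exact g.hasDerivAt_inner_heatVec U X hφ hr

lemma ae_fst_nonneg (hE : g.IsJointSpectralMeasure X U E) (f : Lp ℂ 2 𝔪) :
    ∀ᵐ a ∂(E.scalarMeasure f), 0 ≤ a.1 := by
  refine E.ae_nonneg_of_core measurable_fst (D := testGraph 𝔪 (g.sublaplacian X))
    hE.1.ge (fun p hp => ?_) f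
  obtain ⟨φ, hφ, rfl⟩ := (mem_testGraph_iff (fun φ hφ => g.isTest_sublaplacian (φ := φ) X hφ) p).1 hp
  exact g.re_inner_testLp_sublaplacian_nonneg U X hφ

/-- The moments of the spectral measure of a weighted heat kernel over a set of frequencies. -/
lemma lintegral_exp_scalarMeasure_heatVec (hE : g.IsJointSpectralMeasure X U E) 
    (hs : 0 < s) (ht : 0 ≤ t) {B : Set (κ → ℝ)} (hB : MeasurableSet B) :
    ∫⁻ a in Prod.snd ⁻¹' B, ofReal (exp (-(2 * t) * a.1))
        ∂(E.scalarMeasure (g.heatVec U s))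
      = ∫⁻ η in B, ofReal (g.weight U η ^ 2 * g.heatDiag U (2 * s + 2 * t) η) := by
  have hb := ProjectionValuedMeasure.bddMeas_expPos
    (measurable_fst : Measurable (Prod.fst : ℝ × (κ → ℝ) → ℝ)) ht
  have hst : 0 < s + t := by linarith
  -- The mass that `heatVec (s + t) = e^{-tL} heatVec s` has over `B` is computed twice: through the
  -- spectral measure of `heatVec s`, and through the explicit density on the Fourier side.
  have h1 := congrArg (fun μ : Measure (κ → ℝ) => μ B)
    (g.map_snd_scalarMeasure U hE (g.heatVec U (s + t)))
  rw [Measure.map_apply measurable_snd hB, Measure.map_apply measurable_snd hB,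
    g.heatVec_add U hE hs ht, E.scalarMeasure_op hb, withDensity_apply _ (measurable_snd hB),
    ← g.heatVec_add U hE hs ht, fourierDensity, withDensity_apply _ (measurable_snd hB)] at h1
  have h2 : ∫⁻ a in Prod.snd ⁻¹' B, ofReal (exp (-(2 * t) * a.1))
      ∂(E.scalarMeasure (g.heatVec U s))
      = ∫⁻ a in Prod.snd ⁻¹' B, ‖ProjectionValuedMeasure.expPos Prod.fst t a‖ₑ ^ 2
        ∂(E.scalarMeasure (g.heatVec U s)) := by
    refine lintegral_congr_ae (ae_restrict_of_ae ?_)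
    filter_upwards [g.ae_fst_nonneg U hE (g.heatVec U s)] with a ha
    rw [ProjectionValuedMeasure.expPos, indicator_of_mem (s := {a : ℝ × (κ → ℝ) | 0 ≤ a.1}) ha,
      ← ofReal_norm, norm_real, norm_of_nonneg (exp_pos _).le,
      ← ofReal_pow (exp_pos _).le, ← exp_nat_mul]
    congr 2
    push_cast
    ring
  rw [h2, h1]
  have h3 : ∫⁻ q in Prod.snd ⁻¹' B, ‖partialFourierL U (g.heatVec U (s + t)) q‖ₑ ^ 2
      ∂((volume : Measure V).prod volume)
      = ∫⁻ q, (Prod.snd ⁻¹' B).indicator (fun q => ofReal (g.weight U q.2 ^ 2 *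
        (g.heat U (s + t) q.2 q.1 * g.heat U (s + t) q.2 q.1))) q
          ∂((volume : Measure V).prod volume) := by
    rw [lintegral_indicator (measurable_snd hB)]
    refine lintegral_congr_ae (ae_restrict_of_ae ?_)
    filter_upwards [g.coeFn_partialFourierL_heatVec U hst] with q hq
    rw [hq, weightHeat, ← ofReal_norm, norm_real, ← ofReal_pow (norm_nonneg _),
      norm_eq_abs, sq_abs]
    congr 1
    ring
  have hm : Measurable fun q : V × (κ → ℝ) => ofReal (g.weight U q.2 ^ 2 *
        (g.heat U (s + t) q.2 q.1 * g.heat U (s + t) q.2 q.1)) :=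
    ((((g.measurable_weight U).comp measurable_snd).pow_const 2).mul
      ((g.measurable_heat U hst).mul (g.measurable_heat U hst))).ennreal_ofReal
  rw [h3, lintegral_prod_symm' _ (hm.indicator (measurable_snd hB)), ← lintegral_indicator hB]
  refine lintegral_congr fun η => ?_
  by_cases hη : η ∈ B
  · have e : ∀ x : V, (x, η) ∈ (Prod.snd ⁻¹' B : Set (V × (κ → ℝ))) := fun x => hη
    simp only [indicator_of_mem (e _), indicator_of_mem hη]
    rw [← ofReal_integral_eq_lintegral_ofReal]
    · rw [integral_const_mul, g.integral_heat_mul_heat U hst hst]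
      ring_nf
    · exact (g.integrable_heat_mul_heat U hst hst η).const_mul _
    · refine .of_forall fun x => ?_
      have := g.heat_pos U (s + t) η x
      simp only [Pi.zero_apply]
      positivity
  · have e : ∀ x : V, (x, η) ∉ (Prod.snd ⁻¹' B : Set (V × (κ → ℝ))) := fun x => hη
    simp [indicator_of_notMem (e _), indicator_of_notMem hη]

end TwoStepAlgebra

/-! ### Uniqueness of measures with given exponential moments -/

/-- A bounded injective continuous function that equals `exp (-x)` on the half-line. -/
def expFold (x : ℝ) : ℝ := if 0 ≤ x then exp (-x) else 2 - exp x

lemma continuous_expFold : Continuous expFold := by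
  refine Continuous.if_le (by fun_prop) (by fun_prop) continuous_const continuous_id fun x hx => ?_
  rw [← hx]; norm_num

lemma injective_expFold : Injective expFold := by
  intro x y h
  simp only [expFold] at h
  split_ifs at h with hx hy hy
  · simpa using Real.exp_injective h
  · have h1 : exp (-x) ≤ 1 := exp_le_one_iff.2 (by linarith)
    have h2 : exp y < 1 := exp_lt_one_iff.2 (by linarith)
    linarith
  · have h1 : exp (-y) ≤ 1 := exp_le_one_iff.2 (by linarith)
    have h2 : exp x < 1 := exp_lt_one_iff.2 (by linarith)
    linarith
  · exact Real.exp_injective (by linarith)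

lemma norm_expFold_le (x : ℝ) : ‖expFold x‖ ≤ 2 := by
  rw [norm_eq_abs, abs_le]
  unfold expFold
  split_ifs with hx
  · have h1 : exp (-x) ≤ 1 := exp_le_one_iff.2 (by linarith)
    constructor <;> linarith [exp_pos (-x)]
  · have h2 : exp x < 1 := exp_lt_one_iff.2 (by linarith)
    constructor <;> linarith [exp_pos x]

/-- Polynomials in `expFold` form a star algebra of bounded functions that separates the points of
the line, and on the half-line its monomials are the functions `e^{-nx}`. The folding only replaces
the exponential where the measures have no mass. -/
lemma Measure.ext_of_lintegral_exp {μ ν : Measure ℝ} [IsFiniteMeasure μ] [IsFiniteMeasure ν]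
    (hμ : ∀ᵐ x ∂μ, 0 ≤ x) (hν : ∀ᵐ x ∂ν, 0 ≤ x)
    (h : ∀ n : ℕ, ∫⁻ x, ofReal (exp (-n * x)) ∂μ
      = ∫⁻ x, ofReal (exp (-n * x)) ∂ν) : μ = ν := by
  let A : StarSubalgebra ℂ (BoundedContinuousFunction ℝ ℂ) :=
    { carrier := {a | ∃ p : Polynomial ℂ, ∀ x, a x = p.eval (expFold x : ℂ)}
      mul_mem' := by
        rintro a b ⟨p, hp⟩ ⟨q, hq⟩
        exact ⟨p * q, fun x => by rw [Polynomial.eval_mul, ← hp, ← hq]; rfl⟩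
      add_mem' := by
        rintro a b ⟨p, hp⟩ ⟨q, hq⟩
        exact ⟨p + q, fun x => by rw [Polynomial.eval_add, ← hp, ← hq]; rfl⟩
      algebraMap_mem' := fun c => ⟨Polynomial.C c, fun x => by rw [Polynomial.eval_C]; rfl⟩
      star_mem' := by
        rintro a ⟨p, hp⟩
        refine ⟨p.map (starRingEnd ℂ), fun x => ?_⟩
        have e := Polynomial.eval₂_at_apply (p := p) conj (expFold x : ℂ)
        rw [conj_ofReal] at e
        rw [Polynomial.eval_map, e, ← hp]; rfl }
  refine ext_of_forall_mem_subalgebra_integral_eq_of_pseudoEMetric_complete_countable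
    (𝕜 := ℂ) (A := A) ?_ ?_
  · intro x y hxy
    let r : BoundedContinuousFunction ℝ ℂ := BoundedContinuousFunction.ofNormedAddCommGroup
      (fun x => (expFold x : ℂ)) (continuous_ofReal.comp continuous_expFold) 2
      (fun x => by rw [norm_real]; exact norm_expFold_le x)
    refine ⟨r, ⟨r.toContinuousMap, ⟨r, ⟨Polynomial.X, fun x => by rw [Polynomial.eval_X]; rfl⟩,
      rfl⟩, rfl⟩, fun hr => hxy (injective_expFold ?_)⟩
    have hr' : (expFold x : ℂ) = (expFold y : ℂ) := hr
    exact_mod_cast hr'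
  · rintro a ⟨p, hp⟩
    have hint : ∀ (ρ : Measure ℝ) [IsFiniteMeasure ρ] (n : ℕ),
        Integrable (fun x => (expFold x : ℂ) ^ n) ρ := fun ρ _ n => by
      refine Integrable.of_bound ((continuous_ofReal.comp
        continuous_expFold).pow n).aestronglyMeasurable (2 ^ n) (.of_forall fun x => ?_)
      rw [norm_pow, norm_real]
      exact pow_le_pow_left₀ (norm_nonneg _) (norm_expFold_le x) n
    have hmom : ∀ (ρ : Measure ℝ) [IsFiniteMeasure ρ] (n : ℕ), (∀ᵐ x ∂ρ, 0 ≤ x) →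
        ∫ x, (expFold x : ℂ) ^ n ∂ρ
        = ((∫⁻ x, ofReal (exp (-n * x)) ∂ρ).toReal : ℂ) := fun ρ _ n hρ => by
      rw [← integral_eq_lintegral_of_nonneg_ae (.of_forall fun x =>
        (exp_pos _).le) (by fun_prop), ← integral_complex_ofReal]
      refine integral_congr_ae ?_
      filter_upwards [hρ] with x hx
      rw [expFold, if_pos hx, ← Complex.ofReal_pow, ← exp_nat_mul]
      congr 2
      ring
    simp_rw [hp, Polynomial.eval_eq_sum_range]
    rw [integral_finsetSum _ fun n _ => (hint μ n).const_mul _,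
      integral_finsetSum _ fun n _ => (hint ν n).const_mul _]
    refine sum_congr rfl fun n _ => ?_
    rw [integral_const_mul, integral_const_mul, hmom μ n hμ, hmom ν n hν, h n]

namespace TwoStepAlgebra

/-- The spectral measure of a weighted heat kernel in terms of a family of measures on the line
whose Laplace transforms are the traces of the fibre heat kernels. -/
lemma lintegral_scalarMeasure_heatVec (hE : g.IsJointSpectralMeasure X U E) {s C : ℝ}
    (hs : 0 < s) (hC : 0 < C) (m : (κ → ℝ) → Measure ℝ) (hm0 : ∀ᵐ η, ∀ᵐ x ∂(m η), 0 ≤ x)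
    (hm : ∀ᵐ η, ∀ r, 0 < r → ∫⁻ x, ofReal (exp (-r * x)) ∂(m η)
      = ofReal (C * g.heatDiag U r η))
    {F : ℝ × (κ → ℝ) → ENNReal} (hF : Measurable F) :
    ∫⁻ a, F a ∂(E.scalarMeasure (g.heatVec U s))
      = ∫⁻ η, ofReal (C⁻¹ * g.weight U η ^ 2) *
        ∫⁻ x, ofReal (exp (-(2 * s) * x)) * F (x, η) ∂(m η) := by
  -- The coordinates are exchanged so that disintegration gives conditional measures on the line for
  -- each `η`.
  set τ := (E.scalarMeasure (g.heatVec U s)).map Prod.swap with hτ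
  have hM : ∀ r, 0 < r → Measurable fun η => ofReal (g.weight U η ^ 2 * g.heatDiag U r η) :=
    fun r hr => (((g.measurable_weight U).pow_const 2).mul
      (g.measurable_heatDiag U hr)).ennreal_ofReal
  have h2s : 0 < 2 * s := by linarith
  have hpos : ∀ r η, 0 < g.weight U η ^ 2 * g.heatDiag U r η := fun r η =>
    mul_pos (pow_pos (g.weight_pos U η) 2) (g.heatDiag_pos U r η)
  have hmom : ∀ (n : ℕ) (B : Set (κ → ℝ)), MeasurableSet B →
      ∫⁻ q in B ×ˢ univ, ofReal (exp (-n * q.2)) ∂τ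
        = ∫⁻ η in B, ofReal (g.weight U η ^ 2 * g.heatDiag U (2 * s + n) η) := by
    intro n B hB
    rw [hτ, setLIntegral_map (hB.prod MeasurableSet.univ) (by fun_prop) measurable_swap]
    have h := g.lintegral_exp_scalarMeasure_heatVec U hE hs (t := (n : ℝ) / 2) (by positivity) hB
    rw [mul_div_cancel₀ _ (two_ne_zero' ℝ)] at h
    rw [← h]
    congr 2
    ext q; simp
  have hfst : τ.fst = volume.withDensity
      fun η => ofReal (g.weight U η ^ 2 * g.heatDiag U (2 * s) η) := by
    ext B hB
    have h := hmom 0 B hB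
    simp only [Nat.cast_zero, neg_zero, MulZeroClass.zero_mul, Real.exp_zero, ofReal_one,
      lintegral_const, one_mul, Measure.restrict_apply MeasurableSet.univ, univ_inter, add_zero] at h
    rw [Measure.fst_apply hB, withDensity_apply _ hB, ← h, prod_univ]
  -- The marginal has a positive density, so statements that hold almost everywhere for it also hold
  -- for Lebesgue measure.
  have hac : volume ≪ τ.fst := by
    rw [hfst]
    exact withDensity_absolutelyContinuous' (hM _ h2s).aemeasurable
      (.of_forall fun η => (ofReal_pos.2 (hpos _ η)).ne')
  -- The exponential moments of almost every conditional measure, read off from the moments over all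
  -- sets `B` of frequencies.
  have h1 : ∀ n : ℕ, ∀ᵐ η, ofReal (g.weight U η ^ 2 * g.heatDiag U (2 * s) η) *
      ∫⁻ x, ofReal (exp (-n * x)) ∂(τ.condKernel η)
      = ofReal (g.weight U η ^ 2 * g.heatDiag U (2 * s + n) η) := by
    intro n
    have hk : Measurable fun η => ∫⁻ x, ofReal (exp (-n * x)) ∂(τ.condKernel η) :=
      Measurable.lintegral_kernel (by fun_prop)
    refine ae_eq_of_forall_setLIntegral_eq_of_sigmaFinite ((hM _ h2s).mul hk)
      (hM _ (by positivity)) fun B hB _ => ?_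
    rw [← hmom n B hB, ← Measure.setLIntegral_condKernel_univ_right (by fun_prop) hB, hfst,
      restrict_withDensity hB, lintegral_withDensity_eq_lintegral_mul _ (hM _ h2s) hk]
    rfl
  have h2 : ∀ᵐ η, ∀ᵐ x ∂(τ.condKernel η), 0 ≤ x := by
    refine hac.ae_le ?_
    have h3 : ∀ᵐ q ∂τ, 0 ≤ q.2 := by
      rw [hτ, ae_map_iff measurable_swap.aemeasurable
        (measurableSet_le measurable_const measurable_snd)]
      exact g.ae_fst_nonneg U hE _
    rw [← τ.disintegrate τ.condKernel] at h3
    exact Measure.ae_ae_of_ae_compProd h3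
  -- Both measures are finite, live on the half-line and have the same integer exponential moments.
  -- Countably many moments suffice, so one null set of `η` is discarded.
  have h3 : ∀ᵐ η, τ.condKernel η = ofReal (C * g.heatDiag U (2 * s) η)⁻¹ •
      (m η).withDensity fun x => ofReal (exp (-(2 * s) * x)) := by
    filter_upwards [ae_all_iff.2 h1, h2, hm0, hm] with η e1 e2 e3 e4
    have hH := g.heatDiag_pos U (2 * s) η
    have hfin : IsFiniteMeasure ((m η).withDensity fun x =>
        ofReal (exp (-(2 * s) * x))) :=
      ⟨by rw [withDensity_apply _ MeasurableSet.univ, setLIntegral_univ, e4 _ h2s]; simp⟩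
    have hfin2 : IsFiniteMeasure (ofReal (C * g.heatDiag U (2 * s) η)⁻¹ •
      (m η).withDensity fun x => ofReal (exp (-(2 * s) * x))) :=
      Measure.smul_finite _ ofReal_ne_top
    refine Measure.ext_of_lintegral_exp e2 ?_ fun n => ?_
    · exact Measure.ae_smul_measure ((withDensity_absolutelyContinuous _ _).ae_le e3) _
    · rw [lintegral_smul_measure, lintegral_withDensity_eq_lintegral_mul _ (by fun_prop)
        (by fun_prop)]
      have e5 : ∀ x : ℝ, ((fun x => ofReal (exp (-(2 * s) * x))) * fun x =>
          ofReal (exp (-n * x))) x = ofReal (exp (-(2 * s + n) * x)) :=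
        fun x => by
          rw [Pi.mul_apply, ← ofReal_mul (exp_pos _).le, ← exp_add]
          ring_nf
      simp_rw [e5]
      rw [e4 _ (by positivity), smul_eq_mul, ← ofReal_mul (by positivity)]
      have e6 := e1 n
      rw [← ENNReal.eq_div_iff (ofReal_pos.2 (hpos _ η)).ne' ofReal_ne_top,
        ← ENNReal.ofReal_div_of_pos (hpos _ η)] at e6
      rw [e6]
      congr 1
      have := g.weight_pos U η
      field_simp
  have hFs : Measurable fun q : (κ → ℝ) × ℝ => F q.swap := hF.comp measurable_swap
  have h4 : ∫⁻ a, F a ∂(E.scalarMeasure (g.heatVec U s)) = ∫⁻ q, F q.swap ∂τ := by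
    rw [hτ, lintegral_map hFs measurable_swap]; simp
  rw [h4, ← Measure.lintegral_condKernel hFs, hfst, lintegral_withDensity_eq_lintegral_mul _ (hM _ h2s)
    (hFs.lintegral_kernel_prod_right')]
  refine lintegral_congr_ae ?_
  filter_upwards [h3] with η e
  have hFη : Measurable fun x => F (x, η) := hF.comp measurable_prodMk_right
  rw [Pi.mul_apply, e, lintegral_smul_measure, lintegral_withDensity_eq_lintegral_mul _
    (by fun_prop) (by simpa using hFη), smul_eq_mul, ← _root_.mul_assoc,
    ← ofReal_mul (hpos _ η).le]
  congr 2
  have := g.heatDiag_pos U (2 * s) η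
  field_simp

end TwoStepAlgebra

/-! ### Zero sets of polynomials -/

lemma continuous_mvPolynomial_eval {κ : Type*} (p : MvPolynomial κ ℝ) :
    Continuous fun η : κ → ℝ => MvPolynomial.eval η p := MvPolynomial.continuous_eval p

/-- On each line `t ↦ η₀ + t x` the polynomial is nonzero at `t = 0`, hence has finitely many zeros.
Fubini gives some `t ≠ 0` for which the set of bad `x` is null, and scaling and translating this set
gives the zero set. -/
lemma volume_zeros_mvPolynomial {κ : Type*} [Fintype κ] {p : MvPolynomial κ ℝ} {η₀ : κ → ℝ}
    (h0 : MvPolynomial.eval η₀ p ≠ 0) : volume {η : κ → ℝ | MvPolynomial.eval η p = 0} = 0 := by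
  set Z : Set (κ → ℝ) := {x | MvPolynomial.eval (η₀ + x) p = 0} with hZ
  have hc : Continuous fun q : (κ → ℝ) × ℝ => MvPolynomial.eval (η₀ + q.2 • q.1) p :=
    (continuous_mvPolynomial_eval p).comp (by fun_prop)
  have h1 : ((volume : Measure (κ → ℝ)).prod (volume : Measure ℝ))
      {q | MvPolynomial.eval (η₀ + q.2 • q.1) p = 0} = 0 := by
    rw [Measure.measure_prod_null (measurableSet_eq_fun hc.measurable measurable_const)]
    refine .of_forall fun x => ?_
    set q : Polynomial ℝ := MvPolynomial.aeval
      (fun k => Polynomial.C (η₀ k) + Polynomial.X * Polynomial.C (x k)) p with hq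
    have e : ∀ t : ℝ, q.eval t = MvPolynomial.eval (η₀ + t • x) p := fun t => by
      rw [hq, ← Polynomial.coe_evalRingHom, MvPolynomial.aeval_def, MvPolynomial.eval₂_eq',
        map_sum, MvPolynomial.eval_eq']
      refine sum_congr rfl fun d _ => ?_
      rw [map_mul, map_prod]
      congr 1
      · simp
      · refine prod_congr rfl fun i _ => ?_
        simp [mul_comm (x i)]
    have hq0 : q ≠ 0 := fun h => h0 (by rw [h] at e; simpa using (e 0).symm)
    refine measure_mono_null (fun t ht => ?_) (q.roots.toFinset.finite_toSet.measure_zero volume)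
    have ht' : MvPolynomial.eval (η₀ + t • x) p = 0 := ht
    simpa [hq0, e] using ht'
  rw [Measure.prod_apply_symm (measurableSet_eq_fun hc.measurable measurable_const),
    lintegral_eq_zero_iff (measurable_measure_prodMk_right
      (measurableSet_eq_fun hc.measurable measurable_const))] at h1
  obtain ⟨t, ht, ht0⟩ := (h1.and (measure_eq_zero_iff_ae_notMem.1
    (Real.volume_singleton (a := 0)))).exists
  have h2 : volume ((fun x : κ → ℝ => t • x) ⁻¹' Z) = 0 := ht
  rw [Measure.addHaar_preimage_smul _ ht0] at h2
  have h3 : volume Z = 0 := by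
    refine (mul_eq_zero.1 h2).resolve_left ?_
    have ht1 : t ≠ 0 := ht0
    simpa using pow_pos (abs_pos.2 ht1) _
  have h4 := measure_preimage_add (volume : Measure (κ → ℝ)) (-η₀) Z
  rw [h3] at h4
  rw [← h4]
  congr 1
  ext η
  simp [hZ]

lemma ENNReal.tsum_pi_prod {k : ℕ} (f : Fin k → ℕ → ENNReal) :
    ∑' n : Fin k → ℕ, ∏ j, f j (n j) = ∏ j, ∑' a, f j a := by
  induction k with
  | zero => simp
  | succ k ih =>
    rw [← (Fin.consEquiv fun _ : Fin (k + 1) => ℕ).tsum_eq, ENNReal.tsum_prod', Fin.prod_univ_succ,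
      ← ih, ← ENNReal.tsum_mul_right]
    refine tsum_congr fun a => ?_
    rw [← ENNReal.tsum_mul_left]
    refine tsum_congr fun m => ?_
    rw [Fin.prod_univ_succ]
    simp [Fin.consEquiv]

lemma hasSum_choose_mul_pow {r : ℕ} (hr : 0 < r) {x : ℝ} (hx0 : 0 ≤ x) (hx : x < 1) :
    HasSum (fun n : ℕ => ((n + r - 1).choose n : ℝ) * x ^ n) (((1 - x) ^ r)⁻¹) := by
  obtain ⟨k, rfl⟩ : ∃ k, r = k + 1 := ⟨r - 1, by omega⟩
  have h := hasSum_choose_mul_geometric_of_norm_lt_one k (r := x) (by rwa [norm_of_nonneg hx0])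
  rw [one_div] at h
  refine h.congr_fun fun n => ?_
  rw [show n + (k + 1) - 1 = n + k by omega, Nat.choose_symm_add]

/-! ### Plancherel measures of the fibres and their Laplace transforms. -/

namespace TwoStepAlgebra

/-- For `r₀ > 0` this is the Gamma integral; the normalization of `sigma` makes the result the power
`r₀` of a one-dimensional factor. -/
lemma lintegral_exp_sigma (r₀ : ℕ) (hs : 0 < s) : ∫⁻ μ, ofReal (exp (-s * μ)) ∂(sigma r₀)
      = ofReal (√(π / s) ^ r₀) := by
  rw [sigma]
  split_ifs with h
  · simp [h]
  have hr : (0 : ℝ) < r₀ / 2 := by have : 0 < r₀ := Nat.pos_of_ne_zero h; positivity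
  have hG := Real.Gamma_pos_of_pos hr
  have hpi := pi_pos
  rw [lintegral_withDensity_eq_lintegral_mul _ (by fun_prop) (by fun_prop)]
  have e : ∀ x ∈ Ioi (0 : ℝ), ((fun μ => ofReal (π ^ ((r₀ : ℝ) / 2) /
      Gamma ((r₀ : ℝ) / 2) * (μ ^ ((r₀ : ℝ) / 2) / μ))) *
      fun μ => ofReal (exp (-s * μ))) x
      = ofReal (π ^ ((r₀ : ℝ) / 2) / Gamma ((r₀ : ℝ) / 2) *
        (x ^ ((r₀ : ℝ) / 2 - 1) * exp (-(s * x)))) := fun x hx => by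
    have hx : 0 < x := hx
    rw [Pi.mul_apply, ← ofReal_mul (by positivity), Real.rpow_sub_one hx.ne']
    ring_nf
  have hI := Real.integral_rpow_mul_exp_neg_mul_Ioi hr hs
  have hint : IntegrableOn (fun x : ℝ => x ^ ((r₀ : ℝ) / 2 - 1) * exp (-(s * x))) (Ioi 0) := by
    by_contra hcon
    rw [integral_undef hcon] at hI
    have : 0 < (1 / s) ^ ((r₀ : ℝ) / 2) * Gamma ((r₀ : ℝ) / 2) := by positivity
    linarith
  rw [setLIntegral_congr_fun measurableSet_Ioi e, ← ofReal_integral_eq_lintegral_ofReal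
    (hint.const_mul _), integral_const_mul, hI]
  · congr 1
    rw [sqrt_eq_rpow, ← Real.rpow_natCast, ← Real.rpow_mul (by positivity),
      Real.div_rpow hpi.le hs.le, one_div, Real.inv_rpow hs.le,
      show (1 / 2 : ℝ) * r₀ = r₀ / 2 by ring]
    field_simp
  · filter_upwards [self_mem_ae_restrict measurableSet_Ioi] with x hx
    have hx : 0 < x := hx
    simp only [Pi.zero_apply]
    positivity

lemma ae_sigma_nonneg (r₀ : ℕ) : ∀ᵐ μ ∂(sigma r₀), 0 ≤ μ := by
  rw [sigma]
  split_ifs with h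
  · simp [ae_dirac_eq]
  · refine (withDensity_absolutelyContinuous _ _).ae_le ?_
    filter_upwards [self_mem_ae_restrict measurableSet_Ioi] with x hx
    exact le_of_lt hx

namespace SpectralData

variable {g U} (S : g.SpectralData U)

/-- The weight of the Plancherel formula at `n`. -/
def coef (n : Fin S.d₁ → ℕ) (η : κ → ℝ) : ℝ :=
  ∏ j, (S.b j η ^ S.r j * ((n j + S.r j - 1).choose (n j) : ℝ))

/-- The point of the spectrum attached to `n`. -/
def level (n : Fin S.d₁ → ℕ) (η : κ → ℝ) : ℝ := ∑ j, (2 * (n j : ℝ) + S.r j) * S.b j η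

/-- The Plancherel measure of the fibre over `η`. -/
def fibreMeasure : Measure ℝ := Measure.sum fun n => ofReal (S.coef n η) •
    (sigma S.r₀).map (fun μ => S.level n η + μ)

lemma ae_mem_dom : ∀ᵐ η, η ∈ S.dom := by
  obtain ⟨P, hP⟩ := S.dom_zariski_open
  obtain ⟨η₀, h⟩ := S.dom_nonempty
  rw [hP] at h
  obtain ⟨p, hp, h0⟩ := h
  refine measure_mono_null (fun η hη => ?_) (volume_zeros_mvPolynomial h0)
  by_contra hcon
  exact hη (by rw [hP]; exact ⟨p, hp, hcon⟩)

lemma map_ev_eq {η : κ → ℝ} (hη : η ∈ S.dom) : Multiset.map (g.ev U η) Finset.univ.val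
      = S.r₀ • {0} + ∑ j, (2 * S.r j) • {S.b j η ^ 2} := by
  have h1 := (g.isSymmetric_negJSq U η).roots_charpoly_eq_eigenvalues rfl
  have h2 : (g.negJSq U η).charpoly = _ := S.charpoly_eq η hη
  have hne : (∏ j, (Polynomial.X - Polynomial.C (S.b j η ^ 2)) ^ (2 * S.r j)) ≠ 0 :=
    prod_ne_zero_iff.2 fun j _ => pow_ne_zero _ (Polynomial.X_sub_C_ne_zero _)
  rw [h2, Polynomial.roots_mul (mul_ne_zero (pow_ne_zero _ Polynomial.X_ne_zero) hne),
    Polynomial.roots_X_pow, Polynomial.roots_prod _ _ hne] at h1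
  simp only [Polynomial.roots_pow, Polynomial.roots_X_sub_C] at h1
  exact h1.symm

lemma prod_ev {η : κ → ℝ} (hη : η ∈ S.dom) (f : ℝ → ℝ) :
    ∏ i, f (g.ev U η i) = f 0 ^ S.r₀ * ∏ j, f (S.b j η ^ 2) ^ (2 * S.r j) := by
  have h := congrArg (fun s => (Multiset.map f s).prod) (S.map_ev_eq hη)
  simp only [Multiset.map_map, Multiset.map_add, Multiset.prod_add, Multiset.map_nsmul,
    Multiset.prod_nsmul, Multiset.map_singleton, Multiset.prod_singleton] at h
  refine Eq.trans ?_ (h.trans ?_)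
  · rfl
  · congr 1
    rw [← Multiset.coe_mapAddMonoidHom, map_sum, Multiset.prod_sum]
    simp [Multiset.prod_nsmul, Multiset.map_nsmul]

lemma finrank_eq : Module.finrank ℝ V = S.r₀ + 2 * ∑ j, S.r j := by
  obtain ⟨η, hη⟩ := S.dom_nonempty
  have h := congrArg Multiset.card (S.map_ev_eq hη)
  simpa [mul_sum] using h

/-- The constant of the Plancherel formula of the fibres. -/
def const : ℝ := (2 * π) ^ (S.r₀ + ∑ j, S.r j)

lemma const_pos : 0 < S.const := by have := pi_pos; unfold const; positivity

lemma coef_nonneg (n : Fin S.d₁ → ℕ) {η : κ → ℝ} (hη : η ∈ S.dom) : 0 ≤ S.coef n η :=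
  Finset.prod_nonneg fun j _ => mul_nonneg (pow_nonneg (S.b_pos η hη j).le _) (Nat.cast_nonneg _)

lemma lintegral_fibreMeasure {F : ℝ → ENNReal} (hF : Measurable F) : ∫⁻ x, F x ∂(S.fibreMeasure η)
      = ∑' n, ofReal (S.coef n η) * ∫⁻ μ, F (S.level n η + μ) ∂(sigma S.r₀) := by
  rw [fibreMeasure, lintegral_sum_measure]
  refine tsum_congr fun n => ?_
  rw [lintegral_smul_measure, lintegral_map hF (by fun_prop), smul_eq_mul]

lemma ae_fibreMeasure_nonneg {η : κ → ℝ} (hη : η ∈ S.dom) : ∀ᵐ x ∂(S.fibreMeasure η), 0 ≤ x := by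
  have h : (fun x : ℝ => 0 ≤ x) = fun x => x ∈ Ici (0 : ℝ) := rfl
  rw [fibreMeasure, Measure.ae_sum_iff' measurableSet_Ici]
  intro n
  refine Measure.ae_smul_measure ((ae_map_iff (by fun_prop) measurableSet_Ici).2 ?_) _
  filter_upwards [ae_sigma_nonneg S.r₀] with μ hμ
  refine add_nonneg (sum_nonneg fun j _ => ?_) hμ
  have := S.b_pos η hη j
  positivity

/-- The negative binomial series in `e^{-2sb}`, together with `e^{-sb} / (1 - e^{-2sb}) = 1 / (2
sinh(sb))`. -/
lemma tsum_factor {b s : ℝ} (hb : 0 < b) (hs : 0 < s) {r : ℕ} (hr : 0 < r) :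
    ∑' k : ℕ, ofReal (b ^ r * ((k + r - 1).choose k : ℝ) *
      exp (-s * ((2 * (k : ℝ) + r) * b))) = ofReal ((b / (2 * sinh (s * b))) ^ r) := by
  have hx : exp (-(2 * s * b)) < 1 := exp_lt_one_iff.2 (by nlinarith [mul_pos hs hb])
  have h := (hasSum_choose_mul_pow hr (exp_pos _).le hx).mul_left (b ^ r * exp (-(s * b)) ^ r)
  have e : ∀ k : ℕ, b ^ r * ((k + r - 1).choose k : ℝ) * exp (-s * ((2 * (k : ℝ) + r) * b))
      = b ^ r * exp (-(s * b)) ^ r *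
        (((k + r - 1).choose k : ℝ) * exp (-(2 * s * b)) ^ k) := fun k => by
    rw [← exp_nat_mul, ← exp_nat_mul, show -s * ((2 * (k : ℝ) + r) * b)
      = r * -(s * b) + k * -(2 * s * b) by ring, exp_add]
    ring
  simp_rw [e]
  rw [← ENNReal.ofReal_tsum_of_nonneg (fun k => by positivity) h.summable, h.tsum_eq, ← mul_pow,
    ← div_eq_mul_inv, ← div_pow]
  congr 2
  have h3 : exp (-(2 * s * b)) = exp (-(s * b)) * exp (-(s * b)) := by
    rw [← exp_add]; ring_nf
  have h4 : exp (s * b) * exp (-(s * b)) = 1 := by rw [← exp_add]; simp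
  have h5 : 0 < sinh (s * b) := Real.sinh_pos_iff.2 (by positivity)
  have h6 : 0 < 1 - exp (-(2 * s * b)) := by linarith
  rw [div_eq_div_iff h6.ne' (by positivity), Real.sinh_eq, h3]
  linear_combination b * h4

/-- The sum over `n` factors over `j`. Each zero eigenvalue contributes `2π (4πs)^{-1/2} = √(π/s)`.
Each `b` of multiplicity `2r` contributes `(2π)^r (b / (4π sinh(sb)))^r`, the sum found in
`tsum_factor`. This explains the power of `2π` in `const`. -/
lemma lintegral_exp_fibreMeasure {η : κ → ℝ} (hη : η ∈ S.dom) (hs : 0 < s) :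
    ∫⁻ x, ofReal (exp (-s * x)) ∂(S.fibreMeasure η)
      = ofReal (S.const * g.heatDiag U s η) := by
  have hpi := pi_pos
  rw [S.lintegral_fibreMeasure η (by fun_prop)]
  have h1 : ∀ n, ofReal (S.coef n η) * ∫⁻ μ, ofReal (exp (-s * (S.level n η + μ))) ∂(sigma S.r₀)
      = (∏ j, ofReal (S.b j η ^ S.r j * ((n j + S.r j - 1).choose (n j) : ℝ) *
        exp (-s * ((2 * (n j : ℝ) + S.r j) * S.b j η))))
        * ofReal (√(π / s) ^ S.r₀) := fun n => by
    simp_rw [mul_add, exp_add, ofReal_mul (exp_pos _).le]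
    rw [lintegral_const_mul _ (by fun_prop), lintegral_exp_sigma _ hs, ← _root_.mul_assoc,
      ← ofReal_mul (S.coef_nonneg n hη), ← ENNReal.ofReal_prod_of_nonneg fun j _ => by
        have := S.b_pos η hη j; positivity]
    rw [prod_mul_distrib, ← exp_sum, coef, level, ← mul_sum]
  simp_rw [h1]
  rw [ENNReal.tsum_mul_right, ENNReal.tsum_pi_prod (fun j k => ofReal (S.b j η ^ S.r j *
    ((k + S.r j - 1).choose k : ℝ) * exp (-s * ((2 * (k : ℝ) + S.r j) * S.b j η))))]
  simp_rw [fun j => tsum_factor (S.b_pos η hη j) hs (S.r_pos j)]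
  have hsinh : ∀ j, 0 < sinh (s * S.b j η) := fun j =>
    Real.sinh_pos_iff.2 (mul_pos hs (S.b_pos η hη j))
  rw [← ENNReal.ofReal_prod_of_nonneg fun j _ => by
      have := S.b_pos η hη j; have := hsinh j; positivity,
    ← ofReal_mul (Finset.prod_nonneg fun j _ => by
      have := S.b_pos η hη j; have := hsinh j; positivity)]
  congr 1
  rw [g.heatDiag_eq_prod U s hs, S.prod_ev hη fun a => (√(4 * π * shc s a))⁻¹, const, pow_add,
    ← Finset.prod_pow_eq_pow_sum, mul_mul_mul_comm, ← mul_pow, ← prod_mul_distrib, mul_comm]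
  congr 1
  · congr 1
    rw [shc_of_sqrt_eq_zero Real.sqrt_zero, ← div_eq_mul_inv, eq_div_iff (by positivity),
      ← sqrt_mul (by positivity), show π / s * (4 * π * s) = (2 * π) ^ 2 by
        field_simp; ring, sqrt_sq (by positivity)]
  · refine prod_congr rfl fun j _ => ?_
    have hb := S.b_pos η hη j
    have h3 : 0 < shc s (S.b j η ^ 2) := shc_pos hs _
    rw [pow_mul, ← mul_pow, inv_pow, sq_sqrt (by positivity),
      shc_of_sqrt_ne_zero (by rw [sqrt_sq hb.le]; exact hb.ne'), sqrt_sq hb.le]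
    congr 1
    have := hsinh j
    field_simp
    ring

end SpectralData

/-! ### Convolution with the weighted heat kernels -/

lemma tendsto_shc_div (a : ℝ) : Tendsto (fun s => shc s a / s) (𝓝[>] 0) (𝓝 1) := by
  have h1 : ContinuousAt (dslope sinh 0) 0 :=
    continuousAt_dslope_same.2 (Real.differentiable_sinh 0)
  have h2 : Tendsto (fun s : ℝ => s * √a) (𝓝[>] 0) (𝓝 0) := by
    have : Tendsto (fun s : ℝ => s * √a) (𝓝 0) (𝓝 (0 * √a)) := tendsto_id.mul_const _
    rw [MulZeroClass.zero_mul] at this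
    exact this.mono_left nhdsWithin_le_nhds
  have h3 := h1.tendsto.comp h2
  rw [dslope_same, Real.deriv_sinh, cosh_zero] at h3
  refine h3.congr' ?_
  filter_upwards [self_mem_nhdsWithin] with s hs
  have hs : s ≠ 0 := ne_of_gt hs
  rw [shc, comp_apply, mul_div_cancel_left₀ _ hs]

lemma tendsto_mul_cth (a : ℝ) : Tendsto (fun s => s * cth s a) (𝓝[>] 0) (𝓝 1) := by
  have h1 : Tendsto (fun s => chc s a) (𝓝[>] 0) (𝓝 (chc 0 a)) :=
    ((continuous_chc.comp (continuous_id.prodMk continuous_const)).tendsto 0).mono_left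
      nhdsWithin_le_nhds
  have h2 := h1.div (tendsto_shc_div a) one_ne_zero
  rw [show chc 0 a = 1 by simp [chc], div_one] at h2
  refine h2.congr' ?_
  filter_upwards [self_mem_nhdsWithin] with s hs
  have hs : 0 < s := hs
  have := shc_pos hs a
  simp only [Pi.div_apply, cth]
  field_simp

/-- The Euclidean heat kernel. -/
def gaussKer {V : Type*} [NormedAddCommGroup V] [InnerProductSpace ℝ V] (s : ℝ) (x : V) : ℝ :=
  (√(4 * π * s))⁻¹ ^ Module.finrank ℝ V * exp (-(1 / 4) * (s⁻¹ * ‖x‖ ^ 2))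

section

variable {V : Type*} [NormedAddCommGroup V] [InnerProductSpace ℝ V] [FiniteDimensional ℝ V]
  [MeasurableSpace V] [BorelSpace V]

lemma continuous_gaussKer (s : ℝ) : Continuous (gaussKer (V := V) s) := by
  unfold gaussKer; fun_prop

lemma gaussKer_pos (hs : 0 < s) (x : V) : 0 < gaussKer s x := by
  have := pi_pos
  unfold gaussKer; positivity

lemma integral_gaussKer (hs : 0 < s) : ∫ x : V, gaussKer s x = 1 := by
  have hpi := pi_pos
  have h := integral_exp_neg_sum_sq (stdOrthonormalBasis ℝ V) fun _ => (4 * s)⁻¹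
  simp_rw [← mul_sum] at h
  have e : ∀ x : V, ∑ i, inner ℝ (stdOrthonormalBasis ℝ V i) x ^ 2 = ‖x‖ ^ 2 := fun x => by
    rw [← (stdOrthonormalBasis ℝ V).sum_sq_norm_inner_right x]; simp
  simp_rw [e] at h
  rw [Finset.prod_const, Finset.card_univ, Fintype.card_fin] at h
  simp only [gaussKer]
  rw [integral_const_mul, show (fun x : V => exp (-(1 / 4) * (s⁻¹ * ‖x‖ ^ 2)))
    = fun x => exp (-((4 * s)⁻¹ * ‖x‖ ^ 2)) by ext x; congr 1; rw [_root_.mul_inv]; ring, h, ← mul_pow,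
    show π / (4 * s)⁻¹ = 4 * π * s by field_simp,
    inv_mul_cancel₀ (by positivity), one_pow]

lemma integrable_gaussKer (hs : 0 < s) : Integrable (gaussKer (V := V) s) := by
  by_contra h
  have h1 := integral_gaussKer (V := V) hs
  rw [integral_undef h] at h1
  exact zero_ne_one h1

lemma lintegral_gaussKer (hs : 0 < s) : ∫⁻ x : V, ofReal (gaussKer s x) = 1 := by
  rw [← ofReal_integral_eq_lintegral_ofReal (integrable_gaussKer hs)
    (.of_forall fun x => (gaussKer_pos hs x).le), integral_gaussKer hs, ofReal_one]

end

lemma heat_le_gaussKer (hs : 0 < s) (η : κ → ℝ) (x : V) :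
    g.heat U s η x ≤ gaussKer s x := g.heat_le U hs η x

/-- At parabolic scale the twist disappears as `s → 0`, because `shc s a / s` and `s · cth s a` tend
to `1`; the limit is the Euclidean heat kernel at time one. -/
lemma tendsto_heat_scaled (z : V) :
    Tendsto (fun s : ℝ => √s ^ Module.finrank ℝ V * g.heat U s η (√s • z)) (𝓝[>] 0)
      (𝓝 (gaussKer 1 z)) := by
  have hpi := pi_pos
  have h1 : Tendsto (fun s : ℝ => ∏ i, (√(4 * π * (shc s (g.ev U η i) / s)))⁻¹) (𝓝[>] 0)
      (𝓝 (∏ _i : Fin (Module.finrank ℝ V), (√(4 * π * 1))⁻¹)) :=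
    tendsto_finsetProd _ fun i _ =>
      (((tendsto_shc_div (g.ev U η i)).const_mul (4 * π)).sqrt).inv₀ (by positivity)
  have h2 : Tendsto (fun s : ℝ => exp (-(1 / 4) * ∑ i, s * cth s (g.ev U η i) *
      (inner ℝ (g.evec U η i) z * inner ℝ (g.evec U η i) z))) (𝓝[>] 0)
      (𝓝 (exp (-(1 / 4) * ∑ i, 1 * (inner ℝ (g.evec U η i) z * inner ℝ (g.evec U η i) z)))) :=
    ((tendsto_finsetSum _ fun i _ =>
      (tendsto_mul_cth (g.ev U η i)).mul_const _).const_mul _).rexp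
  have h3 := h1.mul h2
  have e : ∑ i, 1 * (inner ℝ (g.evec U η i) z * inner ℝ (g.evec U η i) z) = ‖z‖ ^ 2 := by
    rw [← (g.evec U η).sum_sq_norm_inner_right z]
    simp [sq]
  rw [e] at h3
  refine (h3.congr' ?_).trans (le_of_eq ?_)
  · filter_upwards [self_mem_nhdsWithin] with s hs
    have hs : 0 < s := hs
    rw [heat, g.heatDiag_eq_prod U s hs, ← _root_.mul_assoc]
    congr 1
    · rw [show √s ^ Module.finrank ℝ V = ∏ _i : Fin (Module.finrank ℝ V), √s by simp,
        ← prod_mul_distrib]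
      refine prod_congr rfl fun i _ => ?_
      have := shc_pos hs (g.ev U η i)
      rw [← mul_div_assoc, Real.sqrt_div (by positivity), inv_div, div_eq_mul_inv]
    · rw [bil_smul_left, bil_smul_right, ← _root_.mul_assoc (√s), Real.mul_self_sqrt hs.le, bil]
      simp only [mul_sum, _root_.mul_assoc]
  · simp [gaussKer]

lemma integral_heat_scaled (f : V → ℂ) (η : κ → ℝ) (hs : 0 < s) : ∫ x, f x * (g.heat U s η x : ℂ)
      = ∫ z, f (√s • z) * ((√s ^ Module.finrank ℝ V * g.heat U s η (√s • z) : ℝ) : ℂ) := by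
  have h := Measure.integral_comp_smul (volume : Measure V) (fun x => f x * (g.heat U s η x : ℂ)) (√s)
  have hs' : 0 < √s := sqrt_pos.2 hs
  have e : ∀ z, f (√s • z) * ((√s ^ Module.finrank ℝ V * g.heat U s η (√s • z) : ℝ) : ℂ)
      = ((√s ^ Module.finrank ℝ V : ℝ) : ℂ) * (f (√s • z) * (g.heat U s η (√s • z) : ℂ)) :=
    fun z => by push_cast; ring
  simp_rw [e]
  rw [integral_const_mul, h, abs_of_pos (by positivity), real_smul, ← _root_.mul_assoc,
    ← Complex.ofReal_mul, mul_inv_cancel₀ (by positivity), Complex.ofReal_one, one_mul]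

lemma continuous_heat (s : ℝ) (η : κ → ℝ) : Continuous (g.heat U s η) :=
  (g.contDiff_heat U s η (n := 0)).continuous

lemma heat_scaled_le (hs : 0 < s) (η : κ → ℝ) (z : V) :
    √s ^ Module.finrank ℝ V * g.heat U s η (√s • z) ≤ gaussKer 1 z := by
  have hs' : 0 < √s := sqrt_pos.2 hs
  have hpi := pi_pos
  refine (mul_le_mul_of_nonneg_left (g.heat_le U hs η _) (by positivity)).trans (le_of_eq ?_)
  rw [gaussKer, norm_smul, mul_pow, norm_of_nonneg hs'.le,
    sq_sqrt hs.le, ← _root_.mul_assoc, ← mul_pow, sqrt_mul (by positivity) s,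
    inv_mul_cancel_left₀ hs.ne', _root_.mul_inv,
    mul_comm (√s), inv_mul_cancel_right₀ hs'.ne']
  simp

/-- The fibre heat kernels are an approximate identity. -/
lemma tendsto_integral_mul_heat {f : V → ℂ} (hf : Continuous f) {C : ℝ} (hC : ∀ x, ‖f x‖ ≤ C)
    (η : κ → ℝ) : Tendsto (fun s => ∫ x, f x * (g.heat U s η x : ℂ)) (𝓝[>] 0) (𝓝 (f 0)) := by
  have hC0 : 0 ≤ C := (norm_nonneg _).trans (hC 0)
  have h : Tendsto (fun s : ℝ => ∫ z, f (√s • z) *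
      ((√s ^ Module.finrank ℝ V * g.heat U s η (√s • z) : ℝ) : ℂ)) (𝓝[>] 0)
      (𝓝 (∫ z : V, f 0 * ((gaussKer 1 z : ℝ) : ℂ))) := by
    refine tendsto_integral_filter_of_dominated_convergence (fun z : V => C * gaussKer 1 z) ?_ ?_
      ((integrable_gaussKer one_pos).const_mul C) ?_
    · refine .of_forall fun s => Continuous.aestronglyMeasurable ?_
      have := g.continuous_heat U s η
      fun_prop
    · filter_upwards [self_mem_nhdsWithin] with s hs
      refine .of_forall fun z => ?_
      have hp := g.heat_pos U s η (√s • z)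
      rw [norm_mul, norm_real, norm_of_nonneg (by positivity)]
      exact mul_le_mul (hC _) (g.heat_scaled_le U hs η z) (by positivity) hC0
    · refine .of_forall fun z => Tendsto.mul ?_ ?_
      · have h1 : Tendsto (fun s : ℝ => √s • z) (𝓝 0) (𝓝 (√0 • z)) :=
          ((Real.continuous_sqrt.smul continuous_const).tendsto 0)
        rw [Real.sqrt_zero, zero_smul] at h1
        exact (hf.tendsto 0).comp (h1.mono_left nhdsWithin_le_nhds)
      · exact (continuous_ofReal.tendsto _).comp (g.tendsto_heat_scaled U η z)
  rw [integral_const_mul, integral_complex_ofReal, integral_gaussKer one_pos, Complex.ofReal_one,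
    mul_one] at h
  refine h.congr' ?_
  filter_upwards [self_mem_nhdsWithin] with s hs
  exact (g.integral_heat_scaled U f η hs).symm

lemma norm_integral_mul_heat_le {f : V → ℂ} {C : ℝ} (hC : ∀ x, ‖f x‖ ≤ C)
    (η : κ → ℝ) (hs : 0 < s) : ‖∫ x, f x * (g.heat U s η x : ℂ)‖ ≤ C := by
  have hC0 : 0 ≤ C := (norm_nonneg _).trans (hC 0)
  refine (norm_integral_le_of_norm_le ((integrable_gaussKer (V := V) hs).const_mul C)
    (.of_forall fun x => ?_)).trans (le_of_eq ?_)
  · have hp := g.heat_pos U s η x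
    rw [norm_mul, norm_real, norm_of_nonneg hp.le]
    exact mul_le_mul (hC x) (g.heat_le_gaussKer U hs η x) hp.le hC0
  · rw [integral_const_mul, integral_gaussKer hs, mul_one]

lemma continuous_partialFourier_fst (hφ : IsTest φ) (η : κ → ℝ) :
    Continuous fun x => partialFourier U φ (x, η) := by
  obtain ⟨C, hC0, hC⟩ := hφ.exists_norm_le
  have hK : IsCompact (Prod.snd '' tsupport φ) := hφ.2.isCompact.image continuous_snd
  refine continuous_const.mul (continuous_of_dominated (bound := fun u =>
    (Prod.snd '' tsupport φ).indicator (fun _ => C) u) (fun x => ?_) (fun x => ?_) ?_ ?_)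
  · exact (integrable_character_mul U (isTest_slice hφ x).integrable η).aestronglyMeasurable
  · refine .of_forall fun u => ?_
    rw [norm_mul, RCLike.norm_conj, norm_character, one_mul]
    by_cases hu : u ∈ Prod.snd '' tsupport φ
    · rw [indicator_of_mem hu]; exact hC _
    · rw [indicator_of_notMem hu, norm_le_zero_iff]
      by_contra h
      exact hu ⟨(x, u), subset_tsupport _ h, rfl⟩
  · exact (integrable_indicator_iff hK.measurableSet).2 (integrableOn_const hK.measure_lt_top.ne)
  · refine .of_forall fun u => ?_
    have hc : Continuous fun x => φ (x, u) :=
      hφ.continuous.comp (continuous_id.prodMk continuous_const)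
    change Continuous fun x => conj (character U η u) * φ (x, u)
    exact continuous_const.mul hc

lemma exists_norm_partialFourier_le (hφ : IsTest φ) :
    ∃ C, ∀ q : V × (κ → ℝ), ‖partialFourier U φ q‖ ≤ C := by
  obtain ⟨C, hC0, hC⟩ := hφ.exists_norm_le
  have hK : IsCompact (Prod.snd '' tsupport φ) := hφ.2.isCompact.image continuous_snd
  have hi : Integrable (fun u => (Prod.snd '' tsupport φ).indicator (fun _ => C) u) U.addHaar :=
    (integrable_indicator_iff hK.measurableSet).2 (integrableOn_const hK.measure_lt_top.ne)
  refine ⟨fourierConst κ * ∫ u, (Prod.snd '' tsupport φ).indicator (fun _ => C) u ∂U.addHaar,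
    fun q => (norm_partialFourier_le U φ q).trans (mul_le_mul_of_nonneg_left
      (integral_mono (isTest_slice hφ q.1).integrable.norm hi fun u => ?_) fourierConst_pos.le)⟩
  by_cases hu : u ∈ Prod.snd '' tsupport φ
  · rw [indicator_of_mem hu]; exact hC _
  · rw [indicator_of_notMem hu, norm_le_zero_iff]
    by_contra h
    exact hu ⟨(q.1, u), subset_tsupport _ h, rfl⟩

/-- As `s → 0` the vector `heatVec s` tends weakly, against test functions, to the point mass at `x
= 0` with weight `w(η)` on the Fourier side. -/
lemma tendsto_inner_testLp_heatVec (hφ : IsTest φ) :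
    Tendsto (fun s => inner ℂ (testLp 𝔪 φ) (g.heatVec U s)) (𝓝[>] 0)
      (𝓝 (∫ η : κ → ℝ, (g.weight U η : ℂ) * conj (partialFourier U φ (0, η)))) := by
  obtain ⟨C, hC⟩ := exists_norm_partialFourier_le U hφ
  have hC' : ∀ η x, ‖conj (partialFourier U φ (x, η))‖ ≤ C := fun η x => by
    rw [RCLike.norm_conj]; exact hC _
  have hi : ∀ {t : ℝ}, 0 < t →
      Integrable (fun q => conj (partialFourier U φ q) * g.weightHeat U t q)
        ((volume : Measure V).prod volume) := fun ht => by
    have h1 : MemLp (fun q => conj (partialFourier U φ q)) 2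
      ((volume : Measure V).prod volume) := (memLp_partialFourier U hφ).star
    exact h1.integrable_mul (g.memLp_weightHeat U ht)
  have e : ∀ s η, ∫ x, conj (partialFourier U φ (x, η)) * g.weightHeat U s (x, η)
      = (g.weight U η : ℂ) * ∫ x, conj (partialFourier U φ (x, η)) * (g.heat U s η x : ℂ) :=
    fun s η => by
      rw [← integral_const_mul]
      refine integral_congr_ae (.of_forall fun x => ?_)
      simp only [weightHeat]; push_cast; ring
  have h : Tendsto (fun s => ∫ η, (g.weight U η : ℂ) *
      ∫ x, conj (partialFourier U φ (x, η)) * (g.heat U s η x : ℂ)) (𝓝[>] 0)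
      (𝓝 (∫ η : κ → ℝ, (g.weight U η : ℂ) * conj (partialFourier U φ (0, η)))) := by
    refine tendsto_integral_filter_of_dominated_convergence (fun η => g.weight U η * C) ?_ ?_
      ((g.integrable_weight U).mul_const C) ?_
    · filter_upwards [self_mem_nhdsWithin] with s hs
      refine (hi hs).integral_prod_right.aestronglyMeasurable.congr (.of_forall fun η => e s η)
    · filter_upwards [self_mem_nhdsWithin] with s hs
      refine .of_forall fun η => ?_
      have := g.weight_pos U η
      rw [norm_mul, norm_real, norm_of_nonneg this.le]
      exact mul_le_mul_of_nonneg_left (g.norm_integral_mul_heat_le U (hC' η) η hs) this.le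
    · refine .of_forall fun η => Tendsto.const_mul _ ?_
      exact g.tendsto_integral_mul_heat U
        (continuous_conj.comp (continuous_partialFourier_fst U hφ η)) (hC' η) η
  refine h.congr' ?_
  filter_upwards [self_mem_nhdsWithin] with s hs
  rw [g.inner_testLp_heatVec U hφ hs, integral_prod_symm _ (hi hs)]
  exact integral_congr_ae (.of_forall fun η => (e s η).symm)

/-- The bound is uniform in `s` because each fibre kernel lies below a Gaussian of total mass one
that does not depend on `η`. -/
lemma norm_inner_testLp_heatVec_le (hφ : IsTest φ) {B : ℝ}
    (hB : ∀ x, ∫⁻ η, ‖partialFourier U φ (x, η)‖ₑ ≤ ofReal B) (hB0 : 0 ≤ B)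
    (hs : 0 < s) :
    ‖inner ℂ (testLp 𝔪 φ) (g.heatVec U s)‖ ≤ B := by
  rw [g.inner_testLp_heatVec U hφ hs, ← ENNReal.ofReal_le_ofReal_iff hB0, ofReal_norm_eq_enorm]
  refine (enorm_integral_le_lintegral_enorm _).trans ?_
  have hm := (stronglyMeasurable_partialFourier U hφ.continuous).measurable
  have hm2 : Measurable fun q : V × (κ → ℝ) =>
      ofReal (gaussKer s q.1) * ‖partialFourier U φ q‖ₑ :=
    ((continuous_gaussKer s).measurable.comp measurable_fst).ennreal_ofReal.mul hm.enorm
  calc ∫⁻ q, ‖conj (partialFourier U φ q) * g.weightHeat U s q‖ₑ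
        ∂((volume : Measure V).prod volume)
      ≤ ∫⁻ q, ofReal (gaussKer s q.1) * ‖partialFourier U φ q‖ₑ
        ∂((volume : Measure V).prod volume) := lintegral_mono fun q => by
        rw [enorm_mul, mul_comm, RCLike.enorm_conj]
        gcongr
        have h1 := g.heat_pos U s q.2 q.1
        have h2 := g.weight_pos U q.2
        rw [weightHeat, ← ofReal_norm_eq_enorm, norm_real,
          norm_of_nonneg (by positivity)]
        refine ofReal_le_ofReal ?_
        exact (mul_le_of_le_one_left h1.le (g.weight_le_one U _)).trans
          (g.heat_le_gaussKer U hs _ _)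
    _ = ∫⁻ x : V, ofReal (gaussKer s x) * ∫⁻ η, ‖partialFourier U φ (x, η)‖ₑ := by
        rw [lintegral_prod _ hm2.aemeasurable]
        refine lintegral_congr fun x => ?_
        have hx : Measurable fun η => partialFourier U φ (x, η) := hm.comp measurable_prodMk_left
        exact lintegral_const_mul (ofReal (gaussKer s x)) hx.enorm
    _ ≤ ∫⁻ x : V, ofReal (gaussKer s x) * ofReal B := by
        gcongr with x; exact hB x
    _ = ofReal B := by
        rw [lintegral_mul_const _ (continuous_gaussKer s).measurable.ennreal_ofReal,
          lintegral_gaussKer hs, one_mul]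

/-! ### The semigroup applied to test functions -/

/-- The resolvents of `L` and of the central derivatives commute with left translations, and the
corresponding coordinates separate points. -/
lemma scalarMeasure_leftTrans (hE : g.IsJointSpectralMeasure X U E) (q : V × W)
    (f : Lp ℂ 2 𝔪) : E.scalarMeasure (g.leftTrans U q f) = E.scalarMeasure f := by
  have h2 : ∀ k, Measurable fun a : ℝ × (κ → ℝ) => a.2 k := fun k =>
    (measurable_pi_apply k).comp measurable_snd
  refine E.scalarMeasure_of_intertwine E (g.leftTrans U q) (ι := Option κ)
    (fun i a => i.elim a.1 a.2) (fun i => ?_) (fun a b hab => ?_) (fun i f => ?_) f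
  · cases i with
    | none => exact continuous_fst
    | some k => exact (continuous_apply k).comp continuous_snd
  · exact Prod.ext (hab none) (funext fun k => hab (some k))
  · cases i with
    | none =>
      refine g.leftTrans_resolvent U (fun _ h => g.isTest_sublaplacian X h)
        (g.sublaplacian_comp_leftMul X) (fun f h => ?_) q f
      rw [hE.1]
      exact E.mem_spectralGraph_iff measurable_fst f h
    | some k =>
      refine g.leftTrans_resolvent U (fun _ h => g.isTest_centralDeriv (U k) h)
        (g.centralDeriv_comp_leftMul (U k)) (fun f h => ?_) q f
      rw [hE.2 k]
      exact E.mem_spectralGraph_iff (h2 k) f h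

lemma op_convL (hE : g.IsJointSpectralMeasure X U E) {h : ℝ × (κ → ℝ) → ℂ}
    (hh : BddMeas h) (hφ : IsTest φ) (f : Lp ℂ 2 𝔪) :
    E.op h (g.convL U hφ f) = g.convL U hφ (E.op h f) := by
  rw [convL_apply, convL_apply, ← ContinuousLinearMap.integral_comp_comm _
    (g.integrable_smul_leftTrans U hφ f)]
  congr 1
  ext1 q
  rw [map_smul, E.op_of_scalarMeasure_eq E _ (g.scalarMeasure_leftTrans U hE q) hh]

/-- The correlation `φ* * ψ`. -/
def corr (φ ψ : V × W → ℂ) : V × W → ℂ := g.conv U (fun p => conj (φ (g.inv p))) ψ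

lemma isTest_corr (hφ : IsTest φ) (hψ : IsTest ψ) : IsTest (g.corr U φ ψ) :=
  g.isTest_conv U (g.isTest_conjInv hφ) hψ

lemma inner_testLp_convL (hφ : IsTest φ) (hψ : IsTest ψ) (f : Lp ℂ 2 𝔪) :
    inner ℂ (testLp 𝔪 ψ) (g.convL U hφ f)
      = inner ℂ (testLp 𝔪 (g.corr U φ ψ)) f := by
  rw [corr, ← g.convL_testLp U (g.isTest_conjInv hφ) hψ, inner_convL_left, inner_convL, inner_convL]
  simp only [g.inv_inv, conj_conj]

lemma integrable_corr (hφ : IsTest φ) (hψ : IsTest ψ) (x : V) (η : κ → ℝ) :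
    Integrable (fun r : W × (V × W) => conj (character U η r.1) *
      (conj (φ r.2) * ψ (g.mul r.2 (x, r.1)))) (U.addHaar.prod 𝔪) := by
  have hc : Continuous fun r : W × (V × W) => conj (character U η r.1) *
      (conj (φ r.2) * ψ (g.mul r.2 (x, r.1))) :=
    (continuous_conj.comp ((continuous_character U).comp
      (continuous_const.prodMk continuous_fst))).mul
      ((continuous_conj.comp (hφ.continuous.comp continuous_snd)).mul
        (hψ.continuous.comp (g.continuous_mul continuous_snd
          (continuous_const.prodMk continuous_fst))))
  refine hc.integrable_of_hasCompactSupport ?_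
  have hm : Continuous fun r : (V × W) × (V × W) => ((g.mul (g.inv r.1) r.2).2, r.1) :=
    (continuous_snd.comp (g.continuous_mul (continuous_fst.neg) continuous_snd)).prodMk
      continuous_fst
  refine HasCompactSupport.intro ((hφ.2.prod hψ.2).image hm) fun r hr => ?_
  by_contra hne
  have h1 := right_ne_zero_of_mul hne
  have h2 : φ r.2 ≠ 0 := fun h => left_ne_zero_of_mul h1 (by rw [h, map_zero])
  refine hr ⟨(r.2, g.mul r.2 (x, r.1)), ⟨subset_tsupport _ h2,
    subset_tsupport _ (right_ne_zero_of_mul h1)⟩, ?_⟩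
  simp only [g.inv_mul_cancel_left]

/-- On each fibre the group convolution becomes a convolution twisted by a character of the bracket.
At `x = 0` the twist disappears and an inner product over `V` remains. -/
lemma partialFourier_corr (hφ : IsTest φ) (hψ : IsTest ψ) (x : V) (η : κ → ℝ) :
    partialFourier U (g.corr U φ ψ) (x, η)
      = (fourierConst κ : ℂ)⁻¹ * ∫ y, character U η ((1 / 2 : ℝ) • g.bracket y x) *
        (conj (partialFourier U φ (y, η)) * partialFourier U ψ (x + y, η)) := by
  have hc : (fourierConst κ : ℂ) ≠ 0 := by exact_mod_cast fourierConst_pos.ne'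
  have hI := g.integrable_corr U hφ hψ x η
  have e1 : ∀ u, conj (character U η u) * g.corr U φ ψ (x, u)
      = ∫ q, conj (character U η u) * (conj (φ q) * ψ (g.mul q (x, u))) ∂𝔪 := fun u => by
    rw [integral_const_mul, corr, conv, ← g.integral_inv U]
    simp only [g.inv_inv]
  have e2 : ∀ q : V × W, ∫ u, conj (character U η u) * (conj (φ q) * ψ (g.mul q (x, u))) ∂U.addHaar
      = (fourierConst κ : ℂ)⁻¹ * (character U η ((1 / 2 : ℝ) • g.bracket q.1 x) *
        partialFourier U ψ (x + q.1, η)) * (character U η q.2 * conj (φ q)) := fun q => by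
    have h := integral_add_left_eq_self (μ := U.addHaar) (fun u =>
      conj (character U η (u - (q.2 + (1 / 2 : ℝ) • g.bracket q.1 x))) *
        (conj (φ q) * ψ (x + q.1, u))) (q.2 + (1 / 2 : ℝ) • g.bracket q.1 x)
    have h3 : ∀ u, character U η (u - (q.2 + (1 / 2 : ℝ) • g.bracket q.1 x))
        = character U η u * (conj (character U η q.2) *
          conj (character U η ((1 / 2 : ℝ) • g.bracket q.1 x))) := fun u => by
      rw [sub_eq_add_neg, character_add, neg_add, character_add, character_neg_right,
        character_neg_right]
    simp only [h3, add_sub_cancel_left] at h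
    have h4 : ∀ u, g.mul q (x, u)
        = (x + q.1, q.2 + (1 / 2 : ℝ) • g.bracket q.1 x + u) := fun u => by
      simp only [mul, add_comm x]
      congr 1
      abel
    simp only [h4]
    rw [h, partialFourier]
    have h6 : ∀ I : ℂ, (fourierConst κ : ℂ)⁻¹ * (character U η ((1 / 2 : ℝ) • g.bracket q.1 x) *
        (fourierConst κ * I)) * (character U η q.2 * conj (φ q))
        = (character U η ((1 / 2 : ℝ) • g.bracket q.1 x) * character U η q.2 *
          conj (φ q)) * I := fun I => by field_simp
    rw [h6, ← integral_const_mul]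
    refine integral_congr_ae (.of_forall fun u => ?_)
    simp only [map_mul, conj_conj]
    ring
  have hF : partialFourier U (g.corr U φ ψ) (x, η) = fourierConst κ *
      ∫ q, (fourierConst κ : ℂ)⁻¹ * (character U η ((1 / 2 : ℝ) • g.bracket q.1 x) *
        partialFourier U ψ (x + q.1, η)) * (character U η q.2 * conj (φ q)) ∂𝔪 := by
    rw [partialFourier]
    simp only [e1]
    rw [integral_integral_swap hI]
    simp only [e2]
  have hI2 : Integrable (fun q : V × W => (fourierConst κ : ℂ)⁻¹ *
      (character U η ((1 / 2 : ℝ) • g.bracket q.1 x) * partialFourier U ψ (x + q.1, η)) *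
      (character U η q.2 * conj (φ q))) 𝔪 :=
    hI.integral_prod_right.congr (.of_forall e2)
  rw [hF, integral_prod _ hI2, ← integral_const_mul, ← integral_const_mul]
  refine integral_congr_ae (.of_forall fun y => ?_)
  simp only
  rw [integral_const_mul]
  have h5 : ∫ u, character U η u * conj (φ (y, u)) ∂U.addHaar
      = (fourierConst κ : ℂ)⁻¹ * conj (partialFourier U φ (y, η)) := by
    rw [partialFourier, map_mul, conj_ofReal, ← integral_conj, inv_mul_cancel_left₀ hc]
    simp
  rw [h5]
  field_simp

open ProjectionValuedMeasure

lemma lintegral_sq_rpow_half (hφ : IsTest φ) :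
    (∫⁻ p, ‖φ p‖ₑ ^ 2 ∂𝔪) ^ (1 / 2 : ℝ) = ofReal ‖testLp 𝔪 φ‖ := by
  rw [norm_testLp_of_memLp (hφ.memLp 2), ofReal_toReal (hφ.memLp 2).2.ne,
    ← eLpNorm_two_sq, ← rpow_natCast, ← ENNReal.rpow_mul]
  simp

/-- Cauchy–Schwarz on the twisted convolution, whose phase has modulus one; the bound does not
depend on `x` by translation invariance. -/
lemma lintegral_partialFourier_corr_le (hφ : IsTest φ) (hψ : IsTest ψ) (x : V) :
    ∫⁻ η, ‖partialFourier U (g.corr U φ ψ) (x, η)‖ₑ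
      ≤ ofReal ((fourierConst κ)⁻¹ * (‖testLp 𝔪 φ‖ * ‖testLp 𝔪 ψ‖)) := by
  have hc : (0 : ℝ) < (fourierConst κ)⁻¹ := inv_pos.2 fourierConst_pos
  have hm1 := (stronglyMeasurable_partialFourier U hφ.continuous).measurable.enorm
  have hm2 := (stronglyMeasurable_partialFourier U hψ.continuous).measurable.enorm
  have hm3 : Measurable fun q : V × (κ → ℝ) => ‖partialFourier U ψ ((x, 0) + q)‖ₑ :=
    hm2.comp (measurable_const_add _)
  have hm4 : Measurable fun q : V × (κ → ℝ) =>
      ‖partialFourier U φ q‖ₑ * ‖partialFourier U ψ ((x, 0) + q)‖ₑ := hm1.mul hm3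
  have h1 : ∀ η, ‖partialFourier U (g.corr U φ ψ) (x, η)‖ₑ ≤ ofReal (fourierConst κ)⁻¹ *
      ∫⁻ y, ‖partialFourier U φ (y, η)‖ₑ * ‖partialFourier U ψ ((x, 0) + (y, η))‖ₑ := fun η => by
    rw [g.partialFourier_corr U hφ hψ, enorm_mul]
    refine mul_le_mul' (le_of_eq ?_) ((enorm_integral_le_lintegral_enorm _).trans
      (lintegral_mono fun y => ?_))
    · rw [← ofReal_norm_eq_enorm, norm_inv, norm_real,
        norm_of_nonneg fourierConst_pos.le]
    · rw [enorm_mul, enorm_mul, RCLike.enorm_conj, Prod.mk_add_mk, zero_add,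
        ← ofReal_norm_eq_enorm (character _ _ _), norm_character, ofReal_one, one_mul]
  refine (lintegral_mono h1).trans ?_
  rw [lintegral_const_mul _ hm4.lintegral_prod_left', ofReal_mul hc.le]
  refine mul_le_mul_right ?_ _
  rw [← lintegral_prod_symm _ hm4.aemeasurable, ofReal_mul (norm_nonneg _)]
  refine (ENNReal.lintegral_mul_le_Lp_mul_Lq _ Real.HolderConjugate.two_two hm1.aemeasurable
    hm3.aemeasurable).trans (le_of_eq ?_)
  simp only [ENNReal.rpow_two]
  rw [lintegral_add_left_eq_self (μ := (volume : Measure V).prod (volume : Measure (κ → ℝ)))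
    (fun q => ‖partialFourier U ψ q‖ₑ ^ 2) (x, 0), lintegral_partialFourier_sq U hφ,
    lintegral_partialFourier_sq U hψ, g.lintegral_sq_rpow_half U hφ, g.lintegral_sq_rpow_half U hψ]

/-- The norms of `heatVec s` are not controlled as `s → 0`, but those of its convolutions are. This
extends weak limits from test functions to all of `L²`. -/
lemma norm_convL_heatVec_le (hφ : IsTest φ) (hs : 0 < s) :
    ‖g.convL U hφ (g.heatVec U s)‖ ≤ (fourierConst κ)⁻¹ * ‖testLp 𝔪 φ‖ := by
  have hc : (0 : ℝ) < (fourierConst κ)⁻¹ := inv_pos.2 fourierConst_pos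
  set y := g.convL U hφ (g.heatVec U s) with hy
  have h1 : ∀ f : Lp ℂ 2 𝔪, ‖inner ℂ f y‖ ≤ (fourierConst κ)⁻¹ * ‖testLp 𝔪 φ‖ * ‖f‖ := by
    refine dense_testLp.induction ?_ (isClosed_le (by fun_prop) (by fun_prop))
    rintro _ ⟨ψ, hψ, rfl⟩
    rw [hy, g.inner_testLp_convL U hφ hψ, _root_.mul_assoc]
    exact g.norm_inner_testLp_heatVec_le U (g.isTest_corr U hφ hψ)
      (g.lintegral_partialFourier_corr_le U hφ hψ) (by positivity) hs
  have h2 := h1 y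
  rw [inner_self_eq_norm_sq_to_K] at h2
  simp only [Complex.coe_algebraMap, norm_mul, norm_real, norm_norm, sq] at h2
  by_cases h0 : ‖y‖ = 0
  · rw [h0]; positivity
  · exact le_of_mul_le_mul_right h2 (lt_of_le_of_ne (norm_nonneg _) (Ne.symm h0))

lemma bddMeas_weight : BddMeas fun η : κ → ℝ => (g.weight U η : ℂ) :=
  ⟨measurable_ofReal.comp (g.measurable_weight U), 1, fun η => by
    rw [norm_real, norm_of_nonneg (g.weight_pos U η).le]
    exact g.weight_le_one U η⟩

lemma inner_testLp_op_weight (hE : g.IsJointSpectralMeasure X U E) 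
    (hφ : IsTest φ) (hψ : IsTest ψ) :
    (∫ η : κ → ℝ, (g.weight U η : ℂ) * conj (partialFourier U (g.corr U φ ψ) (0, η)))
      = (fourierConst κ : ℂ)⁻¹ * inner ℂ (testLp 𝔪 ψ)
        (E.op (fun a => (g.weight U a.2 : ℂ)) (testLp 𝔪 φ)) := by
  have hw := g.bddMeas_weight U
  have h1 := g.partialFourierL_op_snd U hE hw (testLp 𝔪 φ)
  rw [← (partialFourierL U).inner_map_map, h1, inner_mulOp]
  have h2 : Integrable (fun q : V × (κ → ℝ) => (g.weight U q.2 : ℂ) *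
      (conj (partialFourier U ψ q) * partialFourier U φ q))
      ((volume : Measure V).prod volume) := by
    have h3 : MemLp (fun q => conj (partialFourier U ψ q)) 2
      ((volume : Measure V).prod volume) := (memLp_partialFourier U hψ).star
    have h4 := h3.integrable_mul (memLp_partialFourier U hφ)
    refine h4.bdd_mul (c := 1) (hw.measurable.comp measurable_snd).aestronglyMeasurable
      (.of_forall fun q => ?_)
    rw [norm_real, norm_of_nonneg (g.weight_pos U q.2).le]
    exact g.weight_le_one U q.2
  have h5 : ∫ q, (g.weight U q.2 : ℂ) * (conj (partialFourierL U (testLp 𝔪 ψ) q) *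
      partialFourierL U (testLp 𝔪 φ) q) ∂((volume : Measure V).prod volume)
      = ∫ q, (g.weight U q.2 : ℂ) * (conj (partialFourier U ψ q) * partialFourier U φ q)
        ∂((volume : Measure V).prod volume) := by
    refine integral_congr_ae ?_
    filter_upwards [coeFn_partialFourierL U hφ, coeFn_partialFourierL U hψ] with q h6 h7
    rw [h6, h7]
  rw [h5, integral_prod_symm _ h2, ← integral_const_mul]
  refine integral_congr_ae (.of_forall fun η => ?_)
  simp only
  rw [integral_const_mul, g.partialFourier_corr U hφ hψ, map_mul, ← integral_conj,
    map_inv₀, conj_ofReal, mul_left_comm]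
  refine congrArg _ (congrArg _ (integral_congr_ae (.of_forall fun y => ?_)))
  simp only [map_mul, map_zero, smul_zero, character_zero, one_mul, zero_add,
    conj_conj]
  ring

/-- For a test function in place of `f` the limit is explicit; the uniform bound and density give
the general case. -/
lemma tendsto_inner_convL_heatVec (hE : g.IsJointSpectralMeasure X U E) 
    (hφ : IsTest φ) (f : Lp ℂ 2 𝔪) :
    Tendsto (fun s => inner ℂ f (g.convL U hφ (g.heatVec U s))) (𝓝[>] 0)
      (𝓝 (inner ℂ f ((fourierConst κ : ℂ)⁻¹ •
        E.op (fun a => (g.weight U a.2 : ℂ)) (testLp 𝔪 φ)))) := by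
  set z := (fourierConst κ : ℂ)⁻¹ • E.op (fun a => (g.weight U a.2 : ℂ)) (testLp 𝔪 φ)
  set M := (fourierConst κ)⁻¹ * ‖testLp 𝔪 φ‖ + ‖z‖ with hM
  have hM0 : 0 ≤ M := by have := fourierConst_pos (κ := κ); positivity
  rw [Metric.tendsto_nhds]
  intro ε hε
  obtain ⟨_, ⟨ψ, hψ, rfl⟩, hd⟩ := dense_testLp (ν := 𝔪).exists_dist_lt f
    (show 0 < ε / (2 * (M + 1)) by positivity)
  have h1 : Tendsto (fun s => inner ℂ (testLp 𝔪 ψ) (g.convL U hφ (g.heatVec U s)))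
      (𝓝[>] 0) (𝓝 (inner ℂ (testLp 𝔪 ψ) z)) := by
    simp only [g.inner_testLp_convL U hφ hψ]
    rw [inner_smul_right, ← g.inner_testLp_op_weight U hE hφ hψ]
    exact g.tendsto_inner_testLp_heatVec U (g.isTest_corr U hφ hψ)
  filter_upwards [(Metric.tendsto_nhds.1 h1) (ε / 2) (half_pos hε), self_mem_nhdsWithin] with s h2 hs
  set y := g.convL U hφ (g.heatVec U s) with hy
  have h3 : ‖y - z‖ ≤ M := (norm_sub_le _ _).trans
    (add_le_add (g.norm_convL_heatVec_le U hφ hs) le_rfl)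
  have h4 : ‖inner ℂ (f - testLp 𝔪 ψ) (y - z)‖ ≤ ε / (2 * (M + 1)) * M := by
    refine (norm_inner_le_norm _ _).trans (mul_le_mul ?_ h3 (norm_nonneg _) (by positivity))
    rw [← dist_eq_norm]; exact hd.le
  have h5 : ε / (2 * (M + 1)) * M ≤ ε / 2 := by
    rw [div_mul_eq_mul_div, div_le_div_iff₀ (by positivity) two_pos]
    nlinarith
  have h6 : inner ℂ f y - inner ℂ f z = inner ℂ (f - testLp 𝔪 ψ) (y - z)
      + (inner ℂ (testLp 𝔪 ψ) y - inner ℂ (testLp 𝔪 ψ) z) := by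
    rw [inner_sub_left, inner_sub_right, inner_sub_right]; ring
  rw [dist_eq_norm] at h2 ⊢
  rw [h6]
  calc _ ≤ _ := norm_add_le _ _
    _ < ε / 2 + ε / 2 := add_lt_add_of_le_of_lt (h4.trans h5) h2
    _ = ε := add_halves ε

lemma conj_expPos {α : Type*} (h : α → ℝ) (t : ℝ) (a : α) : conj (expPos h t a) = expPos h t a := by
  rw [expPos, indicator_apply]
  split_ifs
  · exact conj_ofReal _
  · exact map_zero _

/-- The weighted heat semigroup acts by convolution with the weighted heat kernel. -/
lemma convL_heatVec (hE : g.IsJointSpectralMeasure X U E) (hφ : IsTest φ) (ht : 0 < t) :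
    g.convL U hφ (g.heatVec U t) = (fourierConst κ : ℂ)⁻¹ • E.op (expPos Prod.fst t)
      (E.op (fun a => (g.weight U a.2 : ℂ)) (testLp 𝔪 φ)) := by
  have hb : BddMeas (expPos (Prod.fst : ℝ × (κ → ℝ) → ℝ) t) := bddMeas_expPos measurable_fst ht.le
  refine ext_inner_left ℂ fun f => ?_
  rw [← map_smul, ← E.inner_op_left_of_real hb (conj_expPos _ t)]
  -- The limit as `s → 0` of the pairing of `f` with `φ * heatVec (s + t)` is taken twice: by
  -- continuity of `heatVec` at `t`, and by moving `e^{-tL}` onto `f` and using the weak limit.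
  refine tendsto_nhds_unique (f := fun s => inner ℂ f (g.convL U hφ (g.heatVec U (s + t))))
    (l := 𝓝[>] 0) ?_ ?_
  · have h1 : ContinuousAt (g.heatVec U) t := (g.continuousOn_heatVec U).continuousAt (Ioi_mem_nhds ht)
    have h2 : Tendsto (fun s : ℝ => s + t) (𝓝[>] 0) (𝓝 t) := by
      have : Tendsto (fun s : ℝ => s + t) (𝓝 0) (𝓝 (0 + t)) := tendsto_id.add_const t
      rw [zero_add] at this
      exact this.mono_left nhdsWithin_le_nhds
    have h3 := h1.tendsto.comp h2
    exact tendsto_const_nhds.inner (((g.convL U hφ).continuous.tendsto _).comp h3)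
  · refine (g.tendsto_inner_convL_heatVec U hE hφ (E.op (expPos Prod.fst t) f)).congr' ?_
    filter_upwards [self_mem_nhdsWithin] with s hs
    rw [E.inner_op_left_of_real hb (conj_expPos _ t), g.op_convL U hE hb,
      ← g.heatVec_add U hE hs ht.le]

end TwoStepAlgebra

/-! ### The convolution kernels -/

/-- A substitute for applying the unbounded operator `∫ Q dE` to `f`: square integrability of `Q`
for the measure of `f` makes the truncated integrals converge. -/
lemma ProjectionValuedMeasure.exists_tendsto_op {α F : Type*} [MeasurableSpace α]
    [NormedAddCommGroup F] [InnerProductSpace ℂ F] [CompleteSpace F]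
    (E : ProjectionValuedMeasure α F) {q : ℕ → α → ℂ} {Q : α → ℂ} (hq : ∀ n, BddMeas (q n))
    (hQ : Measurable Q) {f : F} (hI : Integrable (fun a => ‖Q a‖ ^ 2) (E.scalarMeasure f))
    (hle : ∀ n a, ‖q n a‖ ≤ ‖Q a‖)
    (hlim : ∀ a, Tendsto (fun n => q n a) atTop (nhds (Q a))) :
    ∃ v, Tendsto (fun n => E.op (q n) f) atTop (nhds v) ∧
      ‖v‖ ^ 2 = ∫ a, ‖Q a‖ ^ 2 ∂(E.scalarMeasure f) := by
  have hd : ∀ n a, ‖q n a - Q a‖ ^ 2 ≤ 4 * ‖Q a‖ ^ 2 := fun n a => by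
    have h1 : ‖q n a - Q a‖ ≤ 2 * ‖Q a‖ := (norm_sub_le _ _).trans (by linarith [hle n a])
    calc ‖q n a - Q a‖ ^ 2 ≤ (2 * ‖Q a‖) ^ 2 := pow_le_pow_left₀ (norm_nonneg _) h1 2
      _ = _ := by ring
  have hdi : ∀ n, Integrable (fun a => ‖q n a - Q a‖ ^ 2) (E.scalarMeasure f) := fun n =>
    (hI.const_mul 4).mono' (((hq n).measurable.sub hQ).norm.pow_const 2).aestronglyMeasurable
      (.of_forall fun a => by
        rw [norm_of_nonneg (sq_nonneg _)]; exact hd n a)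
  have hb : Tendsto (fun n => ∫ a, ‖q n a - Q a‖ ^ 2 ∂(E.scalarMeasure f)) atTop (nhds 0) := by
    rw [show (0 : ℝ) = ∫ _, (0 : ℝ) ∂(E.scalarMeasure f) by simp]
    refine tendsto_integral_of_dominated_convergence _ (fun n => (hdi n).aestronglyMeasurable)
      (hI.const_mul 4) (fun n => .of_forall fun a => ?_)
      (.of_forall fun a => ?_)
    · rw [norm_of_nonneg (sq_nonneg _)]; exact hd n a
    · have h1 := ((hlim a).sub_const (Q a)).norm.pow 2
      simpa using h1
  have hb2 := hb.const_mul 2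
  rw [MulZeroClass.mul_zero] at hb2
  have hc : CauchySeq fun n => E.op (q n) f := by
    refine cauchySeq_of_norm_sub_sq_le hb2 fun n m => ?_
    rw [← ContinuousLinearMap.sub_apply, ← E.op_sub (hq n) (hq m),
      E.norm_sq_op ((hq n).sub (hq m)), ← integral_const_mul, ← integral_const_mul,
      ← integral_add ((hdi n).const_mul 2) ((hdi m).const_mul 2)]
    refine integral_mono (((hq n).sub (hq m)).integrable_sq _)
      (((hdi n).const_mul 2).add ((hdi m).const_mul 2)) fun a => ?_
    have h1 : ‖q n a - q m a‖ ≤ ‖q n a - Q a‖ + ‖q m a - Q a‖ := by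
      rw [← sub_sub_sub_cancel_right _ _ (Q a)]; exact norm_sub_le _ _
    have h2 := pow_le_pow_left₀ (norm_nonneg _) h1 2
    simp only
    nlinarith [sq_nonneg (‖q n a - Q a‖ - ‖q m a - Q a‖)]
  obtain ⟨v, hv⟩ := cauchySeq_tendsto_of_complete hc
  refine ⟨v, hv, tendsto_nhds_unique (hv.norm.pow 2) ?_⟩
  simp only [fun n => E.norm_sq_op (hq n) f]
  refine tendsto_integral_of_dominated_convergence _
    (fun n => ((hq n).integrable_sq _).aestronglyMeasurable) hI
    (fun n => .of_forall fun a => ?_)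
    (.of_forall fun a => (hlim a).norm.pow 2)
  rw [norm_of_nonneg (sq_nonneg _)]
  exact pow_le_pow_left₀ (norm_nonneg _) (hle n a) 2

namespace TwoStepAlgebra

open ProjectionValuedMeasure

/-- The multiplier `H` divided by the weighted heat multiplier. -/
def heatQuot (H : ℝ × (κ → ℝ) → ℂ) : ℝ × (κ → ℝ) → ℂ :=
  {a | 0 ≤ a.1}.indicator fun a => H a * ((exp a.1 / g.weight U a.2 : ℝ) : ℂ)

lemma measurable_heatQuot {H : ℝ × (κ → ℝ) → ℂ} (hH : Measurable H) : Measurable (g.heatQuot U H) :=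
  (hH.mul (measurable_ofReal.comp ((measurable_exp.comp measurable_fst).div
    ((g.measurable_weight U).comp measurable_snd)))).indicator
      (measurableSet_le measurable_const measurable_fst)

/-- The kernel is `(2π)^{-dim W / 2} Q(L, U) heatVec 1`, where `Q` is `heatQuot`. Indeed convolution
commutes with the functional calculus, and `Q` times the multiplier `e^{-λ} w` of `heatVec 1` is `H`
on the spectrum. -/
lemma exists_convL_eq_op (hE : g.IsJointSpectralMeasure X U E) {H : ℝ × (κ → ℝ) → ℂ}
    (hH : BddMeas H)
    (hI : Integrable (fun a => ‖g.heatQuot U H a‖ ^ 2) (E.scalarMeasure (g.heatVec U 1))) :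
    ∃ K : Lp ℂ 2 𝔪, (∀ φ (hφ : IsTest φ), E.op H (testLp 𝔪 φ) = g.convL U hφ K) ∧
      ‖K‖ ^ 2 = fourierConst κ ^ 2 *
        ∫ a, ‖g.heatQuot U H a‖ ^ 2 ∂(E.scalarMeasure (g.heatVec U 1)) := by
  have hcp := fourierConst_pos (κ := κ)
  have hc : (fourierConst κ : ℂ) ≠ 0 := by exact_mod_cast hcp.ne'
  obtain ⟨C, hC⟩ := hH.bdd
  have hC0 : 0 ≤ C := (norm_nonneg _).trans (hC 0)
  -- On `A n` the exponential and the inverse weight are bounded, so the truncation of `heatQuot` is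
  -- a bounded function; the sets exhaust the space.
  set A : ℕ → Set (ℝ × (κ → ℝ)) := fun n => {a | a.1 ≤ n ∧ ((n : ℝ) + 1)⁻¹ ≤ g.weight U a.2} with hA
  have hAm : ∀ n, MeasurableSet (A n) := fun n =>
    (measurableSet_le measurable_fst measurable_const).inter
      (measurableSet_le measurable_const ((g.measurable_weight U).comp measurable_snd))
  have hPm : MeasurableSet {a : ℝ × (κ → ℝ) | 0 ≤ a.1} :=
    measurableSet_le measurable_const measurable_fst
  have hAev : ∀ a, ∀ᶠ n in atTop, a ∈ A n := fun a => by
    have hw := g.weight_pos U a.2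
    filter_upwards [eventually_ge_atTop ⌈a.1⌉₊, eventually_ge_atTop ⌈(g.weight U a.2)⁻¹⌉₊]
      with n h1 h2
    refine ⟨Nat.ceil_le.1 h1, inv_le_of_inv_le₀ hw ?_⟩
    linarith [Nat.ceil_le.1 h2]
  have hlimA : ∀ (G : ℝ × (κ → ℝ) → ℂ) a,
      Tendsto (fun n => (A n).indicator G a) atTop (𝓝 (G a)) := fun G a =>
    tendsto_const_nhds.congr' ((hAev a).mono fun n hn => (indicator_of_mem hn G).symm)
  have hq : ∀ n, BddMeas ((A n).indicator (g.heatQuot U H)) := fun n => by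
    refine ⟨(g.measurable_heatQuot U hH.measurable).indicator (hAm n),
      C * (exp n * (n + 1)), fun a => ?_⟩
    by_cases ha : a ∈ A n
    · rw [indicator_of_mem ha]
      refine (norm_indicator_le_norm_self _ _).trans ?_
      have hw := g.weight_pos U a.2
      rw [norm_mul, norm_real, norm_of_nonneg (by positivity), div_eq_mul_inv]
      refine mul_le_mul (hC a) (mul_le_mul (exp_le_exp.2 ha.1) ?_ (by positivity)
        (by positivity)) (by positivity) hC0
      exact inv_le_of_inv_le₀ (by positivity) ha.2
    · rw [indicator_of_notMem ha, norm_zero]; positivity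
  obtain ⟨v, hv, hn⟩ := E.exists_tendsto_op hq (g.measurable_heatQuot U hH.measurable) hI
    (fun n a => norm_indicator_le_norm_self _ _) (hlimA _)
  refine ⟨(fourierConst κ : ℂ) • v, fun φ hφ => ?_, ?_⟩
  · have hH' := hH.indicator hPm
    have hexp : BddMeas (expPos (Prod.fst : ℝ × (κ → ℝ) → ℝ) 1) :=
      bddMeas_expPos measurable_fst zero_le_one
    have hw : BddMeas fun a : ℝ × (κ → ℝ) => (g.weight U a.2 : ℂ) :=
      (g.bddMeas_weight U).comp measurable_snd
    have h1 : ∀ n, g.convL U hφ ((fourierConst κ : ℂ) • E.op ((A n).indicator (g.heatQuot U H))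
        (g.heatVec U 1)) = E.op ((A n).indicator ({a | 0 ≤ a.1}.indicator H)) (testLp _ φ) := by
      intro n
      rw [map_smul, ← g.op_convL U hE (hq n), g.convL_heatVec U hE hφ one_pos, map_smul, smul_smul,
        mul_inv_cancel₀ hc, one_smul, ← E.op_mul_apply hexp hw, ← E.op_mul_apply (hq n)
        (hexp.mul hw)]
      congr 2
      ext a
      have hw0 : (g.weight U a.2 : ℂ) ≠ 0 := by exact_mod_cast (g.weight_pos U a.2).ne'
      by_cases ha : a ∈ A n
      · rw [indicator_of_mem ha, indicator_of_mem ha]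
        by_cases hp : 0 ≤ a.1
        · have hp' : a ∈ {a : ℝ × (κ → ℝ) | 0 ≤ a.1} := hp
          rw [heatQuot, expPos, indicator_of_mem hp', indicator_of_mem hp', indicator_of_mem hp']
          have he : (exp a.1 : ℂ) * (exp (-a.1) : ℂ) = 1 := by
            rw [← Complex.ofReal_mul, ← exp_add]; simp
          rw [Complex.ofReal_div]
          field_simp
          linear_combination (H a) * he
        · have hp' : a ∉ {a : ℝ × (κ → ℝ) | 0 ≤ a.1} := hp
          rw [heatQuot, indicator_of_notMem hp', indicator_of_notMem hp', MulZeroClass.zero_mul]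
      · rw [indicator_of_notMem ha, indicator_of_notMem ha, MulZeroClass.zero_mul]
    have h2 := ((g.convL U hφ).continuous.tendsto _).comp (hv.const_smul (fourierConst κ : ℂ))
    have h3 : Tendsto (fun n => E.op ((A n).indicator ({a | 0 ≤ a.1}.indicator H))
        (testLp 𝔪 φ)) atTop (𝓝 (E.op H (testLp 𝔪 φ))) := by
      refine E.tendsto_op (fun n => hH'.indicator (hAm n)) hH (C := C) (fun n a =>
        ((norm_indicator_le_norm_self _ _).trans (norm_indicator_le_norm_self _ _)).trans (hC a)) _ ?_
      filter_upwards [g.ae_fst_nonneg U hE (testLp 𝔪 φ)] with a ha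
      have h4 := hlimA ({a | 0 ≤ a.1}.indicator H) a
      have ha' : a ∈ {a : ℝ × (κ → ℝ) | 0 ≤ a.1} := ha
      rwa [indicator_of_mem ha'] at h4
    exact tendsto_nhds_unique h3 (h2.congr h1)
  · rw [norm_smul, mul_pow, hn, norm_real, norm_of_nonneg hcp.le]

/-- The `L²` norm of a convolution kernel, for an abstract family of fibre measures. -/
lemma exists_convL_eq_op_of_fibre (hE : g.IsJointSpectralMeasure X U E) {H : ℝ × (κ → ℝ) → ℂ}
    (hH : BddMeas H) {C : ℝ} (hC : 0 < C) (m : (κ → ℝ) → Measure ℝ)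
    (hm0 : ∀ᵐ η, ∀ᵐ x ∂(m η), 0 ≤ x)
    (hm : ∀ᵐ η, ∀ r, 0 < r → ∫⁻ x, ofReal (exp (-r * x)) ∂(m η)
      = ofReal (C * g.heatDiag U r η))
    (hfin : ∫⁻ η, ∫⁻ x, ‖H (x, η)‖ₑ ^ 2 ∂(m η) < ⊤) :
    ∃ K : Lp ℂ 2 𝔪, (∀ φ (hφ : IsTest φ), E.op H (testLp 𝔪 φ) = g.convL U hφ K) ∧
      ofReal (‖K‖ ^ 2) = ofReal (fourierConst κ ^ 2 * C⁻¹) *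
        ∫⁻ η, ∫⁻ x, ‖H (x, η)‖ₑ ^ 2 ∂(m η) := by
  have hQ := g.measurable_heatQuot U hH.measurable
  have h1 : ∫⁻ a, ‖g.heatQuot U H a‖ₑ ^ 2 ∂(E.scalarMeasure (g.heatVec U 1))
      = ofReal C⁻¹ * ∫⁻ η, ∫⁻ x, ‖H (x, η)‖ₑ ^ 2 ∂(m η) := by
    rw [g.lintegral_scalarMeasure_heatVec U hE one_pos hC m hm0 hm (hQ.enorm.pow_const 2),
      ← lintegral_const_mul' _ _ ofReal_ne_top]
    refine lintegral_congr_ae ?_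
    filter_upwards [hm0] with η h0
    have hw := g.weight_pos U η
    rw [ofReal_mul (by positivity), _root_.mul_assoc]
    congr 1
    rw [← lintegral_const_mul' _ _ ofReal_ne_top]
    refine lintegral_congr_ae ?_
    filter_upwards [h0] with x hx
    have hx' : (x, η) ∈ {a : ℝ × (κ → ℝ) | 0 ≤ a.1} := hx
    rw [heatQuot, indicator_of_mem hx', enorm_mul, mul_pow, ← ofReal_norm_eq_enorm
      ((exp _ / _ : ℝ) : ℂ), norm_real, norm_of_nonneg (by positivity),
      ← ofReal_pow (by positivity), mul_left_comm _ (‖H (x, η)‖ₑ ^ 2), mul_left_comm _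
      (‖H (x, η)‖ₑ ^ 2), ← ofReal_mul (exp_pos _).le,
      ← ofReal_mul (by positivity)]
    -- The weight and the exponential of the spectral density cancel those of `|Q|²` exactly, and
    -- only `|H|²` is left.
    have h2 : g.weight U η ^ 2 * (exp (-(2 * 1) * x) * (exp x / g.weight U η) ^ 2) = 1 := by
      have h3 : exp (-(2 * x)) * (exp x * exp x) = 1 := by
        rw [← exp_add, ← exp_add, Real.exp_eq_one_iff]; ring
      field_simp
      linear_combination h3
    rw [h2, ofReal_one, mul_one]
  have hI : Integrable (fun a => ‖g.heatQuot U H a‖ ^ 2) (E.scalarMeasure (g.heatVec U 1)) := by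
    refine ⟨(hQ.norm.pow_const 2).aestronglyMeasurable, ?_⟩
    rw [HasFiniteIntegral]
    have : ∀ a, ‖‖g.heatQuot U H a‖ ^ 2‖ₑ = ‖g.heatQuot U H a‖ₑ ^ 2 := fun a => by
      rw [enorm_pow, enorm_norm]
    simp_rw [this]
    rw [h1]
    exact ENNReal.mul_lt_top ofReal_lt_top hfin
  obtain ⟨K, hK, hn⟩ := g.exists_convL_eq_op U hE hH hI
  refine ⟨K, hK, ?_⟩
  rw [hn, ofReal_mul (sq_nonneg _), ofReal_integral_eq_lintegral_ofReal hI
    (.of_forall fun a => sq_nonneg _), ofReal_mul (sq_nonneg _), _root_.mul_assoc,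
    ← h1]
  congr 1
  refine lintegral_congr fun a => ?_
  rw [ofReal_pow (norm_nonneg _), ofReal_norm_eq_enorm]

lemma isConvKernel_of_convL {T : Lp ℂ 2 𝔪 →L[ℂ] Lp ℂ 2 𝔪}
    {K : Lp ℂ 2 𝔪} (h : ∀ φ (hφ : IsTest φ), T (testLp 𝔪 φ) = g.convL U hφ K) :
    g.IsConvKernel U T K := by
  refine ⟨g.locallyIntegrable_Lp U K, fun φ hφ f hf => ?_⟩
  rw [eq_testLp hφ hf, h φ hφ]
  exact g.coeFn_convL U hφ K

/-- A locally integrable kernel is determined by its convolutions with test functions, so every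
kernel inherits the norm of the one constructed in `L²`. -/
lemma IsConvKernel.ae_eq {T : Lp ℂ 2 𝔪 →L[ℂ] Lp ℂ 2 𝔪}
    (h : g.IsConvKernel U T K) (h' : g.IsConvKernel U T K') :
    K =ᵐ[𝔪] K' := by
  have hconv : ∀ ψ, IsTest ψ → ∀ {k : V × W → ℂ}, LocallyIntegrable k 𝔪 → ∀ p,
      Integrable (fun q => ψ (g.mul p (g.inv q)) * k q) 𝔪 := fun ψ hψ k hk p => by
    have hψ' : IsTest fun q => ψ (g.mul p (g.inv q)) :=
      g.isTest_comp_inv (g.isTest_comp_leftMul hψ p)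
    exact hk.integrable_smul_left_of_hasCompactSupport hψ'.continuous hψ'.2
  have h0 := g.ae_eq_zero_of_conv U (h.1.sub h'.1) fun ψ hψ => by
    have e1 := h.2 ψ hψ _ (coeFn_testLp hψ)
    have e2 := h'.2 ψ hψ _ (coeFn_testLp hψ)
    filter_upwards [e1, e2] with p h1 h2
    rw [conv_eq]
    simp only [Pi.sub_apply, mul_sub]
    rw [integral_sub (hconv ψ hψ h.1 p) (hconv ψ hψ h'.1 p), ← conv_eq, ← conv_eq]
    exact sub_eq_zero.2 (h1.symm.trans h2)
  filter_upwards [h0] with p hp using sub_eq_zero.1 hp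

end TwoStepAlgebra

/-! ### The Plancherel formula -/

/-- Squaring splits the joint decay into a product, since `(1 + ‖a‖)(1 + ‖b‖) ≤ (1 + ‖(a, b)‖)²`. -/
lemma SchwartzMap.exists_norm_sq_le {A B : Type*} [NormedAddCommGroup A] [NormedSpace ℝ A]
    [NormedAddCommGroup B] [NormedSpace ℝ B] (H : 𝓢(A × B, ℂ)) (n : ℕ) :
    ∃ C, 0 ≤ C ∧ ∀ a b, ‖H (a, b)‖ ^ 2 ≤ C * (((1 + ‖a‖) ^ n)⁻¹ * ((1 + ‖b‖) ^ n)⁻¹) := by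
  obtain ⟨C, hC⟩ : ∃ C, ∀ p, (1 + ‖p‖) ^ n * ‖H p‖ ≤ C := ⟨_, fun p => by
    have h := SchwartzMap.one_add_le_sup_seminorm_apply (𝕜 := ℝ) (m := (n, 0)) le_rfl le_rfl H p
    rwa [norm_iteratedFDeriv_zero] at h⟩
  refine ⟨C ^ 2, sq_nonneg _, fun a b => ?_⟩
  have h1 : 1 + ‖a‖ ≤ 1 + ‖(a, b)‖ := by gcongr; exact norm_fst_le (a, b)
  have h2 : 1 + ‖b‖ ≤ 1 + ‖(a, b)‖ := by gcongr; exact norm_snd_le (a, b)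
  have h3 : (1 + ‖a‖) ^ n * (1 + ‖b‖) ^ n ≤ ((1 + ‖(a, b)‖) ^ n) ^ 2 := by
    rw [sq]
    gcongr
  rw [← mul_inv, ← div_eq_mul_inv, le_div_iff₀ (by positivity)]
  calc ‖H (a, b)‖ ^ 2 * ((1 + ‖a‖) ^ n * (1 + ‖b‖) ^ n)
      ≤ ‖H (a, b)‖ ^ 2 * ((1 + ‖(a, b)‖) ^ n) ^ 2 := by gcongr
    _ = ((1 + ‖(a, b)‖) ^ n * ‖H (a, b)‖) ^ 2 := by ring
    _ ≤ C ^ 2 := pow_le_pow_left₀ (by positivity) (hC _) 2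

/-- Polynomial decay is integrable for a measure whose Laplace transform has polynomial growth
at the origin. -/
lemma lintegral_one_add_pow_le {μ : Measure ℝ} (hμ : ∀ᵐ x ∂μ, 0 ≤ x) {C : ℝ} (hC : 0 ≤ C) {d n : ℕ}
    (hn : d + 2 ≤ n) (h : ∀ r, 0 < r → ∫⁻ x, ofReal (exp (-r * x)) ∂μ
      ≤ ofReal (C * (√(4 * π * r))⁻¹ ^ d)) :
    ∫⁻ x, ofReal ((1 + |x|) ^ n)⁻¹ ∂μ
      ≤ ∑' j : ℕ, ofReal (exp 1 * C * (((j : ℝ) + 1) ^ 2)⁻¹) := by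
  have h1 : ∀ x, 0 ≤ x → ofReal ((1 + |x|) ^ n)⁻¹ ≤ ∑' j : ℕ,
      ofReal (exp 1 * (((j : ℝ) + 1) ^ n)⁻¹) * ofReal (exp (-((j : ℝ) + 1)⁻¹ * x)) := fun x hx => by
    -- The term `j = ⌊x⌋` alone suffices: since `x < j + 1`, the exponential `e^{-x/(j+1)}` is at
    -- least `e⁻¹`.
    refine le_trans ?_ (ENNReal.le_tsum ⌊x⌋₊)
    have hx1 := Nat.floor_le hx
    have hx2 := Nat.lt_floor_add_one x
    have hj : (0 : ℝ) < (⌊x⌋₊ : ℝ) + 1 := by positivity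
    rw [← ofReal_mul (by positivity), abs_of_nonneg hx]
    refine ofReal_le_ofReal ?_
    have h2 : 1 ≤ exp 1 * exp (-((⌊x⌋₊ : ℝ) + 1)⁻¹ * x) := by
      rw [← exp_add, Real.one_le_exp_iff]
      have : ((⌊x⌋₊ : ℝ) + 1)⁻¹ * x ≤ 1 := by rw [inv_mul_le_iff₀ hj]; linarith
      linarith
    calc ((1 + x) ^ n)⁻¹ ≤ (((⌊x⌋₊ : ℝ) + 1) ^ n)⁻¹ := by
          rw [add_comm 1 x]
          gcongr
      _ ≤ (((⌊x⌋₊ : ℝ) + 1) ^ n)⁻¹ * (exp 1 * exp (-((⌊x⌋₊ : ℝ) + 1)⁻¹ * x)) :=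
          le_mul_of_one_le_right (by positivity) h2
      _ = _ := by ring
  refine (lintegral_mono_ae (hμ.mono h1)).trans ?_
  rw [lintegral_tsum fun j => by fun_prop]
  refine ENNReal.tsum_le_tsum fun j => ?_
  have hj : (1 : ℝ) ≤ (j : ℝ) + 1 := by linarith [(Nat.cast_nonneg j : (0 : ℝ) ≤ j)]
  have hj0 : (0 : ℝ) < (j : ℝ) + 1 := by linarith
  rw [lintegral_const_mul _ (by fun_prop)]
  refine (mul_le_mul_right (h _ (inv_pos.2 hj0)) _).trans ?_
  rw [← ofReal_mul (by positivity)]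
  refine ofReal_le_ofReal ?_
  have h2 : (√(4 * π * ((j : ℝ) + 1)⁻¹))⁻¹ ≤ (j : ℝ) + 1 := by
    refine inv_le_of_inv_le₀ hj0 (Real.le_sqrt_of_sq_le ?_)
    have h3 : ((j : ℝ) + 1)⁻¹ ≤ 1 := inv_le_one_of_one_le₀ hj
    nlinarith [Real.pi_gt_three, inv_pos.2 hj0]
  have h4 : ((j : ℝ) + 1) ^ d * ((j : ℝ) + 1) ^ 2 ≤ ((j : ℝ) + 1) ^ n := by
    rw [← pow_add]; exact pow_le_pow_right₀ hj hn
  calc exp 1 * (((j : ℝ) + 1) ^ n)⁻¹ * (C * (√(4 * π * ((j : ℝ) + 1)⁻¹))⁻¹ ^ d)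
      ≤ exp 1 * (((j : ℝ) + 1) ^ d * ((j : ℝ) + 1) ^ 2)⁻¹ * (C * ((j : ℝ) + 1) ^ d) := by
        gcongr
    _ = _ := by field_simp

namespace TwoStepAlgebra

open ProjectionValuedMeasure

/-- The decay exponent `n` serves two purposes: `d + 2` beats the growth of the Laplace transform at
`0`, uniformly in `η`, and an exponent beyond the number of coordinates makes the rest integrable in
`η`. -/
lemma lintegral_schwartz_lt_top {C : ℝ} (hC : 0 < C) (m : (κ → ℝ) → Measure ℝ)
    (hm0 : ∀ᵐ η, ∀ᵐ x ∂(m η), 0 ≤ x)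
    (hm : ∀ᵐ η, ∀ r, 0 < r → ∫⁻ x, ofReal (exp (-r * x)) ∂(m η)
      = ofReal (C * g.heatDiag U r η)) (H : 𝓢(ℝ × (κ → ℝ), ℂ)) :
    ∫⁻ η, ∫⁻ x, ‖H (x, η)‖ₑ ^ 2 ∂(m η) < ⊤ := by
  set d := Module.finrank ℝ V
  set n := d + 2 + Fintype.card κ with hn
  obtain ⟨B, hB0, hB⟩ := H.exists_norm_sq_le n
  set D := ∑' j : ℕ, ofReal (exp 1 * C * (((j : ℝ) + 1) ^ 2)⁻¹) with hD
  have hs : Summable fun j : ℕ => exp 1 * C * (((j : ℝ) + 1) ^ 2)⁻¹ := by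
    refine Summable.mul_left _ ?_
    have := (summable_nat_add_iff 1).2 (Real.summable_nat_pow_inv.2 one_lt_two)
    simpa using this
  have hD0 : D ≠ ⊤ := by
    rw [hD, ← ENNReal.ofReal_tsum_of_nonneg (fun j => by positivity) hs]
    exact ofReal_ne_top
  have h1 : ∀ᵐ η : κ → ℝ, ∫⁻ x, ‖H (x, η)‖ₑ ^ 2 ∂(m η)
      ≤ ofReal (B * ((1 + ‖η‖) ^ n)⁻¹) * D := by
    filter_upwards [hm0, hm] with η h0 h
    have h2 := lintegral_one_add_pow_le h0 hC.le (d := d) (n := n) (by omega) fun r hr => by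
      rw [h r hr]
      exact ofReal_le_ofReal (mul_le_mul_of_nonneg_left (g.heatDiag_le U hr η) hC.le)
    refine le_trans ?_ (mul_le_mul_right h2 _)
    rw [← lintegral_const_mul' _ _ ofReal_ne_top]
    refine lintegral_mono fun x => ?_
    rw [← ofReal_mul (by positivity), ← ofReal_norm_eq_enorm, ← ofReal_pow (norm_nonneg _)]
    refine ofReal_le_ofReal ((hB x η).trans (le_of_eq ?_))
    rw [norm_eq_abs]; ring
  refine (lintegral_mono_ae h1).trans_lt ?_
  rw [lintegral_mul_const' _ _ hD0]
  refine ENNReal.mul_lt_top ?_ hD0.lt_top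
  have h3 : Integrable fun η : κ → ℝ => (1 + ‖η‖) ^ (-(n : ℝ)) := integrable_one_add_norm (by
      rw [Module.finrank_fintype_fun_eq_card, hn]; push_cast; linarith [(Nat.cast_nonneg d : (0:ℝ) ≤ d)])
  have h4 := (h3.const_mul B).lintegral_lt_top
  have e : ∀ η : κ → ℝ, (1 + ‖η‖) ^ (-(n : ℝ)) = ((1 + ‖η‖) ^ n)⁻¹ := fun η => by
    rw [Real.rpow_neg (by positivity), Real.rpow_natCast]
  simpa only [e] using h4

/-- The exponents `-dim W` from the Fourier transform and `-(r₀ + |r|)` from the fibres combine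
through `dim V = r₀ + 2|r|`. -/
lemma SpectralData.constant_eq (S : g.SpectralData U) : fourierConst κ ^ 2 * S.const⁻¹ = (2 * π) ^
      ((∑ j, (S.r j : ℤ)) - (Module.finrank ℝ V + Module.finrank ℝ W : ℤ)) := by
  have h2 : (2 * π : ℝ) ≠ 0 := by have := pi_pos; positivity
  have h := fourierConst_sq (κ := κ)
  rw [S.finrank_eq, Module.finrank_eq_card_basis U, ← Nat.cast_sum, eq_inv_of_mul_eq_one_left h,
    const, ← _root_.mul_inv, ← pow_add, ← zpow_natCast, ← zpow_neg]
  congr 1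
  push_cast
  ring

lemma SpectralData.lintegral_fibre_eq (S : g.SpectralData U) (H : 𝓢(ℝ × (κ → ℝ), ℂ)) :
    ∫⁻ η, ∫⁻ x, ‖H (x, η)‖ₑ ^ 2 ∂(S.fibreMeasure η) = ∫⁻ η in S.dom, ∫⁻ μ, ∑' n : Fin S.d₁ → ℕ,
      ofReal (‖S.multiplier H (fun j => (n j : ℝ)) μ η‖ ^ 2 *
        ∏ j, (S.b j η ^ S.r j * ((n j + S.r j - 1).choose (n j) : ℝ))) ∂(sigma S.r₀) := by
  rw [Measure.restrict_eq_self_of_ae_mem S.ae_mem_dom]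
  refine lintegral_congr_ae ?_
  filter_upwards [S.ae_mem_dom] with η hη
  have hm : Measurable fun x => ‖H (x, η)‖ₑ ^ 2 :=
    (H.continuous.measurable.comp (measurable_id.prodMk measurable_const)).enorm.pow_const 2
  have e : ∀ (n : Fin S.d₁ → ℕ) (μ : ℝ), ofReal (‖S.multiplier H (fun j => (n j : ℝ)) μ η‖ ^ 2 *
      ∏ j, (S.b j η ^ S.r j * ((n j + S.r j - 1).choose (n j) : ℝ)))
      = ofReal (S.coef n η) * ‖H (S.level n η + μ, η)‖ₑ ^ 2 := fun n μ => by
    rw [mul_comm]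
    change ofReal (S.coef n η * _) = _
    rw [ofReal_mul (S.coef_nonneg n hη), ofReal_pow (norm_nonneg _), ofReal_norm_eq_enorm]
    rfl
  simp only [e]
  have hm2 : ∀ n : Fin S.d₁ → ℕ, Measurable fun μ : ℝ => ‖H (S.level n η + μ, η)‖ₑ ^ 2 :=
    fun n => hm.comp (measurable_const_add _)
  rw [S.lintegral_fibreMeasure η hm, lintegral_tsum fun n => ((hm2 n).const_mul _).aemeasurable]
  exact tsum_congr fun n => (lintegral_const_mul _ (hm2 n)).symm

/-- The Plancherel formula for the convolution kernels of Schwartz multipliers. -/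
lemma plancherel (hE : g.IsJointSpectralMeasure X U E) (S : g.SpectralData U)
    (H : 𝓢(ℝ × (κ → ℝ), ℂ)) :
    ∃ T : Lp ℂ 2 𝔪 →L[ℂ] Lp ℂ 2 𝔪, E.IsIntegral H T ∧ (∃ K : V × W → ℂ, g.IsConvKernel U T K) ∧
      ∀ K : V × W → ℂ, g.IsConvKernel U T K → MemLp K 2 𝔪 ∧ ∫⁻ p, ‖K p‖ₑ ^ 2 ∂𝔪 = ofReal ((2 * π) ^
            ((∑ j, (S.r j : ℤ)) - (Module.finrank ℝ V + Module.finrank ℝ W : ℤ))) *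
          ∫⁻ η in S.dom, ∫⁻ μ, ∑' n : Fin S.d₁ → ℕ,
            ofReal (‖S.multiplier H (fun j => (n j : ℝ)) μ η‖ ^ 2 *
              ∏ j, (S.b j η ^ S.r j * ((n j + S.r j - 1).choose (n j) : ℝ))) ∂(sigma S.r₀) := by
  obtain ⟨C, -, hC⟩ := H.decay 0 0
  have hH : BddMeas H := ⟨H.continuous.measurable, C, fun a => by simpa using hC a⟩
  have hm0 : ∀ᵐ η, ∀ᵐ x ∂(S.fibreMeasure η), 0 ≤ x := S.ae_mem_dom.mono fun η hη =>
    S.ae_fibreMeasure_nonneg hη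
  have hm : ∀ᵐ η, ∀ r, 0 < r → ∫⁻ x, ofReal (exp (-r * x)) ∂(S.fibreMeasure η)
      = ofReal (S.const * g.heatDiag U r η) := S.ae_mem_dom.mono fun η hη r hr =>
    S.lintegral_exp_fibreMeasure hη hr
  obtain ⟨K, hK, hn⟩ := g.exists_convL_eq_op_of_fibre U hE hH S.const_pos S.fibreMeasure hm0 hm
    (g.lintegral_schwartz_lt_top U S.const_pos S.fibreMeasure hm0 hm H)
  have hKK := g.isConvKernel_of_convL U hK
  refine ⟨E.op H, E.isIntegral_op hH, ⟨K, hKK⟩, fun K' hK' => ?_⟩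
  have hae := hKK.ae_eq g U hK'
  refine ⟨(memLp_congr_ae hae).1 (Lp.memLp K), ?_⟩
  rw [← S.lintegral_fibre_eq, ← S.constant_eq, ← hn, Lp.norm_def, ← toReal_pow,
    ofReal_toReal (pow_ne_top (Lp.eLpNorm_ne_top _)), eLpNorm_two_sq]
  refine lintegral_congr_ae ?_
  filter_upwards [hae] with p hp
  rw [hp]

/-! ### Existence of the spectral data. -/

open Polynomial

/-- On the eigenspace of `a > 0` the operator `J` satisfies `J² = -a`. Taking determinants, `(-a)`
to the dimension is a square, so the dimension is even. -/
lemma even_count_roots (ha : 0 < a) : Even ((g.negJSq U η).charpoly.roots.count a) := by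
  set T := g.negJSq U η with hT
  have hs := g.isSymmetric_negJSq U η
  rw [count_roots, ← LinearMap.finrank_maxGenEigenspace_eq,
    hs.isFinitelySemisimple.maxGenEigenspace_eq_eigenspace]
  set J := g.J U η with hJ
  have hc : Commute T J := by
    ext x
    simp [hT, hJ, negJSq_apply]
  have hm := End.mapsTo_genEigenspace_of_comm hc a 1
  set J' := J.restrict hm with hJ'
  have h1 : J' ∘ₗ J' = (-a) • LinearMap.id := by
    ext x
    have h2 : -J (J x) = a • (x : V) := End.mem_eigenspace_iff.1 x.2
    have h3 : ((J' ∘ₗ J') x : V) = J (J x) := rfl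
    rw [h3, ← neg_neg (J (J x)), h2]
    simp
  have h4 := congrArg LinearMap.det h1
  rw [LinearMap.det_comp, LinearMap.det_smul, LinearMap.det_id, mul_one] at h4
  by_contra hodd
  rw [Nat.not_even_iff_odd] at hodd
  have h5 := hodd.pow_neg (neg_lt_zero.2 ha)
  have h6 := mul_self_nonneg (LinearMap.det J')
  rw [h4] at h6
  exact absurd h5 (not_lt.2 h6)

lemma exists_genericMatrix : ∃ A : Matrix (Fin (Module.finrank ℝ V)) (Fin (Module.finrank ℝ V))
    (MvPolynomial κ ℝ), ∀ η, A.map (MvPolynomial.eval η) = (g.negJSq U η).toMatrix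
      (stdOrthonormalBasis ℝ V).toBasis (stdOrthonormalBasis ℝ V).toBasis := by
  set b := stdOrthonormalBasis ℝ V
  let B : Matrix (Fin (Module.finrank ℝ V)) (Fin (Module.finrank ℝ V)) (MvPolynomial κ ℝ) :=
    Matrix.of fun i j => ∑ k, MvPolynomial.C (U.equivFun (g.bracket (b j) (b i)) k) * MvPolynomial.X k
  have hB : ∀ η, B.map (MvPolynomial.eval η) = (g.J U η).toMatrix b.toBasis b.toBasis := fun η => by
    ext i j
    simp only [B, Matrix.map_apply, Matrix.of_apply, toMatrix_apply,
      OrthonormalBasis.coe_toBasis, OrthonormalBasis.coe_toBasis_repr_apply,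
      OrthonormalBasis.repr_apply_apply]
    rw [real_inner_comm, g.inner_J, constr_eq_sum]
    simp
  refine ⟨-(B * B), fun η => ?_⟩
  rw [negJSq, map_neg, LinearMap.toMatrix_comp b.toBasis b.toBasis b.toBasis, ← hB]
  ext i j
  simp [Matrix.mul_apply]

/-- The eigenvalues with multiplicity. -/
def spec : Multiset ℝ := (g.negJSq U η).charpoly.roots

lemma spec_eq : g.spec U η = Multiset.map (g.ev U η) Finset.univ.val :=
  (g.isSymmetric_negJSq U η).roots_charpoly_eq_eigenvalues rfl

lemma card_spec : (g.spec U η).card = Module.finrank ℝ V := by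
  rw [spec_eq]; simp

lemma charpoly_negJSq :
    (g.negJSq U η).charpoly = ((g.spec U η).map fun a => Polynomial.X - C a).prod := by
  rw [spec_eq, (g.isSymmetric_negJSq U η).charpoly_eq rfl, Multiset.map_map]
  rfl

lemma nonneg_of_mem_spec {η : κ → ℝ} (ha : a ∈ g.spec U η) : 0 ≤ a := by
  rw [spec_eq] at ha
  obtain ⟨i, -, rfl⟩ := Multiset.mem_map.1 ha
  exact g.ev_nonneg U η i

lemma spec_smul (t : ℝ) (η : κ → ℝ) : g.spec U (t • η) = (g.spec U η).map (t ^ 2 * ·) := by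
  have h : g.negJSq U (t • η) = aeval (g.negJSq U η) (C (t ^ 2) * Polynomial.X) := by
    have hJ : g.J U (t • η) = t • g.J U η := by
      ext x
      refine ext_inner_right ℝ fun y => ?_
      rw [LinearMap.smul_apply, real_inner_smul_left, g.inner_J, g.inner_J]
      simp [mul_sum]
    ext x
    simp [negJSq_apply, hJ, sq, smul_smul, Algebra.algebraMap_eq_smul_one]
  rw [spec, h, (g.isSymmetric_negJSq U η).charpoly_aeval]
  simp [spec]

/-- The polynomials are the coefficients of the generic characteristic polynomial built from
`multPoly`. The first one that does not vanish at `η` has index `multCount`, which is therefore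
upper semicontinuous in the Zariski topology. -/
lemma exists_generic (k : ℕ) : ∃ p : ℕ → MvPolynomial κ ℝ, ∀ η,
    (∀ z, MvPolynomial.eval η (p z) ≠ 0 → multCount k (g.spec U η) ≤ z) ∧
    MvPolynomial.eval η (p (multCount k (g.spec U η))) ≠ 0 := by
  obtain ⟨A, hA⟩ := g.exists_genericMatrix U
  have h : ∀ η, (aeval A (multPoly k A.charpoly)).charpoly.map (MvPolynomial.eval η)
      = (aeval (g.negJSq U η) (multPoly k (g.negJSq U η).charpoly)).charpoly := fun η => by
    rw [Matrix.map_aeval_multPoly, hA, charpoly_toMatrix]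
    rw [← charpoly_toMatrix (aeval _ _) (stdOrthonormalBasis ℝ V).toBasis]
    congr 1
    exact aeval_algHom_apply (LinearMap.toMatrixAlgEquiv (stdOrthonormalBasis ℝ V).toBasis) _ _
  refine ⟨fun z => (aeval A (multPoly k A.charpoly)).charpoly.coeff z, fun η => ?_⟩
  have ht := (g.isSymmetric_negJSq U η).natTrailingDegree_charpoly k
  simp only [← Polynomial.coeff_map, h, spec, ← ht]
  refine ⟨fun z hz => natTrailingDegree_le_of_ne_zero hz, ?_⟩
  exact trailingCoeff_nonzero_iff_nonzero.2 (LinearMap.charpoly_monic _).ne_zero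

/-- A point `η₀` is chosen that minimizes the sum of all the counts. Where the product `P` does not
vanish no count exceeds its value at `η₀`, so by minimality all are equal there. Equal counts mean
equal multiplicity profiles; the eigenvalues at `η` are matched with those at `η₀` by an arbitrary
bijection, since no regularity of `b` is asked for. -/
lemma exists_spectralData : Nonempty (g.SpectralData U) := by
  classical
  set d := Module.finrank ℝ V with hd
  set I := Finset.range (d + 2)
  choose p hp using g.exists_generic U
  obtain ⟨η₀, hη₀⟩ : ∃ η₀ : κ → ℝ, ∀ η, ∑ k ∈ I, multCount k (g.spec U η₀)
      ≤ ∑ k ∈ I, multCount k (g.spec U η) := by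
    obtain ⟨m, ⟨η₀, rfl⟩, h⟩ := WellFounded.has_min (wellFounded_lt (α := ℕ))
      (Set.range fun η : κ → ℝ => ∑ k ∈ I, multCount k (g.spec U η)) (Set.range_nonempty _)
    exact ⟨η₀, fun η => not_lt.1 (h _ ⟨η, rfl⟩)⟩
  set P : MvPolynomial κ ℝ := ∏ k ∈ I, p k (multCount k (g.spec U η₀))
  have hdom : ∀ η, MvPolynomial.eval η P ≠ 0 ↔
      ∀ k ∈ I, multCount k (g.spec U η) = multCount k (g.spec U η₀) := fun η => by
    rw [map_prod, prod_ne_zero_iff]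
    constructor
    · intro h
      exact (Finset.sum_eq_sum_iff_of_le fun k hk => (hp k η).1 _ (h k hk)).1
        (le_antisymm (sum_le_sum fun k hk => (hp k η).1 _ (h k hk)) (hη₀ η))
    · intro h k hk
      rw [← h k hk]
      exact (hp k η).2
  set s := g.spec U η₀ with hs
  set D := s.toFinset.erase 0
  have hpos : ∀ η, ∀ a ∈ (g.spec U η).toFinset.erase 0, 0 < a := fun η a ha => by
    obtain ⟨h1, h2⟩ := mem_erase.1 ha
    exact lt_of_le_of_ne (g.nonneg_of_mem_spec U (Multiset.mem_toFinset.1 h2)) (Ne.symm h1)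
  have hfac : ∀ η, ∃ e : D → ℝ, MvPolynomial.eval η P ≠ 0 → (∀ a, 0 < e a) ∧
      Injective e ∧ (g.negJSq U η).charpoly
        = Polynomial.X ^ s.count 0 * ∏ a, (Polynomial.X - C (e a)) ^ s.count (a : ℝ) := fun η => by
    by_cases hη : MvPolynomial.eval η P ≠ 0
    swap
    · exact ⟨0, fun h => absurd h hη⟩
    obtain ⟨h0, e, he⟩ := exists_equiv_of_multCount_eq
      ((g.card_spec U η).trans (g.card_spec U η₀).symm) fun k hk => (hdom η).1 hη k (by
        rw [g.card_spec] at hk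
        exact Finset.mem_range.2 (by omega))
    refine ⟨fun a => e a, fun _ => ⟨fun a => hpos η _ (e a).2,
      Subtype.val_injective.comp e.injective, ?_⟩⟩
    -- The zero eigenvalue is split off; if it does not occur, its factor has exponent `0`.
    have h2 : ∏ a ∈ (g.spec U η).toFinset, (Polynomial.X - C a) ^ (g.spec U η).count a
        = (Polynomial.X - C 0) ^ (g.spec U η).count 0 *
          ∏ a ∈ (g.spec U η).toFinset.erase 0, (Polynomial.X - C a) ^ (g.spec U η).count a := by
      by_cases hm : (0 : ℝ) ∈ (g.spec U η).toFinset
      · exact (Finset.mul_prod_erase _ _ hm).symm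
      · rw [Finset.erase_eq_of_notMem hm, Multiset.count_eq_zero.2 (by simpa using hm), pow_zero,
          one_mul]
    rw [g.charpoly_negJSq, Finset.prod_multiset_map_count, h2, h0, C_0, sub_zero,
      ← Finset.prod_coe_sort, ← e.prod_comp]
    simp only [he]
    rfl
  choose e he using hfac
  have heven : ∀ a : D, ∃ r, s.count (a : ℝ) = 2 * r := fun a => by
    obtain ⟨r, hr⟩ := g.even_count_roots U η₀ (hpos η₀ a a.2)
    exact ⟨r, hr.trans (two_mul r).symm⟩
  choose r hr using heven
  let f := D.equivFin
  refine ⟨{ dom := {η | MvPolynomial.eval η P ≠ 0}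
            dom_nonempty := ⟨η₀, (hdom η₀).2 fun _ _ => rfl⟩
            dom_zariski_open := ⟨{P}, by simp⟩
            dom_homogeneous := fun t ht η hη => ?_
            d₁ := D.card
            r₀ := s.count 0
            r := fun j => r (f.symm j)
            r_pos := fun j => ?_
            b := fun j η => √(e η (f.symm j))
            b_pos := fun η hη j => sqrt_pos.2 ((he η hη).1 _)
            b_distinct := fun η hη j j' hjj' h => hjj' ?_
            charpoly_eq := fun η hη => ?_ }⟩
  · refine (hdom _).2 fun k hk => ?_
    rw [g.spec_smul, multCount_map_mul (pow_ne_zero 2 ht), (hdom η).1 hη k hk]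
  · have h1 := hr (f.symm j)
    have h2 : 0 < s.count ((f.symm j : D) : ℝ) := Multiset.count_pos.2
      (Multiset.mem_toFinset.1 (mem_erase.1 (f.symm j).2).2)
    omega
  · rw [Real.sqrt_inj ((he η hη).1 _).le ((he η hη).1 _).le] at h
    exact f.symm.injective ((he η hη).2.1 h)
  · refine (he η hη).2.2.trans ?_
    rw [← f.symm.prod_comp]
    congr 1
    refine prod_congr rfl fun j _ => ?_
    rw [hr, sq_sqrt ((he η hη).1 _).le]

end TwoStepAlgebra

end

theorem mainTheorem7 {V W : Type*} [NormedAddCommGroup V] [InnerProductSpace ℝ V]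
    [FiniteDimensional ℝ V] [MeasurableSpace V] [BorelSpace V]
    [NormedAddCommGroup W] [NormedSpace ℝ W] [FiniteDimensional ℝ W]
    [MeasurableSpace W] [BorelSpace W]
    {ι κ : Type*} [Fintype ι] [Fintype κ]
    (g : TwoStepAlgebra V W) (X : OrthonormalBasis ι ℝ V) (U : Module.Basis κ ℝ W) :
    Nonempty (g.SpectralData U) ∧
    (∃ E : ProjectionValuedMeasure (ℝ × (κ → ℝ)) (Lp ℂ 2 (g.haar U)),
      g.IsJointSpectralMeasure X U E) ∧
    ∀ (S : g.SpectralData U)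
      (E : ProjectionValuedMeasure (ℝ × (κ → ℝ)) (Lp ℂ 2 (g.haar U))),
      g.IsJointSpectralMeasure X U E →
      ∀ H : 𝓢(ℝ × (κ → ℝ), ℂ),
        ∃ T : Lp ℂ 2 (g.haar U) →L[ℂ] Lp ℂ 2 (g.haar U),
          E.IsIntegral H T ∧
          (∃ K : V × W → ℂ, g.IsConvKernel U T K) ∧
          ∀ K : V × W → ℂ, g.IsConvKernel U T K →
            MemLp K 2 (g.haar U) ∧
            ∫⁻ p, ‖K p‖ₑ ^ 2 ∂(g.haar U) =
              ENNReal.ofReal ((2 * Real.pi) ^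
                ((∑ j, (S.r j : ℤ)) - (Module.finrank ℝ V + Module.finrank ℝ W : ℤ))) *
              ∫⁻ η in S.dom, ∫⁻ μ, ∑' n : Fin S.d₁ → ℕ,
                ENNReal.ofReal (‖S.multiplier H (fun j => (n j : ℝ)) μ η‖ ^ 2 *
                  ∏ j, (S.b j η ^ S.r j * ((n j + S.r j - 1).choose (n j) : ℝ)))
                ∂(TwoStepAlgebra.sigma S.r₀) :=
  ⟨g.exists_spectralData U, g.exists_isJointSpectralMeasure U X,
    fun S _ hE H => g.plancherel U hE S H⟩
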